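/- **Setting.** Let $(\varepsilon_t)_{t\in\mathbb Z}$ be i.i.d. real random variables, $\mathcal F_t=\sigma(\varepsilon_s:s\le t)$, $\|W\|_q=(\mathbb E|W|^q)^{1/q}$, $|y|_1=\sum_i|y_i|$. Let $\Theta\subset\mathbb R^d$ be compact, $\theta_0:[0,1]\to\operatorname{int}(\Theta)$, and $G_\varepsilon(y,u)=\tilde G_\varepsilon(y,\theta_0(u))$ for $y\in\mathbb R^p$, $u\in[0,1]$, measurable in $(\varepsilon,y)$. Let $\tilde X_t(u)=H(u,(\varepsilon_t,\varepsilon_{t-1},\dots))$, $t\in\mathbb Z$, be the stationary solution of $\tilde X_t(u)=G_{\varepsilon_t}(\tilde Y_{t-1}(u),u)$, $\tilde Y_{t-1}(u)=(\tilde X_{t-1}(u),\dots,\tilde X_{t-p}(u))$, and let $X_{t,n}$, $t\le n$, solve $X_{t,n}=G_{\varepsilon_t}(Y_{t-1,n},\frac tn\vee0)$, $Y_{t-1,n}=(X_{t-1,n},\dots,X_{t-p,n})$, with $X_{t,n}=\tilde X_t(0)$ for $t\le 0$. Let $K:\mathbb R\to\mathbb R$ be bounded, of bounded variation, zero outside $[-\frac12,\frac12]$,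 $\int K=1$, $K_b(x)=\frac1bK(\frac xb)$. For $\ell:\mathbb R^{p+1}\times\Theta\to\mathbb R$ put $L_{n,b}(u,\theta)=\frac1n\sum_{t=p+1}^nK_b(\frac tn-u)\,\ell(X_{t,n},Y_{t-1,n},\theta)$, let $\hat\theta_b(u)$ be a measurable minimizer of $L_{n,b}(u,\cdot)$ over $\Theta$, and put $\tilde\ell_t(u,\theta)=\ell(\tilde X_t(u),\tilde Y_{t-1}(u),\theta)$, $L(u,\theta)=\mathbb E\,\tilde\ell_t(u,\theta)$. $\nabla$ is the derivative in $\theta$. A function $g(z,\theta)$ is in $\tilde{\mathcal L}(M)$, $M\ge0$, if with constants $C_z,C_\theta\ge 0$, for all $z,z',\theta,\theta'$, $|g(z,\theta)-g(z',\theta)|\le C_z|z-z'|_1(1+|z|_1^M+|z'|_1^M)$ and $|g(z,\theta)-g(z,\theta')|\le C_\theta(1+|z|_1^{M+1})|\theta-\theta'|_1$. For $q>0$ let $q'=\min\{q,1\}$ and $|z|_{\chi,q'}=(\sum_i|z_i|^{q'}\chi_i)^{1/q'}$. Consider the conditions, in each of which $y_0\in\mathbb R^p$ and $\chi\in\mathbb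 R_{\ge0}^p$ with $|\chi|_1<1$ are required to exist: * (L1) $\sup_u\|G_{\varepsilon_0}(y_0,u)\|_q<\infty$ and $\|G_{\varepsilon_0}(y,u)-G_{\varepsilon_0}(y',u)\|_q\le|y-y'|_{\chi,q'}$ for all $u,y,y'$. * (L2) $(y,u)\mapsto G_\varepsilon(y,u)$ is continuous for all $\varepsilon$, $\|\sup_u|G_{\varepsilon_0}(y_0,u)|\|_q<\infty$ and $(\ast)$ $\big\|\sup_u\sup_{y\ne y'}\frac{|G_{\varepsilon_0}(y,u)-G_{\varepsilon_0}(y',u)|}{|y-y'|_{\chi,q'}}\big\|_q\le1$. * (L3) $(y,u)\mapsto G_\varepsilon(y,u)$ is $C^1$ for all $\varepsilon$, $\|\sup_u|\partial_uG_{\varepsilon_0}(y_0,u)|\|_q<\infty$, $\big\|\sup_u\sup_{y\neq y'}\frac{|\partial G_{\varepsilon_0}(y,u)-\partial G_{\varepsilon_0}(y',u)|_1}{|y-y'|_{(1,\dots,1),q'}}\big\|_q<\infty$ for $\partial=\partial_y$ and $\partial=\partial_u$, and either $(\ast)$ holds with $q/2$ instead of $q$, or $y\mapsto\partial_yG_\varepsilon(y,u)$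 is constant for all $\varepsilon,u$. * (L4) with exponent $\alpha$: $\sup_u\|C(\tilde Y_t(u))\|_q<\infty$, where $C(y)=\sup_{u\ne u'}\|G_{\varepsilon_0}(y,u)-G_{\varepsilon_0}(y,u')\|_q/|u-u'|^\alpha$. **Theorem 5.4.** Suppose that $\ell\in\tilde{\mathcal L}(M)$; (L1) and (L4) hold with $q=M+1$ and exponent $\alpha\in(0,1]$; for all $u\in[0,1]$, $\theta_0(u)$ is the unique minimizer of $L(u,\cdot)$ over $\Theta$; $\ell$ is twice continuously differentiable in $\theta\in\operatorname{int}(\Theta)$ and there the components of $\nabla\ell$ and $\nabla^2\ell$ are in $\tilde{\mathcal L}(M')$ and $\tilde{\mathcal L}(M'')$ respectively; (L1) and (L4) hold with $q=\max\{2(M'+1),M''+1\}$ and exponent $\alpha'\in(0,1]$; (L2) holds with $q=2(M'+1)$. Let $u\in(0,1)$, $\mathbb E[\nabla\tilde\ell_t(u,\theta_0(u))\mid\mathcal F_{t-1}]=0$ a.s. for all $t$, $I(u)=\mathbb E[\nabla\tilde\ell_t(u,\theta_0(u))\nabla\tilde\ell_t(u,\theta_0(u))']$, and let $V(u)=\nabla^2L(u,\theta_0(u))$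 be positive definite. Let $b=b_n\in(0,1)$, $b\to0$, $nb\to\infty$, $bn^{1-2\alpha}=o(1)$. (i) If $nb^{1+2\alpha'}=o(1)$, then $$\sqrt{nb}\,\big(\hat\theta_b(u)-\theta_0(u)\big)\xrightarrow{d}N\Big(0,\int K(x)^2\,dx\cdot V(u)^{-1}I(u)V(u)^{-1}\Big).\qquad(1)$$ (ii) Suppose additionally that $\nabla\ell(\cdot,\theta)$ is continuously differentiable for each $\theta\in\operatorname{int}(\Theta)$, that (L3) holds with $q=M'+1$, and that $nb^3=O(1)$. Then $(\tilde X_t(u))_{u\in[0,1]}$ has a modification with a.s. continuously differentiable paths, and for every such modification (again denoted $\tilde X_t$), $\partial_u\nabla\ell(\tilde X_t(u),\tilde Y_{t-1}(u),\theta)|_{\theta=\theta_0(u)}$ is integrable and $$\sqrt{nb}\,\Big(\hat\theta_b(u)-\theta_0(u)+b\,V(u)^{-1}\,\mathbb E\big[\partial_u\nabla\ell(\tilde X_t(u),\tilde Y_{t-1}(u),\theta)\big]\big|_{\theta=\theta_0(u)}\int K(x)x\,dx\Big)\xrightarrow{d}N\Big(0,\int K(x)^2\,dx\cdot V(u)^{-1}I(u)V(u)^{-1}\Big).$$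 In particular, if $K$ is symmetric then (1) holds. -/

import Mathlib

open MeasureTheory ProbabilityTheory Filter Topology Set
open scoped ENNReal

noncomputable section

namespace LocStat

/-! ### Norms, lags and function classes -/

/-- The norm `|y|₁ = ∑ |y_i|`. -/
def l1 {r : ℕ} (y : Fin r → ℝ) : ℝ := ∑ i, |y i|

/-- The weighted norm `|z|_{χ,s} = (∑ |z_i|^s χ_i)^{1/s}`. -/
def wnorm {p : ℕ} (χ : Fin p → ℝ) (s : ℝ) (z : Fin p → ℝ) : ℝ :=
  (∑ i, |z i| ^ s * χ i) ^ (1 / s)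

/-- The lag vector `(x_t, x_{t-1}, …, x_{t-r+1})`. -/
def lags (r : ℕ) (x : ℤ → ℝ) (t : ℤ) : Fin r → ℝ := fun i => x (t - (i : ℕ))

/-- `g : ℝ^r → ℝ` is in the class `𝓛_r(M, C)`. -/
def ClassL {r : ℕ} (M C : ℝ) (g : (Fin r → ℝ) → ℝ) : Prop :=
  0 ≤ M ∧ ∀ y y' : Fin r → ℝ,
    |g y - g y'| ≤ C * (l1 (fun i => y i - y' i) * (1 + l1 y ^ M + l1 y' ^ M))

/-- `g : ℝ^r × S → ℝ` is in the class `𝓛̃_r(M, (C_z, C_θ))` for some constants `C_z, C_θ ≥ 0`: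
Lipschitz in `z` with polynomially growing constant, uniformly in `θ ∈ S`, and Lipschitz in `θ ∈ S`
with constant `C_θ (1 + |z|₁^{M+1})` (the factor `1 + |θ|₁⁰ + |θ'|₁⁰ = 3` of
`𝓛_d(0, ·)` is absorbed in `C_θ`). -/
def ClassLt {r d : ℕ} (S : Set (EuclideanSpace ℝ (Fin d))) (M : ℝ)
    (g : (Fin r → ℝ) → EuclideanSpace ℝ (Fin d) → ℝ) : Prop :=
  0 ≤ M ∧ ∃ Cz Cθ : ℝ, 0 ≤ Cz ∧ 0 ≤ Cθ ∧
    (∀ θ ∈ S, ClassL M Cz (fun z => g z θ)) ∧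
    (∀ z, ∀ θ ∈ S, ∀ θ' ∈ S,
      |g z θ - g z θ'| ≤ Cθ * (1 + l1 z ^ (M + 1)) * l1 (fun i => θ i - θ' i))

/-- Localizing kernel: bounded, of bounded variation, zero outside `[-1/2, 1/2]`, integral one. -/
structure IsLocalizingKernel (K : ℝ → ℝ) : Prop where
  bounded : ∃ B : ℝ, ∀ x, |K x| ≤ B
  boundedVariation : BoundedVariationOn K univ
  support : ∀ x, x ∉ Icc (-(1 / 2) : ℝ) (1 / 2) → K x = 0
  integral_eq_one : ∫ x, K x = 1

/-! ### The recursively defined processes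

A recursion function is written `G e y u = G_e(y, u)` with `e ∈ ℝ`, `y ∈ ℝ^p`, `u ∈ [0,1]`. -/

section Recursions

variable {Ω : Type*} [MeasurableSpace Ω]

/-- The `σ`-algebra generated by `ε_s`, `s ≤ t`. -/
abbrev past (ε : ℤ → Ω → ℝ) (t : ℤ) : MeasurableSpace Ω :=
  ⨆ s : {s : ℤ // s ≤ t}, MeasurableSpace.comap (ε s) inferInstance

/-- `(ε_t)` is an i.i.d. sequence of real random variables. -/
structure IsIID (P : Measure Ω) (ε : ℤ → Ω → ℝ) : Prop where
  measurable : ∀ t, Measurable (ε t)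
  indep : iIndepFun ε P
  identDistrib : ∀ s t, IdentDistrib (ε s) (ε t) P P

/-- The recursion function `G_a(y,u) = G̃_a(y, θ₀(u))` of a model with parameter curve `θ₀`. -/
def curveRec {p d : ℕ} (Gt : ℝ → (Fin p → ℝ) → EuclideanSpace ℝ (Fin d) → ℝ)
    (θ₀ : ℝ → EuclideanSpace ℝ (Fin d)) : ℝ → (Fin p → ℝ) → ℝ → ℝ :=
  fun a y u => Gt a y (θ₀ u)

/-- `X̃_t(u)`, `u ∈ [0,1]`, is the stationary solution `X̃_t(u) = H(u, (ε_t, ε_{t-1}, …))` of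
`X̃_t(u) = G_{ε_t}(X̃_{t-1}(u), …, X̃_{t-p}(u), u)`, `t ∈ ℤ`. The same `H(u, ·)` serves all `t`, so
stationarity and ergodicity are automatic. -/
structure IsStationarySolution (P : Measure Ω) (ε : ℤ → Ω → ℝ) {p : ℕ}
    (G : ℝ → (Fin p → ℝ) → ℝ → ℝ) (Xt : ℤ → ℝ → Ω → ℝ) : Prop where
  shift : ∀ u ∈ Icc (0 : ℝ) 1, ∃ H : (ℕ → ℝ) → ℝ, Measurable H ∧
    ∀ t, Xt t u =ᵐ[P] fun ω => H (fun k => ε (t - (k : ℤ)) ω)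
  recursion : ∀ u ∈ Icc (0 : ℝ) 1, ∀ t,
    ∀ᵐ ω ∂P, Xt t u ω = G (ε t ω) (lags p (fun s => Xt s u ω) (t - 1)) u

/-- `X n t = X_{t,n}`, `t ≤ n`, is the solution of
`X_{t,n} = G_{ε_t}(X_{t-1,n}, …, X_{t-p,n}, (t/n) ∨ 0)`. For `t ≤ 0` this is the recursion of
`X̃_t(0)`, and the solution meant is the one that coincides with `X̃_t(0)` there. -/
structure IsLocallyStationarySolution (P : Measure Ω) (ε : ℤ → Ω → ℝ) {p : ℕ}
    (G : ℝ → (Fin p → ℝ) → ℝ → ℝ) (Xt : ℤ → ℝ → Ω → ℝ) (X : ℕ → ℤ → Ω → ℝ) : Prop where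
  initial : ∀ n, ∀ t ≤ (0 : ℤ), X n t =ᵐ[P] Xt t 0
  recursion : ∀ n : ℕ, ∀ t ≤ (n : ℤ), ∀ᵐ ω ∂P,
    X n t ω = G (ε t ω) (lags p (fun s => X n s ω) (t - 1)) (max ((t : ℝ) / n) 0)

/-- `Xh` is a modification of `Xt` on `[0,1]` with a.s. continuously differentiable paths. -/
structure IsC1Modification (P : Measure Ω) (Xt Xh : ℤ → ℝ → Ω → ℝ) : Prop where
  modification : ∀ t, ∀ u ∈ Icc (0 : ℝ) 1, Xh t u =ᵐ[P] Xt t u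
  contDiff : ∀ t, ∀ᵐ ω ∂P, ContDiffOn ℝ 1 (fun u => Xh t u ω) (Icc 0 1)

/-! ### Conditions on the recursion function

`e` is a random variable with the law of the innovations, `min q 1` is `q'`. -/

/-- Admissible weights `χ ∈ ℝ^p_{≥0}` with `|χ|₁ < 1`. -/
def IsWeight {p : ℕ} (χ : Fin p → ℝ) : Prop := (∀ i, 0 ≤ χ i) ∧ ∑ i, χ i < 1

/-- Contraction of `y ↦ G_e(y, u)` in `L^q`, uniformly in `u`. -/
def CondL1 (P : Measure Ω) (e : Ω → ℝ) {p : ℕ} (G : ℝ → (Fin p → ℝ) → ℝ → ℝ) (q : ℝ) : Prop :=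
  ∃ (χ : Fin p → ℝ) (y₀ : Fin p → ℝ), IsWeight χ ∧
    (⨆ u ∈ Icc (0 : ℝ) 1, eLpNorm (fun ω => G (e ω) y₀ u) (ENNReal.ofReal q) P) < ∞ ∧
    ∀ u ∈ Icc (0 : ℝ) 1, ∀ y y' : Fin p → ℝ,
      eLpNorm (fun ω => G (e ω) y u - G (e ω) y' u) (ENNReal.ofReal q) P
        ≤ ENNReal.ofReal (wnorm χ (min q 1) (y - y'))

/-- `‖ sup_u sup_{y ≠ y'} |G_e(y,u) - G_e(y',u)| / |y - y'|_{χ,q'} ‖_q ≤ 1`. -/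
def UniformContraction (P : Measure Ω) (e : Ω → ℝ) {p : ℕ} (G : ℝ → (Fin p → ℝ) → ℝ → ℝ)
    (χ : Fin p → ℝ) (q : ℝ) : Prop :=
  eLpNorm (fun ω => ⨆ u ∈ Icc (0 : ℝ) 1, ⨆ (y : Fin p → ℝ) (y' : Fin p → ℝ) (_ : y ≠ y'),
    ENNReal.ofReal |G (e ω) y u - G (e ω) y' u| / ENNReal.ofReal (wnorm χ (min q 1) (y - y')))
    (ENNReal.ofReal q) P ≤ 1

/-- Continuity of `(y,u) ↦ G_e(y,u)` and uniform contraction. -/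
def CondL2 (P : Measure Ω) (e : Ω → ℝ) {p : ℕ} (G : ℝ → (Fin p → ℝ) → ℝ → ℝ) (q : ℝ) : Prop :=
  (∀ a : ℝ, ContinuousOn (fun yu : (Fin p → ℝ) × ℝ => G a yu.1 yu.2) (univ ×ˢ Icc (0 : ℝ) 1)) ∧
  ∃ (χ : Fin p → ℝ) (y₀ : Fin p → ℝ), IsWeight χ ∧
    eLpNorm (fun ω => ⨆ u ∈ Icc (0 : ℝ) 1, ENNReal.ofReal |G (e ω) y₀ u|)
      (ENNReal.ofReal q) P < ∞ ∧
    UniformContraction P e G χ q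

/-- The `i`-th component of `∂₁ G_a(y,u)`, the gradient in `y`. -/
def dG1 {p : ℕ} (G : ℝ → (Fin p → ℝ) → ℝ → ℝ) (a : ℝ) (y : Fin p → ℝ) (u : ℝ) (i : Fin p) : ℝ :=
  fderiv ℝ (fun y => G a y u) y (Pi.single i 1)

/-- `∂₂ G_a(y,u)`, the derivative in `u ∈ [0,1]` (one-sided at the end points). -/
def dG2 {p : ℕ} (G : ℝ → (Fin p → ℝ) → ℝ → ℝ) (a : ℝ) (y : Fin p → ℝ) (u : ℝ) : ℝ :=
  derivWithin (fun v => G a y v) (Icc 0 1) u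

/-- Continuous differentiability of `(y,u) ↦ G_e(y,u)` with Lipschitz derivatives in `y`. -/
def CondL3 (P : Measure Ω) (e : Ω → ℝ) {p : ℕ} (G : ℝ → (Fin p → ℝ) → ℝ → ℝ) (q : ℝ) : Prop :=
  (∀ a : ℝ, ContDiffOn ℝ 1 (fun yu : (Fin p → ℝ) × ℝ => G a yu.1 yu.2)
    (univ ×ˢ Icc (0 : ℝ) 1)) ∧
  (∃ y₀ : Fin p → ℝ, eLpNorm (fun ω => ⨆ u ∈ Icc (0 : ℝ) 1, ENNReal.ofReal |dG2 G (e ω) y₀ u|)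
      (ENNReal.ofReal q) P < ∞) ∧
  eLpNorm (fun ω => ⨆ u ∈ Icc (0 : ℝ) 1, ⨆ (y : Fin p → ℝ) (y' : Fin p → ℝ) (_ : y ≠ y'),
    ENNReal.ofReal (l1 (fun i => dG1 G (e ω) y u i - dG1 G (e ω) y' u i)) /
      ENNReal.ofReal (wnorm (fun _ => 1) (min q 1) (y - y'))) (ENNReal.ofReal q) P < ∞ ∧
  eLpNorm (fun ω => ⨆ u ∈ Icc (0 : ℝ) 1, ⨆ (y : Fin p → ℝ) (y' : Fin p → ℝ) (_ : y ≠ y'),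
    ENNReal.ofReal |dG2 G (e ω) y u - dG2 G (e ω) y' u| /
      ENNReal.ofReal (wnorm (fun _ => 1) (min q 1) (y - y'))) (ENNReal.ofReal q) P < ∞ ∧
  ((∃ χ : Fin p → ℝ, IsWeight χ ∧ UniformContraction P e G χ (q / 2)) ∨
    (∀ a : ℝ, ∀ u ∈ Icc (0 : ℝ) 1, ∀ y y' : Fin p → ℝ, ∀ i, dG1 G a y u i = dG1 G a y' u i))

/-- `C(y) = sup_{u ≠ u'} ‖G_e(y,u) - G_e(y,u')‖_q / |u - u'|^α`. -/
def holderConst (P : Measure Ω) (e : Ω → ℝ) {p : ℕ} (G : ℝ → (Fin p → ℝ) → ℝ → ℝ) (q α : ℝ)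
    (y : Fin p → ℝ) : ℝ≥0∞ :=
  ⨆ u ∈ Icc (0 : ℝ) 1, ⨆ u' ∈ Icc (0 : ℝ) 1, ⨆ (_ : u ≠ u'),
    eLpNorm (fun ω => G (e ω) y u - G (e ω) y u') (ENNReal.ofReal q) P /
      ENNReal.ofReal (|u - u'| ^ α)

/-- `sup_u ‖C(Ỹ_t(u))‖_q < ∞`, written for `t = 0` (`Ỹ_t(u)` is stationary in `t`). -/
def CondL4 (P : Measure Ω) (e : Ω → ℝ) {p : ℕ} (G : ℝ → (Fin p → ℝ) → ℝ → ℝ)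
    (Xt : ℤ → ℝ → Ω → ℝ) (q α : ℝ) : Prop :=
  (⨆ u ∈ Icc (0 : ℝ) 1, eLpNorm
    (fun ω => holderConst P e G q α (lags p (fun s => Xt s u ω) 0)) (ENNReal.ofReal q) P) < ∞

/-! ### Likelihood, estimator and limiting quantities

The objective function is `ℓ z θ` with `z = (x, y) ∈ ℝ^{p+1}`, `x ∈ ℝ`, `y ∈ ℝ^p`. -/

/-- `∂f/∂θ_i (θ)`. -/
def pd {d : ℕ} (f : EuclideanSpace ℝ (Fin d) → ℝ) (i : Fin d) (θ : EuclideanSpace ℝ (Fin d)) : ℝ :=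
  fderiv ℝ f θ (EuclideanSpace.single i 1)

/-- The Hessian matrix of `f` at `θ`. -/
def hess {d : ℕ} (f : EuclideanSpace ℝ (Fin d) → ℝ) (θ : EuclideanSpace ℝ (Fin d)) :
    Matrix (Fin d) (Fin d) ℝ :=
  Matrix.of fun i j => pd (pd f i) j θ

variable {p d : ℕ}

/-- `L_{n,b}(u,θ) = n⁻¹ ∑_{t=p+1}^n K_b(t/n - u) ℓ(X_{t,n}, Y_{t-1,n}, θ)`, `K_b(x) = K(x/b)/b`. -/
def localLik (ℓ : (Fin (p + 1) → ℝ) → EuclideanSpace ℝ (Fin d) → ℝ) (K : ℝ → ℝ)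
    (X : ℕ → ℤ → Ω → ℝ) (n : ℕ) (b u : ℝ) (θ : EuclideanSpace ℝ (Fin d)) (ω : Ω) : ℝ :=
  (1 / (n : ℝ)) * ∑ t ∈ Finset.Icc (p + 1) n,
    (1 / b) * K (((t : ℝ) / n - u) / b) * ℓ (lags (p + 1) (fun s => X n s ω) (t : ℤ)) θ

/-- `T` is a (measurable) choice of `θ̂_b(u) = argmin_{θ ∈ Θ} L_{n,b}(u,θ)`. -/
structure IsLocalMLE (P : Measure Ω) (ℓ : (Fin (p + 1) → ℝ) → EuclideanSpace ℝ (Fin d) → ℝ)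
    (K : ℝ → ℝ) (Θ : Set (EuclideanSpace ℝ (Fin d))) (X : ℕ → ℤ → Ω → ℝ) (n : ℕ) (b u : ℝ)
    (T : Ω → EuclideanSpace ℝ (Fin d)) : Prop where
  aemeasurable : AEMeasurable T P
  argmin : ∀ᵐ ω ∂P, T ω ∈ Θ ∧ ∀ θ ∈ Θ, localLik ℓ K X n b u (T ω) ω ≤ localLik ℓ K X n b u θ ω

/-- `L(u,θ) = E ℓ(X̃_t(u), Ỹ_{t-1}(u), θ)` (by stationarity `t = 0`). -/
def limLik (P : Measure Ω) (ℓ : (Fin (p + 1) → ℝ) → EuclideanSpace ℝ (Fin d) → ℝ)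
    (Xt : ℤ → ℝ → Ω → ℝ) (u : ℝ) (θ : EuclideanSpace ℝ (Fin d)) : ℝ :=
  ∫ ω, ℓ (lags (p + 1) (fun s => Xt s u ω) 0) θ ∂P

/-- The `i`-th component of the score `∇ℓ(X̃_t(u), Ỹ_{t-1}(u), θ)`. -/
def score (ℓ : (Fin (p + 1) → ℝ) → EuclideanSpace ℝ (Fin d) → ℝ)
    (Xt : ℤ → ℝ → Ω → ℝ) (t : ℤ) (u : ℝ) (θ : EuclideanSpace ℝ (Fin d)) (i : Fin d) (ω : Ω) : ℝ :=
  pd (ℓ (lags (p + 1) (fun s => Xt s u ω) t)) i θ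

/-- `I = E[∇ℓ̃_t(u,θ) ∇ℓ̃_t(u,θ)']`. -/
def fisherMat (P : Measure Ω) (ℓ : (Fin (p + 1) → ℝ) → EuclideanSpace ℝ (Fin d) → ℝ)
    (Xt : ℤ → ℝ → Ω → ℝ) (u : ℝ) (θ : EuclideanSpace ℝ (Fin d)) : Matrix (Fin d) (Fin d) ℝ :=
  Matrix.of fun i j => ∫ ω, score ℓ Xt 0 u θ i ω * score ℓ Xt 0 u θ j ω ∂P

/-- `V = ∇²L(u,θ)`. -/
def hessMat (P : Measure Ω) (ℓ : (Fin (p + 1) → ℝ) → EuclideanSpace ℝ (Fin d) → ℝ)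
    (Xt : ℤ → ℝ → Ω → ℝ) (u : ℝ) (θ : EuclideanSpace ℝ (Fin d)) : Matrix (Fin d) (Fin d) ℝ :=
  hess (limLik P ℓ Xt u) θ

/-- The asymptotic covariance `∫ K² · V⁻¹ I V⁻¹`. -/
def asympCov (P : Measure Ω) (ℓ : (Fin (p + 1) → ℝ) → EuclideanSpace ℝ (Fin d) → ℝ) (K : ℝ → ℝ)
    (Xt : ℤ → ℝ → Ω → ℝ) (u : ℝ) (θ : EuclideanSpace ℝ (Fin d)) : Matrix (Fin d) (Fin d) ℝ :=
  (∫ x, K x ^ 2) •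
    ((hessMat P ℓ Xt u θ)⁻¹ * fisherMat P ℓ Xt u θ * (hessMat P ℓ Xt u θ)⁻¹)

/-- The `i`-th component of `∂_u ∇ℓ(X̃_t(u), Ỹ_{t-1}(u), θ)` with `θ` held fixed. -/
def scoreDeriv (ℓ : (Fin (p + 1) → ℝ) → EuclideanSpace ℝ (Fin d) → ℝ)
    (Xh : ℤ → ℝ → Ω → ℝ) (t : ℤ) (u : ℝ) (θ : EuclideanSpace ℝ (Fin d)) (i : Fin d) (ω : Ω) : ℝ :=
  deriv (fun v => score ℓ Xh t v θ i ω) u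

/-- `V⁻¹ E[∂_u ∇ℓ(X̃_t(u), Ỹ_{t-1}(u), θ)] · ∫ K(x) x dx`, with derivatives taken along `Xh`. -/
def biasVec (P : Measure Ω) (ℓ : (Fin (p + 1) → ℝ) → EuclideanSpace ℝ (Fin d) → ℝ) (K : ℝ → ℝ)
    (Xt Xh : ℤ → ℝ → Ω → ℝ) (t : ℤ) (u : ℝ) (θ : EuclideanSpace ℝ (Fin d)) :
    EuclideanSpace ℝ (Fin d) :=
  (∫ x, K x * x) • WithLp.toLp 2
    ((hessMat P ℓ Xt u θ)⁻¹.mulVec fun i => ∫ ω, scoreDeriv ℓ Xh t u θ i ω ∂P)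

end Recursions

end LocStat

end

noncomputable section

set_option linter.unusedSectionVars false

namespace LocStat

/-! ### Causal and shift-invariant random variables -/

section Causality

variable {Ω : Type*} [MeasurableSpace Ω] {P : Measure Ω} {ε : ℤ → Ω → ℝ}
  {β γ : Type*} [MeasurableSpace β] [MeasurableSpace γ]

/-- The history `(ε_t, ε_{t-1}, …)` of the innovations at time `t`. -/
def hist (ε : ℤ → Ω → ℝ) (t : ℤ) (ω : Ω) : ℕ → ℝ := fun k => ε (t - (k : ℤ)) ω

/-- `W` is almost surely a measurable function of the history at time `t`. -/
def Causal (P : Measure Ω) (ε : ℤ → Ω → ℝ) (t : ℤ) (W : Ω → β) : Prop :=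
  ∃ F : (ℕ → ℝ) → β, Measurable F ∧ W =ᵐ[P] F ∘ hist ε t

/-- The process `W` is almost surely the same measurable function of the history at all times. -/
def IsShift (P : Measure Ω) (ε : ℤ → Ω → ℝ) (W : ℤ → Ω → β) : Prop :=
  ∃ F : (ℕ → ℝ) → β, Measurable F ∧ ∀ t, W t =ᵐ[P] F ∘ hist ε t

lemma measurable_hist (hε : ∀ t, Measurable (ε t)) (t : ℤ) : Measurable (hist ε t) :=
  measurable_pi_lambda _ fun _ => hε _

lemma measurable_hist_past (ε : ℤ → Ω → ℝ) (t : ℤ) : Measurable[past ε t] (hist ε t) := by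
  refine @measurable_pi_lambda _ _ _ (past ε t) _ _ fun k => ?_
  have h : t - (k : ℤ) ≤ t := by omega
  exact (comap_measurable (ε (t - k))).mono
    (le_iSup (fun s : {s : ℤ // s ≤ t} => MeasurableSpace.comap (ε s) inferInstance) ⟨_, h⟩) le_rfl

lemma past_le (hε : ∀ t, Measurable (ε t)) (t : ℤ) : past ε t ≤ (inferInstance : MeasurableSpace Ω) :=
  iSup_le fun s => (hε s).comap_le

lemma past_eq_comap_hist (ε : ℤ → Ω → ℝ) (t : ℤ) :
    past ε t = MeasurableSpace.comap (hist ε t) inferInstance := by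
  apply le_antisymm
  · refine iSup_le fun ⟨s, hs⟩ => ?_
    obtain ⟨k, hk⟩ := Int.eq_ofNat_of_zero_le (sub_nonneg.2 hs)
    have : ε s = (fun h : ℕ → ℝ => h k) ∘ hist ε t := by
      funext ω; simp only [hist, Function.comp]; congr 1; omega
    change MeasurableSpace.comap (ε s) _ ≤ _
    rw [this, ← MeasurableSpace.comap_comp]
    exact MeasurableSpace.comap_mono (measurable_pi_apply k).comap_le
  · exact (measurable_hist_past ε t).comap_le

lemma Causal.aemeasurable (hε : ∀ t, Measurable (ε t)) {t : ℤ} {W : Ω → β}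
    (h : Causal P ε t W) : AEMeasurable W P := by
  obtain ⟨F, hF, h⟩ := h
  exact ⟨_, hF.comp (measurable_hist hε t), h⟩

lemma Causal.comp {t : ℤ} {W : Ω → β} (h : Causal P ε t W) {g : β → γ} (hg : Measurable g) :
    Causal P ε t (fun ω => g (W ω)) := by
  obtain ⟨F, hF, h⟩ := h
  exact ⟨g ∘ F, hg.comp hF, h.fun_comp g⟩

lemma Causal.prodMk {t : ℤ} {W : Ω → β} {W' : Ω → γ} (h : Causal P ε t W) (h' : Causal P ε t W') :
    Causal P ε t (fun ω => (W ω, W' ω)) := by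
  obtain ⟨F, hF, h⟩ := h
  obtain ⟨F', hF', h'⟩ := h'
  exact ⟨fun e => (F e, F' e), hF.prodMk hF', h.prodMk h'⟩

lemma Causal.pi {ι : Type*} [Countable ι] {t : ℤ} {W : ι → Ω → β} (h : ∀ i, Causal P ε t (W i)) :
    Causal P ε t (fun ω i => W i ω) := by
  choose F hF h using h
  refine ⟨fun e i => F i e, measurable_pi_lambda _ hF, ?_⟩
  filter_upwards [ae_all_iff.2 h] with ω hω
  funext i
  exact hω i

lemma Causal.mono {s t : ℤ} (hst : s ≤ t) {W : Ω → β} (h : Causal P ε s W) : Causal P ε t W := by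
  obtain ⟨F, hF, h⟩ := h
  obtain ⟨k, hk⟩ := Int.eq_ofNat_of_zero_le (sub_nonneg.2 hst)
  refine ⟨fun e => F (fun j => e (j + k)), hF.comp (measurable_pi_lambda _ fun j =>
    measurable_pi_apply _), h.trans (Eventually.of_forall fun ω => ?_)⟩
  simp only [Function.comp]
  congr 1
  funext j
  simp only [hist]
  congr 1
  push_cast
  omega

lemma Causal.congr {t : ℤ} {W W' : Ω → β} (h : Causal P ε t W) (hW : W' =ᵐ[P] W) :
    Causal P ε t W' := by
  obtain ⟨F, hF, h⟩ := h
  exact ⟨F, hF, hW.trans h⟩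

lemma causal_const (t : ℤ) (c : β) : Causal P ε t (fun _ => c) :=
  ⟨fun _ => c, measurable_const, ae_eq_rfl⟩

lemma causal_innovation (t : ℤ) : Causal P ε t (ε t) :=
  ⟨fun e => e 0, measurable_pi_apply _, Eventually.of_forall fun ω => by simp [hist]⟩

lemma Causal.aestronglyMeasurable_past {E : Type*} [TopologicalSpace E]
    [TopologicalSpace.PseudoMetrizableSpace E] [SecondCountableTopology E] [MeasurableSpace E]
    [BorelSpace E] {t : ℤ} {W : Ω → E} (h : Causal P ε t W) :
    AEStronglyMeasurable[past ε t] W P := by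
  obtain ⟨F, hF, h⟩ := h
  exact ⟨_, (hF.comp (measurable_hist_past ε t)).stronglyMeasurable, h⟩

lemma IsShift.causal {W : ℤ → Ω → β} (h : IsShift P ε W) (t : ℤ) : Causal P ε t (W t) := by
  obtain ⟨F, hF, h⟩ := h
  exact ⟨F, hF, h t⟩

lemma IsShift.comp {W : ℤ → Ω → β} (h : IsShift P ε W) {g : β → γ} (hg : Measurable g) :
    IsShift P ε (fun t ω => g (W t ω)) := by
  obtain ⟨F, hF, h⟩ := h
  exact ⟨g ∘ F, hg.comp hF, fun t => (h t).fun_comp g⟩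

lemma IsShift.prodMk {W : ℤ → Ω → β} {W' : ℤ → Ω → γ} (h : IsShift P ε W) (h' : IsShift P ε W') :
    IsShift P ε (fun t ω => (W t ω, W' t ω)) := by
  obtain ⟨F, hF, h⟩ := h
  obtain ⟨F', hF', h'⟩ := h'
  exact ⟨fun e => (F e, F' e), hF.prodMk hF', fun t => (h t).prodMk (h' t)⟩

lemma IsShift.pi {ι : Type*} [Countable ι] {W : ι → ℤ → Ω → β} (h : ∀ i, IsShift P ε (W i)) :
    IsShift P ε (fun t ω i => W i t ω) := by
  choose F hF h using h
  refine ⟨fun e i => F i e, measurable_pi_lambda _ hF, fun t => ?_⟩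
  filter_upwards [ae_all_iff.2 fun i => h i t] with ω hω
  funext i
  exact hω i

lemma IsShift.lag {W : ℤ → Ω → β} (h : IsShift P ε W) (k : ℕ) :
    IsShift P ε (fun t => W (t - k)) := by
  obtain ⟨F, hF, h⟩ := h
  refine ⟨fun e => F (fun j => e (j + k)), hF.comp (measurable_pi_lambda _ fun j =>
    measurable_pi_apply _), fun t => (h (t - k)).trans (Eventually.of_forall fun ω => ?_)⟩
  simp only [Function.comp]
  congr 1
  funext j
  simp only [hist]
  congr 1
  push_cast
  omega

lemma IsShift.congr {W W' : ℤ → Ω → β} (h : IsShift P ε W) (hW : ∀ t, W' t =ᵐ[P] W t) :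
    IsShift P ε W' := by
  obtain ⟨F, hF, h⟩ := h
  exact ⟨F, hF, fun t => (hW t).trans (h t)⟩

lemma IsShift.lags {x : ℤ → Ω → ℝ} (h : IsShift P ε x) (r : ℕ) :
    IsShift P ε (fun t ω => lags r (fun s => x s ω) t) :=
  IsShift.pi (fun i : Fin r => h.lag i)

lemma causal_lags {r : ℕ} {t : ℤ} {x : ℤ → Ω → ℝ} (h : ∀ s ≤ t, Causal P ε s (x s)) :
    Causal P ε t (fun ω => lags r (fun s => x s ω) t) :=
  Causal.pi (W := fun (i : Fin r) ω => x (t - (i : ℕ)) ω) fun i =>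
    (h (t - (i : ℕ)) (by omega)).mono (by omega)

variable [IsProbabilityMeasure P]

lemma map_hist (hε : IsIID P ε) (s t : ℤ) : P.map (hist ε s) = P.map (hist ε t) := by
  have key : ∀ t : ℤ, P.map (hist ε t) = Measure.infinitePi fun _ : ℕ => P.map (ε 0) := by
    intro t
    have hinj : Function.Injective (fun k : ℕ => t - (k : ℤ)) := by
      intro a b h
      simpa using h
    have := (hε.indep.precomp hinj).map_fun_eq_infinitePi_map (fun i => hε.measurable _)
    rw [show (fun _ : ℕ => P.map (ε 0)) = fun k : ℕ => P.map (ε (t - k)) from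
      funext fun k => (hε.identDistrib 0 (t - k)).map_eq]
    exact this
  rw [key s, key t]

lemma IsShift.identDistrib (hε : IsIID P ε) {W : ℤ → Ω → β} (h : IsShift P ε W) (s t : ℤ) :
    IdentDistrib (W s) (W t) P P := by
  have hm := fun t => (h.causal t).aemeasurable hε.measurable
  obtain ⟨F, hF, h⟩ := h
  refine ⟨hm s, hm t, ?_⟩
  rw [Measure.map_congr (h s), Measure.map_congr (h t),
    ← Measure.map_map hF (measurable_hist hε.measurable s),
    ← Measure.map_map hF (measurable_hist hε.measurable t), map_hist hε s t]

lemma indepFun_hist (hε : IsIID P ε) (t : ℤ) : IndepFun (ε t) (hist ε (t - 1)) P := by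
  have h := indep_iSup_of_disjoint (fun i => (hε.measurable i).comap_le) hε.indep
    (S := {t}) (T := Iic (t - 1)) (by simp)
  rw [IndepFun_iff_Indep, ← past_eq_comap_hist]
  refine indep_of_indep_of_le_left (indep_of_indep_of_le_right h ?_) ?_
  · exact (iSup_subtype (p := fun s : ℤ => s ≤ t - 1)
      (f := fun s => MeasurableSpace.comap (ε s) inferInstance)).le
  · simp

lemma Causal.indepFun (hε : IsIID P ε) {t : ℤ} {W : Ω → β} (h : Causal P ε (t - 1) W) :
    IndepFun (ε t) W P := by
  obtain ⟨F, hF, h⟩ := h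
  exact ((indepFun_hist hε t).comp measurable_id hF).congr ae_eq_rfl h.symm

lemma Causal.map_prodMk (hε : IsIID P ε) {t : ℤ} {W : Ω → β} (h : Causal P ε (t - 1) W) :
    P.map (fun ω => (ε t ω, W ω)) = (P.map (ε 0)).prod (P.map W) := by
  rw [(indepFun_iff_map_prod_eq_prod_map_map (hε.measurable t).aemeasurable
    (h.aemeasurable hε.measurable)).1 (h.indepFun hε), (hε.identDistrib t 0).map_eq]

lemma Causal.lintegral_innovation (hε : IsIID P ε) {t : ℤ} {W : Ω → β} (h : Causal P ε (t - 1) W)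
    {f : ℝ × β → ℝ≥0∞} (hf : Measurable f) :
    ∫⁻ ω, f (ε t ω, W ω) ∂P = ∫⁻ ω, ∫⁻ ω', f (ε 0 ω', W ω) ∂P ∂P := by
  have hW := h.aemeasurable hε.measurable
  have := Measure.isProbabilityMeasure_map hW
  have := Measure.isProbabilityMeasure_map (hε.measurable 0).aemeasurable (μ := P)
  have h1 := h.map_prodMk hε
  rw [← lintegral_map' hf.aemeasurable ((hε.measurable t).aemeasurable.prodMk hW), h1,
    lintegral_prod_symm' _ hf, lintegral_map' hf.lintegral_prod_left'.aemeasurable hW]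
  refine lintegral_congr fun ω => ?_
  exact lintegral_map (hf.comp (measurable_id.prodMk measurable_const)) (hε.measurable 0)

/-- If `W` belongs to the past of `ε_t`, moments of `f(ε_t, W)` are bounded by conditioning
on `W`. -/
lemma Causal.eLpNorm_innovation_le (hε : IsIID P ε) {t : ℤ} {W : Ω → β}
    (h : Causal P ε (t - 1) W) {q : ℝ} (hq : 0 < q) {f : ℝ × β → ℝ} (hf : Measurable f)
    {g : β → ℝ≥0∞} (hg : ∀ w, eLpNorm (fun ω => f (ε 0 ω, w)) (ENNReal.ofReal q) P ≤ g w) :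
    eLpNorm (fun ω => f (ε t ω, W ω)) (ENNReal.ofReal q) P ≤
      eLpNorm (fun ω => g (W ω)) (ENNReal.ofReal q) P := by
  have hq0 : ENNReal.ofReal q ≠ 0 := by simpa using hq
  rw [eLpNorm_eq_lintegral_rpow_enorm_toReal hq0 ENNReal.ofReal_ne_top,
    eLpNorm_eq_lintegral_rpow_enorm_toReal hq0 ENNReal.ofReal_ne_top, ENNReal.toReal_ofReal hq.le]
  refine ENNReal.rpow_le_rpow ?_ (by positivity)
  rw [h.lintegral_innovation hε (f := fun x => ‖f x‖ₑ ^ q) (by fun_prop)]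
  refine lintegral_mono fun ω => ?_
  have h1 := hg (W ω)
  rw [eLpNorm_eq_lintegral_rpow_enorm_toReal hq0 ENNReal.ofReal_ne_top,
    ENNReal.toReal_ofReal hq.le] at h1
  have h2 := ENNReal.rpow_le_rpow h1 hq.le
  rwa [← ENNReal.rpow_mul, one_div_mul_cancel hq.ne', ENNReal.rpow_one] at h2

lemma IsShift.eLpNorm_eq (hε : IsIID P ε) {W : ℤ → Ω → ℝ} (h : IsShift P ε W) (q : ℝ≥0∞)
    (s t : ℤ) : eLpNorm (W s) q P = eLpNorm (W t) q P :=
  (h.identDistrib hε s t).eLpNorm_eq q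

end Causality

/-! ### Moments of the stationary and the locally stationary process -/

section Moments

variable {Ω : Type*} [MeasurableSpace Ω] {P : Measure Ω} [IsProbabilityMeasure P] {ε : ℤ → Ω → ℝ}
  {p : ℕ}

lemma wnorm_one (χ z : Fin p → ℝ) : wnorm χ 1 z = ∑ i, |z i| * χ i := by
  simp [wnorm]

lemma one_le_ofReal {q : ℝ} (hq : 1 ≤ q) : 1 ≤ ENNReal.ofReal q := by
  simpa using ENNReal.ofReal_le_ofReal hq

lemma eLpNorm_weighted_sum_le {ι : Type*} [Fintype ι] {q : ℝ} (hq : 1 ≤ q) {χ : ι → ℝ}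
    (hχ : ∀ i, 0 ≤ χ i) {f : ι → Ω → ℝ} (hf : ∀ i, AEMeasurable (f i) P) :
    eLpNorm (fun ω => ∑ i, |f i ω| * χ i) (ENNReal.ofReal q) P ≤
      ∑ i, ENNReal.ofReal (χ i) * eLpNorm (f i) (ENNReal.ofReal q) P := by
  have h1 : (fun ω => ∑ i, |f i ω| * χ i) = ∑ i, χ i • fun ω => |f i ω| := by
    funext ω
    simp [mul_comm]
  rw [h1]
  refine (eLpNorm_sum_le (fun i _ => ((hf i).abs.aestronglyMeasurable).const_smul _)
    (one_le_ofReal hq)).trans (Finset.sum_le_sum fun i _ => ?_)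
  rw [eLpNorm_const_smul, Real.enorm_eq_ofReal (hχ i)]
  gcongr
  exact eLpNorm_mono fun ω => by simp

/-- Contraction of `y ↦ g(e, y)` in `L^q` with weights `χ`. -/
def Contracts (P : Measure Ω) (e : Ω → ℝ) (g : ℝ → (Fin p → ℝ) → ℝ) (χ : Fin p → ℝ)
    (q : ℝ) : Prop :=
  ∀ y y' : Fin p → ℝ, eLpNorm (fun ω => g (e ω) y - g (e ω) y') (ENNReal.ofReal q) P ≤
    ENNReal.ofReal (∑ i, |y i - y' i| * χ i)

lemma Contracts.eLpNorm_sub_le (hε : IsIID P ε) {g : ℝ → (Fin p → ℝ) → ℝ}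
    (hg : Measurable fun ay : ℝ × (Fin p → ℝ) => g ay.1 ay.2) {q : ℝ} (hq : 1 ≤ q)
    {χ : Fin p → ℝ} (hχ : ∀ i, 0 ≤ χ i) (hc : Contracts P (ε 0) g χ q) {t : ℤ}
    {W W' : Ω → Fin p → ℝ} (hW : Causal P ε (t - 1) W) (hW' : Causal P ε (t - 1) W') :
    eLpNorm (fun ω => g (ε t ω) (W ω) - g (ε t ω) (W' ω)) (ENNReal.ofReal q) P ≤
      ∑ i, ENNReal.ofReal (χ i) *
        eLpNorm (fun ω => W ω i - W' ω i) (ENNReal.ofReal q) P := by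
  have hm := hW.aemeasurable hε.measurable
  have hm' := hW'.aemeasurable hε.measurable
  have h1 := (hW.prodMk hW').eLpNorm_innovation_le hε (by linarith : 0 < q)
    (f := fun x => g x.1 x.2.1 - g x.1 x.2.2)
    ((hg.comp (measurable_fst.prodMk measurable_snd.fst)).sub
      (hg.comp (measurable_fst.prodMk measurable_snd.snd)))
    (g := fun w => ENNReal.ofReal (∑ i, |w.1 i - w.2 i| * χ i)) (fun w => hc w.1 w.2)
  refine h1.trans (le_trans (eLpNorm_mono_enorm fun ω => ?_)
    (eLpNorm_weighted_sum_le hq hχ (f := fun i ω => W ω i - W' ω i) fun i =>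
    ((measurable_pi_apply i).comp_aemeasurable hm).sub
      ((measurable_pi_apply i).comp_aemeasurable hm')))
  rw [Real.enorm_eq_ofReal (Finset.sum_nonneg fun i _ => mul_nonneg (abs_nonneg _) (hχ i))]
  simp

lemma sum_ofReal_mul_le {χ : Fin p → ℝ} (hχ : ∀ i, 0 ≤ χ i) {m : Fin p → ℝ≥0∞} {c : ℝ}
    (hm : ∀ i, m i ≤ ENNReal.ofReal c) :
    ∑ i, ENNReal.ofReal (χ i) * m i ≤ ENNReal.ofReal ((∑ i, χ i) * c) := by
  calc ∑ i, ENNReal.ofReal (χ i) * m i ≤ ∑ i, ENNReal.ofReal (χ i) * ENNReal.ofReal c := by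
        gcongr with i; exact hm i
    _ = ENNReal.ofReal ((∑ i, χ i) * c) := by
        rw [← Finset.sum_mul, ← ENNReal.ofReal_sum_of_nonneg fun i _ => hχ i,
          ENNReal.ofReal_mul (Finset.sum_nonneg fun i _ => hχ i)]

/-- Truncation at level `R`. -/
def clip (R x : ℝ) : ℝ := max (-R) (min x R)

lemma measurable_clip (R : ℝ) : Measurable (clip R) := by
  unfold clip; fun_prop

lemma abs_clip_le {R : ℝ} (hR : 0 ≤ R) (x : ℝ) : |clip R x| ≤ R := by
  unfold clip
  rw [abs_le]
  exact ⟨le_max_left _ _, max_le (by linarith) (min_le_right _ _)⟩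

lemma abs_clip_le_abs {R : ℝ} (hR : 0 ≤ R) (x : ℝ) : |clip R x| ≤ |x| := by
  unfold clip
  rcases le_total x R with h | h
  · rw [min_eq_left h]
    rcases le_total (-R) x with h' | h'
    · rw [max_eq_right h']
    · rw [max_eq_left h', abs_neg, abs_of_nonneg hR, abs_of_nonpos (by linarith)]; linarith
  · rw [min_eq_right h, max_eq_right (by linarith), abs_of_nonneg hR, abs_of_nonneg (by linarith)]
    exact h

lemma clip_of_abs_le {R x : ℝ} (h : |x| ≤ R) : clip R x = x := by
  obtain ⟨h1, h2⟩ := abs_le.1 h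
  rw [clip, min_eq_left h2, max_eq_right h1]

lemma tendsto_clip (x : ℝ) : Tendsto (fun n : ℕ => clip n x) atTop (𝓝 x) := by
  refine tendsto_const_nhds.congr' ?_
  obtain ⟨N, hN⟩ := exists_nat_ge |x|
  filter_upwards [eventually_ge_atTop N] with n hn
  exact (clip_of_abs_le (hN.trans (by exact_mod_cast hn))).symm

lemma localized_step (hε : IsIID P ε) {g : ℝ → (Fin p → ℝ) → ℝ}
    (hg : Measurable fun ay : ℝ × (Fin p → ℝ) => g ay.1 ay.2) {q : ℝ} (hq : 1 ≤ q)
    {χ : Fin p → ℝ} (hχ : ∀ i, 0 ≤ χ i) (hc : Contracts P (ε 0) g χ q) {y₀ : Fin p → ℝ} {C₀ : ℝ}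
    (hC : 0 ≤ C₀) (hC₀ : eLpNorm (fun ω => g (ε 0 ω) y₀) (ENNReal.ofReal q) P ≤ ENNReal.ofReal C₀)
    {t : ℤ} {s : Set Ω} (hs : MeasurableSet[past ε (t - 1)] s) {W : Ω → Fin p → ℝ}
    (hW : Causal P ε (t - 1) W) {B : ℝ} (hB : 0 ≤ B)
    (hWB : ∀ i, eLpNorm (s.indicator fun ω => W ω i) (ENNReal.ofReal q) P ≤ ENNReal.ofReal B) :
    eLpNorm (s.indicator fun ω => g (ε t ω) (W ω)) (ENNReal.ofReal q) P ≤
      ENNReal.ofReal (C₀ + ∑ i, |y₀ i| * χ i + (∑ i, χ i) * B) := by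
  classical
  have hq1 := one_le_ofReal hq
  have hs' := past_le hε.measurable _ _ hs
  have hs0 := hs
  rw [past_eq_comap_hist] at hs
  obtain ⟨s', hs'm, rfl⟩ := hs
  set W'' : Ω → Fin p → ℝ := fun ω => if hist ε (t - 1) ω ∈ s' then W ω else y₀ with hW''
  have hcW : Causal P ε (t - 1) W'' := by
    obtain ⟨F, hF, h⟩ := hW
    refine ⟨fun e => if e ∈ s' then F e else y₀, Measurable.ite hs'm hF measurable_const, ?_⟩
    filter_upwards [h] with ω hω
    simp [hW'', hω]
  have hWm := hcW.aemeasurable hε.measurable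
  have h0 : eLpNorm (fun ω => g (ε t ω) y₀) (ENNReal.ofReal q) P ≤ ENNReal.ofReal C₀ := by
    have hy : Measurable fun a => g a y₀ := hg.comp (measurable_id.prodMk measurable_const)
    exact (((hε.identDistrib t 0).comp hy).eLpNorm_eq _).trans_le hC₀
  have hle := hc.eLpNorm_sub_le hε hg hq hχ hcW (causal_const (t - 1) y₀)
  have hgm : AEStronglyMeasurable (fun ω => g (ε t ω) (W'' ω)) P :=
    (hg.comp_aemeasurable ((hε.measurable t).aemeasurable.prodMk hWm)).aestronglyMeasurable
  have hgm0 : AEStronglyMeasurable (fun ω => g (ε t ω) y₀) P :=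
    (hg.comp_aemeasurable ((hε.measurable t).aemeasurable.prodMk
      aemeasurable_const)).aestronglyMeasurable
  have hterm : ∀ i, eLpNorm (fun ω => W'' ω i - y₀ i) (ENNReal.ofReal q) P ≤
      ENNReal.ofReal (B + |y₀ i|) := by
    intro i
    have hWi : AEStronglyMeasurable (((hist ε (t - 1)) ⁻¹' s').indicator fun ω => W ω i) P :=
      (((measurable_pi_apply i).comp_aemeasurable
        (hW.aemeasurable hε.measurable)).aestronglyMeasurable).indicator hs'
    calc eLpNorm (fun ω => W'' ω i - y₀ i) (ENNReal.ofReal q) P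
        ≤ eLpNorm ((((hist ε (t - 1)) ⁻¹' s').indicator fun ω => W ω i) -
            ((hist ε (t - 1)) ⁻¹' s').indicator fun ω => y₀ i) (ENNReal.ofReal q) P := by
          refine eLpNorm_mono fun ω => ?_
          by_cases h : hist ε (t - 1) ω ∈ s' <;> simp [hW'', h]
      _ ≤ eLpNorm (((hist ε (t - 1)) ⁻¹' s').indicator fun ω => W ω i) (ENNReal.ofReal q) P +
          eLpNorm (((hist ε (t - 1)) ⁻¹' s').indicator fun ω => y₀ i) (ENNReal.ofReal q) P :=
          eLpNorm_sub_le hWi (aestronglyMeasurable_const.indicator hs') hq1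
      _ ≤ ENNReal.ofReal B + ENNReal.ofReal |y₀ i| := by
          gcongr
          · exact hWB i
          · refine (eLpNorm_le_of_ae_bound (C := |y₀ i|) (Eventually.of_forall fun ω => ?_)).trans ?_
            · by_cases h : hist ε (t - 1) ω ∈ s' <;> simp [h]
            · simp
      _ = ENNReal.ofReal (B + |y₀ i|) := (ENNReal.ofReal_add hB (abs_nonneg _)).symm
  calc eLpNorm (((hist ε (t - 1)) ⁻¹' s').indicator fun ω => g (ε t ω) (W ω)) (ENNReal.ofReal q) P
      ≤ eLpNorm ((fun ω => g (ε t ω) (W'' ω) - g (ε t ω) y₀) +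
        ((hist ε (t - 1)) ⁻¹' s').indicator fun ω => g (ε t ω) y₀) (ENNReal.ofReal q) P := by
        refine eLpNorm_mono fun ω => ?_
        by_cases h : hist ε (t - 1) ω ∈ s' <;> simp [hW'', h]
    _ ≤ eLpNorm (fun ω => g (ε t ω) (W'' ω) - g (ε t ω) y₀) (ENNReal.ofReal q) P +
        eLpNorm (((hist ε (t - 1)) ⁻¹' s').indicator fun ω => g (ε t ω) y₀) (ENNReal.ofReal q) P :=
        eLpNorm_add_le (hgm.sub hgm0) (hgm0.indicator hs') hq1
    _ ≤ ∑ i, ENNReal.ofReal (χ i * (B + |y₀ i|)) + ENNReal.ofReal C₀ := by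
        gcongr
        · refine hle.trans (Finset.sum_le_sum fun i _ => ?_)
          rw [ENNReal.ofReal_mul (hχ i)]
          gcongr
          exact hterm i
        · exact (eLpNorm_indicator_le _).trans h0
    _ = ENNReal.ofReal (C₀ + ∑ i, |y₀ i| * χ i + (∑ i, χ i) * B) := by
        rw [← ENNReal.ofReal_sum_of_nonneg fun i _ => mul_nonneg (hχ i)
          (add_nonneg hB (abs_nonneg _)), ← ENNReal.ofReal_add (Finset.sum_nonneg fun i _ =>
          mul_nonneg (hχ i) (add_nonneg hB (abs_nonneg _))) hC]
        congr 1
        simp only [mul_add, Finset.sum_add_distrib, Finset.sum_mul]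
        rw [Finset.sum_congr rfl fun i _ => mul_comm (χ i) |y₀ i|]
        ring

/-- Any stationary causal solution of a contracting recursion has a `q`-th moment, with an
explicit bound. -/
lemma IsShift.eLpNorm_le_of_recursion (hε : IsIID P ε) {g : ℝ → (Fin p → ℝ) → ℝ}
    (hg : Measurable fun ay : ℝ × (Fin p → ℝ) => g ay.1 ay.2) {q : ℝ} (hq : 1 ≤ q)
    {χ : Fin p → ℝ} (hχ : IsWeight χ) (hc : Contracts P (ε 0) g χ q) {y₀ : Fin p → ℝ} {C₀ : ℝ}
    (hC : 0 ≤ C₀) (hC₀ : eLpNorm (fun ω => g (ε 0 ω) y₀) (ENNReal.ofReal q) P ≤ ENNReal.ofReal C₀)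
    {x : ℤ → Ω → ℝ} (hx : IsShift P ε x)
    (hrec : ∀ t, ∀ᵐ ω ∂P, x t ω = g (ε t ω) (LocStat.lags p (fun s => x s ω) (t - 1))) (t : ℤ) :
    eLpNorm (x t) (ENNReal.ofReal q) P ≤
      ENNReal.ofReal ((C₀ + ∑ i, |y₀ i| * χ i) / (1 - ∑ i, χ i)) := by
  obtain ⟨hχ0, hχ1⟩ := hχ
  set ρ := ∑ i, χ i with hρ
  have hρ0 : 0 ≤ ρ := Finset.sum_nonneg fun i _ => hχ0 i
  set C₁ := C₀ + ∑ i, |y₀ i| * χ i with hC₁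
  have hC₁0 : 0 ≤ C₁ := add_nonneg hC (Finset.sum_nonneg fun i _ => mul_nonneg (abs_nonneg _) (hχ0 i))
  set B := C₁ / (1 - ρ) with hB
  have h1ρ : 0 < 1 - ρ := by linarith
  have hB0 : 0 ≤ B := div_nonneg hC₁0 h1ρ.le
  have hBeq : C₁ + ρ * B = B := by rw [hB]; field_simp; ring
  have hq1 := one_le_ofReal hq
  have hq0 : ENNReal.ofReal q ≠ 0 := by simp; linarith
  obtain ⟨F, hF, hxF⟩ := hx
  -- a measurable version
  set z : ℤ → Ω → ℝ := fun t => F ∘ hist ε t with hz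
  have hzm : ∀ t, Measurable (z t) := fun t => hF.comp (measurable_hist hε.measurable t)
  have hzs : IsShift P ε z := ⟨F, hF, fun t => ae_eq_rfl⟩
  have hzrec : ∀ t, ∀ᵐ ω ∂P, z t ω = g (ε t ω) (LocStat.lags p (fun s => z s ω) (t - 1)) := by
    intro t
    filter_upwards [hrec t, ae_all_iff.2 hxF] with ω h1 h2
    have : (fun s => z s ω) = fun s => x s ω := funext fun s => (h2 s).symm
    rw [this, ← h1]
    exact (h2 t).symm
  -- localization to bounded initial values
  let A : ℕ → Set Ω := fun c => {ω | ∀ i : Fin p, |z (-(i : ℕ)) ω| ≤ c}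
  have hzpast : ∀ s ≤ (0 : ℤ), Measurable[past ε 0] (z s) := by
    intro s hs
    refine (hF.comp (measurable_hist_past ε s)).mono ?_ le_rfl
    exact iSup_le fun ⟨r, hr⟩ => le_iSup
      (fun r : {r : ℤ // r ≤ 0} => MeasurableSpace.comap (ε r) inferInstance) ⟨r, hr.trans hs⟩
  have hA0 : ∀ c, MeasurableSet[past ε 0] (A c) := by
    intro c
    simp only [A, ofPred_forall]
    exact @MeasurableSet.iInter _ _ (past ε 0) _ _ fun i =>
      (measurable_abs.comp (hzpast _ (by omega))) measurableSet_Iic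
  have hA : ∀ c (t : ℤ), 0 ≤ t → MeasurableSet[past ε t] (A c) := by
    intro c t ht
    refine (?_ : past ε 0 ≤ past ε t) _ (hA0 c)
    exact iSup_le fun ⟨r, hr⟩ => le_iSup
      (fun r : {r : ℤ // r ≤ t} => MeasurableSpace.comap (ε r) inferInstance) ⟨r, hr.trans ht⟩
  have hAm : ∀ c, MeasurableSet (A c) := fun c => past_le hε.measurable _ _ (hA0 c)
  have hstep : ∀ (c : ℕ) (t : ℤ) (b : ℝ), 1 ≤ t → 0 ≤ b →
      (∀ i : Fin p, eLpNorm ((A c).indicator (z (t - 1 - (i : ℕ)))) (ENNReal.ofReal q) P ≤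
        ENNReal.ofReal b) →
      eLpNorm ((A c).indicator (z t)) (ENNReal.ofReal q) P ≤ ENNReal.ofReal (C₁ + ρ * b) := by
    intro c t b ht hb hm
    have := localized_step hε hg hq hχ0 hc hC hC₀ (hA c (t - 1) (by omega))
      (W := fun ω => LocStat.lags p (fun s => z s ω) (t - 1))
      (causal_lags fun s _ => hzs.causal s) hb hm
    refine le_trans (le_of_eq (eLpNorm_congr_ae ?_)) this
    filter_upwards [hzrec t] with ω hω
    by_cases h : ω ∈ A c
    · simp only [indicator_of_mem h]; exact hω
    · simp [indicator_of_notMem h]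
  have hinit : ∀ (c : ℕ) (t : ℤ), -(p : ℤ) + 1 ≤ t →
      eLpNorm ((A c).indicator (z t)) (ENNReal.ofReal q) P ≤ ENNReal.ofReal (B + c) := by
    intro c
    have : ∀ (k : ℕ) (t : ℤ), -(p : ℤ) + 1 ≤ t → t ≤ k →
        eLpNorm ((A c).indicator (z t)) (ENNReal.ofReal q) P ≤ ENNReal.ofReal (B + c) := by
      intro k
      induction k with
      | zero =>
        intro t ht1 ht0
        have hi : (-t).toNat < p := by omega
        refine (eLpNorm_le_of_ae_bound (C := (c : ℝ)) (Eventually.of_forall fun ω => ?_)).trans ?_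
        · by_cases h : ω ∈ A c
          · rw [indicator_of_mem h]
            have := h ⟨(-t).toNat, hi⟩
            have e : (-(((-t).toNat : ℕ) : ℤ)) = t := by simp only [Nat.cast_zero] at ht0; omega
            simp only at this
            rwa [e] at this
          · simp [indicator_of_notMem h]
        · simp only [measure_univ, ENNReal.one_rpow, one_mul]
          exact ENNReal.ofReal_le_ofReal (by linarith)
      | succ k ih =>
        intro t ht1 htk
        rcases (le_or_gt t k) with h | h
        · exact ih t ht1 h
        · have h2 : 1 ≤ t := by omega
          refine (hstep c t (B + c) h2 (by positivity) fun i => ih _ ?_ ?_).trans ?_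
          · have := i.2; omega
          · push_cast at htk; omega
          · refine ENNReal.ofReal_le_ofReal ?_
            have hc0 : (0 : ℝ) ≤ c := Nat.cast_nonneg c
            nlinarith
    intro t ht
    exact this t.toNat t ht (by omega)
  have hdecay : ∀ (c k : ℕ) (t : ℤ), ((k : ℤ) - 1) * p + 1 ≤ t →
      eLpNorm ((A c).indicator (z t)) (ENNReal.ofReal q) P ≤ ENNReal.ofReal (B + c * ρ ^ k) := by
    intro c k
    induction k with
    | zero => intro t ht; simpa using hinit c t (by simpa using ht)
    | succ k ih =>
      intro t ht
      have h0 : (0 : ℤ) ≤ (k : ℤ) * p := by positivity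
      have ht' : (k : ℤ) * p + 1 ≤ t := by push_cast at ht; linarith
      refine (hstep c t (B + c * ρ ^ k) (by linarith) (by positivity) fun i => ih _ ?_).trans ?_
      · have h3 : ((k : ℤ) - 1) * p = k * p - p := by ring
        have := i.2; rw [h3]; omega
      · refine ENNReal.ofReal_le_ofReal (le_of_eq ?_)
        rw [mul_add, ← add_assoc, hBeq]; ring
  have hclip : ∀ R c k : ℕ, eLpNorm (fun ω => clip R (z 0 ω)) (ENNReal.ofReal q) P ≤
      ENNReal.ofReal (B + c * ρ ^ k) + ENNReal.ofReal R * P (A c)ᶜ ^ (1 / q) := by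
    intro R c k
    set T : ℤ := ((k : ℤ) - 1) * p + 1 with hT
    have hR : (0 : ℝ) ≤ R := Nat.cast_nonneg R
    have heq : eLpNorm (fun ω => clip R (z 0 ω)) (ENNReal.ofReal q) P =
        eLpNorm (fun ω => clip R (z T ω)) (ENNReal.ofReal q) P :=
      (hzs.comp (measurable_clip R)).eLpNorm_eq hε _ _ _
    rw [heq]
    have hle : eLpNorm (fun ω => clip R (z T ω)) (ENNReal.ofReal q) P ≤
        eLpNorm ((A c).indicator (fun ω => |z T ω|) + (A c)ᶜ.indicator (fun _ => (R : ℝ)))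
          (ENNReal.ofReal q) P := by
      refine eLpNorm_mono_real fun ω => ?_
      by_cases h : ω ∈ A c
      · simpa [h] using abs_clip_le_abs hR _
      · simpa [h] using abs_clip_le hR _
    refine hle.trans ((eLpNorm_add_le ((hzm T).abs.aestronglyMeasurable.indicator (hAm c))
      (aestronglyMeasurable_const.indicator (hAm c).compl) hq1).trans ?_)
    gcongr
    · refine le_trans (eLpNorm_mono fun ω => ?_) (hdecay c k T le_rfl)
      by_cases h : ω ∈ A c <;> simp [h]
    · rw [eLpNorm_indicator_const (hAm c).compl hq0 ENNReal.ofReal_ne_top,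
        ENNReal.toReal_ofReal (by linarith), Real.enorm_eq_ofReal hR]
  have hclip1 : ∀ R c : ℕ, eLpNorm (fun ω => clip R (z 0 ω)) (ENNReal.ofReal q) P ≤
      ENNReal.ofReal B + ENNReal.ofReal R * P (A c)ᶜ ^ (1 / q) := by
    intro R c
    have hlim : Tendsto (fun k : ℕ => ENNReal.ofReal (B + c * ρ ^ k) +
        ENNReal.ofReal R * P (A c)ᶜ ^ (1 / q)) atTop
        (𝓝 (ENNReal.ofReal (B + c * 0) + ENNReal.ofReal R * P (A c)ᶜ ^ (1 / q))) := by
      refine Tendsto.add (ENNReal.tendsto_ofReal ?_) tendsto_const_nhds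
      exact ((tendsto_pow_atTop_nhds_zero_of_lt_one hρ0 hχ1).const_mul _).const_add _
    have := ge_of_tendsto' hlim (hclip R c)
    simpa using this
  have hAlim : Tendsto (fun c => P (A c)ᶜ) atTop (𝓝 0) := by
    have := tendsto_measure_iInter_atTop (μ := P) (s := fun c => (A c)ᶜ)
      (fun c => (hAm c).compl.nullMeasurableSet)
      (fun c c' hcc' => compl_subset_compl.2 fun ω hω i => (hω i).trans (by exact_mod_cast hcc'))
      ⟨0, measure_ne_top _ _⟩
    rw [show ⋂ c, (A c)ᶜ = ∅ from ?_, measure_empty] at this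
    · exact this
    · rw [← compl_iUnion, compl_empty_iff, eq_univ_iff_forall]
      intro ω
      obtain ⟨N, hN⟩ := exists_nat_ge (∑ i : Fin p, |z (-(i : ℕ)) ω|)
      refine mem_iUnion.2 ⟨N, fun i => le_trans ?_ hN⟩
      exact Finset.single_le_sum (f := fun i : Fin p => |z (-(i : ℕ)) ω|)
        (fun i _ => abs_nonneg _) (Finset.mem_univ i)
  have hclip2 : ∀ R : ℕ, eLpNorm (fun ω => clip R (z 0 ω)) (ENNReal.ofReal q) P ≤
      ENNReal.ofReal B := by
    intro R
    have hlim : Tendsto (fun c : ℕ => ENNReal.ofReal B +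
        ENNReal.ofReal R * P (A c)ᶜ ^ (1 / q)) atTop
        (𝓝 (ENNReal.ofReal B + ENNReal.ofReal R * 0 ^ (1 / q))) := by
      refine Tendsto.const_add _ (ENNReal.Tendsto.const_mul ?_ (Or.inr ENNReal.ofReal_ne_top))
      exact ((ENNReal.continuous_rpow_const (y := 1 / q)).tendsto 0).comp hAlim
    have := ge_of_tendsto' hlim (hclip1 R)
    rwa [ENNReal.zero_rpow_of_pos (by positivity), mul_zero, add_zero] at this
  rw [eLpNorm_congr_ae (hxF t), show eLpNorm (F ∘ hist ε t) (ENNReal.ofReal q) P =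
    eLpNorm (z 0) (ENNReal.ofReal q) P from hzs.eLpNorm_eq hε _ _ _]
  refine (Lp.eLpNorm_lim_le_liminf_eLpNorm (fun R : ℕ =>
    ((measurable_clip R).comp (hzm 0)).aestronglyMeasurable) (z 0)
    (Eventually.of_forall fun ω => tendsto_clip _)).trans ?_
  exact liminf_le_of_le (by isBoundedDefault) fun b hb => by
    obtain ⟨n, hn⟩ := hb.exists
    exact hn.trans (hclip2 n)

end Moments

section Approximation

variable {Ω : Type*} [MeasurableSpace Ω] {P : Measure Ω} [IsProbabilityMeasure P] {ε : ℤ → Ω → ℝ}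
  {p : ℕ} {G : ℝ → (Fin p → ℝ) → ℝ → ℝ} {Xt : ℤ → ℝ → Ω → ℝ} {X : ℕ → ℤ → Ω → ℝ}

lemma IsStationarySolution.isShift (hXt : IsStationarySolution P ε G Xt) {u : ℝ}
    (hu : u ∈ Icc (0 : ℝ) 1) : IsShift P ε (fun t => Xt t u) := by
  obtain ⟨H, hH, h⟩ := hXt.shift u hu
  exact ⟨H, hH, h⟩

lemma CondL1.exists_contracts {q : ℝ} (hq : 1 ≤ q) (h : CondL1 P (ε 0) G q) :
    ∃ (χ y₀ : Fin p → ℝ) (C₀ : ℝ), IsWeight χ ∧ 0 ≤ C₀ ∧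
      (∀ u ∈ Icc (0 : ℝ) 1, eLpNorm (fun ω => G (ε 0 ω) y₀ u) (ENNReal.ofReal q) P ≤
        ENNReal.ofReal C₀) ∧
      ∀ u ∈ Icc (0 : ℝ) 1, Contracts P (ε 0) (fun a y => G a y u) χ q := by
  obtain ⟨χ, y₀, hχ, hs, hc⟩ := h
  refine ⟨χ, y₀, (⨆ u ∈ Icc (0 : ℝ) 1, eLpNorm (fun ω => G (ε 0 ω) y₀ u)
    (ENNReal.ofReal q) P).toReal, hχ, ENNReal.toReal_nonneg, fun u hu => ?_, fun u hu y y' => ?_⟩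
  · rw [ENNReal.ofReal_toReal hs.ne]
    exact le_iSup₂ (f := fun u (_ : u ∈ Icc (0 : ℝ) 1) =>
      eLpNorm (fun ω => G (ε 0 ω) y₀ u) (ENNReal.ofReal q) P) u hu
  · have := hc u hu y y'
    rw [min_eq_right hq, wnorm_one] at this
    exact this

lemma Contracts.mono (hε : IsIID P ε) {g : ℝ → (Fin p → ℝ) → ℝ}
    (hg : Measurable fun ay : ℝ × (Fin p → ℝ) => g ay.1 ay.2) {χ : Fin p → ℝ} {q q' : ℝ}
    (hqq' : q' ≤ q) (h : Contracts P (ε 0) g χ q) : Contracts P (ε 0) g χ q' := by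
  intro y y'
  refine le_trans (eLpNorm_le_eLpNorm_of_exponent_le (ENNReal.ofReal_le_ofReal hqq') ?_) (h y y')
  have := hε.measurable 0
  exact ((hg.comp (this.prodMk measurable_const)).sub
    (hg.comp (this.prodMk measurable_const))).aestronglyMeasurable

/-- Uniform moment bound for the stationary solutions. -/
lemma IsStationarySolution.exists_eLpNorm_le (hε : IsIID P ε)
    (hG : ∀ u ∈ Icc (0 : ℝ) 1, Measurable fun ay : ℝ × (Fin p → ℝ) => G ay.1 ay.2 u)
    (hXt : IsStationarySolution P ε G Xt) {q : ℝ} (hq : 1 ≤ q) (hL1 : CondL1 P (ε 0) G q) :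
    ∃ B : ℝ, 0 ≤ B ∧ ∀ u ∈ Icc (0 : ℝ) 1, ∀ t,
      eLpNorm (Xt t u) (ENNReal.ofReal q) P ≤ ENNReal.ofReal B := by
  obtain ⟨χ, y₀, C₀, hχ, hC, hC₀, hc⟩ := hL1.exists_contracts hq
  refine ⟨(C₀ + ∑ i, |y₀ i| * χ i) / (1 - ∑ i, χ i), ?_, fun u hu t => ?_⟩
  · have := hχ.2
    exact div_nonneg (add_nonneg hC (Finset.sum_nonneg fun i _ =>
      mul_nonneg (abs_nonneg _) (hχ.1 i))) (by linarith)
  · exact (hXt.isShift hu).eLpNorm_le_of_recursion hε (hG u hu) hq hχ (hc u hu) hC (hC₀ u hu)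
      (hXt.recursion u hu) t

lemma ENNReal_le_of_le_mul_add {d : ℝ≥0∞} (hd : d ≠ ∞) {ρ s : ℝ} (hρ : 0 ≤ ρ) (hρ1 : ρ < 1)
    (hs : 0 ≤ s) (h : d ≤ ENNReal.ofReal ρ * d + ENNReal.ofReal s) :
    d ≤ ENNReal.ofReal (s / (1 - ρ)) := by
  lift d to NNReal using hd
  rw [← ENNReal.ofReal_coe_nnreal, ← ENNReal.ofReal_mul hρ,
    ← ENNReal.ofReal_add (by positivity) hs, ENNReal.ofReal_le_ofReal_iff (by positivity)] at h
  rw [← ENNReal.ofReal_coe_nnreal]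
  refine ENNReal.ofReal_le_ofReal ?_
  rw [le_div_iff₀ (by linarith)]
  linarith

/-- Hölder continuity of the stationary solution in the time parameter. -/
lemma IsStationarySolution.exists_holder (hε : IsIID P ε)
    (hG : ∀ u ∈ Icc (0 : ℝ) 1, Measurable fun ay : ℝ × (Fin p → ℝ) => G ay.1 ay.2 u)
    (hXt : IsStationarySolution P ε G Xt) {q α : ℝ} (hq : 1 ≤ q)
    (hL1 : CondL1 P (ε 0) G q) (hL4 : CondL4 P (ε 0) G Xt q α) :
    ∃ D : ℝ, 0 ≤ D ∧ ∀ u ∈ Icc (0 : ℝ) 1, ∀ v ∈ Icc (0 : ℝ) 1, ∀ t,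
      eLpNorm (fun ω => Xt t u ω - Xt t v ω) (ENNReal.ofReal q) P ≤
        ENNReal.ofReal (D * |u - v| ^ α) := by
  have hq0 : 0 < q := by linarith
  have hq1 := one_le_ofReal hq
  obtain ⟨χ, y₀, C₀, hχ, hC, hC₀, hc⟩ := hL1.exists_contracts hq
  obtain ⟨B, hB0, hB⟩ := hXt.exists_eLpNorm_le hε hG hq hL1
  obtain ⟨hχ0, hχ1⟩ := hχ
  have hρ0 : 0 ≤ ∑ i, χ i := Finset.sum_nonneg fun i _ => hχ0 i
  set S : ℝ≥0∞ := ⨆ u ∈ Icc (0 : ℝ) 1, eLpNorm (fun ω => holderConst P (ε 0) G q α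
    (lags p (fun s => Xt s u ω) 0)) (ENNReal.ofReal q) P with hS
  have hSfin : S ≠ ∞ := ne_of_lt hL4
  refine ⟨S.toReal / (1 - ∑ i, χ i), div_nonneg ENNReal.toReal_nonneg (by linarith),
    fun u hu v hv t => ?_⟩
  rcases eq_or_ne u v with rfl | huv
  · simp
  have hpos : 0 < |u - v| ^ α := Real.rpow_pos_of_pos (abs_pos.2 (sub_ne_zero.2 huv)) _
  have hsu := hXt.isShift hu
  have hsv := hXt.isShift hv
  have hm : ∀ w ∈ Icc (0 : ℝ) 1, ∀ t, AEMeasurable (Xt t w) P := fun w hw t =>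
    ((hXt.isShift hw).causal t).aemeasurable hε.measurable
  have hsd : IsShift P ε (fun t ω => Xt t u ω - Xt t v ω) :=
    (hsu.prodMk hsv).comp (g := fun x : ℝ × ℝ => x.1 - x.2) (by fun_prop)
  set d := eLpNorm (fun ω => Xt 1 u ω - Xt 1 v ω) (ENNReal.ofReal q) P with hd
  have hds : ∀ s, eLpNorm (fun ω => Xt s u ω - Xt s v ω) (ENNReal.ofReal q) P = d := fun s =>
    hsd.eLpNorm_eq hε _ s 1
  have hdfin : d ≠ ∞ := by
    refine ne_top_of_le_ne_top ?_ (eLpNorm_sub_le (hm u hu 1).aestronglyMeasurable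
      (hm v hv 1).aestronglyMeasurable hq1)
    exact ENNReal.add_ne_top.2 ⟨ne_top_of_le_ne_top ENNReal.ofReal_ne_top (hB u hu 1),
      ne_top_of_le_ne_top ENNReal.ofReal_ne_top (hB v hv 1)⟩
  have hcu : Causal P ε (1 - 1) (fun ω => lags p (fun s => Xt s u ω) (1 - 1)) :=
    (hsu.lags p).causal _
  have hcv : Causal P ε (1 - 1) (fun ω => lags p (fun s => Xt s v ω) (1 - 1)) :=
    (hsv.lags p).causal _
  have hgm : ∀ {w w'} (hw : w ∈ Icc (0 : ℝ) 1) (hw' : w' ∈ Icc (0 : ℝ) 1), AEStronglyMeasurable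
      (fun ω => G (ε 1 ω) (lags p (fun s => Xt s w' ω) (1 - 1)) w) P := fun {w w'} hw hw' =>
    ((hG w hw).comp_aemeasurable ((hε.measurable 1).aemeasurable.prodMk
      ((((hXt.isShift hw').lags p).causal (1 - 1)).aemeasurable hε.measurable))).aestronglyMeasurable
  have h1 := (hc u hu).eLpNorm_sub_le hε (hG u hu) hq hχ0 hcu hcv
  have h2 : eLpNorm (fun ω => G (ε 1 ω) (lags p (fun s => Xt s v ω) (1 - 1)) u -
      G (ε 1 ω) (lags p (fun s => Xt s v ω) (1 - 1)) v) (ENNReal.ofReal q) P ≤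
      ENNReal.ofReal (|u - v| ^ α * S.toReal) := by
    have hle := hcv.eLpNorm_innovation_le hε hq0
      (f := fun x => G x.1 x.2 u - G x.1 x.2 v) ((hG u hu).sub (hG v hv))
      (g := fun y => ENNReal.ofReal (|u - v| ^ α) * holderConst P (ε 0) G q α y) ?_
    · refine hle.trans ?_
      have hq0' : ENNReal.ofReal q ≠ 0 := by simpa using hq0
      have hS' : eLpNorm (fun ω => holderConst P (ε 0) G q α (lags p (fun s => Xt s v ω) 0))
          (ENNReal.ofReal q) P ≤ S := le_iSup₂ (f := fun u (_ : u ∈ Icc (0 : ℝ) 1) =>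
        eLpNorm (fun ω => holderConst P (ε 0) G q α (lags p (fun s => Xt s u ω) 0))
          (ENNReal.ofReal q) P) v hv
      rw [ENNReal.ofReal_mul hpos.le, ENNReal.ofReal_toReal hSfin]
      refine le_trans (le_of_eq ?_) (mul_le_mul_right hS' _)
      rw [eLpNorm_eq_lintegral_rpow_enorm_toReal hq0' ENNReal.ofReal_ne_top,
        eLpNorm_eq_lintegral_rpow_enorm_toReal hq0' ENNReal.ofReal_ne_top,
        ENNReal.toReal_ofReal hq0.le]
      simp only [enorm_eq_self, ENNReal.mul_rpow_of_nonneg _ _ hq0.le, sub_self]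
      rw [lintegral_const_mul' _ _ (ENNReal.rpow_ne_top_of_nonneg hq0.le ENNReal.ofReal_ne_top),
        ENNReal.mul_rpow_of_nonneg _ _ (by positivity), ← ENNReal.rpow_mul,
        mul_one_div_cancel hq0.ne', ENNReal.rpow_one]
    · intro y
      have h3 : eLpNorm (fun ω => G (ε 0 ω) y u - G (ε 0 ω) y v) (ENNReal.ofReal q) P /
          ENNReal.ofReal (|u - v| ^ α) ≤ holderConst P (ε 0) G q α y := by
        unfold holderConst
        refine le_iSup₂_of_le u hu (le_iSup₂_of_le v hv (le_iSup_of_le huv le_rfl))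
      rw [mul_comm]
      exact (ENNReal.div_le_iff (by simpa using hpos) ENNReal.ofReal_ne_top).1 h3
  rw [hds t]
  have h3 : d ≤ ENNReal.ofReal (∑ i, χ i) * d + ENNReal.ofReal (|u - v| ^ α * S.toReal) := by
    calc d = eLpNorm ((fun ω => G (ε 1 ω) (lags p (fun s => Xt s u ω) (1 - 1)) u -
          G (ε 1 ω) (lags p (fun s => Xt s v ω) (1 - 1)) u) +
          fun ω => G (ε 1 ω) (lags p (fun s => Xt s v ω) (1 - 1)) u -
          G (ε 1 ω) (lags p (fun s => Xt s v ω) (1 - 1)) v) (ENNReal.ofReal q) P := by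
          refine eLpNorm_congr_ae ?_
          filter_upwards [hXt.recursion u hu 1, hXt.recursion v hv 1] with ω h h'
          rw [h, h']
          simp
      _ ≤ _ := eLpNorm_add_le ((hgm hu hu).sub (hgm hu hv)) ((hgm hu hv).sub (hgm hv hv)) hq1
      _ ≤ ENNReal.ofReal (∑ i, χ i) * d + ENNReal.ofReal (|u - v| ^ α * S.toReal) := by
          gcongr
          refine h1.trans (le_of_eq ?_)
          rw [ENNReal.ofReal_sum_of_nonneg fun i _ => hχ0 i, Finset.sum_mul]
          exact Finset.sum_congr rfl fun i _ => by rw [← hds (1 - 1 - (i : ℕ))]; rfl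
  refine (ENNReal_le_of_le_mul_add hdfin hρ0 hχ1 (by positivity) h3).trans
    (ENNReal.ofReal_le_ofReal (le_of_eq ?_))
  ring

lemma rescaled_mem_Icc {n : ℕ} {t : ℤ} (ht : t ≤ n) :
    max ((t : ℝ) / n) 0 ∈ Icc (0 : ℝ) 1 := by
  refine ⟨le_max_right _ _, max_le ?_ zero_le_one⟩
  rcases Nat.eq_zero_or_pos n with rfl | hn
  · simp
  · rw [div_le_one (by exact_mod_cast hn)]
    exact_mod_cast ht

lemma IsLocallyStationarySolution.causal
    (hG : ∀ u ∈ Icc (0 : ℝ) 1, Measurable fun ay : ℝ × (Fin p → ℝ) => G ay.1 ay.2 u)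
    (hXt : IsStationarySolution P ε G Xt) (hX : IsLocallyStationarySolution P ε G Xt X)
    (n : ℕ) (t : ℤ) (ht : t ≤ n) : Causal P ε t (X n t) := by
  have key : ∀ (k : ℕ) (t : ℤ), t ≤ k → t ≤ n → Causal P ε t (X n t) := by
    intro k
    induction k with
    | zero =>
      intro t ht _
      exact ((hXt.isShift ⟨le_rfl, zero_le_one⟩).causal t).congr (hX.initial n t (by simpa using ht))
    | succ k ih =>
      intro t htk htn
      rcases le_or_gt t k with h | h
      · exact ih t h htn
      have hl : Causal P ε (t - 1) (fun ω => lags p (fun s => X n s ω) (t - 1)) :=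
        causal_lags fun s hs => ih s (by push_cast at htk; omega) (by omega)
      exact (((causal_innovation t).prodMk (hl.mono (by omega))).comp
        (hG _ (rescaled_mem_Icc htn))).congr (hX.recursion n t htn)
  exact key t.toNat t (by omega) ht

lemma abs_rescaled_sub_le (n : ℕ) (t : ℤ) (k : ℕ) :
    |max (((t - k : ℤ) : ℝ) / n) 0 - max ((t : ℝ) / n) 0| ≤ (k : ℝ) / n := by
  refine (abs_max_sub_max_le_abs _ _ _).trans (le_of_eq ?_)
  rw [← sub_div]
  push_cast
  rw [show (t : ℝ) - k - t = -k by ring, abs_div, abs_neg, Nat.abs_cast, Nat.abs_cast]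

/-- The locally stationary process is close to its stationary approximations. -/
lemma IsLocallyStationarySolution.exists_eLpNorm_sub_le (hε : IsIID P ε)
    (hG : ∀ u ∈ Icc (0 : ℝ) 1, Measurable fun ay : ℝ × (Fin p → ℝ) => G ay.1 ay.2 u)
    (hXt : IsStationarySolution P ε G Xt) (hX : IsLocallyStationarySolution P ε G Xt X)
    {q α : ℝ} (hq : 1 ≤ q) (hα : α ∈ Ioc (0 : ℝ) 1) {χ : Fin p → ℝ} (hχ : IsWeight χ)
    (hc : ∀ u ∈ Icc (0 : ℝ) 1, Contracts P (ε 0) (fun a y => G a y u) χ q) {D : ℝ} (hD : 0 ≤ D)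
    (hH : ∀ u ∈ Icc (0 : ℝ) 1, ∀ v ∈ Icc (0 : ℝ) 1, ∀ t,
      eLpNorm (fun ω => Xt t u ω - Xt t v ω) (ENNReal.ofReal q) P ≤
        ENNReal.ofReal (D * |u - v| ^ α)) :
    ∃ E : ℝ, 0 < E ∧ ∀ (n : ℕ) (t : ℤ), t ≤ n → ∀ v ∈ Icc (0 : ℝ) 1, ∀ j ≤ p,
      eLpNorm (fun ω => X n (t - j) ω - Xt (t - j) v ω) (ENNReal.ofReal q) P ≤
        ENNReal.ofReal (E * ((1 / (n : ℝ)) ^ α + |max ((t : ℝ) / n) 0 - v| ^ α)) := by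
  obtain ⟨hα0, hα1⟩ := hα
  obtain ⟨hχ0, hχ1⟩ := hχ
  have hq1 := one_le_ofReal hq
  set ρ := ∑ i, χ i with hρ
  have hρ0 : 0 ≤ ρ := Finset.sum_nonneg fun i _ => hχ0 i
  have h1ρ : 0 < 1 - ρ := by linarith
  have hXm : ∀ (n : ℕ) (t : ℤ), t ≤ n → AEStronglyMeasurable (X n t) P := fun n t ht =>
    ((hX.causal hG hXt n t ht).aemeasurable hε.measurable).aestronglyMeasurable
  have hm : ∀ w ∈ Icc (0 : ℝ) 1, ∀ t, AEStronglyMeasurable (Xt t w) P := fun w hw t =>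
    (((hXt.isShift hw).causal t).aemeasurable hε.measurable).aestronglyMeasurable
  -- distance to the approximation at the running time
  have key : ∀ n : ℕ, ∀ (k : ℕ) (t : ℤ), t ≤ k → t ≤ n →
      eLpNorm (fun ω => X n t ω - Xt t (max ((t : ℝ) / n) 0) ω) (ENNReal.ofReal q) P ≤
        ENNReal.ofReal (ρ * (D * ((p : ℝ) / n) ^ α) / (1 - ρ)) := by
    intro n k
    set e := ρ * (D * ((p : ℝ) / n) ^ α) / (1 - ρ) with he
    have he0 : 0 ≤ e := by positivity
    have heq : ρ * (e + D * ((p : ℝ) / n) ^ α) = e := by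
      rw [he]; field_simp; ring
    induction k with
    | zero =>
      intro t ht _
      have ht0 : t ≤ 0 := by simpa using ht
      have hz : max ((t : ℝ) / n) 0 = 0 :=
        max_eq_right (div_nonpos_of_nonpos_of_nonneg (by exact_mod_cast ht0) (by positivity))
      rw [hz, eLpNorm_congr_ae (g := fun _ => (0 : ℝ))]
      · simp
      · filter_upwards [hX.initial n t ht0] with ω h
        simp [h]
    | succ k ih =>
      intro t htk htn
      rcases le_or_gt t k with h | h
      · exact ih t h htn
      set w := max ((t : ℝ) / n) 0 with hw
      have hwI : w ∈ Icc (0 : ℝ) 1 := rescaled_mem_Icc htn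
      have h1 := (hc w hwI).eLpNorm_sub_le hε (hG w hwI) hq hχ0 (t := t)
        (W := fun ω => lags p (fun s => X n s ω) (t - 1))
        (W' := fun ω => lags p (fun s => Xt s w ω) (t - 1))
        (causal_lags fun s hs => hX.causal hG hXt n s (by omega))
        (((hXt.isShift hwI).lags p).causal _)
      have h2 : eLpNorm (fun ω => X n t ω - Xt t w ω) (ENNReal.ofReal q) P =
          eLpNorm (fun ω => G (ε t ω) (lags p (fun s => X n s ω) (t - 1)) w -
            G (ε t ω) (lags p (fun s => Xt s w ω) (t - 1)) w) (ENNReal.ofReal q) P := by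
        refine eLpNorm_congr_ae ?_
        filter_upwards [hX.recursion n t htn, hXt.recursion w hwI t] with ω h h'
        rw [← h, ← h']
      rw [h2]
      refine h1.trans ?_
      rw [← heq]
      refine sum_ofReal_mul_le hχ0 fun i => ?_
      set s : ℤ := t - 1 - (i : ℕ) with hs
      have hsn : s ≤ n := by omega
      set w' := max ((s : ℝ) / n) 0 with hw'
      have hw'I : w' ∈ Icc (0 : ℝ) 1 := rescaled_mem_Icc hsn
      have hww : |w' - w| ≤ (p : ℝ) / n := by
        have := abs_rescaled_sub_le n t ((i : ℕ) + 1)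
        rw [show t - (((i : ℕ) + 1 : ℕ) : ℤ) = s by rw [hs]; push_cast; ring] at this
        refine this.trans ?_
        gcongr
        exact i.2
      calc eLpNorm (fun ω => X n s ω - Xt s w ω) (ENNReal.ofReal q) P
          = eLpNorm ((fun ω => X n s ω - Xt s w' ω) + fun ω => Xt s w' ω - Xt s w ω)
            (ENNReal.ofReal q) P := by
            congr 1; funext ω; simp
        _ ≤ _ := eLpNorm_add_le ((hXm n s hsn).sub (hm w' hw'I s))
            ((hm w' hw'I s).sub (hm w hwI s)) hq1
        _ ≤ ENNReal.ofReal e + ENNReal.ofReal (D * ((p : ℝ) / n) ^ α) := by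
            gcongr
            · exact ih s (by push_cast at htk; omega) hsn
            · refine (hH w' hw'I w hwI s).trans (ENNReal.ofReal_le_ofReal ?_)
              gcongr
        _ = _ := (ENNReal.ofReal_add he0 (by positivity)).symm
  refine ⟨ρ * (D * (p : ℝ) ^ α) / (1 - ρ) + D * (p : ℝ) ^ α + D + 1, by positivity,
    fun n t ht v hv j hj => ?_⟩
  have hsn : t - (j : ℤ) ≤ n := by omega
  set s : ℤ := t - (j : ℤ) with hs
  set w := max ((t : ℝ) / n) 0 with hw
  set w' := max ((s : ℝ) / n) 0 with hw'
  have hw'I : w' ∈ Icc (0 : ℝ) 1 := rescaled_mem_Icc hsn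
  have hww : |w' - w| ≤ (p : ℝ) / n := (abs_rescaled_sub_le n t j).trans (by gcongr)
  have hpn : ((p : ℝ) / n) ^ α = (p : ℝ) ^ α * (1 / (n : ℝ)) ^ α := by
    rw [div_eq_mul_one_div, Real.mul_rpow (by positivity) (by positivity)]
  calc eLpNorm (fun ω => X n s ω - Xt s v ω) (ENNReal.ofReal q) P
      = eLpNorm ((fun ω => X n s ω - Xt s w' ω) + fun ω => Xt s w' ω - Xt s v ω)
        (ENNReal.ofReal q) P := by
        congr 1; funext ω; simp
    _ ≤ _ := eLpNorm_add_le ((hXm n s hsn).sub (hm w' hw'I s))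
        ((hm w' hw'I s).sub (hm v hv s)) hq1
    _ ≤ ENNReal.ofReal (ρ * (D * ((p : ℝ) / n) ^ α) / (1 - ρ)) +
        ENNReal.ofReal (D * (((p : ℝ) / n) ^ α + |w - v| ^ α)) := by
        gcongr
        · exact key n s.toNat s (by omega) hsn
        · refine (hH w' hw'I v hv s).trans (ENNReal.ofReal_le_ofReal ?_)
          gcongr
          calc |w' - v| ^ α ≤ ((p : ℝ) / n + |w - v|) ^ α := by
                gcongr
                calc |w' - v| ≤ |w' - w| + |w - v| := abs_sub_le _ _ _
                  _ ≤ _ := by gcongr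
            _ ≤ _ := Real.rpow_add_le_add_rpow (by positivity) (abs_nonneg _) hα0.le hα1
    _ ≤ _ := by
        rw [← ENNReal.ofReal_add (by positivity) (by positivity)]
        refine ENNReal.ofReal_le_ofReal ?_
        rw [hpn]
        have ha : 0 ≤ (1 / (n : ℝ)) ^ α := by positivity
        have hb : 0 ≤ |w - v| ^ α := by positivity
        have hc : 0 ≤ ρ * (D * (p : ℝ) ^ α) / (1 - ρ) := by positivity
        have hd : 0 ≤ D * (p : ℝ) ^ α := by positivity
        have e1 : ρ * (D * ((p : ℝ) ^ α * (1 / (n : ℝ)) ^ α)) / (1 - ρ) =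
          ρ * (D * (p : ℝ) ^ α) / (1 - ρ) * (1 / (n : ℝ)) ^ α := by ring
        rw [e1]
        nlinarith [mul_nonneg hc hb, mul_nonneg hd hb, mul_nonneg hD ha]

end Approximation

/-! ### Functions of polynomial growth -/

section PolynomialGrowth

variable {Ω : Type*} [MeasurableSpace Ω] {P : Measure Ω} [IsProbabilityMeasure P] {r : ℕ}

lemma l1_nonneg (y : Fin r → ℝ) : 0 ≤ l1 y := Finset.sum_nonneg fun _ _ => abs_nonneg _

lemma l1_zero : l1 (0 : Fin r → ℝ) = 0 := by simp [l1]

lemma continuous_l1 : Continuous (l1 : (Fin r → ℝ) → ℝ) := by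
  unfold l1; fun_prop

lemma mul_rpow_le_add {x y M : ℝ} (hx : 0 ≤ x) (hy : 0 ≤ y) (hM : 0 ≤ M) :
    x * y ^ M ≤ x ^ (M + 1) + y ^ (M + 1) := by
  rw [Real.rpow_add_of_nonneg hx hM zero_le_one, Real.rpow_add_of_nonneg hy hM zero_le_one,
    Real.rpow_one, Real.rpow_one]
  have h1 : 0 ≤ x ^ M := by positivity
  have h2 : 0 ≤ y ^ M := by positivity
  rcases le_total x y with h | h
  · nlinarith [mul_nonneg h1 hx]
  · have := Real.rpow_le_rpow hy h hM
    nlinarith [mul_nonneg h2 hy]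

lemma ClassL.continuous {M C : ℝ} {g : (Fin r → ℝ) → ℝ} (hg : ClassL M C g) : Continuous g := by
  rw [continuous_iff_continuousAt]
  intro y
  have hM := hg.1
  have h1 : Tendsto (fun y' => C * (l1 (fun i => y' i - y i) * (1 + l1 y' ^ M + l1 y ^ M))) (𝓝 y)
      (𝓝 0) := by
    have hc : Continuous fun y' : Fin r → ℝ =>
        C * (l1 (fun i => y' i - y i) * (1 + l1 y' ^ M + l1 y ^ M)) := by
      have h2 : Continuous fun y' : Fin r → ℝ => l1 (fun i => y' i - y i) :=
        continuous_l1.comp (by fun_prop)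
      have h3 : Continuous fun y' : Fin r → ℝ => l1 y' ^ M :=
        continuous_l1.rpow_const fun _ => Or.inr hM
      fun_prop
    have := hc.tendsto y
    simpa [l1] using this
  rw [ContinuousAt, tendsto_iff_dist_tendsto_zero]
  exact squeeze_zero (fun _ => dist_nonneg) (fun y' => by rw [Real.dist_eq]; exact hg.2 y' y) h1

/-- The Lipschitz bound of the class, in a form adapted to a perturbation of size `δ`. -/
lemma ClassL.abs_sub_le {M C : ℝ} (hC : 0 ≤ C) {g : (Fin r → ℝ) → ℝ} (hg : ClassL M C g)
    {δ : ℝ} (hδ : 0 < δ) (y y' : Fin r → ℝ) :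
    |g y - g y'| ≤ C * δ * (3 * (l1 (fun i => y i - y' i) / δ) ^ (M + 1) + 1 +
      l1 y ^ (M + 1) + l1 y' ^ (M + 1)) := by
  obtain ⟨hM, hg⟩ := hg
  refine (hg y y').trans ?_
  set a := l1 (fun i => y i - y' i) with ha
  have ha0 : 0 ≤ a / δ := div_nonneg (l1_nonneg _) hδ.le
  have e : a = δ * (a / δ) := by field_simp
  have h1 := mul_rpow_le_add ha0 zero_le_one hM
  have h2 := mul_rpow_le_add ha0 (l1_nonneg y) hM
  have h3 := mul_rpow_le_add ha0 (l1_nonneg y') hM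
  rw [Real.one_rpow, Real.one_rpow] at h1
  calc C * (a * (1 + l1 y ^ M + l1 y' ^ M))
      = C * δ * (a / δ * 1 + a / δ * l1 y ^ M + a / δ * l1 y' ^ M) := by
        conv_lhs => rw [e]
        ring
    _ ≤ _ := mul_le_mul_of_nonneg_left (by linarith) (by positivity)

lemma ClassL.abs_le {M C : ℝ} (hC : 0 ≤ C) {g : (Fin r → ℝ) → ℝ} (hg : ClassL M C g)
    (y : Fin r → ℝ) : |g y| ≤ (|g 0| + 5 * C) * (1 + l1 y ^ (M + 1)) := by
  have h := hg.abs_sub_le hC one_pos y 0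
  have hM := hg.1
  rw [l1_zero, Real.zero_rpow (by linarith), div_one] at h
  simp only [Pi.zero_apply, sub_zero] at h
  change _ ≤ C * 1 * (3 * l1 y ^ (M + 1) + 1 + l1 y ^ (M + 1) + 0) at h
  have h1 : |g y| ≤ |g 0| + |g y - g 0| := by
    calc |g y| = |g 0 + (g y - g 0)| := by ring_nf
      _ ≤ _ := abs_add_le _ _
  have h2 : 0 ≤ l1 y ^ (M + 1) := Real.rpow_nonneg (l1_nonneg _) _
  nlinarith [mul_nonneg hC h2, mul_nonneg (abs_nonneg (g 0)) h2]

lemma eLpNorm_l1_le {q : ℝ} (hq : 1 ≤ q) {Z : Ω → Fin r → ℝ} (hZ : AEMeasurable Z P) {B : ℝ}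
    (hB : ∀ i, eLpNorm (fun ω => Z ω i) (ENNReal.ofReal q) P ≤ ENNReal.ofReal B) :
    eLpNorm (fun ω => l1 (Z ω)) (ENNReal.ofReal q) P ≤ ENNReal.ofReal (r * B) := by
  have h := eLpNorm_weighted_sum_le (P := P) hq (χ := fun _ : Fin r => 1) (fun _ => zero_le_one)
    (f := fun i ω => Z ω i) fun i => (measurable_pi_apply i).comp_aemeasurable hZ
  simp only [mul_one] at h
  refine h.trans ((sum_ofReal_mul_le (fun _ => zero_le_one) hB).trans ?_)
  simp

lemma lintegral_rpow_le_of_eLpNorm_le {q : ℝ} (hq : 0 < q) {f : Ω → ℝ} (hf : ∀ ω, 0 ≤ f ω) {b : ℝ}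
    (hb : 0 ≤ b) (h : eLpNorm f (ENNReal.ofReal q) P ≤ ENNReal.ofReal b) :
    ∫⁻ ω, ENNReal.ofReal (f ω ^ q) ∂P ≤ ENNReal.ofReal (b ^ q) := by
  rw [eLpNorm_eq_lintegral_rpow_enorm_toReal (by simpa using hq) ENNReal.ofReal_ne_top,
    ENNReal.toReal_ofReal hq.le] at h
  have h2 := ENNReal.rpow_le_rpow h hq.le
  rw [← ENNReal.rpow_mul, one_div_mul_cancel hq.ne', ENNReal.rpow_one,
    ENNReal.ofReal_rpow_of_nonneg hb hq.le] at h2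
  refine le_trans (le_of_eq (lintegral_congr fun ω => ?_)) h2
  rw [Real.enorm_eq_ofReal (hf ω), ENNReal.ofReal_rpow_of_nonneg (hf ω) hq.le]

lemma lintegral_l1_rpow_le {q : ℝ} (hq : 1 ≤ q) {Z : Ω → Fin r → ℝ} (hZ : AEMeasurable Z P) {B : ℝ}
    (hB0 : 0 ≤ B) (hB : ∀ i, eLpNorm (fun ω => Z ω i) (ENNReal.ofReal q) P ≤ ENNReal.ofReal B) :
    ∫⁻ ω, ENNReal.ofReal (l1 (Z ω) ^ q) ∂P ≤ ENNReal.ofReal ((r * B) ^ q) :=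
  lintegral_rpow_le_of_eLpNorm_le (by linarith) (fun _ => l1_nonneg _) (by positivity)
    (eLpNorm_l1_le hq hZ hB)

lemma ClassL.eLpNorm_sub_le {M C : ℝ} (hC : 0 ≤ C) {g : (Fin r → ℝ) → ℝ} (hg : ClassL M C g)
    {B : ℝ} (hB0 : 0 ≤ B) {Z Z' : Ω → Fin r → ℝ} (hZ : AEMeasurable Z P) (hZ' : AEMeasurable Z' P)
    (hB : ∀ i, eLpNorm (fun ω => Z ω i) (ENNReal.ofReal (M + 1)) P ≤ ENNReal.ofReal B)
    (hB' : ∀ i, eLpNorm (fun ω => Z' ω i) (ENNReal.ofReal (M + 1)) P ≤ ENNReal.ofReal B)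
    {δ : ℝ} (hδ : 0 < δ)
    (h : ∀ i, eLpNorm (fun ω => Z ω i - Z' ω i) (ENNReal.ofReal (M + 1)) P ≤ ENNReal.ofReal δ) :
    eLpNorm (fun ω => g (Z ω) - g (Z' ω)) 1 P ≤
      ENNReal.ofReal (C * (3 * (r : ℝ) ^ (M + 1) + 1 + 2 * (r * B) ^ (M + 1)) * δ) := by
  have hM := hg.1
  have hq : (1 : ℝ) ≤ M + 1 := by linarith
  have hq0 : (0 : ℝ) < M + 1 := by linarith
  have hd : AEMeasurable (fun ω => fun i => Z ω i - Z' ω i) P := by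
    have := hZ.sub hZ'
    exact this
  have h1 : ∫⁻ ω, ENNReal.ofReal ((l1 (fun i => Z ω i - Z' ω i) / δ) ^ (M + 1)) ∂P ≤
      ENNReal.ofReal ((r : ℝ) ^ (M + 1)) := by
    refine lintegral_rpow_le_of_eLpNorm_le hq0 (fun ω => div_nonneg (l1_nonneg _) hδ.le)
      (by positivity) ?_
    have e : (fun ω => l1 (fun i => Z ω i - Z' ω i) / δ) =
        δ⁻¹ • fun ω => l1 (fun i => Z ω i - Z' ω i) := by
      funext ω; simp [div_eq_inv_mul]
    rw [e, eLpNorm_const_smul, Real.enorm_eq_ofReal (by positivity)]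
    calc _ ≤ ENNReal.ofReal δ⁻¹ * ENNReal.ofReal (r * δ) := by
          gcongr; exact eLpNorm_l1_le hq hd h
      _ = _ := by
          rw [← ENNReal.ofReal_mul (by positivity)]; congr 1; field_simp
  have h2 := lintegral_l1_rpow_le hq hZ hB0 hB
  have h3 := lintegral_l1_rpow_le hq hZ' hB0 hB'
  have m1 : AEMeasurable (fun ω => ENNReal.ofReal (l1 (Z ω) ^ (M + 1))) P :=
    ((continuous_l1.measurable.comp_aemeasurable hZ).pow_const _).ennreal_ofReal
  have m2 : AEMeasurable (fun ω => ENNReal.ofReal (l1 (Z' ω) ^ (M + 1))) P :=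
    ((continuous_l1.measurable.comp_aemeasurable hZ').pow_const _).ennreal_ofReal
  rw [eLpNorm_one_eq_lintegral_enorm]
  calc ∫⁻ ω, ‖g (Z ω) - g (Z' ω)‖ₑ ∂P
      ≤ ∫⁻ ω, ENNReal.ofReal (C * δ) * (3 * ENNReal.ofReal ((l1 (fun i => Z ω i - Z' ω i) / δ) ^ (M + 1))
          + 1 + ENNReal.ofReal (l1 (Z ω) ^ (M + 1)) + ENNReal.ofReal (l1 (Z' ω) ^ (M + 1))) ∂P := by
        refine lintegral_mono fun ω => ?_
        rw [Real.enorm_eq_ofReal_abs]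
        have ha : 0 ≤ (l1 (fun i => Z ω i - Z' ω i) / δ) ^ (M + 1) :=
          Real.rpow_nonneg (div_nonneg (l1_nonneg _) hδ.le) _
        have hb : 0 ≤ l1 (Z ω) ^ (M + 1) := Real.rpow_nonneg (l1_nonneg _) _
        have hc : 0 ≤ l1 (Z' ω) ^ (M + 1) := Real.rpow_nonneg (l1_nonneg _) _
        refine (ENNReal.ofReal_le_ofReal (hg.abs_sub_le hC hδ _ _)).trans (le_of_eq ?_)
        rw [ENNReal.ofReal_mul (by positivity), ENNReal.ofReal_add (by positivity) hc,
          ENNReal.ofReal_add (by positivity) hb, ENNReal.ofReal_add (by positivity) zero_le_one,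
          ENNReal.ofReal_mul (p := 3) (by norm_num)]
        simp
    _ = ENNReal.ofReal (C * δ) * (3 * ∫⁻ ω, ENNReal.ofReal
          ((l1 (fun i => Z ω i - Z' ω i) / δ) ^ (M + 1)) ∂P
          + 1 + ∫⁻ ω, ENNReal.ofReal (l1 (Z ω) ^ (M + 1)) ∂P +
          ∫⁻ ω, ENNReal.ofReal (l1 (Z' ω) ^ (M + 1)) ∂P) := by
        rw [lintegral_const_mul' _ _ ENNReal.ofReal_ne_top, lintegral_add_right' _ m2,
          lintegral_add_right' _ m1, lintegral_add_right _ measurable_const,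
          lintegral_const_mul' _ _ (by norm_num)]
        simp
    _ ≤ ENNReal.ofReal (C * δ) * (3 * ENNReal.ofReal ((r : ℝ) ^ (M + 1)) + 1 +
          ENNReal.ofReal ((r * B) ^ (M + 1)) + ENNReal.ofReal ((r * B) ^ (M + 1))) := by
        gcongr
    _ = _ := by
        have e3 : (3 : ℝ≥0∞) = ENNReal.ofReal 3 := by simp
        have e1 : (1 : ℝ≥0∞) = ENNReal.ofReal 1 := by simp
        rw [e3, e1, ← ENNReal.ofReal_mul (by norm_num), ← ENNReal.ofReal_add (by positivity)
          (by norm_num), ← ENNReal.ofReal_add (by positivity) (by positivity),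
          ← ENNReal.ofReal_add (by positivity) (by positivity), ← ENNReal.ofReal_mul (by positivity)]
        congr 1
        ring

lemma ClassL.integrable {M C : ℝ} (hC : 0 ≤ C) {g : (Fin r → ℝ) → ℝ} (hg : ClassL M C g)
    {Z : Ω → Fin r → ℝ} (hZ : AEMeasurable Z P)
    (hB : Integrable (fun ω => l1 (Z ω) ^ (M + 1)) P) :
    Integrable (fun ω => g (Z ω)) P := by
  refine Integrable.mono' (((integrable_const (1 : ℝ)).add hB).const_mul (|g 0| + 5 * C))
    (hg.continuous.measurable.comp_aemeasurable hZ).aestronglyMeasurable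
    (Eventually.of_forall fun ω => ?_)
  exact hg.abs_le hC (Z ω)

lemma integrable_l1_rpow {q : ℝ} (hq : 1 ≤ q) {Z : Ω → Fin r → ℝ} (hZ : AEMeasurable Z P) {B : ℝ}
    (hB0 : 0 ≤ B) (hB : ∀ i, eLpNorm (fun ω => Z ω i) (ENNReal.ofReal q) P ≤ ENNReal.ofReal B) :
    Integrable (fun ω => l1 (Z ω) ^ q) P := by
  refine ⟨((continuous_l1.measurable.comp_aemeasurable hZ).pow_const _).aestronglyMeasurable, ?_⟩
  rw [hasFiniteIntegral_iff_ofReal (Eventually.of_forall fun ω => Real.rpow_nonneg (l1_nonneg _) _)]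
  exact (lintegral_l1_rpow_le hq hZ hB0 hB).trans_lt ENNReal.ofReal_lt_top

lemma ClassL.memLp_two {M C : ℝ} (hC : 0 ≤ C) {g : (Fin r → ℝ) → ℝ} (hg : ClassL M C g)
    {Z : Ω → Fin r → ℝ} (hZ : AEMeasurable Z P)
    (hB : Integrable (fun ω => l1 (Z ω) ^ (2 * (M + 1))) P) :
    MemLp (fun ω => g (Z ω)) 2 P := by
  have hm : AEStronglyMeasurable (fun ω => l1 (Z ω) ^ (M + 1)) P :=
    ((continuous_l1.measurable.comp_aemeasurable hZ).pow_const _).aestronglyMeasurable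
  have h1 : MemLp (fun ω => l1 (Z ω) ^ (M + 1)) 2 P := by
    rw [memLp_two_iff_integrable_sq hm]
    refine hB.congr (Eventually.of_forall fun ω => ?_)
    simp only
    rw [← Real.rpow_natCast, ← Real.rpow_mul (l1_nonneg _)]
    congr 1
    push_cast
    ring
  have h2 : MemLp (fun ω => (|g 0| + 5 * C) * (1 + l1 (Z ω) ^ (M + 1))) 2 P :=
    ((memLp_const (1 : ℝ)).add h1).const_mul _
  refine h2.mono (hg.continuous.measurable.comp_aemeasurable hZ).aestronglyMeasurable
    (Eventually.of_forall fun ω => ?_)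
  exact (hg.abs_le hC (Z ω)).trans (le_abs_self _)

end PolynomialGrowth

/-! ### A weighted law of large numbers -/

section LawOfLargeNumbers

variable {Ω : Type*} [MeasurableSpace Ω] {P : Measure Ω} [IsProbabilityMeasure P] {ε : ℤ → Ω → ℝ}

lemma abs_sub_clip_le {R : ℝ} (hR : 0 ≤ R) (x : ℝ) : |x - clip R x| ≤ |x| := by
  unfold clip
  rcases le_total x R with h | h
  · rw [min_eq_left h]
    rcases le_total (-R) x with h' | h'
    · rw [max_eq_right h']; simp
    · rw [max_eq_left h', abs_of_nonpos (by linarith), abs_of_nonpos (by linarith)]; linarith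
  · rw [min_eq_right h, max_eq_right (by linarith), abs_of_nonneg (by linarith),
      abs_of_nonneg (by linarith)]
    linarith

lemma tendsto_eLpNorm_sub_clip {α : Type*} [MeasurableSpace α] {μ : Measure α} {q : ℝ≥0∞}
    (hq0 : q ≠ 0) (hq : q ≠ ∞) {f : α → ℝ} (hf : MemLp f q μ) :
    Tendsto (fun n : ℕ => eLpNorm (fun x => f x - clip n (f x)) q μ) atTop (𝓝 0) := by
  have hq' : 0 < q.toReal := ENNReal.toReal_pos hq0 hq
  have h := tendsto_lintegral_of_dominated_convergence' (μ := μ)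
    (F := fun (n : ℕ) x => ‖f x - clip n (f x)‖ₑ ^ q.toReal) (f := fun _ => 0)
    (fun x => ‖f x‖ₑ ^ q.toReal) (fun n => ?_) (fun n => Eventually.of_forall fun x => ?_) ?_
    (Eventually.of_forall fun x => ?_)
  · simp only [lintegral_zero] at h
    have h2 := ((ENNReal.continuous_rpow_const (y := 1 / q.toReal)).tendsto 0).comp h
    rw [ENNReal.zero_rpow_of_pos (by positivity)] at h2
    refine h2.congr fun n => ?_
    rw [eLpNorm_eq_lintegral_rpow_enorm_toReal hq0 hq]
    rfl
  · exact ((hf.1.aemeasurable.sub ((measurable_clip n).comp_aemeasurable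
      hf.1.aemeasurable)).enorm).pow_const _
  · refine ENNReal.rpow_le_rpow ?_ hq'.le
    rw [Real.enorm_eq_ofReal_abs, Real.enorm_eq_ofReal_abs]
    exact ENNReal.ofReal_le_ofReal (abs_sub_clip_le (Nat.cast_nonneg n) _)
  · exact (lintegral_rpow_enorm_lt_top_of_eLpNorm_lt_top hq0 hq hf.2).ne
  · have h1 : Tendsto (fun n : ℕ => f x - clip n (f x)) atTop (𝓝 0) := by
      simpa using (tendsto_clip (f x)).const_sub (f x)
    have h2 := ((ENNReal.continuous_rpow_const (y := q.toReal)).tendsto _).comp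
      (h1.enorm)
    simpa [ENNReal.zero_rpow_of_pos hq', Function.comp_def] using h2

/-- Coordinate filtration on sequence space. -/
def coordFiltration : Filtration ℕ (inferInstance : MeasurableSpace (ℕ → ℝ)) :=
  Filtration.natural (fun k (e : ℕ → ℝ) => e k) fun k => (measurable_pi_apply k).stronglyMeasurable

lemma iSup_coordFiltration : ⨆ n, coordFiltration n = (inferInstance : MeasurableSpace (ℕ → ℝ)) := by
  apply le_antisymm (iSup_le fun n => coordFiltration.le n)
  refine iSup_le fun k => ?_
  exact le_trans (le_iSup₂ (f := fun j (_ : j ≤ k) =>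
    MeasurableSpace.comap (fun e : ℕ → ℝ => e j) inferInstance) k le_rfl)
    (le_iSup (fun n => coordFiltration n) k)

/-- Integrable functions on sequence space are approximated in `L¹` by bounded functions of
finitely many coordinates. -/
lemma exists_finite_range_approx {ν : Measure (ℕ → ℝ)} [IsProbabilityMeasure ν]
    {F : (ℕ → ℝ) → ℝ} (hFm : Measurable F) (hF : Integrable F ν) {η : ℝ≥0∞} (hη : 0 < η) :
    ∃ (m R : ℕ) (F' : (ℕ → ℝ) → ℝ), Measurable[coordFiltration m] F' ∧ (∀ e, |F' e| ≤ R) ∧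
      eLpNorm (F - F') 1 ν ≤ η := by
  have hη2 : 0 < η / 2 := ENNReal.half_pos hη.ne'
  have h1 := hF.tendsto_eLpNorm_condExp (ℱ := coordFiltration)
    (by rw [iSup_coordFiltration]; exact hFm.stronglyMeasurable)
  obtain ⟨m, hm⟩ := ((tendsto_order.1 h1).2 _ hη2).exists
  have h2 := tendsto_eLpNorm_sub_clip (μ := ν) one_ne_zero ENNReal.one_ne_top
    (memLp_one_iff_integrable.2 (integrable_condExp (f := F) (m := coordFiltration m) (μ := ν)))
  obtain ⟨R, hR⟩ := ((tendsto_order.1 h2).2 _ hη2).exists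
  have hsm : StronglyMeasurable[coordFiltration m] (ν[F | coordFiltration m]) :=
    stronglyMeasurable_condExp
  refine ⟨m, R, fun e => clip R ((ν[F | coordFiltration m]) e),
    (measurable_clip R).comp hsm.measurable, fun e => abs_clip_le (Nat.cast_nonneg R) _, ?_⟩
  have hsm' := (hsm.mono (coordFiltration.le m)).measurable
  calc eLpNorm (F - fun e => clip R ((ν[F | coordFiltration m]) e)) 1 ν
      = eLpNorm ((F - ν[F | coordFiltration m]) + fun e => (ν[F | coordFiltration m]) e -
        clip R ((ν[F | coordFiltration m]) e)) 1 ν := by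
        congr 1; funext e; simp
    _ ≤ _ := eLpNorm_add_le (hFm.sub hsm').aestronglyMeasurable
        (hsm'.sub ((measurable_clip R).comp hsm')).aestronglyMeasurable le_rfl
    _ ≤ η / 2 + η / 2 := by
        gcongr
        rw [eLpNorm_sub_comm]
        exact hm.le
    _ = η := ENNReal.add_halves η

lemma measurable_hist_window (t : ℤ) (m : ℕ) :
    Measurable[⨆ r ∈ Icc (t - m) t, MeasurableSpace.comap (ε r) inferInstance, coordFiltration m]
      (hist ε t) := by
  rw [measurable_iff_comap_le]
  change MeasurableSpace.comap (hist ε t) (⨆ j ≤ m, MeasurableSpace.comap _ _) ≤ _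
  rw [MeasurableSpace.comap_iSup]
  refine iSup_le fun j => ?_
  rw [MeasurableSpace.comap_iSup]
  refine iSup_le fun hj => ?_
  rw [MeasurableSpace.comap_comp]
  refine le_iSup₂_of_le (t - j) ⟨by omega, by omega⟩ ?_
  exact le_of_eq rfl

lemma indepFun_finite_range (hε : IsIID P ε) {m : ℕ} {F : (ℕ → ℝ) → ℝ}
    (hF : Measurable[coordFiltration m] F) {s t : ℤ} (hst : s + m < t) :
    IndepFun (F ∘ hist ε s) (F ∘ hist ε t) P := by
  have h := indep_iSup_of_disjoint (fun i => (hε.measurable i).comap_le) hε.indep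
    (S := Icc (s - m) s) (T := Icc (t - m) t)
    (Set.disjoint_left.2 fun r h1 h2 => by have := h1.2; have := h2.1; omega)
  rw [IndepFun_iff_Indep]
  exact indep_of_indep_of_le_left (indep_of_indep_of_le_right h
    (measurable_iff_comap_le.1 (hF.comp (measurable_hist_window t m))))
    (measurable_iff_comap_le.1 (hF.comp (measurable_hist_window s m)))

lemma eLpNorm_one_le_of_sq {f : Ω → ℝ} (hf : Integrable (fun ω => f ω ^ 2) P) {η : ℝ} (hη : 0 < η) :
    eLpNorm f 1 P ≤ ENNReal.ofReal (η + (∫ ω, f ω ^ 2 ∂P) / η) := by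
  rw [eLpNorm_one_eq_lintegral_enorm]
  calc ∫⁻ ω, ‖f ω‖ₑ ∂P ≤ ∫⁻ ω, ENNReal.ofReal (η + f ω ^ 2 / η) ∂P := by
        refine lintegral_mono fun ω => ?_
        rw [Real.enorm_eq_ofReal_abs]
        refine ENNReal.ofReal_le_ofReal ?_
        have h1 : η + f ω ^ 2 / η = (η ^ 2 + |f ω| ^ 2) / η := by rw [sq_abs]; field_simp
        rw [h1, le_div_iff₀ hη]
        nlinarith [sq_nonneg (η - |f ω|), sq_nonneg (η + |f ω|), abs_nonneg (f ω)]
    _ = ENNReal.ofReal (∫ ω, (η + f ω ^ 2 / η) ∂P) := by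
        have hi : Integrable (fun ω => η + f ω ^ 2 / η) P :=
          (integrable_const _).add (hf.div_const _)
        rw [ofReal_integral_eq_lintegral_ofReal hi]
        exact Eventually.of_forall fun ω => by positivity
    _ = _ := by
        rw [integral_add (integrable_const _) (hf.div_const _), integral_div]; simp

lemma integral_sq_weighted_sum_le (hε : IsIID P ε) {m R : ℕ} {F : (ℕ → ℝ) → ℝ}
    (hF : Measurable[coordFiltration m] F) (hR : ∀ e, |F e| ≤ R) (s : Finset ℕ) (w : ℕ → ℝ)
    {C δ : ℝ} (hδ : 0 ≤ δ) (hC : ∑ t ∈ s, |w t| ≤ C) (hw : ∀ t ∈ s, |w t| ≤ δ) :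
    ∫ ω, (∑ t ∈ s, w t * (F (hist ε t ω) - ∫ ω', F (hist ε 0 ω') ∂P)) ^ 2 ∂P ≤
      C * ((2 * m + 1) * δ * (2 * R) ^ 2) := by
  have hFm : Measurable F := hF.mono (coordFiltration.le m) le_rfl
  have hm : ∀ t : ℤ, Measurable fun ω => F (hist ε t ω) := fun t =>
    hFm.comp (measurable_hist hε.measurable t)
  set c := ∫ ω', F (hist ε 0 ω') ∂P with hc
  have hint : ∀ t : ℤ, Integrable (fun ω => F (hist ε t ω)) P := fun t =>
    Integrable.of_bound (hm t).aestronglyMeasurable R (Eventually.of_forall fun ω => hR _)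
  have hcR : |c| ≤ R := by
    have := norm_integral_le_of_norm_le_const (μ := P) (f := fun ω' => F (hist ε 0 ω')) (C := R)
      (Eventually.of_forall fun ω => hR _)
    simpa using this
  have hct : ∀ t : ℤ, ∫ ω, F (hist ε t ω) ∂P = c := fun t =>
    (IsShift.identDistrib hε (W := fun t ω => F (hist ε t ω)) ⟨F, hFm, fun t => ae_eq_rfl⟩ t 0).integral_eq
  set D : ℤ → Ω → ℝ := fun t ω => F (hist ε t ω) - c with hD
  have hDm : ∀ t, Measurable (D t) := fun t => (hm t).sub_const c
  have hDb : ∀ t ω, |D t ω| ≤ 2 * R := fun t ω => by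
    have := abs_sub (F (hist ε t ω)) c
    have := hR (hist ε t ω)
    simp only [hD]; linarith
  have hDb2 : ∀ s t ω, |D s ω * D t ω| ≤ (2 * R) ^ 2 := fun s t ω => by
    rw [abs_mul, sq]
    exact mul_le_mul (hDb s ω) (hDb t ω) (abs_nonneg _) (by positivity)
  have hDi : ∀ s t, Integrable (fun ω => D s ω * D t ω) P := fun s t =>
    Integrable.of_bound ((hDm s).mul (hDm t)).aestronglyMeasurable _
      (Eventually.of_forall fun ω => hDb2 s t ω)
  have hcov0 : ∀ s t : ℤ, s + m < t → ∫ ω, D s ω * D t ω ∂P = 0 := by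
    intro s t hst
    have hF' : Measurable[coordFiltration m] fun e => F e - c := hF.sub_const c
    have := (indepFun_finite_range hε hF' hst).integral_fun_mul_eq_mul_integral
      (hDm s).aestronglyMeasurable (hDm t).aestronglyMeasurable
    refine this.trans ?_
    have h0 : ∫ ω, D s ω ∂P = 0 := by
      rw [hD]; simp only
      rw [integral_sub (hint s) (integrable_const _), hct s]; simp
    change (∫ ω, D s ω ∂P) * _ = 0
    rw [h0, zero_mul]
  have hcov : ∀ s t : ℕ, |∫ ω, D s ω * D t ω ∂P| ≤
      if t ∈ Finset.Icc (s - m) (s + m) then (2 * (R : ℝ)) ^ 2 else 0 := by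
    intro s t
    split_ifs with h
    · have := norm_integral_le_of_norm_le_const (μ := P) (f := fun ω => D s ω * D t ω)
        (C := (2 * (R : ℝ)) ^ 2) (Eventually.of_forall fun ω => hDb2 s t ω)
      simpa using this
    · rw [Finset.mem_Icc, not_and_or, not_le, not_le] at h
      rcases h with h | h
      · rw [show (fun ω => D s ω * D t ω) = fun ω => D t ω * D s ω from
          funext fun ω => mul_comm _ _, hcov0 t s (by omega)]; simp
      · rw [hcov0 s t (by omega)]; simp
  have hexp : ∀ ω, (∑ t ∈ s, w t * D t ω) ^ 2 =
      ∑ i ∈ s, ∑ j ∈ s, w i * w j * (D i ω * D j ω) := fun ω => by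
    rw [sq, Finset.sum_mul_sum]
    exact Finset.sum_congr rfl fun i _ => Finset.sum_congr rfl fun j _ => by ring
  change ∫ ω, (∑ t ∈ s, w t * D t ω) ^ 2 ∂P ≤ _
  simp_rw [hexp]
  rw [integral_finsetSum _ fun (i : ℕ) _ => integrable_finsetSum _ fun (j : ℕ) _ =>
    (hDi i j).const_mul (w i * w j)]
  calc ∑ i ∈ s, ∫ ω, ∑ j ∈ s, w i * w j * (D i ω * D j ω) ∂P
      ≤ ∑ i ∈ s, |w i| * ((2 * m + 1) * δ * (2 * R) ^ 2) := by
        refine Finset.sum_le_sum fun i _ => ?_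
        rw [integral_finsetSum _ fun (j : ℕ) _ => (hDi i j).const_mul (w i * w j)]
        calc ∑ j ∈ s, ∫ ω, w i * w j * (D i ω * D j ω) ∂P
            ≤ ∑ j ∈ s, |w i| * (δ * if j ∈ Finset.Icc (i - m) (i + m) then (2 * (R : ℝ)) ^ 2
                else 0) := by
              refine Finset.sum_le_sum fun j hj => ?_
              rw [integral_const_mul]
              refine (le_abs_self _).trans ?_
              rw [abs_mul, abs_mul, mul_assoc]
              refine mul_le_mul_of_nonneg_left ?_ (abs_nonneg _)
              exact mul_le_mul (hw j hj) (hcov i j) (abs_nonneg _) hδ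
          _ ≤ |w i| * ((2 * m + 1) * δ * (2 * R) ^ 2) := by
              rw [← Finset.mul_sum, ← Finset.mul_sum, ← Finset.sum_filter]
              refine mul_le_mul_of_nonneg_left ?_ (abs_nonneg _)
              rw [Finset.sum_const, nsmul_eq_mul]
              have hcard : ((s.filter (· ∈ Finset.Icc (i - m) (i + m))).card : ℝ) ≤ 2 * m + 1 := by
                have h1 : (s.filter (· ∈ Finset.Icc (i - m) (i + m))).card ≤
                    (Finset.Icc (i - m) (i + m)).card :=
                  Finset.card_le_card fun x hx => (Finset.mem_filter.1 hx).2
                rw [Nat.card_Icc] at h1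
                have h2 : (s.filter (· ∈ Finset.Icc (i - m) (i + m))).card ≤ 2 * m + 1 := by omega
                exact_mod_cast h2
              calc δ * (_ * (2 * (R : ℝ)) ^ 2) ≤ δ * ((2 * m + 1) * (2 * (R : ℝ)) ^ 2) := by gcongr
                _ = _ := by ring
    _ = (∑ i ∈ s, |w i|) * ((2 * m + 1) * δ * (2 * R) ^ 2) := by rw [Finset.sum_mul]
    _ ≤ _ := mul_le_mul_of_nonneg_right hC (by positivity)

/-- Weighted law of large numbers in `L¹` for functionals of the innovation history. -/
lemma IsShift.tendsto_weighted_sum (hε : IsIID P ε) {Z : ℤ → Ω → ℝ} (hZ : IsShift P ε Z)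
    (hint : Integrable (Z 0) P) {s : ℕ → Finset ℕ} {w : ℕ → ℕ → ℝ} {C : ℝ}
    (hC : ∀ᶠ n in atTop, ∑ t ∈ s n, |w n t| ≤ C) {δ : ℕ → ℝ} (hδ : Tendsto δ atTop (𝓝 0))
    (hw : ∀ᶠ n in atTop, ∀ t ∈ s n, |w n t| ≤ δ n) :
    Tendsto (fun n => eLpNorm (fun ω => ∑ t ∈ s n, w n t * (Z t ω - ∫ ω', Z 0 ω' ∂P)) 1 P)
      atTop (𝓝 0) := by
  have hC0 : 0 ≤ C := by
    obtain ⟨n, hn⟩ := hC.exists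
    exact (Finset.sum_nonneg fun _ _ => abs_nonneg _).trans hn
  have hZi : ∀ t, Integrable (Z t) P := fun t => (hZ.identDistrib hε 0 t).integrable_iff.1 hint
  have hZm : ∀ t, AEMeasurable (Z t) P := fun t => (hZ.causal t).aemeasurable hε.measurable
  obtain ⟨F, hFm, hF⟩ := hZ
  have hhist := measurable_hist hε.measurable
  have hν : IsProbabilityMeasure (P.map (hist ε 0)) :=
    Measure.isProbabilityMeasure_map (hhist 0).aemeasurable
  have hFi : Integrable F (P.map (hist ε 0)) := by
    rw [integrable_map_measure hFm.aestronglyMeasurable (hhist 0).aemeasurable]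
    exact (integrable_congr (hF 0)).1 hint
  rw [ENNReal.tendsto_nhds_zero]
  intro η hη
  rcases eq_or_ne η ∞ with rfl | hηtop
  · simp
  obtain ⟨η', hη'0, hη'⟩ : ∃ η' : ℝ, 0 < η' ∧ ENNReal.ofReal (C * η' + C * η' + (η' + η')) ≤ η := by
    refine ⟨η.toReal / (2 * (C + 1)), div_pos (ENNReal.toReal_pos hη.ne' hηtop) (by positivity), ?_⟩
    rw [← ENNReal.ofReal_toReal hηtop]
    refine ENNReal.ofReal_le_ofReal (le_of_eq ?_)
    rw [ENNReal.toReal_ofReal ENNReal.toReal_nonneg]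
    field_simp
    ring
  obtain ⟨m, R, F', hF'm, hR, hFF'⟩ := exists_finite_range_approx hFm hFi
    (ENNReal.ofReal_pos.2 hη'0)
  have hF'mm : Measurable F' := hF'm.mono (coordFiltration.le m) le_rfl
  have hF'i : ∀ t : ℤ, Integrable (fun ω => F' (hist ε t ω)) P := fun t =>
    Integrable.of_bound (hF'mm.comp (hhist t)).aestronglyMeasurable R
      (Eventually.of_forall fun ω => hR _)
  have hdiff : ∀ t : ℤ, eLpNorm (fun ω => Z t ω - F' (hist ε t ω)) 1 P ≤ ENNReal.ofReal η' := by
    intro t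
    refine le_trans (le_of_eq ?_) hFF'
    rw [map_hist hε 0 t, eLpNorm_map_measure (hFm.sub hF'mm).aestronglyMeasurable
      (hhist t).aemeasurable]
    refine eLpNorm_congr_ae ?_
    filter_upwards [hF t] with ω hω
    simp [hω]
  set c := ∫ ω', F' (hist ε 0 ω') ∂P with hc
  have hcc : |c - ∫ ω', Z 0 ω' ∂P| ≤ η' := by
    rw [hc, ← integral_sub (hF'i 0) hint]
    refine (norm_integral_le_lintegral_norm (fun ω => F' (hist ε 0 ω) - Z 0 ω)).trans ?_
    refine ENNReal.toReal_le_of_le_ofReal hη'0.le ?_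
    refine le_trans (le_of_eq ?_) (hdiff 0)
    rw [eLpNorm_one_eq_lintegral_enorm]
    refine lintegral_congr fun ω => ?_
    rw [ofReal_norm, ← enorm_neg, neg_sub]
  have hsq : Tendsto (fun n => η' + C * ((2 * m + 1) * |δ n| * (2 * R) ^ 2) / η') atTop
      (𝓝 (η' + C * ((2 * m + 1) * |0| * (2 * R) ^ 2) / η')) :=
    (((((hδ.abs).const_mul _).mul_const _).const_mul _).div_const _).const_add _
  have hsq' : ∀ᶠ n in atTop, η' + C * ((2 * m + 1) * |δ n| * (2 * R) ^ 2) / η' ≤ η' + η' := by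
    refine (hsq.eventually (Iio_mem_nhds ?_)).mono fun n hn => le_of_lt hn
    simpa using hη'0
  filter_upwards [hC, hw, hsq'] with n hCn hwn hsqn
  refine le_trans ?_ hη'
  have e : (fun ω => ∑ t ∈ s n, w n t * (Z t ω - ∫ ω', Z 0 ω' ∂P)) =
      (∑ t ∈ s n, w n t • fun ω => Z t ω - F' (hist ε t ω)) +
      ((fun _ => (∑ t ∈ s n, w n t) * (c - ∫ ω', Z 0 ω' ∂P)) +
      fun ω => ∑ t ∈ s n, w n t * (F' (hist ε t ω) - c)) := by
    funext ω
    simp only [Pi.add_apply, Finset.sum_apply, Pi.smul_apply, smul_eq_mul, Finset.sum_mul]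
    rw [← Finset.sum_add_distrib, ← Finset.sum_add_distrib]
    exact Finset.sum_congr rfl fun t _ => by ring
  have m1 : ∀ t : ℤ, AEStronglyMeasurable (fun ω => Z t ω - F' (hist ε t ω)) P := fun t =>
    ((hZm t).sub (hF'mm.comp (hhist t)).aemeasurable).aestronglyMeasurable
  have m3 : Measurable fun ω => ∑ t ∈ s n, w n t * (F' (hist ε t ω) - c) :=
    Finset.measurable_fun_sum _ fun t _ => ((hF'mm.comp (hhist t)).sub_const _).const_mul _
  have m2 : AEStronglyMeasurable (∑ t ∈ s n, w n t • fun ω => Z t ω - F' (hist ε t ω)) P :=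
    Finset.aestronglyMeasurable_sum _ fun (t : ℕ) _ => (m1 t).const_smul (w n t)
  have h1 : eLpNorm (∑ t ∈ s n, w n t • fun ω => Z t ω - F' (hist ε t ω)) 1 P ≤
      ENNReal.ofReal (C * η') := by
    refine (eLpNorm_sum_le (f := fun (t : ℕ) => w n t • fun ω => Z t ω - F' (hist ε t ω))
      (fun (t : ℕ) _ => (m1 t).const_smul (w n t)) le_rfl).trans ?_
    calc _ ≤ ∑ t ∈ s n, ENNReal.ofReal (|w n t| * η') := by
          refine Finset.sum_le_sum fun t _ => ?_
          rw [eLpNorm_const_smul, Real.enorm_eq_ofReal_abs, ENNReal.ofReal_mul (abs_nonneg _)]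
          exact mul_le_mul_right (hdiff t) _
      _ ≤ _ := by
          rw [← ENNReal.ofReal_sum_of_nonneg fun t _ => by positivity, ← Finset.sum_mul]
          exact ENNReal.ofReal_le_ofReal (mul_le_mul_of_nonneg_right hCn hη'0.le)
  have h2 : eLpNorm (fun _ : Ω => (∑ t ∈ s n, w n t) * (c - ∫ ω', Z 0 ω' ∂P)) 1 P ≤
      ENNReal.ofReal (C * η') := by
    refine (eLpNorm_le_of_ae_bound (C := C * η') (Eventually.of_forall fun ω => ?_)).trans ?_
    · rw [Real.norm_eq_abs, abs_mul]
      exact mul_le_mul ((Finset.abs_sum_le_sum_abs _ _).trans hCn) hcc (abs_nonneg _) hC0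
    · simp
  have h3 : eLpNorm (fun ω => ∑ t ∈ s n, w n t * (F' (hist ε t ω) - c)) 1 P ≤
      ENNReal.ofReal (η' + η') := by
    have hbd : ∃ K, ∀ ω, |∑ t ∈ s n, w n t * (F' (hist ε t ω) - c)| ≤ K := by
      refine ⟨∑ t ∈ s n, |w n t| * (R + |c|), fun ω => (Finset.abs_sum_le_sum_abs _ _).trans ?_⟩
      refine Finset.sum_le_sum fun t _ => ?_
      rw [abs_mul]
      refine mul_le_mul_of_nonneg_left ?_ (abs_nonneg _)
      exact (abs_sub _ _).trans (add_le_add_left (hR _) _)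
    obtain ⟨K, hK⟩ := hbd
    have hi : Integrable (fun ω => (∑ t ∈ s n, w n t * (F' (hist ε t ω) - c)) ^ 2) P := by
      refine Integrable.of_bound (m3.pow_const 2).aestronglyMeasurable (K ^ 2)
        (Eventually.of_forall fun ω => ?_)
      rw [norm_pow]
      exact pow_le_pow_left₀ (norm_nonneg _) (hK ω) 2
    refine (eLpNorm_one_le_of_sq hi hη'0).trans (ENNReal.ofReal_le_ofReal (le_trans ?_ hsqn))
    refine add_le_add_right (div_le_div_of_nonneg_right ?_ hη'0.le) _
    exact integral_sq_weighted_sum_le hε hF'm hR (s n) (w n) (abs_nonneg _) hCn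
      fun t ht => (hwn t ht).trans (le_abs_self _)
  rw [e, ENNReal.ofReal_add (by positivity) (by positivity),
    ENNReal.ofReal_add (by positivity) (by positivity), add_assoc]
  refine (eLpNorm_add_le m2 (aestronglyMeasurable_const.add m3.aestronglyMeasurable) le_rfl).trans
    (add_le_add h1 ?_)
  exact (eLpNorm_add_le aestronglyMeasurable_const m3.aestronglyMeasurable le_rfl).trans
    (add_le_add h2 h3)

end LawOfLargeNumbers

/-! ### Riemann sums of the kernel -/

section RiemannSums

lemma sum_indicator_Ioc {F : ℕ → ℝ} {p n t : ℕ} (ht : t ∈ Finset.Icc (p + 1) n) {y : ℝ}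
    (hy : y ∈ Ioc ((t : ℝ) - 1) t) :
    ∑ s ∈ Finset.Icc (p + 1) n, (Ioc ((s : ℝ) - 1) s).indicator (fun _ => F s) y = F t := by
  rw [Finset.sum_eq_single t]
  · rw [indicator_of_mem hy]
  · intro s _ hst
    refine indicator_of_notMem (fun hs => hst ?_) _
    have h1 : (s : ℝ) < t + 1 := by linarith [hs.1, hy.2]
    have h2 : (t : ℝ) < s + 1 := by linarith [hy.1, hs.2]
    norm_cast at h1 h2
    omega
  · exact fun h => absurd ht h

/-- Riemann sums of an almost everywhere continuous function on `[-1/2, 1/2]`, on the grid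
`(t/n - u)/b`. -/
lemma tendsto_riemann_sum {f : ℝ → ℝ} {B : ℝ} (hB : ∀ x, |f x| ≤ B)
    (hsupp : ∀ x, x ∉ Icc (-(1 / 2) : ℝ) (1 / 2) → f x = 0) (hcont : ∀ᵐ x : ℝ, ContinuousAt f x)
    {u : ℝ} (hu : u ∈ Ioo (0 : ℝ) 1) {b : ℕ → ℝ} (hb : ∀ n, 0 < b n)
    (hb0 : Tendsto b atTop (𝓝 0)) (hnb : Tendsto (fun n : ℕ => (n : ℝ) * b n) atTop atTop)
    (p : ℕ) :
    Tendsto (fun n : ℕ => ∑ t ∈ Finset.Icc (p + 1) n,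
      1 / (n * b n) * f (((t : ℝ) / n - u) / b n)) atTop (𝓝 (∫ x, f x)) := by
  have hB0 : 0 ≤ B := (abs_nonneg _).trans (hB 0)
  set F : ℕ → ℕ → ℝ := fun n t => f (((t : ℝ) / n - u) / b n) with hF
  set φ : ℕ → ℝ → ℝ := fun n x => ∑ s ∈ Finset.Icc (p + 1) n,
    (Ioc ((s : ℝ) - 1) s).indicator (fun _ => F n s) (n * b n * x + n * u) with hφ
  have hint : ∀ n : ℕ, 0 < n → ∫ x, φ n x = ∑ t ∈ Finset.Icc (p + 1) n,
      1 / (n * b n) * f (((t : ℝ) / n - u) / b n) := by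
    intro n hn
    have hpos : 0 < (n : ℝ) * b n := mul_pos (by exact_mod_cast hn) (hb n)
    have h1 := Measure.integral_comp_mul_left (fun y => ∑ s ∈ Finset.Icc (p + 1) n,
      (Ioc ((s : ℝ) - 1) s).indicator (fun _ => F n s) (y + n * u)) ((n : ℝ) * b n)
    refine h1.trans ?_
    rw [integral_add_right_eq_self (fun y => ∑ s ∈ Finset.Icc (p + 1) n,
      (Ioc ((s : ℝ) - 1) s).indicator (fun _ => F n s) y), integral_finsetSum, smul_eq_mul,
      Finset.mul_sum]
    · refine Finset.sum_congr rfl fun t _ => ?_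
      rw [integral_indicator measurableSet_Ioc, setIntegral_const, abs_of_pos (inv_pos.2 hpos)]
      simp [hF, Measure.real]
    · intro t _
      rw [integrable_indicator_iff measurableSet_Ioc]
      exact integrableOn_const (by simp)
  have hpt : ∀ {n : ℕ} {t : ℕ} {x : ℝ}, 0 < n → (n * b n * x + n * u) ∈ Ioc ((t : ℝ) - 1) t →
      |((t : ℝ) / n - u) / b n - x| ≤ 1 / (n * b n) := by
    intro n t x hn hx
    have hn' : (0 : ℝ) < n := by exact_mod_cast hn
    have hpos : 0 < (n : ℝ) * b n := mul_pos hn' (hb n)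
    have e : ((t : ℝ) / n - u) / b n - x = (t - (n * b n * x + n * u)) / (n * b n) := by
      have := (hb n).ne'
      field_simp
      ring
    rw [e, abs_div, abs_of_pos hpos]
    gcongr
    rw [abs_of_nonneg (by linarith [hx.2])]
    linarith [hx.1]
  have hlim : Tendsto (fun n => ∫ x, φ n x) atTop (𝓝 (∫ x, f x)) := by
    refine tendsto_integral_filter_of_dominated_convergence
      ((Icc (-2 : ℝ) 2).indicator fun _ => B) ?_ ?_ ?_ ?_
    · refine Eventually.of_forall fun n => Measurable.aestronglyMeasurable ?_
      refine Finset.measurable_fun_sum _ fun s _ => ?_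
      exact (measurable_const.indicator measurableSet_Ioc).comp (by fun_prop)
    · filter_upwards [hnb.eventually_ge_atTop 1, eventually_gt_atTop 0] with n hn hn0
      refine Eventually.of_forall fun x => ?_
      have hBi : 0 ≤ (Icc (-2 : ℝ) 2).indicator (fun _ => B) x :=
        indicator_nonneg (fun _ _ => hB0) x
      by_cases h : ∃ t ∈ Finset.Icc (p + 1) n, (n * b n * x + n * u) ∈ Ioc ((t : ℝ) - 1) t
      · obtain ⟨t, ht, hx⟩ := h
        rw [hφ]; simp only
        rw [sum_indicator_Ioc ht hx, Real.norm_eq_abs]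
        by_cases hz : ((t : ℝ) / n - u) / b n ∈ Icc (-(1 / 2) : ℝ) (1 / 2)
        · have h1 := hpt hn0 hx
          have h2 : 1 / ((n : ℝ) * b n) ≤ 1 := by
            rw [div_le_one (by linarith)]; exact hn
          rw [abs_le] at h1
          rw [indicator_of_mem]
          · exact hB _
          · exact ⟨by linarith [hz.1, h1.2], by linarith [hz.2, h1.1]⟩
        · simp only [hF]
          rw [hsupp _ hz, abs_zero]
          exact hBi
      · push Not at h
        rw [hφ]; simp only
        rw [Finset.sum_eq_zero fun s hs => indicator_of_notMem (h s hs) _, norm_zero]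
        exact hBi
    · rw [integrable_indicator_iff measurableSet_Icc]
      exact integrableOn_const (by simp)
    · filter_upwards [hcont] with x hx
      have h1 : Tendsto (fun n => u + b n * x) atTop (𝓝 u) := by
        simpa using (hb0.mul_const x).const_add u
      have h2 : ∀ᶠ n : ℕ in atTop, ∃ t ∈ Finset.Icc (p + 1) n,
          (n * b n * x + n * u) ∈ Ioc ((t : ℝ) - 1) t := by
        have h3 : ∀ᶠ n in atTop, u / 2 < u + b n * x ∧ u + b n * x < 1 :=
          (h1.eventually (Ioi_mem_nhds (by linarith [hu.1]))).and
            (h1.eventually (Iio_mem_nhds hu.2))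
        have h4 : ∀ᶠ n : ℕ in atTop, (p : ℝ) ≤ n * (u / 2) :=
          (tendsto_natCast_atTop_atTop.atTop_mul_const (by linarith [hu.1])).eventually_ge_atTop _
        filter_upwards [h3, h4, eventually_gt_atTop 0] with n h3 h4 hn0
        have hn : (0 : ℝ) < n := by exact_mod_cast hn0
        set y := (n : ℝ) * b n * x + n * u with hy
        have hye : y = n * (u + b n * x) := by rw [hy]; ring
        have hyp : (p : ℝ) < y := by
          rw [hye]; exact h4.trans_lt (mul_lt_mul_of_pos_left h3.1 hn)
        have hyn : y ≤ n := by
          rw [hye]; nlinarith [h3.2]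
        have hp0 : (0 : ℝ) ≤ p := Nat.cast_nonneg p
        refine ⟨⌈y⌉₊, Finset.mem_Icc.2 ⟨?_, Nat.ceil_le.2 hyn⟩, ?_, Nat.le_ceil y⟩
        · exact Nat.succ_le_of_lt (Nat.lt_ceil.2 hyp)
        · linarith [Nat.ceil_lt_add_one (by linarith : 0 ≤ y)]
      rw [Metric.continuousAt_iff] at hx
      rw [Metric.tendsto_nhds]
      intro η hη
      obtain ⟨δ, hδ, hxδ⟩ := hx η hη
      have h5 : ∀ᶠ n : ℕ in atTop, 1 / ((n : ℝ) * b n) < δ := by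
        have : Tendsto (fun n : ℕ => 1 / ((n : ℝ) * b n)) atTop (𝓝 0) := by
          simp only [one_div]; exact hnb.inv_tendsto_atTop
        exact this.eventually (Iio_mem_nhds hδ)
      filter_upwards [h2, h5, eventually_gt_atTop 0] with n h2 h5 hn0
      obtain ⟨t, ht, hy⟩ := h2
      rw [hφ]; simp only
      rw [sum_indicator_Ioc ht hy]
      refine hxδ ?_
      rw [Real.dist_eq]
      exact (hpt hn0 hy).trans_lt h5
  refine hlim.congr' ?_
  filter_upwards [eventually_gt_atTop 0] with n hn
  exact hint n hn

lemma IsLocalizingKernel.ae_continuousAt {K : ℝ → ℝ} (hK : IsLocalizingKernel K) :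
    ∀ᵐ x : ℝ, ContinuousAt K x :=
  (hK.boundedVariation.locallyBoundedVariationOn.ae_differentiableAt).mono
    fun _ h => h.continuousAt

end RiemannSums

/-! ### A central limit theorem for weighted stationary martingale differences -/

section MartingaleDifferences

variable {Ω : Type*} [MeasurableSpace Ω] {P : Measure Ω} [IsProbabilityMeasure P] {ε : ℤ → Ω → ℝ}

lemma integral_mul_eq_zero_of_condExp (hε : IsIID P ε) {m : ℤ → Ω → ℝ}
    (hc : ∀ t, Causal P ε t (m t)) (h2 : ∀ t, MemLp (m t) 2 P)
    (hmd : ∀ t, P[m t | past ε (t - 1)] =ᵐ[P] 0) {s t : ℤ} (hst : s < t) :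
    ∫ ω, m s ω * m t ω ∂P = 0 := by
  have hle := past_le hε.measurable (t - 1)
  have hi : Integrable (m s * m t) P := (h2 s).integrable_mul (h2 t)
  have h1 := condExp_mul_of_aestronglyMeasurable_left (m := past ε (t - 1))
    ((hc s).mono (by omega : s ≤ t - 1)).aestronglyMeasurable_past hi
    ((h2 t).integrable one_le_two)
  have h3 := integral_condExp (μ := P) (f := m s * m t) hle
  change ∫ ω, (m s * m t) ω ∂P = 0
  rw [← h3]
  refine integral_eq_zero_of_ae ?_
  filter_upwards [h1, hmd t] with ω h1 h2
  rw [h1, Pi.mul_apply, h2]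
  simp

lemma integral_sq_sum_martingale_diff (hε : IsIID P ε) {m : ℤ → Ω → ℝ}
    (hc : ∀ t, Causal P ε t (m t)) (h2 : ∀ t, MemLp (m t) 2 P)
    (hmd : ∀ t, P[m t | past ε (t - 1)] =ᵐ[P] 0) (s : Finset ℕ) (w : ℕ → ℝ) :
    ∫ ω, (∑ t ∈ s, w t * m t ω) ^ 2 ∂P = ∑ t ∈ s, w t ^ 2 * ∫ ω, m t ω ^ 2 ∂P := by
  have hexp : ∀ ω, (∑ t ∈ s, w t * m t ω) ^ 2 =
      ∑ i ∈ s, ∑ j ∈ s, w i * w j * (m i ω * m j ω) := fun ω => by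
    rw [sq, Finset.sum_mul_sum]
    exact Finset.sum_congr rfl fun i _ => Finset.sum_congr rfl fun j _ => by ring
  have hi : ∀ i j : ℕ, Integrable (fun ω => w i * w j * (m i ω * m j ω)) P := fun i j =>
    ((h2 i).integrable_mul (h2 j)).const_mul _
  simp_rw [hexp]
  rw [integral_finsetSum _ fun (i : ℕ) _ => integrable_finsetSum _ fun (j : ℕ) _ => hi i j]
  refine Finset.sum_congr rfl fun i hi' => ?_
  rw [integral_finsetSum _ fun (j : ℕ) _ => hi i j, Finset.sum_eq_single i]
  · rw [integral_const_mul]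
    simp only [sq]
  · intro j _ hij
    rw [integral_const_mul]
    rcases lt_or_gt_of_ne hij with h | h
    · rw [show (fun ω => m i ω * m j ω) = fun ω => m j ω * m i ω from
          funext fun ω => mul_comm _ _, integral_mul_eq_zero_of_condExp hε hc h2 hmd
          (by exact_mod_cast h), mul_zero]
    · rw [integral_mul_eq_zero_of_condExp hε hc h2 hmd (by exact_mod_cast h), mul_zero]
  · exact fun h => absurd hi' h

/-- Prepend a value to a sequence. -/
def consSeq (x : ℝ × (ℕ → ℝ)) : ℕ → ℝ
  | 0 => x.1
  | k + 1 => x.2 k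

lemma measurable_consSeq : Measurable consSeq := by
  refine measurable_pi_lambda _ fun k => ?_
  cases k with
  | zero => exact measurable_fst
  | succ k => exact (measurable_pi_apply k).comp measurable_snd

lemma hist_eq_consSeq (t : ℤ) (ω : Ω) : hist ε t ω = consSeq (ε t ω, hist ε (t - 1) ω) := by
  funext k
  cases k with
  | zero => simp [hist, consSeq]
  | succ k =>
    simp only [hist, consSeq]
    congr 1
    push_cast
    ring

/-- Centering of a functional of the history, conditionally on the past. -/
def center (μ : Measure ℝ) (f : (ℕ → ℝ) → ℝ) (e : ℕ → ℝ) : ℝ :=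
  f e - ∫ a, f (consSeq (a, fun k => e (k + 1))) ∂μ

lemma measurable_condMean {μ : Measure ℝ} [IsProbabilityMeasure μ] {f : (ℕ → ℝ) → ℝ}
    (hf : Measurable f) : Measurable fun h => ∫ a, f (consSeq (a, h)) ∂μ :=
  ((hf.comp measurable_consSeq).stronglyMeasurable.integral_prod_left' (μ := μ)).measurable

lemma measurable_center {μ : Measure ℝ} [IsProbabilityMeasure μ] {f : (ℕ → ℝ) → ℝ}
    (hf : Measurable f) : Measurable (center μ f) := by
  refine hf.sub ((measurable_condMean (μ := μ) hf).comp
    (measurable_pi_lambda _ fun k => measurable_pi_apply (k + 1)))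

lemma abs_condMean_le {μ : Measure ℝ} [IsProbabilityMeasure μ] {f : (ℕ → ℝ) → ℝ} {c : ℝ}
    (hc : ∀ e, |f e| ≤ c) (h : ℕ → ℝ) : |∫ a, f (consSeq (a, h)) ∂μ| ≤ c := by
  have := norm_integral_le_of_norm_le_const (μ := μ) (f := fun a => f (consSeq (a, h))) (C := c)
      (Eventually.of_forall fun a => hc _)
  simpa using this

lemma abs_center_le {μ : Measure ℝ} [IsProbabilityMeasure μ] {f : (ℕ → ℝ) → ℝ} {c : ℝ}
    (hc : ∀ e, |f e| ≤ c) (e : ℕ → ℝ) : |center μ f e| ≤ 2 * c := by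
  have h1 := abs_sub (f e) (∫ a, f (consSeq (a, fun k => e (k + 1))) ∂μ)
  have h2 := abs_condMean_le (μ := μ) hc (fun k => e (k + 1))
  have h3 := hc e
  unfold center
  linarith

lemma center_hist (μ : Measure ℝ) (f : (ℕ → ℝ) → ℝ) (t : ℤ) (ω : Ω) :
    center μ f (hist ε t ω) = f (hist ε t ω) - ∫ a, f (consSeq (a, hist ε (t - 1) ω)) ∂μ := by
  unfold center
  congr 3
  funext a
  congr 2
  rw [hist_eq_consSeq]
  rfl

lemma integral_mul_center {𝕜 : Type*} [RCLike 𝕜] (hε : IsIID P ε) {f : (ℕ → ℝ) → ℝ}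
    (hf : Measurable f) {c : ℝ} (hc : ∀ e, |f e| ≤ c) {t : ℤ} {V : Ω → 𝕜}
    (hV : Causal P ε (t - 1) V) (hVi : Integrable V P) :
    ∫ ω, V ω * (center (P.map (ε 0)) f (hist ε t ω) : 𝕜) ∂P = 0 := by
  set μ := P.map (ε 0) with hμ
  have hμp : IsProbabilityMeasure μ := Measure.isProbabilityMeasure_map (hε.measurable 0).aemeasurable
  obtain ⟨F, hF, hVF⟩ := hV
  have hcau : Causal P ε (t - 1) (hist ε (t - 1)) := ⟨id, measurable_id, ae_eq_rfl⟩
  have hmap := hcau.map_prodMk hε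
  have hh := measurable_hist hε.measurable (t - 1)
  have hνp : IsProbabilityMeasure (P.map (hist ε (t - 1))) :=
    Measure.isProbabilityMeasure_map hh.aemeasurable
  set g : ℝ × (ℕ → ℝ) → 𝕜 := fun x =>
    F x.2 * ((f (consSeq x) - ∫ a, f (consSeq (a, x.2)) ∂μ : ℝ) : 𝕜) with hg
  have hgm : Measurable g := (hF.comp measurable_snd).mul (RCLike.measurable_ofReal.comp
    ((hf.comp measurable_consSeq).sub ((measurable_condMean hf).comp measurable_snd)))
  have hpm : Measurable fun ω => (ε t ω, hist ε (t - 1) ω) := (hε.measurable t).prodMk hh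
  have heq : (fun ω => V ω * (center μ f (hist ε t ω) : 𝕜)) =ᵐ[P]
      fun ω => g (ε t ω, hist ε (t - 1) ω) := by
    filter_upwards [hVF] with ω hω
    rw [center_hist, hω, hist_eq_consSeq (ε := ε) t ω]
    rfl
  have hgi : Integrable g (μ.prod (P.map (hist ε (t - 1)))) := by
    rw [← hmap, integrable_map_measure hgm.aestronglyMeasurable hpm.aemeasurable]
    refine (integrable_congr heq).1 ?_
    refine hVi.mul_bdd (c := 2 * c) ?_ (Eventually.of_forall fun ω => ?_)
    · exact (RCLike.measurable_ofReal.comp ((measurable_center hf).comp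
        (measurable_hist hε.measurable t))).aestronglyMeasurable
    · rw [RCLike.norm_ofReal]
      exact abs_center_le hc _
  rw [integral_congr_ae heq, ← integral_map (φ := fun ω => (ε t ω, hist ε (t - 1) ω)) (f := g)
    hpm.aemeasurable hgm.aestronglyMeasurable, hmap, integral_prod_symm _ hgi]
  refine integral_eq_zero_of_ae (Eventually.of_forall fun h => ?_)
  simp only [hg, Pi.zero_apply]
  have hfi : Integrable (fun a => f (consSeq (a, h))) μ :=
    Integrable.of_bound (hf.comp (measurable_consSeq.comp
      (measurable_id.prodMk measurable_const))).aestronglyMeasurable c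
      (Eventually.of_forall fun a => hc _)
  rw [integral_const_mul, integral_ofReal, integral_sub hfi (integrable_const _)]
  simp

lemma condExp_center (hε : IsIID P ε) {f : (ℕ → ℝ) → ℝ}
    (hf : Measurable f) {c : ℝ} (hc : ∀ e, |f e| ≤ c) (t : ℤ) :
    P[fun ω => center (P.map (ε 0)) f (hist ε t ω) | past ε (t - 1)] =ᵐ[P] 0 := by
  have hμp : IsProbabilityMeasure (P.map (ε 0)) :=
    Measure.isProbabilityMeasure_map (hε.measurable 0).aemeasurable
  have hle := past_le hε.measurable (t - 1)
  have hi : Integrable (fun ω => center (P.map (ε 0)) f (hist ε t ω)) P :=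
    Integrable.of_bound ((measurable_center hf).comp
      (measurable_hist hε.measurable t)).aestronglyMeasurable (2 * c)
      (Eventually.of_forall fun ω => abs_center_le hc _)
  refine (ae_eq_condExp_of_forall_setIntegral_eq hle hi (fun s _ _ => integrableOn_zero)
    (fun s hs _ => ?_) aestronglyMeasurable_zero).symm
  have hs' := hle _ hs
  rw [past_eq_comap_hist] at hs
  obtain ⟨s', hs'm, rfl⟩ := hs
  have h := integral_mul_center (𝕜 := ℝ) hε hf hc (t := t)
    (V := fun ω => s'.indicator (fun _ => (1 : ℝ)) (hist ε (t - 1) ω))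
    ⟨s'.indicator fun _ => 1, measurable_const.indicator hs'm, ae_eq_rfl⟩
    (Integrable.of_bound ((measurable_const.indicator hs'm).comp
      (measurable_hist hε.measurable (t - 1))).aestronglyMeasurable 1
      (Eventually.of_forall fun ω => by
        by_cases h : hist ε (t - 1) ω ∈ s' <;> simp [h]))
  simp only [integral_zero]
  rw [← integral_indicator hs', ← h]
  refine integral_congr_ae (Eventually.of_forall fun ω => ?_)
  by_cases h : hist ε (t - 1) ω ∈ s' <;> simp [h]

end MartingaleDifferences

section ExponentialBounds

open Complex in
lemma norm_exp_sub_le {a : ℝ} (ha : |a| ≤ 1) :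
    ‖exp (I * a) - (1 + I * a) * exp (-((a : ℂ) ^ 2 / 2))‖ ≤ 2 * |a| ^ 3 := by
  have hn1 : ‖I * (a : ℂ)‖ = |a| := by simp
  have hn2 : ‖-((a : ℂ) ^ 2 / 2)‖ = |a| ^ 2 / 2 := by simp
  have ha0 := abs_nonneg a
  have h1 := exp_bound (x := I * a) (by rw [hn1]; exact ha) (n := 3) (by norm_num)
  have h2 := exp_bound (x := -((a : ℂ) ^ 2 / 2)) (by rw [hn2]; nlinarith) (n := 2) (by norm_num)
  rw [hn1] at h1
  rw [hn2] at h2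
  set R1 := exp (I * a) - ∑ m ∈ Finset.range 3, (I * (a : ℂ)) ^ m / (m.factorial : ℂ) with hR1
  set R2 := exp (-((a : ℂ) ^ 2 / 2)) -
    ∑ m ∈ Finset.range 2, (-((a : ℂ) ^ 2 / 2)) ^ m / (m.factorial : ℂ) with hR2
  have e : exp (I * a) - (1 + I * a) * exp (-((a : ℂ) ^ 2 / 2)) =
      R1 + I * (a : ℂ) ^ 3 / 2 - (1 + I * a) * R2 := by
    rw [hR1, hR2]
    simp only [Finset.sum_range_succ, Finset.sum_range_zero, Nat.factorial]
    ring_nf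
    simp only [I_sq]
    ring
  rw [e]
  have hn3 : ‖I * (a : ℂ) ^ 3 / 2‖ = |a| ^ 3 / 2 := by simp
  have hn4 : ‖1 + I * (a : ℂ)‖ ≤ 2 := by
    refine (norm_add_le _ _).trans ?_
    rw [hn1]; simp; linarith
  have h5 : ‖R1 + I * (a : ℂ) ^ 3 / 2 - (1 + I * a) * R2‖ ≤ ‖R1‖ + |a| ^ 3 / 2 + 2 * ‖R2‖ := by
    refine (norm_sub_le _ _).trans (add_le_add ((norm_add_le _ _).trans_eq (by rw [hn3])) ?_)
    rw [norm_mul]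
    exact mul_le_mul_of_nonneg_right hn4 (norm_nonneg _)
  refine h5.trans ?_
  norm_num [Nat.factorial] at h1 h2
  have h6 : |a| ^ 4 ≤ |a| ^ 3 := pow_le_pow_of_le_one ha0 ha (by norm_num)
  have h7 : (|a| ^ 2 / 2) ^ 2 = |a| ^ 4 / 4 := by ring
  have h8 : 0 ≤ |a| ^ 3 := by positivity
  have h9 : a ^ 2 = |a| ^ 2 := (sq_abs a).symm
  rw [h9] at h2
  rw [h7] at h2
  linarith

open Complex in
lemma norm_one_add_I_mul_le (a : ℝ) : ‖1 + I * (a : ℂ)‖ ≤ Real.exp (a ^ 2 / 2) := by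
  have h : ‖1 + I * (a : ℂ)‖ ^ 2 = 1 + a ^ 2 := by
    rw [← normSq_eq_norm_sq, normSq_apply]
    simp
    ring
  have h2 : (Real.exp (a ^ 2 / 2)) ^ 2 = Real.exp (a ^ 2) := by
    rw [← Real.exp_nat_mul]; congr 1; push_cast; ring
  refine le_of_sq_le_sq ?_ (Real.exp_pos _).le
  rw [h, h2]
  linarith [Real.add_one_le_exp (a ^ 2)]

lemma norm_prod_sub_prod_le {ι : Type*} (s : Finset ι) {x y : ι → ℂ}
    (hx : ∀ i ∈ s, ‖x i‖ ≤ 1) (hy : ∀ i ∈ s, ‖y i‖ ≤ 1) :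
    ‖∏ i ∈ s, x i - ∏ i ∈ s, y i‖ ≤ ∑ i ∈ s, ‖x i - y i‖ := by
  classical
  induction s using Finset.induction_on with
  | empty => simp
  | insert a s ha ih =>
    rw [Finset.prod_insert ha, Finset.prod_insert ha, Finset.sum_insert ha]
    have hx' : ∀ i ∈ s, ‖x i‖ ≤ 1 := fun i hi => hx i (Finset.mem_insert_of_mem hi)
    have hy' : ∀ i ∈ s, ‖y i‖ ≤ 1 := fun i hi => hy i (Finset.mem_insert_of_mem hi)
    have e : x a * ∏ i ∈ s, x i - y a * ∏ i ∈ s, y i =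
        (x a - y a) * ∏ i ∈ s, x i + y a * (∏ i ∈ s, x i - ∏ i ∈ s, y i) := by ring
    have hp : ‖∏ i ∈ s, x i‖ ≤ 1 := by
      rw [norm_prod]
      exact Finset.prod_le_one (fun i _ => norm_nonneg _) hx'
    rw [e]
    refine (norm_add_le _ _).trans (add_le_add ?_ ?_)
    · rw [norm_mul]
      exact mul_le_of_le_one_right (norm_nonneg _) hp
    · rw [norm_mul]
      exact (mul_le_of_le_one_left (norm_nonneg _) (hy a (Finset.mem_insert_self _ _))).trans
        (ih hx' hy')

lemma abs_exp_neg_sub_le {x y : ℝ} (hx : 0 ≤ x) (hy : 0 ≤ y) :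
    |Real.exp (-x) - Real.exp (-y)| ≤ |x - y| := by
  wlog h : x ≤ y generalizing x y
  · rw [abs_sub_comm, abs_sub_comm x y]
    exact this hy hx (le_of_not_ge h)
  have h1 : Real.exp (-y) ≤ Real.exp (-x) := Real.exp_le_exp.2 (by linarith)
  rw [abs_of_nonneg (by linarith), abs_of_nonpos (by linarith)]
  have h2 : Real.exp (-y) = Real.exp (-x) * Real.exp (-(y - x)) := by
    rw [← Real.exp_add]; congr 1; ring
  have h3 : 1 - (y - x) ≤ Real.exp (-(y - x)) := by linarith [Real.add_one_le_exp (-(y - x))]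
  have h4 : Real.exp (-x) ≤ 1 := Real.exp_le_one_iff.2 (by linarith)
  have h5 := Real.exp_pos (-x)
  rw [h2]
  nlinarith

end ExponentialBounds

section CentralLimit

variable {Ω : Type*} [MeasurableSpace Ω] {P : Measure Ω} [IsProbabilityMeasure P] {ε : ℤ → Ω → ℝ}

open Complex in
lemma integral_prod_one_add_center (hε : IsIID P ε) {f : (ℕ → ℝ) → ℝ}
    (hf : Measurable f) {c : ℝ} (hc : ∀ e, |f e| ≤ c) (w : ℕ → ℝ) (a N : ℕ) :
    ∫ ω, ∏ t ∈ Finset.Icc a N, (1 + I * ((w t * center (P.map (ε 0)) f (hist ε t ω) : ℝ) : ℂ)) ∂P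
      = 1 := by
  have hμp : IsProbabilityMeasure (P.map (ε 0)) :=
    Measure.isProbabilityMeasure_map (hε.measurable 0).aemeasurable
  set H := center (P.map (ε 0)) f with hH
  have hHm : Measurable H := measurable_center hf
  have hHb : ∀ e, |H e| ≤ 2 * c := abs_center_le hc
  set T : ℕ → Ω → ℂ := fun N ω =>
    ∏ t ∈ Finset.Icc a N, (1 + I * ((w t * H (hist ε t ω) : ℝ) : ℂ)) with hT
  have hfac : ∀ t : ℕ, Causal P ε t (fun ω => (1 + I * ((w t * H (hist ε t ω) : ℝ) : ℂ))) :=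
    fun t => ⟨fun e => 1 + I * ((w t * H e : ℝ) : ℂ), by fun_prop, ae_eq_rfl⟩
  have hbd : ∀ N : ℕ, ∃ K : ℝ, ∀ ω, ‖T N ω‖ ≤ K := by
    intro N
    refine ⟨∏ t ∈ Finset.Icc a N, (1 + |w t| * (2 * c)), fun ω => ?_⟩
    rw [hT]; simp only
    rw [norm_prod]
    refine Finset.prod_le_prod (fun _ _ => norm_nonneg _) fun t _ => ?_
    refine (norm_add_le _ _).trans ?_
    rw [norm_mul, norm_I, norm_real, one_mul, norm_one, Real.norm_eq_abs, abs_mul]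
    exact add_le_add_right (mul_le_mul_of_nonneg_left (hHb _) (abs_nonneg _)) _
  have hcau : ∀ N : ℕ, Causal P ε N (T N) := by
    intro N
    induction N with
    | zero =>
      rcases Nat.eq_zero_or_pos a with rfl | ha
      · simpa [hT] using hfac 0
      · simpa [hT, Finset.Icc_eq_empty_of_lt ha] using causal_const (P := P) (ε := ε) 0 (1 : ℂ)
    | succ N ih =>
      rcases le_or_gt a (N + 1) with h | h
      · have e : T (N + 1) = fun ω => T N ω *
            (1 + I * ((w (N + 1) * H (hist ε (N + 1 : ℕ) ω) : ℝ) : ℂ)) := by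
          funext ω
          simp only [hT]
          rw [← Finset.insert_Icc_right_eq_Icc_add_one h, Finset.prod_insert (by simp), mul_comm]
        rw [e]
        exact ((ih.mono (by push_cast; omega)).prodMk (hfac (N + 1))).comp
          (g := fun x : ℂ × ℂ => x.1 * x.2) (by fun_prop)
      · simpa [hT, Finset.Icc_eq_empty_of_lt h] using
          causal_const (P := P) (ε := ε) ((N + 1 : ℕ) : ℤ) (1 : ℂ)
  have hint : ∀ N, Integrable (T N) P := fun N => by
    obtain ⟨K, hK⟩ := hbd N
    exact Integrable.of_bound ((hcau N).aemeasurable hε.measurable).aestronglyMeasurable K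
      (Eventually.of_forall hK)
  change ∫ ω, T N ω ∂P = 1
  have hstep : ∀ (N : ℤ) (V : Ω → ℂ) (x : ℝ), Causal P ε (N - 1) V → Integrable V P →
      ∫ ω, V ω * (1 + I * ((x * H (hist ε N ω) : ℝ) : ℂ)) ∂P = ∫ ω, V ω ∂P := by
    intro N V x hV hVi
    have h0 := integral_mul_center (𝕜 := ℂ) hε hf hc (t := N) hV hVi
    have e : ∀ ω, V ω * (1 + I * ((x * H (hist ε N ω) : ℝ) : ℂ)) =
        V ω + (I * x) * (V ω * (H (hist ε N ω) : ℂ)) := fun ω => by push_cast; ring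
    simp_rw [e]
    rw [integral_add hVi, integral_const_mul]
    · rw [show ∫ ω, V ω * (H (hist ε N ω) : ℂ) ∂P = 0 from h0]; simp
    · refine Integrable.const_mul (hVi.mul_bdd (c := 2 * c) ?_ (Eventually.of_forall fun ω => ?_)) _
      · exact (measurable_ofReal.comp (hHm.comp
          (measurable_hist hε.measurable N))).aestronglyMeasurable
      · rw [norm_real]; exact hHb _
  induction N with
  | zero =>
    rcases Nat.eq_zero_or_pos a with rfl | ha
    · have := hstep 0 (fun _ => 1) (w 0) (causal_const _ _) (integrable_const _)
      simpa [hT] using this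
    · simp [hT, Finset.Icc_eq_empty_of_lt ha]
  | succ N ih =>
    rcases le_or_gt a (N + 1) with h | h
    · have e : T (N + 1) = fun ω => T N ω *
          (1 + I * ((w (N + 1) * H (hist ε (N + 1 : ℕ) ω) : ℝ) : ℂ)) := by
        funext ω
        simp only [hT]
        rw [← Finset.insert_Icc_right_eq_Icc_add_one h, Finset.prod_insert (by simp), mul_comm]
      rw [e]
      rw [hstep (N + 1 : ℕ) (T N) (w (N + 1)) ((hcau N).mono (by push_cast; omega)) (hint N)]
      exact ih
    · simp [hT, Finset.Icc_eq_empty_of_lt h]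

lemma integral_abs_eq_toReal (f : Ω → ℝ) (hf : AEStronglyMeasurable f P) :
    ∫ ω, |f ω| ∂P = (eLpNorm f 1 P).toReal := by
  rw [eLpNorm_one_eq_lintegral_enorm, ← integral_norm_eq_lintegral_enorm hf]
  rfl

open Complex in
/-- Central limit theorem for bounded martingale differences, in terms of characteristic
functions. -/
lemma tendsto_charFun_center (hε : IsIID P ε) {f : (ℕ → ℝ) → ℝ}
    (hf : Measurable f) {c : ℝ} (hc : ∀ e, |f e| ≤ c) {a : ℕ} {w : ℕ → ℕ → ℝ} {σ : ℝ}
    (hσ : Tendsto (fun n => ∑ t ∈ Finset.Icc a n, w n t ^ 2) atTop (𝓝 σ)) {δ : ℕ → ℝ}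
    (hδ : Tendsto δ atTop (𝓝 0))
    (hw : ∀ᶠ n in atTop, ∀ t ∈ Finset.Icc a n, |w n t| ≤ δ n) :
    Tendsto (fun n => ∫ ω, exp (I * ((∑ t ∈ Finset.Icc a n,
      w n t * center (P.map (ε 0)) f (hist ε t ω) : ℝ) : ℂ)) ∂P) atTop
      (𝓝 ((Real.exp (-(σ * (∫ ω, center (P.map (ε 0)) f (hist ε 0 ω) ^ 2 ∂P) / 2)) : ℝ) : ℂ)) := by
  have hμp : IsProbabilityMeasure (P.map (ε 0)) :=
    Measure.isProbabilityMeasure_map (hε.measurable 0).aemeasurable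
  have hc0 : 0 ≤ c := (abs_nonneg _).trans (hc 0)
  set H := center (P.map (ε 0)) f with hH
  have hHm : Measurable H := measurable_center hf
  have hHb : ∀ e, |H e| ≤ 2 * c := abs_center_le hc
  set η : ℤ → Ω → ℝ := fun t ω => H (hist ε t ω) with hη
  have hηm : ∀ t, Measurable (η t) := fun t => hHm.comp (measurable_hist hε.measurable t)
  have hηb : ∀ t ω, |η t ω| ≤ 2 * c := fun t ω => hHb _
  have hη2b : ∀ t ω, η t ω ^ 2 ≤ (2 * c) ^ 2 := fun t ω => sq_le_sq' (by linarith [abs_le.1 (hηb t ω)])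
    (abs_le.1 (hηb t ω)).2
  set v := ∫ ω, η 0 ω ^ 2 ∂P with hv
  have hv0 : 0 ≤ v := integral_nonneg fun ω => sq_nonneg _
  have hσ0 : 0 ≤ σ := ge_of_tendsto' hσ fun n => Finset.sum_nonneg fun _ _ => sq_nonneg _
  -- law of large numbers for the squares
  have hLLN : Tendsto (fun n => eLpNorm (fun ω => ∑ t ∈ Finset.Icc a n,
      w n t ^ 2 * (η t ω ^ 2 - v)) 1 P) atTop (𝓝 0) := by
    refine IsShift.tendsto_weighted_sum hε (Z := fun t ω => η t ω ^ 2)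
      ⟨fun e => H e ^ 2, hHm.pow_const 2, fun t => ae_eq_rfl⟩
      (Integrable.of_bound ((hηm 0).pow_const 2).aestronglyMeasurable ((2 * c) ^ 2)
        (Eventually.of_forall fun ω => ?_)) (s := fun n => Finset.Icc a n)
      (w := fun n t => w n t ^ 2) (C := σ + 1) ?_ (δ := fun n => δ n ^ 2) ?_ ?_
    · rw [Real.norm_eq_abs, abs_of_nonneg (sq_nonneg _)]; exact hη2b 0 ω
    · filter_upwards [hσ.eventually (Iio_mem_nhds (by linarith : σ < σ + 1))] with n hn
      rw [Finset.sum_congr rfl fun t _ => abs_of_nonneg (sq_nonneg (w n t))]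
      exact le_of_lt hn
    · simpa using hδ.pow 2
    · filter_upwards [hw] with n hn t ht
      rw [abs_of_nonneg (sq_nonneg _), ← sq_abs]
      exact pow_le_pow_left₀ (abs_nonneg _) (hn t ht) 2
  have hLLN' := (ENNReal.tendsto_toReal ENNReal.zero_ne_top).comp hLLN
  -- explicit error bound
  set err : ℕ → ℝ := fun n => 2 * ((2 * c) ^ 3 * |δ n| * ∑ t ∈ Finset.Icc a n, w n t ^ 2) +
    Real.exp ((2 * c) ^ 2 * (σ + 1) / 2) * (((eLpNorm (fun ω => ∑ t ∈ Finset.Icc a n,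
      w n t ^ 2 * (η t ω ^ 2 - v)) 1 P).toReal + |(∑ t ∈ Finset.Icc a n, w n t ^ 2) - σ| * v) / 2)
    with herr
  have herr0 : Tendsto err atTop (𝓝 0) := by
    have h1 : Tendsto (fun n => 2 * ((2 * c) ^ 3 * |δ n| * ∑ t ∈ Finset.Icc a n, w n t ^ 2)) atTop
        (𝓝 (2 * ((2 * c) ^ 3 * |0| * σ))) := ((hδ.abs.const_mul _).mul hσ).const_mul _
    have h2 : Tendsto (fun n => |(∑ t ∈ Finset.Icc a n, w n t ^ 2) - σ| * v) atTop
        (𝓝 (|σ - σ| * v)) := ((hσ.sub_const σ).abs).mul_const v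
    have h3 := h1.add (((hLLN'.add h2).div_const 2).const_mul
      (Real.exp ((2 * c) ^ 2 * (σ + 1) / 2)))
    simpa using h3
  rw [tendsto_iff_norm_sub_tendsto_zero]
  refine squeeze_zero' (Eventually.of_forall fun n => norm_nonneg _) ?_ herr0
  have hsmall : ∀ᶠ n in atTop, |δ n| * (2 * c) ≤ 1 := by
    have : Tendsto (fun n => |δ n| * (2 * c)) atTop (𝓝 (|0| * (2 * c))) := hδ.abs.mul_const _
    exact (this.eventually (Iio_mem_nhds (by simp))).mono fun n hn => le_of_lt hn
  filter_upwards [hw, hsmall, hσ.eventually (Iio_mem_nhds (by linarith : σ < σ + 1))] with n hwn hs hσn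
  have hσn' : ∑ t ∈ Finset.Icc a n, w n t ^ 2 ≤ σ + 1 := le_of_lt hσn
  set A : ℕ → Ω → ℝ := fun t ω => w n t * η t ω with hA
  have hAm : ∀ t, Measurable (A t) := fun t => (hηm t).const_mul _
  have hAb : ∀ t ∈ Finset.Icc a n, ∀ ω, |A t ω| ≤ |δ n| * (2 * c) := fun t ht ω => by
    rw [hA]; simp only
    rw [abs_mul]
    exact mul_le_mul ((hwn t ht).trans (le_abs_self _)) (hηb t ω) (abs_nonneg _) (abs_nonneg _)
  have hA2 : ∀ ω, ∑ t ∈ Finset.Icc a n, A t ω ^ 2 ≤ (2 * c) ^ 2 * (σ + 1) := fun ω => by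
    calc _ ≤ ∑ t ∈ Finset.Icc a n, w n t ^ 2 * (2 * c) ^ 2 := by
          refine Finset.sum_le_sum fun t _ => ?_
          rw [hA]; simp only
          rw [mul_pow]
          exact mul_le_mul_of_nonneg_left (hη2b t ω) (sq_nonneg _)
      _ ≤ _ := by
          rw [← Finset.sum_mul, mul_comm]
          exact mul_le_mul_of_nonneg_left hσn' (sq_nonneg _)
  set T : Ω → ℂ := fun ω => ∏ t ∈ Finset.Icc a n, (1 + I * (A t ω : ℂ)) with hT
  have hTm : Measurable T := Finset.measurable_fun_prod _ fun t _ => by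
    have := hAm t
    fun_prop
  have hTb : ∀ ω, ‖T ω‖ ≤ Real.exp ((2 * c) ^ 2 * (σ + 1) / 2) := fun ω => by
    rw [hT]; simp only
    rw [norm_prod]
    calc _ ≤ ∏ t ∈ Finset.Icc a n, Real.exp (A t ω ^ 2 / 2) :=
          Finset.prod_le_prod (fun _ _ => norm_nonneg _) fun t _ => norm_one_add_I_mul_le _
      _ ≤ _ := by
          rw [← Real.exp_sum, ← Finset.sum_div]
          exact Real.exp_le_exp.2 (by linarith [hA2 ω])
  have hTi : Integrable T P := Integrable.of_bound hTm.aestronglyMeasurable _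
    (Eventually.of_forall hTb)
  have hT1 : ∫ ω, T ω ∂P = 1 := integral_prod_one_add_center hε hf hc (w n) a n
  set S : Ω → ℝ := fun ω => ∑ t ∈ Finset.Icc a n, A t ω ^ 2 with hS
  have hSm : Measurable S := Finset.measurable_fun_sum _ fun t _ => (hAm t).pow_const 2
  have hS0 : ∀ ω, 0 ≤ S ω := fun ω => Finset.sum_nonneg fun _ _ => sq_nonneg _
  -- pointwise comparison
  have hpt : ∀ ω, ‖exp (I * ((∑ t ∈ Finset.Icc a n, A t ω : ℝ) : ℂ)) -
      T ω * ((Real.exp (-(σ * v / 2)) : ℝ) : ℂ)‖ ≤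
      2 * ((2 * c) ^ 3 * |δ n| * ∑ t ∈ Finset.Icc a n, w n t ^ 2) +
      Real.exp ((2 * c) ^ 2 * (σ + 1) / 2) * (|S ω - σ * v| / 2) := by
    intro ω
    have e1 : exp (I * ((∑ t ∈ Finset.Icc a n, A t ω : ℝ) : ℂ)) =
        ∏ t ∈ Finset.Icc a n, exp (I * (A t ω : ℂ)) := by
      rw [← exp_sum]; push_cast; rw [Finset.mul_sum]
    have e2 : T ω * ((Real.exp (-(S ω / 2)) : ℝ) : ℂ) =
        ∏ t ∈ Finset.Icc a n, ((1 + I * (A t ω : ℂ)) * exp (-((A t ω : ℂ) ^ 2 / 2))) := by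
      rw [Finset.prod_mul_distrib, ← exp_sum, hT, ofReal_exp]
      congr 2
      simp only [hS]
      push_cast
      rw [Finset.sum_neg_distrib, Finset.sum_div]
    have h1 : ‖exp (I * ((∑ t ∈ Finset.Icc a n, A t ω : ℝ) : ℂ)) -
        T ω * ((Real.exp (-(S ω / 2)) : ℝ) : ℂ)‖ ≤
        2 * ((2 * c) ^ 3 * |δ n| * ∑ t ∈ Finset.Icc a n, w n t ^ 2) := by
      rw [e1, e2]
      refine (norm_prod_sub_prod_le _ (fun t _ => ?_) fun t _ => ?_).trans ?_
      · rw [mul_comm, norm_exp_ofReal_mul_I]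
      · rw [norm_mul]
        have h3 : ‖exp (-((A t ω : ℂ) ^ 2 / 2))‖ = Real.exp (-(A t ω ^ 2 / 2)) := by
          rw [show -((A t ω : ℂ) ^ 2 / 2) = ((-(A t ω ^ 2 / 2) : ℝ) : ℂ) by push_cast; ring,
            ← ofReal_exp, norm_real, Real.norm_eq_abs, abs_of_pos (Real.exp_pos _)]
        rw [h3]
        calc _ ≤ Real.exp (A t ω ^ 2 / 2) * Real.exp (-(A t ω ^ 2 / 2)) :=
              mul_le_mul_of_nonneg_right (norm_one_add_I_mul_le _) (Real.exp_pos _).le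
          _ = 1 := by rw [← Real.exp_add]; simp
      · rw [Finset.mul_sum, Finset.mul_sum]
        refine Finset.sum_le_sum fun t ht => ?_
        refine (norm_exp_sub_le ((hAb t ht ω).trans hs)).trans ?_
        refine mul_le_mul_of_nonneg_left ?_ zero_le_two
        have h4 : |A t ω| ^ 3 = |w n t| * |w n t| ^ 2 * |η t ω| ^ 3 := by
          rw [hA]; simp only
          rw [abs_mul]; ring
        rw [h4, sq_abs]
        calc |w n t| * w n t ^ 2 * |η t ω| ^ 3 ≤ |δ n| * w n t ^ 2 * (2 * c) ^ 3 := by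
              refine mul_le_mul (mul_le_mul_of_nonneg_right ((hwn t ht).trans (le_abs_self _))
                (sq_nonneg _)) (pow_le_pow_left₀ (abs_nonneg _) (hηb t ω) 3) (by positivity)
                (by positivity)
          _ = _ := by ring
    have h2 : ‖T ω * ((Real.exp (-(S ω / 2)) : ℝ) : ℂ) - T ω * ((Real.exp (-(σ * v / 2)) : ℝ) : ℂ)‖ ≤
        Real.exp ((2 * c) ^ 2 * (σ + 1) / 2) * (|S ω - σ * v| / 2) := by
      rw [← mul_sub, norm_mul, ← ofReal_sub, norm_real, Real.norm_eq_abs]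
      refine mul_le_mul (hTb ω) ?_ (abs_nonneg _) (Real.exp_pos _).le
      refine (abs_exp_neg_sub_le (by linarith [hS0 ω]) (by positivity)).trans (le_of_eq ?_)
      rw [← sub_div, abs_div, abs_two]
    calc _ = ‖(exp (I * ((∑ t ∈ Finset.Icc a n, A t ω : ℝ) : ℂ)) -
        T ω * ((Real.exp (-(S ω / 2)) : ℝ) : ℂ)) + (T ω * ((Real.exp (-(S ω / 2)) : ℝ) : ℂ) -
        T ω * ((Real.exp (-(σ * v / 2)) : ℝ) : ℂ))‖ := by congr 1; ring
      _ ≤ _ := (norm_add_le _ _).trans (add_le_add h1 h2)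
  have hSi : Integrable S P := Integrable.of_bound hSm.aestronglyMeasurable ((2 * c) ^ 2 * (σ + 1))
    (Eventually.of_forall fun ω => by
      rw [Real.norm_eq_abs, abs_of_nonneg (hS0 ω)]; exact hA2 ω)
  have hES : ∫ ω, |S ω - σ * v| ∂P ≤ (eLpNorm (fun ω => ∑ t ∈ Finset.Icc a n,
      w n t ^ 2 * (η t ω ^ 2 - v)) 1 P).toReal + |(∑ t ∈ Finset.Icc a n, w n t ^ 2) - σ| * v := by
    set Q : Ω → ℝ := fun ω => ∑ t ∈ Finset.Icc a n, w n t ^ 2 * (η t ω ^ 2 - v) with hQ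
    have hQS : ∀ ω, Q ω = S ω - (∑ t ∈ Finset.Icc a n, w n t ^ 2) * v := fun ω => by
      rw [hQ, hS]; simp only [hA, mul_sub, Finset.sum_sub_distrib, Finset.sum_mul, mul_pow]
    have hQi : Integrable Q P := by
      rw [show Q = fun ω => S ω - (∑ t ∈ Finset.Icc a n, w n t ^ 2) * v from funext hQS]
      exact hSi.sub (integrable_const _)
    rw [← integral_abs_eq_toReal Q hQi.1]
    calc ∫ ω, |S ω - σ * v| ∂P ≤ ∫ ω, (|Q ω| + |(∑ t ∈ Finset.Icc a n, w n t ^ 2) - σ| * v) ∂P := by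
          refine integral_mono ((hSi.sub (integrable_const _)).abs)
            (hQi.abs.add (integrable_const _)) fun ω => ?_
          simp only
          have : S ω - σ * v = Q ω + ((∑ t ∈ Finset.Icc a n, w n t ^ 2) - σ) * v := by
            rw [hQS]; ring
          rw [this]
          refine (abs_add_le _ _).trans ?_
          rw [abs_mul, abs_of_nonneg hv0]
      _ = _ := by rw [integral_add hQi.abs (integrable_const _)]; simp
  have hSa : Integrable (fun ω => |S ω - σ * v|) P := (hSi.sub (integrable_const _)).abs
  have hexpi : Integrable (fun ω => exp (I * ((∑ t ∈ Finset.Icc a n, A t ω : ℝ) : ℂ))) P := by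
    refine Integrable.of_bound ?_ 1 (Eventually.of_forall fun ω => ?_)
    · refine Measurable.aestronglyMeasurable ?_
      have : Measurable fun ω => ∑ t ∈ Finset.Icc a n, A t ω :=
        Finset.measurable_fun_sum _ fun t _ => hAm t
      fun_prop
    · rw [mul_comm, norm_exp_ofReal_mul_I]
  calc ‖∫ ω, exp (I * ((∑ t ∈ Finset.Icc a n, A t ω : ℝ) : ℂ)) ∂P -
        ((Real.exp (-(σ * v / 2)) : ℝ) : ℂ)‖
      = ‖∫ ω, (exp (I * ((∑ t ∈ Finset.Icc a n, A t ω : ℝ) : ℂ)) -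
        T ω * ((Real.exp (-(σ * v / 2)) : ℝ) : ℂ)) ∂P‖ := by
        rw [integral_sub hexpi (hTi.mul_const _), integral_mul_const, hT1, one_mul]
    _ ≤ ∫ ω, (2 * ((2 * c) ^ 3 * |δ n| * ∑ t ∈ Finset.Icc a n, w n t ^ 2) +
        Real.exp ((2 * c) ^ 2 * (σ + 1) / 2) * (|S ω - σ * v| / 2)) ∂P := by
        refine norm_integral_le_of_norm_le ?_ (Eventually.of_forall hpt)
        exact (integrable_const _).add ((hSa.div_const _).const_mul _)
    _ = 2 * ((2 * c) ^ 3 * |δ n| * ∑ t ∈ Finset.Icc a n, w n t ^ 2) +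
        Real.exp ((2 * c) ^ 2 * (σ + 1) / 2) * ((∫ ω, |S ω - σ * v| ∂P) / 2) := by
        rw [integral_add (integrable_const _) ((hSa.div_const _).const_mul _), integral_const,
          integral_const_mul, integral_div]
        simp
    _ ≤ err n := by
        rw [herr]
        refine add_le_add_right (mul_le_mul_of_nonneg_left ?_ (Real.exp_pos _).le) _
        exact div_le_div_of_nonneg_right hES zero_le_two

lemma integral_sq_eq_toReal {f : Ω → ℝ} (hf : AEStronglyMeasurable f P) :
    ∫ ω, f ω ^ 2 ∂P = (eLpNorm f 2 P).toReal ^ 2 := by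
  have h := eLpNorm_nnreal_pow_eq_lintegral (μ := P) (f := f) (p := 2) (by norm_num)
  rw [integral_eq_lintegral_of_nonneg_ae (Eventually.of_forall fun ω => sq_nonneg _) (hf.pow 2),
    ← ENNReal.toReal_pow]
  congr 1
  have h2 : eLpNorm f 2 P ^ 2 = ∫⁻ ω, ‖f ω‖ₑ ^ (2 : ℝ) ∂P := by
    have := h
    simp only [NNReal.coe_ofNat, ENNReal.coe_ofNat] at this
    rw [← this]
    norm_num
  rw [h2]
  refine lintegral_congr fun ω => ?_
  rw [Real.enorm_eq_ofReal_abs, ENNReal.ofReal_rpow_of_nonneg (abs_nonneg _) zero_le_two]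
  norm_num

/-- Truncated martingale differences approximate in `L²`. -/
lemma eLpNorm_sub_center_clip_le (hε : IsIID P ε) {ξ : ℤ → Ω → ℝ} {F : (ℕ → ℝ) → ℝ}
    (hF : Measurable F) (hξ : ∀ t, ξ t =ᵐ[P] F ∘ hist ε t) (h2 : ∀ t, MemLp (ξ t) 2 P)
    (hmd : ∀ t, P[ξ t | past ε (t - 1)] =ᵐ[P] 0) (c : ℕ) (t : ℤ) :
    eLpNorm (fun ω => ξ t ω - center (P.map (ε 0)) (fun e => clip c (F e)) (hist ε t ω)) 2 P ≤
      2 * eLpNorm (fun ω => ξ t ω - clip c (ξ t ω)) 2 P := by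
  have hμp : IsProbabilityMeasure (P.map (ε 0)) :=
    Measure.isProbabilityMeasure_map (hε.measurable 0).aemeasurable
  have hle := past_le hε.measurable (t - 1)
  set f : (ℕ → ℝ) → ℝ := fun e => clip c (F e) with hf
  have hfm : Measurable f := (measurable_clip c).comp hF
  have hfc : ∀ e, |f e| ≤ c := fun e => abs_clip_le (Nat.cast_nonneg c) _
  set C : Ω → ℝ := fun ω => ∫ a, f (consSeq (a, hist ε (t - 1) ω)) ∂(P.map (ε 0)) with hC
  have hCm : Measurable[past ε (t - 1)] C :=
    (measurable_condMean hfm).comp (measurable_hist_past ε (t - 1))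
  have hCi : Integrable C P := Integrable.of_bound (hCm.mono hle le_rfl).aestronglyMeasurable c
    (Eventually.of_forall fun ω => abs_condMean_le hfc _)
  set D : Ω → ℝ := fun ω => clip c (ξ t ω) with hD
  have hDm : AEStronglyMeasurable D P :=
    ((measurable_clip c).comp_aemeasurable (h2 t).1.aemeasurable).aestronglyMeasurable
  have hDi : Integrable D P := Integrable.of_bound hDm c
    (Eventually.of_forall fun ω => abs_clip_le (Nat.cast_nonneg c) _)
  have hξi := (h2 t).integrable one_le_two
  have hη : (fun ω => center (P.map (ε 0)) f (hist ε t ω)) =ᵐ[P] D - C := by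
    filter_upwards [hξ t] with ω hω
    rw [center_hist]
    simp [hD, hC, hf, hω]
  have h1 : P[D - ξ t | past ε (t - 1)] =ᵐ[P] C := by
    have a1 := condExp_center hε hfm hfc t
    have a2 := (condExp_congr_ae (m := past ε (t - 1)) hη).symm.trans a1
    have a3 := condExp_sub (m := past ε (t - 1)) hDi hCi
    have a4 := condExp_of_stronglyMeasurable hle hCm.stronglyMeasurable hCi
    have a5 := condExp_sub (m := past ε (t - 1)) hDi hξi
    filter_upwards [a2, a3, a5, hmd t] with ω b2 b3 b5 b6
    rw [b5, Pi.sub_apply, b6]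
    rw [b3, Pi.sub_apply, a4] at b2
    simp only [Pi.zero_apply] at b2 ⊢
    linarith
  have h3 : eLpNorm C 2 P ≤ eLpNorm (ξ t - D) 2 P := by
    rw [← eLpNorm_congr_ae h1, eLpNorm_sub_comm]
    exact eLpNorm_condExp_le_eLpNorm _ one_le_two
  calc eLpNorm (fun ω => ξ t ω - center (P.map (ε 0)) f (hist ε t ω)) 2 P
      = eLpNorm ((ξ t - D) + C) 2 P := by
        refine eLpNorm_congr_ae ?_
        filter_upwards [hη] with ω hω
        rw [hω]
        simp only [Pi.add_apply, Pi.sub_apply]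
        ring
    _ ≤ eLpNorm (ξ t - D) 2 P + eLpNorm C 2 P :=
        eLpNorm_add_le ((h2 t).1.sub hDm) hCi.1 one_le_two
    _ ≤ eLpNorm (ξ t - D) 2 P + eLpNorm (ξ t - D) 2 P := add_le_add_right h3 _
    _ = 2 * eLpNorm (fun ω => ξ t ω - clip c (ξ t ω)) 2 P := by rw [two_mul]; rfl

open Complex in
/-- Central limit theorem for weighted sums of square integrable martingale differences that
are functionals of the innovation history, in terms of characteristic functions. -/
lemma tendsto_charFun_weighted_sum (hε : IsIID P ε) {ξ : ℤ → Ω → ℝ} (hξ : IsShift P ε ξ)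
    (h20 : MemLp (ξ 0) 2 P) (hmd : ∀ t, P[ξ t | past ε (t - 1)] =ᵐ[P] 0)
    {a : ℕ} {w : ℕ → ℕ → ℝ} {σ : ℝ}
    (hσ : Tendsto (fun n => ∑ t ∈ Finset.Icc a n, w n t ^ 2) atTop (𝓝 σ)) {δ : ℕ → ℝ}
    (hδ : Tendsto δ atTop (𝓝 0))
    (hw : ∀ᶠ n in atTop, ∀ t ∈ Finset.Icc a n, |w n t| ≤ δ n) :
    Tendsto (fun n => ∫ ω, exp (I * ((∑ t ∈ Finset.Icc a n, w n t * ξ t ω : ℝ) : ℂ)) ∂P) atTop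
      (𝓝 ((Real.exp (-(σ * (∫ ω, ξ 0 ω ^ 2 ∂P) / 2)) : ℝ) : ℂ)) := by
  have hμp : IsProbabilityMeasure (P.map (ε 0)) :=
    Measure.isProbabilityMeasure_map (hε.measurable 0).aemeasurable
  have h2 : ∀ t, MemLp (ξ t) 2 P := fun t => (hξ.identDistrib hε 0 t).memLp_iff.1 h20
  have hξm : ∀ t, AEMeasurable (ξ t) P := fun t => (h2 t).1.aemeasurable
  have hσ0 : 0 ≤ σ := ge_of_tendsto' hσ fun n => Finset.sum_nonneg fun _ _ => sq_nonneg _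
  have hshift := hξ
  obtain ⟨F, hF, hξF⟩ := hξ
  set η : ℕ → ℤ → Ω → ℝ := fun c t ω =>
    center (P.map (ε 0)) (fun e => clip c (F e)) (hist ε t ω) with hη
  have hfm : ∀ c : ℕ, Measurable fun e => clip c (F e) := fun c => (measurable_clip c).comp hF
  have hfc : ∀ (c : ℕ) e, |clip c (F e)| ≤ c := fun c e => abs_clip_le (Nat.cast_nonneg c) _
  have hηs : ∀ c, IsShift P ε (η c) := fun c => ⟨_, measurable_center (hfm c), fun t => ae_eq_rfl⟩
  have hηm : ∀ c t, Measurable (η c t) := fun c t =>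
    (measurable_center (hfm c)).comp (measurable_hist hε.measurable t)
  have hη2 : ∀ c t, MemLp (η c t) 2 P := fun c t =>
    MemLp.of_bound (hηm c t).aestronglyMeasurable (2 * c)
      (Eventually.of_forall fun ω => abs_center_le (hfc c) _)
  set m : ℕ → ℤ → Ω → ℝ := fun c t ω => ξ t ω - η c t ω with hm
  have hms : ∀ c, IsShift P ε (m c) := fun c =>
    (hshift.prodMk (hηs c)).comp (g := fun x : ℝ × ℝ => x.1 - x.2) (by fun_prop)
  have hm2 : ∀ c t, MemLp (m c t) 2 P := fun c t => (h2 t).sub (hη2 c t)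
  have hmmd : ∀ c t, P[m c t | past ε (t - 1)] =ᵐ[P] 0 := by
    intro c t
    have a1 := condExp_sub (m := past ε (t - 1)) ((h2 t).integrable one_le_two)
      ((hη2 c t).integrable one_le_two)
    have a2 := condExp_center hε (hfm c) (hfc c) t
    filter_upwards [a1, hmd t, a2] with ω b1 b2 b3
    change (P[ξ t - η c t | past ε (t - 1)]) ω = 0
    rw [b1, Pi.sub_apply, b2, b3]
    simp
  set e : ℕ → ℝ := fun c => ∫ ω, m c 0 ω ^ 2 ∂P with he
  have he0 : ∀ c, 0 ≤ e c := fun c => integral_nonneg fun ω => sq_nonneg _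
  have hme : ∀ c t, ∫ ω, m c t ω ^ 2 ∂P = e c := fun c t =>
    (((hms c).comp (g := fun x : ℝ => x ^ 2) (by fun_prop)).identDistrib hε t 0).integral_eq
  have helim : Tendsto e atTop (𝓝 0) := by
    have h3 := tendsto_eLpNorm_sub_clip two_ne_zero ENNReal.ofNat_ne_top h20
    have h4 : Tendsto (fun c => eLpNorm (m c 0) 2 P) atTop (𝓝 0) := by
      refine tendsto_of_tendsto_of_tendsto_of_le_of_le tendsto_const_nhds
        (h := fun c : ℕ => 2 * eLpNorm (fun ω => ξ 0 ω - clip c (ξ 0 ω)) 2 P) ?_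
        (fun _ => zero_le) (fun c => eLpNorm_sub_center_clip_le hε hF hξF h2 hmd c 0)
      simpa using ENNReal.Tendsto.const_mul h3 (Or.inr ENNReal.ofNat_ne_top)
    have h5 := ((ENNReal.tendsto_toReal ENNReal.zero_ne_top).comp h4).pow 2
    simp only [ENNReal.toReal_zero, ne_eq, OfNat.ofNat_ne_zero, not_false_eq_true, zero_pow] at h5
    exact h5.congr fun c => (integral_sq_eq_toReal (hm2 c 0).1).symm
  set v := ∫ ω, ξ 0 ω ^ 2 ∂P with hv
  have hv0 : 0 ≤ v := integral_nonneg fun ω => sq_nonneg _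
  set vc : ℕ → ℝ := fun c => ∫ ω, η c 0 ω ^ 2 ∂P with hvc
  have hvc0 : ∀ c, 0 ≤ vc c := fun c => integral_nonneg fun ω => sq_nonneg _
  have hvdiff : ∀ (c : ℕ) (κ : ℝ), 0 < κ → |vc c - v| ≤ (1 + 1 / κ) * e c + κ * v := by
    intro c κ hκ
    rw [hvc, hv]; simp only
    rw [← integral_sub (hη2 c 0).integrable_sq (h2 0).integrable_sq, he]; simp only
    rw [← integral_const_mul, ← integral_const_mul,
      ← integral_add ((hm2 c 0).integrable_sq.const_mul _) ((h2 0).integrable_sq.const_mul _)]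
    refine (abs_integral_le_integral_abs).trans (integral_mono
      (((hη2 c 0).integrable_sq.sub (h2 0).integrable_sq).abs)
      (((hm2 c 0).integrable_sq.const_mul _).add ((h2 0).integrable_sq.const_mul _)) fun ω => ?_)
    simp only [hm]
    set x := ξ 0 ω
    set y := η c 0 ω
    have h3 : 0 ≤ (κ * |x| - |x - y|) ^ 2 / κ := by positivity
    have h4 : (κ * |x| - |x - y|) ^ 2 / κ =
        κ * x ^ 2 + 1 / κ * (x - y) ^ 2 - 2 * (|x| * |x - y|) := by
      rw [← sq_abs x, ← sq_abs (x - y)]; field_simp; ring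
    have h5 : y ^ 2 - x ^ 2 = (x - y) ^ 2 - 2 * (x * (x - y)) := by ring
    rw [h5]
    calc |(x - y) ^ 2 - 2 * (x * (x - y))| ≤ |(x - y) ^ 2| + |2 * (x * (x - y))| := abs_sub _ _
      _ = (x - y) ^ 2 + 2 * (|x| * |x - y|) := by
          rw [abs_of_nonneg (sq_nonneg _), abs_mul, abs_mul, abs_two]
      _ ≤ _ := by rw [h4] at h3; linarith
  rw [Metric.tendsto_nhds]
  intro κ₀ hκ₀
  -- choice of the truncation level
  obtain ⟨κ, hκ, hκle⟩ : ∃ κ : ℝ, 0 < κ ∧ κ + κ + (σ * (κ + κ * v) + κ) < κ₀ := by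
    refine ⟨κ₀ / (2 * (4 + σ * (1 + v))), by positivity, ?_⟩
    have h3 : 0 < 4 + σ * (1 + v) := by positivity
    have h4 : κ₀ / (2 * (4 + σ * (1 + v))) * (4 + σ * (1 + v)) = κ₀ / 2 := by field_simp
    have h5 : 0 < κ₀ / (2 * (4 + σ * (1 + v))) := by positivity
    nlinarith
  have hchoose : ∀ᶠ c in atTop, (σ + 1) * e c / κ ≤ κ ∧ (1 + 1 / κ) * e c ≤ κ := by
    have h3 : Tendsto (fun c => (σ + 1) * e c / κ) atTop (𝓝 ((σ + 1) * 0 / κ)) :=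
      (helim.const_mul _).div_const _
    have h4 : Tendsto (fun c => (1 + 1 / κ) * e c) atTop (𝓝 ((1 + 1 / κ) * 0)) := helim.const_mul _
    exact ((h3.eventually (Iio_mem_nhds (by simpa using hκ))).and
      (h4.eventually (Iio_mem_nhds (by simpa using hκ)))).mono fun c h => ⟨h.1.le, h.2.le⟩
  obtain ⟨c, hc1, hc2⟩ := hchoose.exists
  have hlim := tendsto_charFun_center hε (hfm c) (hfc c) hσ hδ hw
  have hlim' := (Metric.tendsto_nhds.1 hlim) κ hκ
  filter_upwards [hlim', hσ.eventually (Iio_mem_nhds (by linarith : σ < σ + 1))] with n hn hσn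
  set Sξ : Ω → ℝ := fun ω => ∑ t ∈ Finset.Icc a n, w n t * ξ t ω with hSξ
  set Sη : Ω → ℝ := fun ω => ∑ t ∈ Finset.Icc a n, w n t * η c t ω with hSη
  have hSξm : AEMeasurable Sξ P := Finset.aemeasurable_fun_sum _ fun t _ => (hξm t).const_mul _
  have hSηm : Measurable Sη := Finset.measurable_fun_sum _ fun t _ => (hηm c t).const_mul _
  have hei : ∀ S : Ω → ℝ, AEMeasurable S P → Integrable (fun ω => exp (I * (S ω : ℂ))) P := by
    intro S hS
    refine Integrable.of_bound ?_ 1 (Eventually.of_forall fun ω => ?_)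
    · exact (AEMeasurable.cexp ((measurable_ofReal.comp_aemeasurable hS).const_mul
        I)).aestronglyMeasurable
    · rw [mul_comm, norm_exp_ofReal_mul_I]
  have hd2 : ∫ ω, (Sξ ω - Sη ω) ^ 2 ∂P ≤ (σ + 1) * e c := by
    have e1 : ∀ ω, Sξ ω - Sη ω = ∑ t ∈ Finset.Icc a n, w n t * m c t ω := fun ω => by
      simp only [hSξ, hSη, hm, mul_sub, Finset.sum_sub_distrib]
    simp_rw [e1]
    rw [integral_sq_sum_martingale_diff hε (fun t => (hms c).causal t) (hm2 c) (hmmd c)]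
    simp_rw [hme]
    rw [← Finset.sum_mul]
    exact mul_le_mul_of_nonneg_right (le_of_lt hσn) (he0 c)
  have hSdi : Integrable (fun ω => (Sξ ω - Sη ω) ^ 2) P := by
    have : MemLp (fun ω => Sξ ω - Sη ω) 2 P := by
      refine MemLp.sub ?_ ?_
      · exact memLp_finsetSum _ fun t _ => (h2 t).const_mul _
      · exact memLp_finsetSum _ fun t _ => (hη2 c t).const_mul _
    exact this.integrable_sq
  have hd : ‖∫ ω, exp (I * (Sξ ω : ℂ)) ∂P - ∫ ω, exp (I * (Sη ω : ℂ)) ∂P‖ ≤ κ + κ := by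
    rw [← integral_sub (hei _ hSξm) (hei _ hSηm.aemeasurable)]
    have h3 : ∀ ω, ‖exp (I * (Sξ ω : ℂ)) - exp (I * (Sη ω : ℂ))‖ ≤ |Sξ ω - Sη ω| := by
      intro ω
      have e1 : exp (I * (Sξ ω : ℂ)) - exp (I * (Sη ω : ℂ)) =
          exp ((Sη ω : ℂ) * I) * (exp (I * ((Sξ ω - Sη ω : ℝ) : ℂ)) - 1) := by
        rw [mul_sub, ← Complex.exp_add, mul_one]
        congr 1
        · congr 1; push_cast; ring
        · congr 1; ring
      rw [e1, norm_mul, norm_exp_ofReal_mul_I, one_mul]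
      exact Real.norm_exp_I_mul_ofReal_sub_one_le
    have h4 := eLpNorm_one_le_of_sq hSdi hκ
    have h5 : ∫ ω, |Sξ ω - Sη ω| ∂P ≤ κ + (σ + 1) * e c / κ := by
      rw [integral_abs_eq_toReal (fun ω => Sξ ω - Sη ω)
        (hSξm.sub hSηm.aemeasurable).aestronglyMeasurable]
      refine ENNReal.toReal_le_of_le_ofReal (by have := he0 c; positivity) (h4.trans ?_)
      exact ENNReal.ofReal_le_ofReal (add_le_add_right (div_le_div_of_nonneg_right hd2 hκ.le) _)
    refine (norm_integral_le_of_norm_le (g := fun ω => |Sξ ω - Sη ω|) ?_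
      (Eventually.of_forall h3)).trans (h5.trans (by linarith))
    have h6 : MemLp (fun ω => Sξ ω - Sη ω) 1 P := by
      refine ⟨(hSξm.sub hSηm.aemeasurable).aestronglyMeasurable, h4.trans_lt ENNReal.ofReal_lt_top⟩
    exact (memLp_one_iff_integrable.1 h6).abs
  have hv' : ‖((Real.exp (-(σ * vc c / 2)) : ℝ) : ℂ) - ((Real.exp (-(σ * v / 2)) : ℝ) : ℂ)‖ ≤
      σ * (κ + κ * v) := by
    rw [← ofReal_sub, norm_real, Real.norm_eq_abs]
    have := hvc0 c
    refine (abs_exp_neg_sub_le (by positivity) (by positivity)).trans ?_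
    rw [← sub_div, ← mul_sub, abs_div, abs_mul, abs_of_nonneg hσ0, abs_two]
    have h3 := hvdiff c κ hκ
    have h4 : |vc c - v| ≤ κ + κ * v := by linarith
    have h5 := mul_le_mul_of_nonneg_left h4 hσ0
    have h6 : 0 ≤ σ * |vc c - v| := by positivity
    linarith
  rw [dist_eq_norm] at hn ⊢
  calc ‖∫ ω, exp (I * (Sξ ω : ℂ)) ∂P - ((Real.exp (-(σ * v / 2)) : ℝ) : ℂ)‖
      = ‖(∫ ω, exp (I * (Sξ ω : ℂ)) ∂P - ∫ ω, exp (I * (Sη ω : ℂ)) ∂P) +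
        ((∫ ω, exp (I * (Sη ω : ℂ)) ∂P - ((Real.exp (-(σ * vc c / 2)) : ℝ) : ℂ)) +
        (((Real.exp (-(σ * vc c / 2)) : ℝ) : ℂ) - ((Real.exp (-(σ * v / 2)) : ℝ) : ℂ)))‖ := by
        congr 1; ring
    _ ≤ (κ + κ) + (κ + σ * (κ + κ * v)) := by
        refine (norm_add_le _ _).trans (add_le_add hd ((norm_add_le _ _).trans
          (add_le_add hn.le hv')))
    _ < κ₀ := by linarith

end CentralLimit

section InProbability

variable {Ω : Type*} [MeasurableSpace Ω] {P : Measure Ω}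

/-- `f n → 0` in probability. -/
def VanishesInProb (P : Measure Ω) (f : ℕ → Ω → ℝ) : Prop :=
  ∀ η : ℝ, 0 < η → Tendsto (fun n => P {ω | η ≤ |f n ω|}) atTop (𝓝 0)

/-- `f n` is bounded in probability. -/
def BoundedInProb (P : Measure Ω) (f : ℕ → Ω → ℝ) : Prop :=
  ∀ κ : ℝ≥0∞, 0 < κ → ∃ A : ℝ, 0 < A ∧ ∀ᶠ n in atTop, P {ω | A ≤ |f n ω|} ≤ κ

lemma measure_le_of_ae_imp {s t : Set Ω} (h : ∀ᵐ ω ∂P, ω ∈ s → ω ∈ t) : P s ≤ P t :=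
  measure_mono_ae h

lemma VanishesInProb.of_ae_le {f g : ℕ → Ω → ℝ} (hg : VanishesInProb P g)
    (h : ∀ᶠ n in atTop, ∀ᵐ ω ∂P, |f n ω| ≤ |g n ω|) : VanishesInProb P f := by
  intro η hη
  refine tendsto_of_tendsto_of_tendsto_of_le_of_le' tendsto_const_nhds (hg η hη)
    (Eventually.of_forall fun _ => zero_le) ?_
  filter_upwards [h] with n hn
  refine measure_le_of_ae_imp ?_
  filter_upwards [hn] with ω hω h1
  exact le_trans h1 hω

lemma VanishesInProb.add {f g : ℕ → Ω → ℝ} (hf : VanishesInProb P f) (hg : VanishesInProb P g) :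
    VanishesInProb P (fun n ω => f n ω + g n ω) := by
  intro η hη
  have h := (hf (η / 2) (half_pos hη)).add (hg (η / 2) (half_pos hη))
  rw [add_zero] at h
  refine tendsto_of_tendsto_of_tendsto_of_le_of_le tendsto_const_nhds h
    (fun _ => zero_le) fun n => ?_
  refine (measure_mono ?_).trans (measure_union_le _ _)
  intro ω hω
  simp only [mem_ofPred_eq, mem_union] at hω ⊢
  by_contra hc
  push Not at hc
  have := abs_add_le (f n ω) (g n ω)
  linarith [hc.1, hc.2]

lemma vanishesInProb_zero : VanishesInProb P (fun _ _ => 0) := by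
  intro η hη
  simp [not_le.2 hη]

lemma VanishesInProb.sum {ι : Type*} (s : Finset ι) {f : ι → ℕ → Ω → ℝ}
    (hf : ∀ i ∈ s, VanishesInProb P (f i)) :
    VanishesInProb P (fun n ω => ∑ i ∈ s, f i n ω) := by
  classical
  induction s using Finset.induction_on with
  | empty => simpa using vanishesInProb_zero
  | insert a s ha ih =>
    simp only [Finset.sum_insert ha]
    exact (hf a (Finset.mem_insert_self _ _)).add (ih fun i hi => hf i (Finset.mem_insert_of_mem hi))

lemma VanishesInProb.mul_bounded {f g : ℕ → Ω → ℝ} (hf : VanishesInProb P f)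
    (hg : BoundedInProb P g) : VanishesInProb P (fun n ω => f n ω * g n ω) := by
  intro η hη
  rw [ENNReal.tendsto_nhds_zero]
  intro κ hκ
  obtain ⟨A, hA, hgA⟩ := hg (κ / 2) (ENNReal.half_pos hκ.ne')
  have hf' := (ENNReal.tendsto_nhds_zero.1 (hf (η / A) (by positivity))) (κ / 2)
    (ENNReal.half_pos hκ.ne')
  filter_upwards [hgA, hf'] with n h1 h2
  calc P {ω | η ≤ |f n ω * g n ω|} ≤ P ({ω | η / A ≤ |f n ω|} ∪ {ω | A ≤ |g n ω|}) := by
        refine measure_mono fun ω hω => ?_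
        simp only [mem_ofPred_eq, mem_union] at hω ⊢
        by_contra hc
        push Not at hc
        rw [abs_mul] at hω
        have h3 : |f n ω| * |g n ω| ≤ |f n ω| * A :=
          mul_le_mul_of_nonneg_left hc.2.le (abs_nonneg _)
        have h4 : |f n ω| * A < η / A * A := mul_lt_mul_of_pos_right hc.1 hA
        rw [div_mul_cancel₀ _ hA.ne'] at h4
        linarith
    _ ≤ κ / 2 + κ / 2 := (measure_union_le _ _).trans (add_le_add h2 h1)
    _ = κ := ENNReal.add_halves κ

lemma BoundedInProb.add {f g : ℕ → Ω → ℝ} (hf : BoundedInProb P f) (hg : BoundedInProb P g) :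
    BoundedInProb P (fun n ω => f n ω + g n ω) := by
  intro κ hκ
  obtain ⟨A, hA, hfA⟩ := hf (κ / 2) (ENNReal.half_pos hκ.ne')
  obtain ⟨A', hA', hgA⟩ := hg (κ / 2) (ENNReal.half_pos hκ.ne')
  refine ⟨A + A', by positivity, ?_⟩
  filter_upwards [hfA, hgA] with n h1 h2
  refine ((measure_mono ?_).trans (measure_union_le {ω | A ≤ |f n ω|} {ω | A' ≤ |g n ω|})).trans
    ((add_le_add h1 h2).trans_eq (ENNReal.add_halves κ))
  intro ω hω
  simp only [mem_ofPred_eq, mem_union] at hω ⊢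
  by_contra hc
  push Not at hc
  have := abs_add_le (f n ω) (g n ω)
  linarith [hc.1, hc.2]

lemma BoundedInProb.of_ae_le {f g : ℕ → Ω → ℝ} (hg : BoundedInProb P g)
    (h : ∀ᶠ n in atTop, ∀ᵐ ω ∂P, |f n ω| ≤ |g n ω|) : BoundedInProb P f := by
  intro κ hκ
  obtain ⟨A, hA, hgA⟩ := hg κ hκ
  refine ⟨A, hA, ?_⟩
  filter_upwards [hgA, h] with n h1 h2
  refine le_trans (measure_le_of_ae_imp ?_) h1
  filter_upwards [h2] with ω hω h3
  exact le_trans h3 hω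

lemma boundedInProb_of_bounded {c : ℕ → ℝ} {A : ℝ} (h : ∀ᶠ n in atTop, |c n| ≤ A) :
    BoundedInProb P (fun n _ => c n) := by
  intro κ hκ
  refine ⟨|A| + 1, by positivity, ?_⟩
  filter_upwards [h] with n hn
  have : {ω : Ω | |A| + 1 ≤ |c n|} = ∅ := by
    ext ω
    simp only [mem_ofPred_eq, mem_empty_iff_false, iff_false, not_le]
    linarith [le_abs_self A]
  rw [this]
  simp

lemma VanishesInProb.bounded {f : ℕ → Ω → ℝ} (hf : VanishesInProb P f) : BoundedInProb P f := by
  intro κ hκ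
  exact ⟨1, one_pos, (ENNReal.tendsto_nhds_zero.1 (hf 1 one_pos)) κ hκ⟩

lemma BoundedInProb.sum {ι : Type*} (s : Finset ι) {f : ι → ℕ → Ω → ℝ}
    (hf : ∀ i ∈ s, BoundedInProb P (f i)) :
    BoundedInProb P (fun n ω => ∑ i ∈ s, f i n ω) := by
  classical
  induction s using Finset.induction_on with
  | empty => simpa using (vanishesInProb_zero (P := P)).bounded
  | insert a s ha ih =>
    simp only [Finset.sum_insert ha]
    exact (hf a (Finset.mem_insert_self _ _)).add (ih fun i hi => hf i (Finset.mem_insert_of_mem hi))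

lemma VanishesInProb.const_mul {f : ℕ → Ω → ℝ} (hf : VanishesInProb P f) (c : ℝ) :
    VanishesInProb P (fun n ω => c * f n ω) :=
  (hf.mul_bounded (boundedInProb_of_bounded (c := fun _ => c)
    (Eventually.of_forall fun _ => le_rfl))).of_ae_le
    (Eventually.of_forall fun _ => Eventually.of_forall fun _ => by rw [mul_comm])

lemma VanishesInProb.abs {f : ℕ → Ω → ℝ} (hf : VanishesInProb P f) :
    VanishesInProb P (fun n ω => |f n ω|) := by
  intro η hη
  simpa using hf η hη

lemma BoundedInProb.abs {f : ℕ → Ω → ℝ} (hf : BoundedInProb P f) :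
    BoundedInProb P (fun n ω => |f n ω|) := by
  intro κ hκ
  simpa using hf κ hκ

lemma BoundedInProb.const_mul {f : ℕ → Ω → ℝ} (hf : BoundedInProb P f) (c : ℝ) :
    BoundedInProb P (fun n ω => c * f n ω) := by
  intro κ hκ
  obtain ⟨A, hA, hfA⟩ := hf κ hκ
  refine ⟨(|c| + 1) * A, by positivity, ?_⟩
  filter_upwards [hfA] with n h1
  refine (measure_mono fun ω hω => ?_).trans h1
  simp only [mem_ofPred_eq, abs_mul] at hω ⊢
  by_contra hc
  push Not at hc
  nlinarith [abs_nonneg c, abs_nonneg (f n ω), mul_le_mul_of_nonneg_left hc.le (abs_nonneg c)]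

lemma measure_abs_ge_le {f : Ω → ℝ} (hf : AEMeasurable f P) {A : ℝ} (hA : 0 < A) :
    P {ω | A ≤ |f ω|} ≤ eLpNorm f 1 P / ENNReal.ofReal A := by
  rw [eLpNorm_one_eq_lintegral_enorm]
  refine le_trans (measure_mono fun ω hω => ?_)
    (meas_ge_le_lintegral_div hf.enorm (ENNReal.ofReal_pos.2 hA).ne' ENNReal.ofReal_ne_top)
  simp only [mem_ofPred_eq, Real.enorm_eq_ofReal_abs] at hω ⊢
  exact ENNReal.ofReal_le_ofReal hω

lemma vanishesInProb_of_eLpNorm {f : ℕ → Ω → ℝ} (hf : ∀ n, AEMeasurable (f n) P)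
    (h : Tendsto (fun n => eLpNorm (f n) 1 P) atTop (𝓝 0)) : VanishesInProb P f := by
  intro η hη
  refine tendsto_of_tendsto_of_tendsto_of_le_of_le tendsto_const_nhds ?_
    (fun _ => zero_le) fun n => measure_abs_ge_le (hf n) hη
  simpa using ENNReal.Tendsto.div_const h (Or.inr (ENNReal.ofReal_pos.2 hη).ne')

lemma boundedInProb_of_eLpNorm {f : ℕ → Ω → ℝ} (hf : ∀ n, AEMeasurable (f n) P) {C : ℝ}
    (h : ∀ᶠ n in atTop, eLpNorm (f n) 1 P ≤ ENNReal.ofReal C) : BoundedInProb P f := by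
  intro κ hκ
  have h1 : Tendsto (fun k : ℕ => ENNReal.ofReal C / ENNReal.ofReal ((k : ℝ) + 1)) atTop (𝓝 0) := by
    have h2 : Tendsto (fun k : ℕ => C / ((k : ℝ) + 1)) atTop (𝓝 0) :=
      tendsto_const_nhds.div_atTop (tendsto_atTop_add_const_right _ _ tendsto_natCast_atTop_atTop)
    have h3 := ENNReal.tendsto_ofReal h2
    rw [ENNReal.ofReal_zero] at h3
    refine h3.congr fun k => ?_
    rw [ENNReal.ofReal_div_of_pos (by positivity)]
  obtain ⟨k, hk⟩ := ((ENNReal.tendsto_nhds_zero.1 h1) κ hκ).exists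
  refine ⟨k + 1, by positivity, ?_⟩
  filter_upwards [h] with n hn
  exact (measure_abs_ge_le (hf n) (by positivity)).trans
    ((ENNReal.div_le_div_right hn _).trans hk)

lemma VanishesInProb.tendstoInMeasure {E : Type*} [NormedAddCommGroup E] {Y : ℕ → Ω → E}
    (h : VanishesInProb P (fun n ω => ‖Y n ω‖)) : TendstoInMeasure P Y atTop 0 := by
  rw [tendstoInMeasure_iff_norm]
  intro η hη
  simpa using h η hη

/-- A minimizer of random functions converging pointwise in probability, with Lipschitz constants
bounded in probability, converges to the unique minimizer of the limit. -/
lemma vanishesInProb_norm_sub_argmin {E : Type*} [NormedAddCommGroup E] {Θ : Set E}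
    (hΘ : IsCompact Θ) {L : E → ℝ} (hL : ContinuousOn L Θ) {θ₀ : E} (hθ₀ : θ₀ ∈ Θ)
    (hmin : ∀ θ ∈ Θ, θ ≠ θ₀ → L θ₀ < L θ)
    {Ln : ℕ → E → Ω → ℝ} (hconv : ∀ θ ∈ Θ, VanishesInProb P (fun n ω => Ln n θ ω - L θ))
    {R : ℕ → Ω → ℝ} (hR : BoundedInProb P R)
    (hlip : ∀ n, ∀ θ ∈ Θ, ∀ θ' ∈ Θ, ∀ ω, |Ln n θ ω - Ln n θ' ω| ≤ R n ω * ‖θ - θ'‖)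
    {T : ℕ → Ω → E} (hT : ∀ n, ∀ᵐ ω ∂P, T n ω ∈ Θ ∧ ∀ θ ∈ Θ, Ln n (T n ω) ω ≤ Ln n θ ω) :
    VanishesInProb P (fun n ω => ‖T n ω - θ₀‖) := by
  intro η hη
  set F : Set E := Θ \ Metric.ball θ₀ η with hF
  have hFc : IsCompact F := hΘ.diff Metric.isOpen_ball
  have hFΘ : F ⊆ Θ := sdiff_subset
  obtain ⟨γ, hγ, hgap⟩ : ∃ γ : ℝ, 0 < γ ∧ ∀ θ ∈ F, L θ₀ + γ ≤ L θ := by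
    rcases F.eq_empty_or_nonempty with h | h
    · exact ⟨1, one_pos, by simp [h]⟩
    · obtain ⟨θ, hθ, hm⟩ := hFc.exists_isMinOn h (hL.mono hFΘ)
      refine ⟨L θ - L θ₀, sub_pos.2 (hmin θ (hFΘ hθ) ?_), fun θ' hθ' => ?_⟩
      · rintro rfl
        exact hθ.2 (Metric.mem_ball_self hη)
      · have := hm hθ'
        simp only [mem_ofPred_eq] at this
        linarith
  rw [ENNReal.tendsto_nhds_zero]
  intro κ hκ
  obtain ⟨A, hA, hRA⟩ := hR (κ / 2) (ENNReal.half_pos hκ.ne')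
  obtain ⟨N, hNF, hNfin, hNcov⟩ := hFc.finite_cover_balls (e := γ / (4 * A)) (by positivity)
  have hsum : Tendsto (fun n => P {ω | γ / 4 ≤ |Ln n θ₀ ω - L θ₀|} +
      ∑ θ ∈ hNfin.toFinset, P {ω | γ / 4 ≤ |Ln n θ ω - L θ|}) atTop (𝓝 0) := by
    have h1 := (hconv θ₀ hθ₀ (γ / 4) (by positivity)).add (tendsto_finsetSum hNfin.toFinset
      fun θ hθ => hconv θ (hFΘ (hNF (hNfin.mem_toFinset.1 hθ))) (γ / 4) (by positivity))
    simpa using h1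
  filter_upwards [hRA, (ENNReal.tendsto_nhds_zero.1 hsum) (κ / 2) (ENNReal.half_pos hκ.ne')]
    with n h1 h2
  calc P {ω | η ≤ |‖T n ω - θ₀‖|}
      ≤ P ({ω | A ≤ |R n ω|} ∪ ({ω | γ / 4 ≤ |Ln n θ₀ ω - L θ₀|} ∪
        ⋃ θ ∈ hNfin.toFinset, {ω | γ / 4 ≤ |Ln n θ ω - L θ|})) := by
        refine measure_le_of_ae_imp ?_
        filter_upwards [hT n] with ω hω hηω
        by_contra hc
        simp only [mem_union, mem_ofPred_eq, mem_iUnion, Set.Finite.mem_toFinset, exists_prop,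
          not_or, not_le, not_exists, not_and, abs_norm] at hc hηω
        obtain ⟨c1, c2, c3⟩ := hc
        have hTF : T n ω ∈ F := ⟨hω.1, by
          rw [Metric.mem_ball, dist_eq_norm, not_lt]; exact hηω⟩
        obtain ⟨θ, hθN, hθ⟩ : ∃ θ ∈ N, T n ω ∈ Metric.ball θ (γ / (4 * A)) := by
          have := hNcov hTF
          simpa using this
        rw [Metric.mem_ball, dist_eq_norm] at hθ
        have h3 := hlip n (T n ω) hω.1 θ (hFΘ (hNF hθN)) ω
        have h4 : R n ω * ‖T n ω - θ‖ ≤ A * (γ / (4 * A)) :=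
          mul_le_mul ((le_abs_self _).trans c1.le) hθ.le (norm_nonneg _) hA.le
        have h5 : A * (γ / (4 * A)) = γ / 4 := by field_simp
        have h6 := c3 θ hθN
        have h7 := hgap θ (hNF hθN)
        have h8 := hω.2 θ₀ hθ₀
        rw [abs_lt] at c2 h6
        rw [abs_le] at h3
        linarith [h3.1, h6.1, c2.2]
    _ ≤ κ / 2 + κ / 2 := by
        refine (measure_union_le _ _).trans (add_le_add h1 (le_trans ?_ h2))
        exact (measure_union_le _ _).trans (add_le_add le_rfl (measure_biUnion_finset_le _ _))
    _ = κ := ENNReal.add_halves κ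

end InProbability

section Linearization

variable {d : ℕ}

lemma abs_apply_le_norm (x : EuclideanSpace ℝ (Fin d)) (i : Fin d) : |x i| ≤ ‖x‖ := by
  have := PiLp.norm_apply_le x i
  rwa [Real.norm_eq_abs] at this

lemma eq_sum_single (x : EuclideanSpace ℝ (Fin d)) :
    x = ∑ i, x i • EuclideanSpace.single i (1 : ℝ) := by
  ext j
  simp [Pi.single_apply]

lemma norm_le_sum_abs (x : EuclideanSpace ℝ (Fin d)) : ‖x‖ ≤ ∑ i, |x i| := by
  conv_lhs => rw [eq_sum_single x]
  refine (norm_sum_le _ _).trans (Finset.sum_le_sum fun i _ => ?_)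
  rw [norm_smul, PiLp.norm_single]
  simp

lemma clm_apply_eq_sum (A : EuclideanSpace ℝ (Fin d) →L[ℝ] ℝ) (x : EuclideanSpace ℝ (Fin d)) :
    A x = ∑ i, x i * A (EuclideanSpace.single i 1) := by
  conv_lhs => rw [eq_sum_single x]
  simp

lemma clm_norm_le_sum (A : EuclideanSpace ℝ (Fin d) →L[ℝ] ℝ) :
    ‖A‖ ≤ ∑ i, |A (EuclideanSpace.single i 1)| := by
  refine A.opNorm_le_bound (Finset.sum_nonneg fun i _ => abs_nonneg _) fun x => ?_
  rw [clm_apply_eq_sum, Real.norm_eq_abs, Finset.sum_mul]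
  refine (Finset.abs_sum_le_sum_abs _ _).trans (Finset.sum_le_sum fun i _ => ?_)
  rw [abs_mul, mul_comm]
  exact mul_le_mul_of_nonneg_left (abs_apply_le_norm x i) (abs_nonneg _)

lemma l1_le_norm (x : EuclideanSpace ℝ (Fin d)) : l1 (fun i => x i) ≤ d * ‖x‖ := by
  unfold l1
  refine (Finset.sum_le_sum fun i _ => abs_apply_le_norm x i).trans ?_
  simp

lemma differentiableAt_pd {f : EuclideanSpace ℝ (Fin d) → ℝ} {U : Set (EuclideanSpace ℝ (Fin d))}
    (hU : IsOpen U) (hf : ContDiffOn ℝ 2 f U) (i : Fin d) {θ : EuclideanSpace ℝ (Fin d)}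
    (hθ : θ ∈ U) : DifferentiableAt ℝ (pd f i) θ := by
  have h1 : ContDiffOn ℝ 1 (fderiv ℝ f) U :=
    ((contDiffOn_succ_iff_fderiv_of_isOpen (n := 1) hU).1 (by rw [one_add_one_eq_two]; exact hf)).2.2
  have h2 : DifferentiableAt ℝ (fderiv ℝ f) θ :=
    (h1.differentiableOn one_ne_zero).differentiableAt (hU.mem_nhds hθ)
  exact h2.clm_apply (differentiableAt_const _)

lemma differentiableAt_of_contDiffOn_two {f : EuclideanSpace ℝ (Fin d) → ℝ}
    {U : Set (EuclideanSpace ℝ (Fin d))}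
    (hU : IsOpen U) (hf : ContDiffOn ℝ 2 f U) {θ : EuclideanSpace ℝ (Fin d)}
    (hθ : θ ∈ U) : DifferentiableAt ℝ f θ :=
  (hf.differentiableOn two_ne_zero).differentiableAt (hU.mem_nhds hθ)

/-- Mean value bound for the gradient around a critical point `θ`. -/
lemma abs_pd_add_mulVec_le {f : EuclideanSpace ℝ (Fin d) → ℝ}
    {U : Set (EuclideanSpace ℝ (Fin d))} (hU : IsOpen U) (hf : ContDiffOn ℝ 2 f U)
    {θ₀ θ : EuclideanSpace ℝ (Fin d)} (hball : Metric.closedBall θ₀ ‖θ - θ₀‖ ⊆ U)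
    (V : Matrix (Fin d) (Fin d) ℝ) {κ : ℝ}
    (hκ : ∀ θ' ∈ Metric.closedBall θ₀ ‖θ - θ₀‖, ∀ i, ∑ j, |hess f θ' i j - V i j| ≤ κ)
    (hcrit : ∀ i, pd f i θ = 0) (i : Fin d) :
    |pd f i θ₀ + V.mulVec (fun j => (θ - θ₀) j) i| ≤ κ * ‖θ - θ₀‖ := by
  set A : EuclideanSpace ℝ (Fin d) →L[ℝ] ℝ := ∑ j, V i j • EuclideanSpace.proj j with hA
  have hAe : ∀ j, A (EuclideanSpace.single j 1) = V i j := by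
    intro j
    simp [hA, PiLp.single_apply]
  have hφ : ∀ θ' ∈ Metric.closedBall θ₀ ‖θ - θ₀‖,
      HasFDerivWithinAt (fun θ' => pd f i θ' - A θ') (fderiv ℝ (pd f i) θ' - A)
        (Metric.closedBall θ₀ ‖θ - θ₀‖) θ' := by
    intro θ' hθ'
    exact ((differentiableAt_pd hU hf i (hball hθ')).hasFDerivAt.sub
      A.hasFDerivAt).hasFDerivWithinAt
  have hb : ∀ θ' ∈ Metric.closedBall θ₀ ‖θ - θ₀‖, ‖fderiv ℝ (pd f i) θ' - A‖ ≤ κ := by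
    intro θ' hθ'
    refine (clm_norm_le_sum _).trans (le_trans (le_of_eq ?_) (hκ θ' hθ' i))
    refine Finset.sum_congr rfl fun j _ => ?_
    simp [hAe, hess, pd]
  have h1 := (convex_closedBall θ₀ ‖θ - θ₀‖).norm_image_sub_le_of_norm_hasFDerivWithin_le hφ hb
    (Metric.mem_closedBall_self (norm_nonneg _))
    (show θ ∈ Metric.closedBall θ₀ ‖θ - θ₀‖ by rw [Metric.mem_closedBall, dist_eq_norm])
  have h2 : A θ - A θ₀ = V.mulVec (fun j => (θ - θ₀) j) i := by
    rw [← map_sub, clm_apply_eq_sum]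
    simp [hAe, Matrix.mulVec, dotProduct, mul_comm]
  rw [Real.norm_eq_abs, hcrit i, ← abs_neg] at h1
  convert h1 using 2
  rw [← h2]
  ring

/-- `V⁻¹ s` as a vector of the Euclidean space. -/
def invVec (V : Matrix (Fin d) (Fin d) ℝ) (s : Fin d → ℝ) : EuclideanSpace ℝ (Fin d) :=
  WithLp.toLp 2 (V⁻¹.mulVec s)

lemma norm_invVec_le (V : Matrix (Fin d) (Fin d) ℝ) (s : Fin d → ℝ) :
    ‖invVec V s‖ ≤ ∑ i, ∑ j, |V⁻¹ i j| * |s j| := by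
  refine (norm_le_sum_abs _).trans (Finset.sum_le_sum fun i _ => ?_)
  simp only [invVec, Matrix.mulVec, dotProduct]
  refine (Finset.abs_sum_le_sum_abs _ _).trans (le_of_eq ?_)
  exact Finset.sum_congr rfl fun j _ => abs_mul _ _

lemma norm_invVec_le_mul (V : Matrix (Fin d) (Fin d) ℝ) {s : Fin d → ℝ} {κ : ℝ}
    (hs : ∀ i, |s i| ≤ κ) : ‖invVec V s‖ ≤ (∑ i, ∑ j, |V⁻¹ i j|) * κ := by
  refine (norm_invVec_le V s).trans ?_
  rw [Finset.sum_mul]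
  refine Finset.sum_le_sum fun i _ => ?_
  rw [Finset.sum_mul]
  exact Finset.sum_le_sum fun j _ => mul_le_mul_of_nonneg_left (hs j) (abs_nonneg _)

lemma norm_add_invVec_le {V : Matrix (Fin d) (Fin d) ℝ} (hV : IsUnit V.det)
    {x : EuclideanSpace ℝ (Fin d)} {s : Fin d → ℝ} {κ : ℝ}
    (h : ∀ i, |s i + V.mulVec (fun j => x j) i| ≤ κ * ‖x‖)
    (hκ : (∑ i, ∑ j, |V⁻¹ i j|) * κ ≤ 1 / 2) :
    ‖x + invVec V s‖ ≤ 2 * (∑ i, ∑ j, |V⁻¹ i j|) * |κ| * ‖invVec V s‖ := by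
  set C := ∑ i, ∑ j, |V⁻¹ i j| with hC
  have hC0 : 0 ≤ C := Finset.sum_nonneg fun i _ => Finset.sum_nonneg fun j _ => abs_nonneg _
  have h1 : x + invVec V s = invVec V (fun i => s i + V.mulVec (fun j => x j) i) := by
    have h2 : V⁻¹.mulVec (fun i => s i + V.mulVec (fun j => x j) i) =
        V⁻¹.mulVec s + fun j => x j := by
      rw [show (fun i => s i + V.mulVec (fun j => x j) i) = s + V.mulVec (fun j => x j) from rfl,
        Matrix.mulVec_add, Matrix.mulVec_mulVec, Matrix.nonsing_inv_mul V hV, Matrix.one_mulVec]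
    ext j
    simp only [invVec, h2]
    simp [add_comm]
  have h3 : ‖x + invVec V s‖ ≤ C * (κ * ‖x‖) := by
    rw [h1]
    exact norm_invVec_le_mul V h
  have h4 : ‖x‖ ≤ ‖x + invVec V s‖ + ‖invVec V s‖ := by
    simpa using norm_sub_le (x + invVec V s) (invVec V s)
  have h5 : C * κ * ‖x‖ ≤ 1 / 2 * ‖x‖ := mul_le_mul_of_nonneg_right hκ (norm_nonneg _)
  have h6 : ‖x‖ ≤ 2 * ‖invVec V s‖ := by nlinarith
  calc ‖x + invVec V s‖ ≤ C * (κ * ‖x‖) := h3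
    _ ≤ C * (|κ| * (2 * ‖invVec V s‖)) := by
        refine mul_le_mul_of_nonneg_left ?_ hC0
        exact mul_le_mul (le_abs_self _) h6 (norm_nonneg _) (abs_nonneg _)
    _ = _ := by ring

variable {Ω : Type*} [MeasurableSpace Ω] {P : Measure Ω}

/-- The Newton expansion of a consistent minimizer. -/
lemma vanishesInProb_linearization {Θ : Set (EuclideanSpace ℝ (Fin d))}
    {θ₀ : EuclideanSpace ℝ (Fin d)} (hθ₀ : θ₀ ∈ interior Θ)
    {Ln : ℕ → Ω → EuclideanSpace ℝ (Fin d) → ℝ}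
    (hC2 : ∀ n ω, ContDiffOn ℝ 2 (Ln n ω) (interior Θ))
    {T : ℕ → Ω → EuclideanSpace ℝ (Fin d)}
    (hT : ∀ n, ∀ᵐ ω ∂P, T n ω ∈ Θ ∧ ∀ θ ∈ Θ, Ln n ω (T n ω) ≤ Ln n ω θ)
    (hcons : VanishesInProb P (fun n ω => ‖T n ω - θ₀‖))
    {V : Matrix (Fin d) (Fin d) ℝ} (hV : IsUnit V.det)
    (hH : ∀ i j, VanishesInProb P (fun n ω => hess (Ln n ω) θ₀ i j - V i j))
    {R : ℕ → Ω → ℝ} (hR : BoundedInProb P R)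
    (hlip : ∀ n ω, ∀ θ ∈ interior Θ, ∀ i j,
      |hess (Ln n ω) θ i j - hess (Ln n ω) θ₀ i j| ≤ R n ω * ‖θ - θ₀‖)
    {a : ℕ → ℝ} (hS : ∀ i, BoundedInProb P (fun n ω => a n * pd (Ln n ω) i θ₀)) :
    VanishesInProb P (fun n ω =>
      ‖a n • (T n ω - θ₀ + invVec V (fun i => pd (Ln n ω) i θ₀))‖) := by
  set C := ∑ i, ∑ j, |V⁻¹ i j| with hC
  obtain ⟨r, hr, hball⟩ := Metric.isOpen_iff.1 isOpen_interior θ₀ hθ₀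
  set κ : ℕ → Ω → ℝ := fun n ω => ∑ i, ∑ j, |hess (Ln n ω) θ₀ i j - V i j| +
    d * (‖T n ω - θ₀‖ * R n ω) with hκ
  have hκv : VanishesInProb P κ :=
    (VanishesInProb.sum _ fun i _ => VanishesInProb.sum _ fun j _ => (hH i j).abs).add
      ((hcons.mul_bounded hR).const_mul d)
  set Sb : ℕ → Ω → ℝ := fun n ω =>
    ∑ i, ∑ j, |V⁻¹ i j| * |a n * pd (Ln n ω) j θ₀| with hSb
  have hSbb : BoundedInProb P Sb :=
    BoundedInProb.sum _ fun i _ => BoundedInProb.sum _ fun j _ => (hS j).abs.const_mul _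
  have hprod : VanishesInProb P (fun n ω => (2 * C) * (κ n ω * Sb n ω)) :=
    (hκv.mul_bounded hSbb).const_mul _
  have hCκ : VanishesInProb P (fun n ω => C * κ n ω) := hκv.const_mul C
  have hkey : ∀ n, ∀ᵐ ω ∂P, ‖T n ω - θ₀‖ < r → |C * κ n ω| < 1 / 2 →
      ‖a n • (T n ω - θ₀ + invVec V (fun i => pd (Ln n ω) i θ₀))‖ ≤
        |(2 * C) * (κ n ω * Sb n ω)| := by
    intro n
    filter_upwards [hT n] with ω hω h1 h2
    have hTU : T n ω ∈ interior Θ := hball (by rwa [Metric.mem_ball, dist_eq_norm])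
    have hcl : Metric.closedBall θ₀ ‖T n ω - θ₀‖ ⊆ interior Θ :=
      (Metric.closedBall_subset_ball h1).trans hball
    have hloc : IsLocalMin (Ln n ω) (T n ω) := by
      filter_upwards [isOpen_interior.mem_nhds hTU] with θ hθ
      exact hω.2 θ (interior_subset hθ)
    have hcrit : ∀ i, pd (Ln n ω) i (T n ω) = 0 := by
      intro i
      simp [pd, hloc.fderiv_eq_zero]
    have h3 := abs_pd_add_mulVec_le isOpen_interior (hC2 n ω) hcl V (κ := κ n ω) (by
      intro θ' hθ' i
      have e1 : ∀ j, |hess (Ln n ω) θ' i j - V i j| ≤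
          |hess (Ln n ω) θ₀ i j - V i j| + ‖T n ω - θ₀‖ * R n ω := by
        intro j
        have e2 := hlip n ω θ' (hcl hθ') i j
        have e3 : ‖θ' - θ₀‖ ≤ ‖T n ω - θ₀‖ := by
          rwa [Metric.mem_closedBall, dist_eq_norm] at hθ'
        have e4 : hess (Ln n ω) θ' i j - V i j =
          (hess (Ln n ω) θ' i j - hess (Ln n ω) θ₀ i j) +
          (hess (Ln n ω) θ₀ i j - V i j) := by ring
        rcases (norm_nonneg (θ' - θ₀)).eq_or_lt with h0 | h0
        · have e5 : θ' = θ₀ := by rw [eq_comm, norm_eq_zero, sub_eq_zero] at h0; exact h0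
          have e6 := hlip n ω (T n ω) hTU i j
          have e7 : 0 ≤ R n ω * ‖T n ω - θ₀‖ := (abs_nonneg _).trans e6
          rw [e5]
          linarith
        · have e5 : 0 ≤ R n ω := by
            by_contra hc
            have := (abs_nonneg _).trans e2
            nlinarith
          have e6 : R n ω * ‖θ' - θ₀‖ ≤ R n ω * ‖T n ω - θ₀‖ :=
            mul_le_mul_of_nonneg_left e3 e5
          rw [e4]
          refine (abs_add_le _ _).trans ?_
          linarith
      calc ∑ j, |hess (Ln n ω) θ' i j - V i j|
          ≤ ∑ j, (|hess (Ln n ω) θ₀ i j - V i j| + ‖T n ω - θ₀‖ * R n ω) :=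
            Finset.sum_le_sum fun j _ => e1 j
        _ = ∑ j, |hess (Ln n ω) θ₀ i j - V i j| + d * (‖T n ω - θ₀‖ * R n ω) := by
            rw [Finset.sum_add_distrib]; simp
        _ ≤ κ n ω := by
            refine add_le_add_left ?_ _
            exact Finset.single_le_sum (f := fun i => ∑ j, |hess (Ln n ω) θ₀ i j - V i j|)
              (fun i _ => Finset.sum_nonneg fun j _ => abs_nonneg _) (Finset.mem_univ i)) hcrit
    have h4 := norm_add_invVec_le hV h3 ((le_abs_self _).trans h2.le)
    have h5 : |a n| * ‖invVec V (fun i => pd (Ln n ω) i θ₀)‖ ≤ Sb n ω := by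
      refine (mul_le_mul_of_nonneg_left (norm_invVec_le _ _) (abs_nonneg _)).trans (le_of_eq ?_)
      rw [hSb, Finset.mul_sum]
      refine Finset.sum_congr rfl fun i _ => ?_
      rw [Finset.mul_sum]
      refine Finset.sum_congr rfl fun j _ => ?_
      rw [abs_mul]; ring
    have hC0 : 0 ≤ C := Finset.sum_nonneg fun i _ => Finset.sum_nonneg fun j _ => abs_nonneg _
    have hSb0 : 0 ≤ Sb n ω := le_trans (by positivity) h5
    rw [norm_smul, Real.norm_eq_abs, abs_mul, abs_mul (κ n ω), abs_of_nonneg hSb0,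
      abs_of_nonneg (by positivity : 0 ≤ 2 * C)]
    calc |a n| * ‖T n ω - θ₀ + invVec V (fun i => pd (Ln n ω) i θ₀)‖
        ≤ |a n| * (2 * C * |κ n ω| * ‖invVec V (fun i => pd (Ln n ω) i θ₀)‖) :=
          mul_le_mul_of_nonneg_left h4 (abs_nonneg _)
      _ = 2 * C * |κ n ω| * (|a n| * ‖invVec V (fun i => pd (Ln n ω) i θ₀)‖) := by ring
      _ ≤ 2 * C * |κ n ω| * Sb n ω := mul_le_mul_of_nonneg_left h5 (by positivity)
      _ = _ := by ring
  intro η hη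
  have hlim := ((hcons r hr).add (hCκ (1 / 2) (by norm_num))).add (hprod η hη)
  simp only [add_zero] at hlim
  refine tendsto_of_tendsto_of_tendsto_of_le_of_le tendsto_const_nhds hlim
    (fun _ => zero_le) fun n => ?_
  refine le_trans ?_ ((measure_union_le _ _).trans (add_le_add_left (measure_union_le _ _) _))
  refine measure_le_of_ae_imp ?_
  filter_upwards [hkey n] with ω hω h1
  by_contra hc
  simp only [mem_union, mem_ofPred_eq, not_or, not_le, abs_norm] at hc h1
  have := hω hc.1.1 hc.1.2
  linarith [hc.2]

end Linearization

section KernelWeights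

/-- The weights `(nb)⁻¹ K((t/n - u)/b)`. -/
def kernelWeight (K : ℝ → ℝ) (b : ℕ → ℝ) (u : ℝ) (n t : ℕ) : ℝ :=
  1 / (n * b n) * K (((t : ℝ) / n - u) / b n)

/-- Bandwidths `b_n ∈ (0,1)` with `b_n → 0` and `n b_n → ∞`. -/
structure IsBandwidth (b : ℕ → ℝ) : Prop where
  mem : ∀ n, b n ∈ Ioo (0 : ℝ) 1
  tendsto : Tendsto b atTop (𝓝 0)
  tendsto_mul : Tendsto (fun n : ℕ => (n : ℝ) * b n) atTop atTop

variable {K : ℝ → ℝ} {b : ℕ → ℝ} {u : ℝ}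

lemma IsBandwidth.pos (hb : IsBandwidth b) (n : ℕ) : 0 < b n := (hb.mem n).1

lemma IsBandwidth.tendsto_inv (hb : IsBandwidth b) (c : ℝ) :
    Tendsto (fun n : ℕ => c * (1 / ((n : ℝ) * b n))) atTop (𝓝 0) := by
  have := (tendsto_inv_atTop_zero.comp hb.tendsto_mul).const_mul c
  simpa [Function.comp_def] using this

lemma tendsto_sum_kernelWeight_mul (hK : IsLocalizingKernel K) (hu : u ∈ Ioo (0 : ℝ) 1)
    (hb : IsBandwidth b) {φ : ℝ → ℝ → ℝ} (hφ : Continuous (Function.uncurry φ))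
    (hφ0 : ∀ x, φ 0 x = 0) (p : ℕ) :
    Tendsto (fun n => ∑ t ∈ Finset.Icc (p + 1) n,
      1 / (n * b n) * φ (K (((t : ℝ) / n - u) / b n)) (((t : ℝ) / n - u) / b n)) atTop
      (𝓝 (∫ x, φ (K x) x)) := by
  obtain ⟨B, hB⟩ := hK.bounded
  have hcomp : IsCompact (Icc (-B) B ×ˢ Icc (-(1 / 2) : ℝ) (1 / 2)) := isCompact_Icc.prod isCompact_Icc
  obtain ⟨A, hA⟩ := hcomp.exists_bound_of_continuousOn hφ.continuousOn
  refine tendsto_riemann_sum (f := fun x => φ (K x) x) (B := |A|) ?_ ?_ ?_ hu hb.pos hb.tendsto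
    hb.tendsto_mul p
  · intro x
    by_cases hx : x ∈ Icc (-(1 / 2) : ℝ) (1 / 2)
    · exact (hA (K x, x) ⟨abs_le.1 (hB x), hx⟩).trans (le_abs_self _)
    · rw [hK.support x hx, hφ0]
      simp
  · intro x hx
    rw [hK.support x hx, hφ0]
  · filter_upwards [hK.ae_continuousAt] with x hx
    exact hφ.continuousAt.comp (hx.prodMk continuousAt_id)

lemma tendsto_sum_kernelWeight (hK : IsLocalizingKernel K) (hu : u ∈ Ioo (0 : ℝ) 1)
    (hb : IsBandwidth b) (p : ℕ) :
    Tendsto (fun n => ∑ t ∈ Finset.Icc (p + 1) n, kernelWeight K b u n t) atTop (𝓝 1) := by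
  have := tendsto_sum_kernelWeight_mul hK hu hb (φ := fun k _ => k) (by fun_prop) (fun _ => rfl) p
  rwa [hK.integral_eq_one] at this

lemma exists_sum_abs_kernelWeight_le (hK : IsLocalizingKernel K) (hu : u ∈ Ioo (0 : ℝ) 1)
    (hb : IsBandwidth b) (p : ℕ) : ∃ C : ℝ, 0 ≤ C ∧
    ∀ᶠ n in atTop, ∑ t ∈ Finset.Icc (p + 1) n, |kernelWeight K b u n t| ≤ C := by
  have := tendsto_sum_kernelWeight_mul hK hu hb (φ := fun k _ => |k|) (by fun_prop) (by simp) p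
  refine ⟨abs (∫ x, abs (K x)) + 1, by positivity, ?_⟩
  filter_upwards [this.eventually_le_const (lt_of_le_of_lt (le_abs_self _) (lt_add_one _))]
    with n hn
  refine le_trans (le_of_eq (Finset.sum_congr rfl fun t _ => ?_)) hn
  have hbn := hb.pos n
  rw [kernelWeight, abs_mul, abs_of_nonneg (by positivity)]

lemma exists_abs_kernelWeight_le (hK : IsLocalizingKernel K) (hb : IsBandwidth b) :
    ∃ B : ℝ, 0 ≤ B ∧ ∀ n t, |kernelWeight K b u n t| ≤ B * (1 / ((n : ℝ) * b n)) := by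
  obtain ⟨B, hB⟩ := hK.bounded
  refine ⟨B, (abs_nonneg _).trans (hB 0), fun n t => ?_⟩
  have hbn := hb.pos n
  rw [kernelWeight, abs_mul, abs_of_nonneg (by positivity), mul_comm]
  exact mul_le_mul_of_nonneg_right (hB _) (by positivity)

lemma abs_sub_le_of_kernelWeight_ne_zero (hK : IsLocalizingKernel K) (hb : IsBandwidth b) {n t : ℕ}
    (h : kernelWeight K b u n t ≠ 0) : |(t : ℝ) / n - u| ≤ b n := by
  have hbn := hb.pos n
  have h1 : (((t : ℝ) / n - u) / b n) ∈ Icc (-(1 / 2) : ℝ) (1 / 2) := by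
    by_contra hc
    exact h (by rw [kernelWeight, hK.support _ hc, mul_zero])
  have h2 : |((t : ℝ) / n - u) / b n| ≤ 1 := by
    rw [abs_le]; exact ⟨by linarith [h1.1], by linarith [h1.2]⟩
  rwa [abs_div, abs_of_pos hbn, div_le_one hbn] at h2

lemma tendsto_sum_sq_kernelWeight (hK : IsLocalizingKernel K) (hu : u ∈ Ioo (0 : ℝ) 1)
    (hb : IsBandwidth b) (p : ℕ) :
    Tendsto (fun n : ℕ => ∑ t ∈ Finset.Icc (p + 1) n,
      (√((n : ℝ) * b n) * kernelWeight K b u n t) ^ 2) atTop (𝓝 (∫ x, K x ^ 2)) := by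
  refine (tendsto_sum_kernelWeight_mul hK hu hb (φ := fun k _ => k ^ 2) (by fun_prop)
    (by simp) p).congr' ?_
  filter_upwards [hb.tendsto_mul.eventually_gt_atTop 0] with n hn
  refine Finset.sum_congr rfl fun t _ => ?_
  rw [mul_pow, Real.sq_sqrt hn.le, kernelWeight, mul_pow]
  field_simp

lemma tendsto_sum_kernelWeight_moment (hK : IsLocalizingKernel K) (hu : u ∈ Ioo (0 : ℝ) 1)
    (hb : IsBandwidth b) (p : ℕ) :
    Tendsto (fun n : ℕ => ∑ t ∈ Finset.Icc (p + 1) n,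
      kernelWeight K b u n t * (((t : ℝ) / n - u) / b n)) atTop (𝓝 (∫ x, K x * x)) := by
  refine (tendsto_sum_kernelWeight_mul hK hu hb (φ := fun k x => k * x) (by fun_prop)
    (by simp) p).congr fun n => ?_
  refine Finset.sum_congr rfl fun t _ => ?_
  rw [kernelWeight]
  ring

lemma exists_abs_scaled_kernelWeight_le (hK : IsLocalizingKernel K) (hb : IsBandwidth b) :
    ∃ δ : ℕ → ℝ, Tendsto δ atTop (𝓝 0) ∧
      ∀ n t : ℕ, |√((n : ℝ) * b n) * kernelWeight K b u n t| ≤ δ n := by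
  obtain ⟨B, hB0, hB⟩ := exists_abs_kernelWeight_le (u := u) hK hb
  refine ⟨fun n => √((n : ℝ) * b n) * (B * (1 / ((n : ℝ) * b n))), ?_, fun n t => ?_⟩
  · have h1 : Tendsto (fun n : ℕ => B * (√((n : ℝ) * b n))⁻¹) atTop (𝓝 0) := by
      have := (tendsto_inv_atTop_zero.comp
        (Real.tendsto_sqrt_atTop.comp hb.tendsto_mul)).const_mul B
      simpa [Function.comp_def] using this
    refine h1.congr' ?_
    filter_upwards [hb.tendsto_mul.eventually_gt_atTop 0] with n hn
    have h2 : √((n : ℝ) * b n) * √((n : ℝ) * b n) = n * b n := Real.mul_self_sqrt hn.le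
    have h3 : 0 < √((n : ℝ) * b n) := Real.sqrt_pos.2 hn
    calc B * (√((n : ℝ) * b n))⁻¹ = √((n : ℝ) * b n) * (B * (1 /
          (√((n : ℝ) * b n) * √((n : ℝ) * b n)))) := by field_simp
      _ = _ := by rw [h2]
  · rw [abs_mul, abs_of_nonneg (Real.sqrt_nonneg _)]
    exact mul_le_mul_of_nonneg_left (hB n t) (Real.sqrt_nonneg _)

end KernelWeights

section LocalApproximation

variable {Ω : Type*} [MeasurableSpace Ω] {P : Measure Ω} [IsProbabilityMeasure P]
  {Xt : ℤ → ℝ → Ω → ℝ} {X : ℕ → ℤ → Ω → ℝ} {p : ℕ} {q α : ℝ}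

/-- `X_{t,n}` is approximated by `X̃_t(v)` in `L^q` up to `(1/n)^α + |t/n - v|^α`. -/
structure LocApprox (P : Measure Ω) (Xt : ℤ → ℝ → Ω → ℝ) (X : ℕ → ℤ → Ω → ℝ) (p : ℕ) (q α : ℝ) :
    Prop where
  aemeasurable_stationary : ∀ v ∈ Icc (0 : ℝ) 1, ∀ t, AEMeasurable (Xt t v) P
  aemeasurable : ∀ (n : ℕ) (t : ℤ), t ≤ n → AEMeasurable (X n t) P
  moment : ∃ B : ℝ, 0 ≤ B ∧ ∀ v ∈ Icc (0 : ℝ) 1, ∀ t,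
    eLpNorm (Xt t v) (ENNReal.ofReal q) P ≤ ENNReal.ofReal B
  approx : ∃ E : ℝ, 0 < E ∧ ∀ (n : ℕ) (t : ℤ), t ≤ n → ∀ v ∈ Icc (0 : ℝ) 1, ∀ j ≤ p,
    eLpNorm (fun ω => X n (t - j) ω - Xt (t - j) v ω) (ENNReal.ofReal q) P ≤
      ENNReal.ofReal (E * ((1 / (n : ℝ)) ^ α + |max ((t : ℝ) / n) 0 - v| ^ α))

lemma LocApprox.mono (h : LocApprox P Xt X p q α) {q' : ℝ} (hq : q' ≤ q) :
    LocApprox P Xt X p q' α where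
  aemeasurable_stationary := h.aemeasurable_stationary
  aemeasurable := h.aemeasurable
  moment := by
    obtain ⟨B, hB0, hB⟩ := h.moment
    refine ⟨B, hB0, fun v hv t => le_trans ?_ (hB v hv t)⟩
    exact eLpNorm_le_eLpNorm_of_exponent_le (ENNReal.ofReal_le_ofReal hq)
      (h.aemeasurable_stationary v hv t).aestronglyMeasurable
  approx := by
    obtain ⟨E, hE0, hE⟩ := h.approx
    refine ⟨E, hE0, fun n t ht v hv j hj => le_trans ?_ (hE n t ht v hv j hj)⟩
    exact eLpNorm_le_eLpNorm_of_exponent_le (ENNReal.ofReal_le_ofReal hq)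
      ((h.aemeasurable n _ (by lia)).sub (h.aemeasurable_stationary v hv _)).aestronglyMeasurable

lemma LocApprox.aemeasurable_lags (h : LocApprox P Xt X p q α) {n t : ℕ} (ht : t ≤ n) (r : ℕ) :
    AEMeasurable (fun ω => lags r (fun s => X n s ω) (t : ℤ)) P :=
  aemeasurable_pi_lambda _ fun _ => h.aemeasurable n _ (by lia)

lemma LocApprox.aemeasurable_lags_stationary (h : LocApprox P Xt X p q α) {v : ℝ}
    (hv : v ∈ Icc (0 : ℝ) 1) (t : ℤ) (r : ℕ) :
    AEMeasurable (fun ω => lags r (fun s => Xt s v ω) t) P :=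
  aemeasurable_pi_lambda _ fun _ => h.aemeasurable_stationary v hv _

lemma LocApprox.exists_moment (h : LocApprox P Xt X p q α) (hq : 1 ≤ q) (hα : 0 ≤ α) :
    ∃ B : ℝ, 0 ≤ B ∧ (∀ v ∈ Icc (0 : ℝ) 1, ∀ t, ∀ i : Fin (p + 1),
      eLpNorm (fun ω => lags (p + 1) (fun s => Xt s v ω) t i) (ENNReal.ofReal q) P ≤
        ENNReal.ofReal B) ∧
      ∀ n t : ℕ, 1 ≤ n → t ≤ n → ∀ i : Fin (p + 1),
        eLpNorm (fun ω => lags (p + 1) (fun s => X n s ω) (t : ℤ) i) (ENNReal.ofReal q) P ≤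
        ENNReal.ofReal B := by
  obtain ⟨B, hB0, hB⟩ := h.moment
  obtain ⟨E, hE0, hE⟩ := h.approx
  refine ⟨B + E * 2, by positivity, fun v hv t i => (hB v hv _).trans
    (ENNReal.ofReal_le_ofReal (by linarith)), fun n t hn ht i => ?_⟩
  have h0 : (0 : ℝ) ∈ Icc (0 : ℝ) 1 := by simp
  have h1 := hE n t (by exact_mod_cast ht) 0 h0 i (by lia)
  have hm := rescaled_mem_Icc (n := n) (t := (t : ℤ)) (by exact_mod_cast ht)
  have h2 : (1 / (n : ℝ)) ^ α ≤ 1 := Real.rpow_le_one (by positivity) (by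
    rw [div_le_one (by positivity)]; exact_mod_cast hn) hα
  have h3 : |max (((t : ℤ) : ℝ) / n) 0 - 0| ^ α ≤ 1 := by
    refine Real.rpow_le_one (abs_nonneg _) ?_ hα
    rw [sub_zero, abs_of_nonneg hm.1]
    exact hm.2
  have hXm := h.aemeasurable n ((t : ℤ) - i) (by lia)
  have hXtm := h.aemeasurable_stationary 0 h0 ((t : ℤ) - i)
  have h4 : eLpNorm (X n ((t : ℤ) - i)) (ENNReal.ofReal q) P ≤
      eLpNorm (Xt ((t : ℤ) - i) 0) (ENNReal.ofReal q) P +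
      eLpNorm (fun ω => X n ((t : ℤ) - i) ω - Xt ((t : ℤ) - i) 0 ω) (ENNReal.ofReal q) P := by
    refine le_trans (le_of_eq ?_) (eLpNorm_add_le hXtm.aestronglyMeasurable
      (hXm.sub hXtm).aestronglyMeasurable (one_le_ofReal hq))
    congr 1
    ext ω
    simp
  refine h4.trans ((add_le_add (hB 0 h0 _) h1).trans ?_)
  rw [← ENNReal.ofReal_add hB0 (by positivity)]
  refine ENNReal.ofReal_le_ofReal (add_le_add_right (mul_le_mul_of_nonneg_left ?_ hE0.le) _)
  linarith

lemma LocApprox.exists_eLpNorm_comp_sub_le {M : ℝ} (hM : 0 ≤ M)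
    (h : LocApprox P Xt X p (M + 1) α) (hα : 0 ≤ α) {C : ℝ} (hC : 0 ≤ C) :
    ∃ A : ℝ, 0 ≤ A ∧ ∀ g, ClassL M C g → ∀ n t : ℕ, 1 ≤ n → t ≤ n → ∀ v ∈ Icc (0 : ℝ) 1,
      eLpNorm (fun ω => g (lags (p + 1) (fun s => X n s ω) (t : ℤ)) -
        g (lags (p + 1) (fun s => Xt s v ω) t)) 1 P ≤
        ENNReal.ofReal (A * ((1 / (n : ℝ)) ^ α + |(t : ℝ) / n - v| ^ α)) := by
  obtain ⟨B, hB0, hB1, hB2⟩ := h.exists_moment (by linarith) hα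
  obtain ⟨E, hE0, hE⟩ := h.approx
  refine ⟨C * (3 * ((p + 1 : ℕ) : ℝ) ^ (M + 1) + 1 + 2 * ((p + 1 : ℕ) * B) ^ (M + 1)) * E,
    by positivity, fun g hg n t hn ht v hv => ?_⟩
  have hn' : (0 : ℝ) < n := by exact_mod_cast hn
  have hδ : 0 < E * ((1 / (n : ℝ)) ^ α + |(t : ℝ) / n - v| ^ α) := by
    have : 0 < (1 / (n : ℝ)) ^ α := Real.rpow_pos_of_pos (by positivity) _
    positivity
  refine (hg.eLpNorm_sub_le hC hB0 (h.aemeasurable_lags ht _) (h.aemeasurable_lags_stationary hv _ _)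
    (hB2 n t hn ht) (hB1 v hv t) hδ fun i => ?_).trans_eq (by rw [mul_assoc _ E])
  have h1 := hE n t (by exact_mod_cast ht) v hv i (by lia)
  rwa [max_eq_left (by positivity), Int.cast_natCast] at h1

lemma LocApprox.exists_eLpNorm_l1_rpow_le (h : LocApprox P Xt X p q α) (hq : 1 ≤ q) (hα : 0 ≤ α) :
    ∃ A : ℝ, 0 ≤ A ∧ ∀ n t : ℕ, 1 ≤ n → t ≤ n →
      eLpNorm (fun ω => l1 (lags (p + 1) (fun s => X n s ω) (t : ℤ)) ^ q) 1 P ≤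
        ENNReal.ofReal A := by
  obtain ⟨B, hB0, hB1, hB2⟩ := h.exists_moment hq hα
  refine ⟨((p + 1 : ℕ) * B) ^ q, by positivity, fun n t hn ht => ?_⟩
  refine le_trans (le_of_eq ?_) (lintegral_l1_rpow_le hq (h.aemeasurable_lags ht _) hB0
    (hB2 n t hn ht))
  rw [eLpNorm_one_eq_lintegral_enorm]
  refine lintegral_congr fun ω => ?_
  rw [Real.enorm_eq_ofReal (Real.rpow_nonneg (l1_nonneg _) _)]

lemma LocApprox.integrable_l1_rpow (h : LocApprox P Xt X p q α) (hq : 1 ≤ q) {v : ℝ}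
    (hv : v ∈ Icc (0 : ℝ) 1) (t : ℤ) :
    Integrable (fun ω => l1 (lags (p + 1) (fun s => Xt s v ω) t) ^ q) P := by
  obtain ⟨B, hB0, hB1⟩ := h.moment
  exact LocStat.integrable_l1_rpow hq (h.aemeasurable_lags_stationary hv _ _) hB0
    fun i => hB1 v hv _

lemma eLpNorm_sum_mul_le (s : Finset ℕ) (w : ℕ → ℝ) {f : ℕ → Ω → ℝ}
    (hf : ∀ t ∈ s, AEMeasurable (f t) P) :
    eLpNorm (fun ω => ∑ t ∈ s, w t * f t ω) 1 P ≤
      ∑ t ∈ s, ENNReal.ofReal |w t| * eLpNorm (f t) 1 P := by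
  have h1 : (fun ω => ∑ t ∈ s, w t * f t ω) = ∑ t ∈ s, fun ω => w t * f t ω := by
    ext ω; simp
  rw [h1]
  refine (eLpNorm_sum_le (fun t ht => ((hf t ht).const_mul _).aestronglyMeasurable) le_rfl).trans
    (Finset.sum_le_sum fun t _ => ?_)
  have h2 := eLpNorm_const_smul_le (c := w t) (f := f t) (p := 1) (μ := P)
  refine le_trans (le_of_eq ?_) (h2.trans_eq ?_)
  · rfl
  · rw [Real.enorm_eq_ofReal_abs]

lemma eLpNorm_sum_mul_le_of_le (s : Finset ℕ) (w : ℕ → ℝ) {f : ℕ → Ω → ℝ}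
    (hf : ∀ t ∈ s, AEMeasurable (f t) P) {c C : ℝ} (hc : 0 ≤ c) (hC : ∑ t ∈ s, |w t| ≤ C)
    (h : ∀ t ∈ s, w t ≠ 0 → eLpNorm (f t) 1 P ≤ ENNReal.ofReal c) :
    eLpNorm (fun ω => ∑ t ∈ s, w t * f t ω) 1 P ≤ ENNReal.ofReal (C * c) := by
  refine (eLpNorm_sum_mul_le s w hf).trans ?_
  calc ∑ t ∈ s, ENNReal.ofReal |w t| * eLpNorm (f t) 1 P
      ≤ ∑ t ∈ s, ENNReal.ofReal (|w t| * c) := by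
        refine Finset.sum_le_sum fun t ht => ?_
        rcases eq_or_ne (w t) 0 with h0 | h0
        · simp [h0]
        · rw [ENNReal.ofReal_mul (abs_nonneg _)]
          gcongr
          exact h t ht h0
    _ = ENNReal.ofReal ((∑ t ∈ s, |w t|) * c) := by
        rw [← ENNReal.ofReal_sum_of_nonneg fun t _ => by positivity, Finset.sum_mul]
    _ ≤ _ := ENNReal.ofReal_le_ofReal (mul_le_mul_of_nonneg_right hC hc)

variable {ε : ℤ → Ω → ℝ} {K : ℝ → ℝ} {b : ℕ → ℝ} {u : ℝ}

/-- Replacing `X_{t,n}` by `X̃_t(u)` in a kernel weighted sum. -/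
lemma LocApprox.exists_eLpNorm_weighted_sub_le {M : ℝ} (hM : 0 ≤ M)
    (h : LocApprox P Xt X p (M + 1) α) (hα : 0 ≤ α) (hK : IsLocalizingKernel K)
    (hu : u ∈ Ioo (0 : ℝ) 1) (hb : IsBandwidth b) {C : ℝ} (hC : 0 ≤ C) {g} (hg : ClassL M C g) :
    ∃ A : ℝ, 0 ≤ A ∧ ∀ᶠ n : ℕ in atTop,
      eLpNorm (fun ω => ∑ t ∈ Finset.Icc (p + 1) n, kernelWeight K b u n t *
        (g (lags (p + 1) (fun s => X n s ω) (t : ℤ)) -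
          g (lags (p + 1) (fun s => Xt s u ω) t))) 1 P ≤
        ENNReal.ofReal (A * ((1 / (n : ℝ)) ^ α + b n ^ α)) := by
  obtain ⟨A, hA0, hA⟩ := h.exists_eLpNorm_comp_sub_le hM hα hC
  obtain ⟨CK, hCK0, hCK⟩ := exists_sum_abs_kernelWeight_le hK hu hb p
  refine ⟨CK * A, by positivity, ?_⟩
  have hgm := hg.continuous.measurable
  filter_upwards [hCK, eventually_ge_atTop 1] with n h1 hn
  rw [mul_assoc]
  have hbn := hb.pos n
  refine eLpNorm_sum_mul_le_of_le _ _ (fun t ht => ?_) (by positivity) h1 fun t ht h0 => ?_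
  · exact (hgm.comp_aemeasurable (h.aemeasurable_lags (Finset.mem_Icc.1 ht).2 _)).sub
      (hgm.comp_aemeasurable (h.aemeasurable_lags_stationary (Ioo_subset_Icc_self hu) _ _))
  · refine (hA g hg n t hn (Finset.mem_Icc.1 ht).2 u (Ioo_subset_Icc_self hu)).trans ?_
    refine ENNReal.ofReal_le_ofReal (mul_le_mul_of_nonneg_left (add_le_add_right ?_ _) hA0)
    exact Real.rpow_le_rpow (abs_nonneg _) (abs_sub_le_of_kernelWeight_ne_zero hK hb h0) hα

lemma IsBandwidth.tendsto_rate (hb : IsBandwidth b) (hα : 0 < α) (A : ℝ) :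
    Tendsto (fun n : ℕ => A * ((1 / (n : ℝ)) ^ α + b n ^ α)) atTop (𝓝 0) := by
  have h1 : Tendsto (fun n : ℕ => (1 / (n : ℝ)) ^ α) atTop (𝓝 0) := by
    have := (tendsto_one_div_atTop_nhds_zero_nat (𝕜 := ℝ)).rpow_const (p := α) (Or.inr hα.le)
    simpa [Real.zero_rpow hα.ne'] using this
  have h2 : Tendsto (fun n : ℕ => b n ^ α) atTop (𝓝 0) := by
    have := hb.tendsto.rpow_const (p := α) (Or.inr hα.le)
    simpa [Real.zero_rpow hα.ne'] using this
  simpa using (h1.add h2).const_mul A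

lemma tendsto_eLpNorm_zero_of_le {f : ℕ → Ω → ℝ} {c : ℕ → ℝ} (hc : Tendsto c atTop (𝓝 0))
    (h : ∀ᶠ n in atTop, eLpNorm (f n) 1 P ≤ ENNReal.ofReal (c n)) :
    Tendsto (fun n => eLpNorm (f n) 1 P) atTop (𝓝 0) := by
  have h1 := ENNReal.tendsto_ofReal hc
  rw [ENNReal.ofReal_zero] at h1
  exact tendsto_of_tendsto_of_tendsto_of_le_of_le' tendsto_const_nhds h1
    (Eventually.of_forall fun _ => zero_le) h

lemma tendsto_eLpNorm_zero_add {f g : ℕ → Ω → ℝ} (hfm : ∀ n, AEMeasurable (f n) P)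
    (hgm : ∀ n, AEMeasurable (g n) P)
    (hf : Tendsto (fun n => eLpNorm (f n) 1 P) atTop (𝓝 0))
    (hg : Tendsto (fun n => eLpNorm (g n) 1 P) atTop (𝓝 0)) :
    Tendsto (fun n => eLpNorm (fun ω => f n ω + g n ω) 1 P) atTop (𝓝 0) := by
  have := hf.add hg
  rw [add_zero] at this
  exact tendsto_of_tendsto_of_tendsto_of_le_of_le tendsto_const_nhds this
    (fun _ => zero_le) fun n => eLpNorm_add_le (hfm n).aestronglyMeasurable
      (hgm n).aestronglyMeasurable le_rfl

lemma tendsto_eLpNorm_zero_const {c : ℕ → ℝ} (hc : Tendsto c atTop (𝓝 0)) :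
    Tendsto (fun n => eLpNorm (fun _ : Ω => c n) 1 P) atTop (𝓝 0) := by
  refine tendsto_eLpNorm_zero_of_le (c := fun n => |c n|) (by simpa using hc.abs)
    (Eventually.of_forall fun n => ?_)
  rw [eLpNorm_const' _ one_ne_zero ENNReal.one_ne_top]
  simp [Real.enorm_eq_ofReal_abs]

lemma LocApprox.aemeasurable_weighted {g : (Fin (p + 1) → ℝ) → ℝ} (hg : Measurable g)
    (h : LocApprox P Xt X p q α) (n : ℕ) (w : ℕ → ℝ) :
    AEMeasurable (fun ω => ∑ t ∈ Finset.Icc (p + 1) n, w t *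
      g (lags (p + 1) (fun s => X n s ω) (t : ℤ))) P :=
  Finset.aemeasurable_fun_sum _ fun _ ht =>
    (hg.comp_aemeasurable (h.aemeasurable_lags (Finset.mem_Icc.1 ht).2 _)).const_mul _

/-- Law of large numbers for kernel weighted sums. -/
lemma LocApprox.tendsto_weighted (hε : IsIID P ε) (hsh : IsShift P ε fun t => Xt t u) {M : ℝ}
    (hM : 0 ≤ M) (h : LocApprox P Xt X p (M + 1) α) (hα : 0 < α) (hK : IsLocalizingKernel K)
    (hu : u ∈ Ioo (0 : ℝ) 1) (hb : IsBandwidth b) {C : ℝ} (hC : 0 ≤ C) {g} (hg : ClassL M C g) :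
    Tendsto (fun n => eLpNorm (fun ω => ∑ t ∈ Finset.Icc (p + 1) n, kernelWeight K b u n t *
        g (lags (p + 1) (fun s => X n s ω) (t : ℤ)) -
          ∫ ω, g (lags (p + 1) (fun s => Xt s u ω) 0) ∂P) 1 P) atTop (𝓝 0) := by
  have hu' := Ioo_subset_Icc_self hu
  have hgm := hg.continuous.measurable
  set m := ∫ ω, g (lags (p + 1) (fun s => Xt s u ω) 0) ∂P with hm
  obtain ⟨A, hA0, hA⟩ := h.exists_eLpNorm_weighted_sub_le hM hα.le hK hu hb hC hg
  have h1 := tendsto_eLpNorm_zero_of_le (hb.tendsto_rate hα A) hA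
  obtain ⟨CK, -, hCK⟩ := exists_sum_abs_kernelWeight_le hK hu hb p
  obtain ⟨B, hB0, hB⟩ := exists_abs_kernelWeight_le (u := u) hK hb
  have hsg : IsShift P ε (fun t ω => g (lags (p + 1) (fun s => Xt s u ω) t)) :=
    (hsh.lags (p + 1)).comp hgm
  have h2 := hsg.tendsto_weighted_sum hε (hg.integrable hC (h.aemeasurable_lags_stationary hu' 0 _)
    (h.integrable_l1_rpow (by linarith) hu' 0)) hCK (hb.tendsto_inv B)
    (Eventually.of_forall fun n t _ => hB n t)
  have h3 : Tendsto (fun n => (∑ t ∈ Finset.Icc (p + 1) n, kernelWeight K b u n t - 1) * m) atTop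
      (𝓝 0) := by
    simpa using ((tendsto_sum_kernelWeight hK hu hb p).sub_const 1).mul_const m
  have m1 : ∀ n : ℕ, AEMeasurable (fun ω => ∑ t ∈ Finset.Icc (p + 1) n, kernelWeight K b u n t *
        (g (lags (p + 1) (fun s => X n s ω) (t : ℤ)) -
          g (lags (p + 1) (fun s => Xt s u ω) t))) P := fun n =>
    Finset.aemeasurable_fun_sum _ fun t ht => ((hgm.comp_aemeasurable
      (h.aemeasurable_lags (Finset.mem_Icc.1 ht).2 _)).sub (hgm.comp_aemeasurable
      (h.aemeasurable_lags_stationary hu' _ _))).const_mul _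
  have m2 : ∀ n : ℕ, AEMeasurable (fun ω => ∑ t ∈ Finset.Icc (p + 1) n, kernelWeight K b u n t *
          (g (lags (p + 1) (fun s => Xt s u ω) t) - m)) P := fun n =>
    Finset.aemeasurable_fun_sum _ fun t _ => ((hgm.comp_aemeasurable
      (h.aemeasurable_lags_stationary hu' _ _)).sub_const _).const_mul _
  refine (tendsto_eLpNorm_zero_add (fun n => (m1 n).add (m2 n)) (fun n => aemeasurable_const)
    (tendsto_eLpNorm_zero_add m1 m2 h1 h2) (tendsto_eLpNorm_zero_const h3)).congr fun n => ?_
  congr 1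
  ext ω
  simp only [Pi.add_apply, mul_sub, Finset.sum_sub_distrib, ← Finset.sum_mul]
  ring

end LocalApproximation

section VectorCLT

variable {Ω : Type*} [MeasurableSpace Ω] {P : Measure Ω} [IsProbabilityMeasure P] {ε : ℤ → Ω → ℝ}
  {d : ℕ}

lemma integral_sq_sum_mul {ξ : Fin d → Ω → ℝ} (h2 : ∀ i, MemLp (ξ i) 2 P) (x : Fin d → ℝ) :
    ∫ ω, (∑ i, x i * ξ i ω) ^ 2 ∂P =
      x ⬝ᵥ (Matrix.of fun i j => ∫ ω, ξ i ω * ξ j ω ∂P).mulVec x := by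
  have h1 : ∀ ω, (∑ i, x i * ξ i ω) ^ 2 = ∑ i, ∑ j, x i * x j * (ξ i ω * ξ j ω) := by
    intro ω
    rw [sq, Finset.sum_mul_sum]
    exact Finset.sum_congr rfl fun i _ => Finset.sum_congr rfl fun j _ => by ring
  have h3 : ∀ i j, Integrable (fun ω => ξ i ω * ξ j ω) P := fun i j => (h2 i).integrable_mul (h2 j)
  simp_rw [h1]
  rw [integral_finsetSum _ fun i _ => integrable_finsetSum _ fun j _ => (h3 i j).const_mul _]
  simp only [dotProduct, Matrix.mulVec, Matrix.of_apply, Finset.mul_sum]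
  refine Finset.sum_congr rfl fun i _ => ?_
  rw [integral_finsetSum _ fun j _ => (h3 i j).const_mul _]
  refine Finset.sum_congr rfl fun j _ => ?_
  rw [integral_const_mul]
  ring

lemma posSemidef_second_moment {ξ : Fin d → Ω → ℝ} (h2 : ∀ i, MemLp (ξ i) 2 P) :
    (Matrix.of fun i j => ∫ ω, ξ i ω * ξ j ω ∂P).PosSemidef := by
  refine Matrix.PosSemidef.of_dotProduct_mulVec_nonneg ?_ fun x => ?_
  · ext i j
    simp [mul_comm]
  · rw [star_trivial, ← integral_sq_sum_mul h2]
    exact integral_nonneg fun ω => sq_nonneg _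

/-- Multivariate central limit theorem for weighted sums of stationary martingale differences. -/
lemma tendstoInDistribution_weighted_sum (hε : IsIID P ε) {ξ : Fin d → ℤ → Ω → ℝ}
    (hξ : ∀ i, IsShift P ε (ξ i)) (h2 : ∀ i t, MemLp (ξ i t) 2 P)
    (hmd : ∀ i t, P[ξ i t | past ε (t - 1)] =ᵐ[P] 0)
    {a : ℕ} {w : ℕ → ℕ → ℝ} {σ : ℝ}
    (hσ : Tendsto (fun n => ∑ t ∈ Finset.Icc a n, w n t ^ 2) atTop (𝓝 σ)) {δ : ℕ → ℝ}
    (hδ : Tendsto δ atTop (𝓝 0))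
    (hw : ∀ᶠ n in atTop, ∀ t ∈ Finset.Icc a n, |w n t| ≤ δ n) (A : Matrix (Fin d) (Fin d) ℝ) :
    TendstoInDistribution (fun n ω => (WithLp.toLp 2
      (A.mulVec fun i => ∑ t ∈ Finset.Icc a n, w n t * ξ i t ω) : EuclideanSpace ℝ (Fin d))) atTop
      (id : EuclideanSpace ℝ (Fin d) → EuclideanSpace ℝ (Fin d)) (fun _ => P)
      (multivariateGaussian 0 (σ • (A * (Matrix.of fun i j => ∫ ω, ξ i 0 ω * ξ j 0 ω ∂P) *
        A.transpose))) := by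
  set S : Matrix (Fin d) (Fin d) ℝ := Matrix.of fun i j => ∫ ω, ξ i 0 ω * ξ j 0 ω ∂P with hS
  have hσ0 : 0 ≤ σ := ge_of_tendsto' hσ fun n => Finset.sum_nonneg fun t _ => sq_nonneg _
  have hpsd : (σ • (A * S * A.transpose)).PosSemidef := by
    refine Matrix.PosSemidef.smul ?_ hσ0
    have := (posSemidef_second_moment fun i => h2 i 0).mul_mul_conjTranspose_same A
    rwa [Matrix.conjTranspose_eq_transpose_of_trivial] at this
  have hm : ∀ n, AEMeasurable (fun ω => (WithLp.toLp 2
      (A.mulVec fun i => ∑ t ∈ Finset.Icc a n, w n t * ξ i t ω) : EuclideanSpace ℝ (Fin d))) P := by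
    intro n
    have h1 : AEMeasurable (fun ω (i : Fin d) => ∑ t ∈ Finset.Icc a n, w n t * ξ i t ω) P :=
      aemeasurable_pi_lambda _ fun i => Finset.aemeasurable_fun_sum _ fun t _ =>
        (h2 i t).1.aemeasurable.const_mul _
    have h3 : Continuous fun v : Fin d → ℝ =>
        (WithLp.toLp 2 (A.mulVec v) : EuclideanSpace ℝ (Fin d)) :=
      (PiLp.continuous_toLp 2 _).comp (Continuous.matrix_mulVec continuous_const continuous_id)
    exact h3.measurable.comp_aemeasurable h1
  refine ⟨hm, aemeasurable_id, ?_⟩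
  refine ProbabilityMeasure.tendsto_iff_tendsto_charFun.2 fun x => ?_
  set y : Fin d → ℝ := A.transpose.mulVec (fun i => x i) with hy
  have key := tendsto_charFun_weighted_sum hε (ξ := fun t ω => ∑ i, y i * ξ i t ω)
    ((IsShift.pi hξ).comp (g := fun v : Fin d → ℝ => ∑ i, y i * v i) (by fun_prop))
    (memLp_finsetSum _ fun i _ => (h2 i 0).const_mul _) (by
      intro t
      have e1 : (fun ω => ∑ i, y i * ξ i t ω) = ∑ i, (y i • ξ i t) := by
        ext ω; simp
      rw [e1]
      refine (condExp_finsetSum (fun i _ => ((h2 i t).integrable one_le_two).smul (y i)) _).trans ?_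
      have e2 : ∀ i, P[y i • ξ i t | past ε (t - 1)] =ᵐ[P] 0 := by
        intro i
        refine (condExp_smul (y i) (ξ i t) _).trans ?_
        filter_upwards [hmd i t] with ω hω
        simp [hω]
      have e3 : ∀ᵐ ω ∂P, ∀ i, (P[y i • ξ i t | past ε (t - 1)]) ω = 0 :=
        ae_all_iff.2 e2
      filter_upwards [e3] with ω hω
      simp [hω]) hσ hδ hw
  have hlim : ((Real.exp (-(σ * (∫ ω, (∑ i, y i * ξ i 0 ω) ^ 2 ∂P) / 2)) : ℝ) : ℂ) =
      charFun (multivariateGaussian 0 (σ • (A * S * A.transpose))) x := by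
    rw [charFun_multivariateGaussian hpsd, integral_sq_sum_mul fun i => h2 i 0]
    have e1 : (x.ofLp) ⬝ᵥ (σ • (A * S * A.transpose)).mulVec x.ofLp = σ * (y ⬝ᵥ S.mulVec y) := by
      rw [Matrix.smul_mulVec, dotProduct_smul, smul_eq_mul, ← Matrix.mulVec_mulVec,
        ← Matrix.mulVec_mulVec, Matrix.dotProduct_mulVec, ← Matrix.mulVec_transpose]
    rw [e1, ← hS]
    push_cast
    congr 1
    simp
  rw [ProbabilityMeasure.coe_mk]
  simp only [Measure.map_id]
  rw [← hlim]
  refine key.congr fun n => ?_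
  rw [ProbabilityMeasure.coe_mk, charFun_apply, integral_map (hm n) (by fun_prop)]
  congr 1
  ext ω
  congr 1
  have e2 : inner ℝ (WithLp.toLp 2 (A.mulVec fun i => ∑ t ∈ Finset.Icc a n, w n t * ξ i t ω) :
      EuclideanSpace ℝ (Fin d)) x = ∑ t ∈ Finset.Icc a n, w n t * ∑ i, y i * ξ i t ω := by
    rw [EuclideanSpace.inner_eq_star_dotProduct]
    simp only [star_trivial]
    rw [Matrix.dotProduct_mulVec, ← Matrix.mulVec_transpose]
    simp only [dotProduct, Finset.mul_sum]
    rw [Finset.sum_comm]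
    refine Finset.sum_congr rfl fun t _ => Finset.sum_congr rfl fun i _ => ?_
    rw [hy]
    ring
  rw [e2, mul_comm]

end VectorCLT

section DiffIntegral

variable {Ω : Type*} [MeasurableSpace Ω] {P : Measure Ω} [IsProbabilityMeasure P] {r d : ℕ}

lemma ClassLt.abs_sub_le_norm {S : Set (EuclideanSpace ℝ (Fin d))} {M : ℝ}
    {g : (Fin r → ℝ) → EuclideanSpace ℝ (Fin d) → ℝ} (hg : ClassLt S M g) :
    ∃ D : ℝ, 0 ≤ D ∧ ∀ z, ∀ θ ∈ S, ∀ θ' ∈ S,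
      |g z θ - g z θ'| ≤ D * (1 + l1 z ^ (M + 1)) * ‖θ - θ'‖ := by
  obtain ⟨hM, Cz, Cθ, hCz, hCθ, h1, h2⟩ := hg
  refine ⟨Cθ * d, by positivity, fun z θ hθ θ' hθ' => (h2 z θ hθ θ' hθ').trans ?_⟩
  have h3 := l1_le_norm (θ - θ')
  have h4 : 0 ≤ l1 z ^ (M + 1) := Real.rpow_nonneg (l1_nonneg _) _
  calc Cθ * (1 + l1 z ^ (M + 1)) * l1 (fun i => θ i - θ' i)
      ≤ Cθ * (1 + l1 z ^ (M + 1)) * (d * ‖θ - θ'‖) :=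
        mul_le_mul_of_nonneg_left h3 (by positivity)
    _ = _ := by ring

lemma hasFDerivAt_integral_of_classLt {S : Set (EuclideanSpace ℝ (Fin d))} {M : ℝ}
    {g : (Fin r → ℝ) → EuclideanSpace ℝ (Fin d) → ℝ} (hg : ClassLt S M g)
    {θ : EuclideanSpace ℝ (Fin d)} (hθ : θ ∈ interior S) {Z : Ω → Fin r → ℝ}
    (hZ : AEMeasurable Z P) (hB : Integrable (fun ω => l1 (Z ω) ^ (M + 1)) P)
    (hd : ∀ z, DifferentiableAt ℝ (g z) θ)
    (hm : ∀ i, AEStronglyMeasurable (fun ω => pd (g (Z ω)) i θ) P) :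
    HasFDerivAt (fun θ => ∫ ω, g (Z ω) θ ∂P) (∫ ω, fderiv ℝ (g (Z ω)) θ ∂P) θ ∧
      ∀ i, pd (fun θ => ∫ ω, g (Z ω) θ ∂P) i θ = ∫ ω, pd (g (Z ω)) i θ ∂P := by
  obtain ⟨D, hD0, hD⟩ := hg.abs_sub_le_norm
  obtain ⟨hM, Cz, Cθ, hCz, hCθ, hc, -⟩ := hg
  have hfm : AEStronglyMeasurable (fun ω => fderiv ℝ (g (Z ω)) θ) P := by
    have h1 : (fun ω => fderiv ℝ (g (Z ω)) θ) = fun ω =>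
        ∑ i, pd (g (Z ω)) i θ • (EuclideanSpace.proj i : EuclideanSpace ℝ (Fin d) →L[ℝ] ℝ) := by
      ext ω x
      rw [clm_apply_eq_sum]
      simp [pd, mul_comm]
    rw [h1]
    refine Finset.aestronglyMeasurable_fun_sum _ fun i _ => ?_
    exact (hm i).smul_const _
  have hSn : S ∈ 𝓝 θ := mem_interior_iff_mem_nhds.1 hθ
  have h := hasFDerivAt_integral_of_dominated_loc_of_lip' (𝕜 := ℝ) (μ := P)
    (F := fun θ ω => g (Z ω) θ) (F' := fun ω => fderiv ℝ (g (Z ω)) θ) (s := S) (x₀ := θ)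
    (bound := fun ω => D * (1 + l1 (Z ω) ^ (M + 1))) hSn
    (fun θ' hθ' => ((hc θ' hθ').continuous.measurable.comp_aemeasurable hZ).aestronglyMeasurable)
    ((hc θ (interior_subset hθ)).integrable hCz hZ hB) hfm
    (Eventually.of_forall fun ω θ' hθ' => hD _ θ' hθ' θ (interior_subset hθ))
    (((integrable_const _).add hB).const_mul D)
    (Eventually.of_forall fun ω => (hd _).hasFDerivAt)
  refine ⟨h.2, fun i => ?_⟩
  rw [pd, h.2.fderiv, ContinuousLinearMap.integral_apply h.1]
  rfl

end DiffIntegral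

section Estimation

variable {Ω : Type*} [MeasurableSpace Ω]

/-- The hypotheses on the estimation problem at a fixed time point `u`. -/
structure EstimationSetup (P : Measure Ω) (ε : ℤ → Ω → ℝ) {p d : ℕ}
    (Θ : Set (EuclideanSpace ℝ (Fin d))) (θ₀ : EuclideanSpace ℝ (Fin d)) (K : ℝ → ℝ)
    (ℓ : (Fin (p + 1) → ℝ) → EuclideanSpace ℝ (Fin d) → ℝ) (M M' M'' α α' : ℝ)
    (Xt : ℤ → ℝ → Ω → ℝ) (X : ℕ → ℤ → Ω → ℝ) (u : ℝ) (b : ℕ → ℝ)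
    (θhat : ℕ → Ω → EuclideanSpace ℝ (Fin d)) : Prop where
  iid : IsIID P ε
  shift : IsShift P ε fun t => Xt t u
  compact : IsCompact Θ
  mem_interior : θ₀ ∈ interior Θ
  kernel : IsLocalizingKernel K
  time : u ∈ Ioo (0 : ℝ) 1
  bandwidth : IsBandwidth b
  classLt : ClassLt Θ M ℓ
  contDiffOn : ∀ z, ContDiffOn ℝ 2 (ℓ z) (interior Θ)
  classLt_grad : ∀ i, ClassLt (interior Θ) M' (fun z => pd (ℓ z) i)
  classLt_hess : ∀ i j, ClassLt (interior Θ) M'' (fun z θ => hess (ℓ z) θ i j)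
  M_nonneg : 0 ≤ M
  M'_nonneg : 0 ≤ M'
  M''_nonneg : 0 ≤ M''
  α_pos : 0 < α
  α'_pos : 0 < α'
  approx : LocApprox P Xt X p (M + 1) α
  approx' : LocApprox P Xt X p (max (2 * (M' + 1)) (M'' + 1)) α'
  argmin : ∀ θ ∈ Θ, θ ≠ θ₀ → limLik P ℓ Xt u θ₀ < limLik P ℓ Xt u θ
  martingale : ∀ (t : ℤ) (i), P[score ℓ Xt t u θ₀ i | past ε (t - 1)] =ᵐ[P] 0
  posDef : (hessMat P ℓ Xt u θ₀).PosDef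
  estimator : ∀ n, IsLocalMLE P ℓ K Θ X n (b n) u (θhat n)

variable {P : Measure Ω} [IsProbabilityMeasure P] {ε : ℤ → Ω → ℝ} {p d : ℕ}
  {Θ : Set (EuclideanSpace ℝ (Fin d))} {θ₀ : EuclideanSpace ℝ (Fin d)} {K : ℝ → ℝ}
  {ℓ : (Fin (p + 1) → ℝ) → EuclideanSpace ℝ (Fin d) → ℝ} {M M' M'' α α' : ℝ}
  {Xt : ℤ → ℝ → Ω → ℝ} {X : ℕ → ℤ → Ω → ℝ} {u : ℝ} {b : ℕ → ℝ}
  {θhat : ℕ → Ω → EuclideanSpace ℝ (Fin d)}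

lemma localLik_eq (n : ℕ) (θ : EuclideanSpace ℝ (Fin d)) (ω : Ω) :
    localLik ℓ K X n (b n) u θ ω = ∑ t ∈ Finset.Icc (p + 1) n,
      kernelWeight K b u n t * ℓ (lags (p + 1) (fun s => X n s ω) (t : ℤ)) θ := by
  rw [localLik, Finset.mul_sum]
  refine Finset.sum_congr rfl fun t _ => ?_
  rw [kernelWeight, one_div_mul_eq_div, one_div_mul_eq_div, one_div_mul_eq_div]
  ring

lemma pd_localLik (hC2 : ∀ z, ContDiffOn ℝ 2 (ℓ z) (interior Θ)) (n : ℕ)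
    {θ : EuclideanSpace ℝ (Fin d)} (hθ : θ ∈ interior Θ) (ω : Ω) (i : Fin d) :
    pd (fun θ => localLik ℓ K X n (b n) u θ ω) i θ = ∑ t ∈ Finset.Icc (p + 1) n,
      kernelWeight K b u n t * pd (ℓ (lags (p + 1) (fun s => X n s ω) (t : ℤ))) i θ := by
  simp only [localLik_eq]
  rw [pd, fderiv_fun_sum fun t _ => (differentiableAt_of_contDiffOn_two isOpen_interior
    (hC2 _) hθ).const_mul _]
  simp only [sum_apply]
  refine Finset.sum_congr rfl fun t _ => ?_
  rw [fderiv_const_mul (differentiableAt_of_contDiffOn_two isOpen_interior (hC2 _) hθ)]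
  rfl

lemma hess_localLik (hC2 : ∀ z, ContDiffOn ℝ 2 (ℓ z) (interior Θ)) (n : ℕ)
    {θ : EuclideanSpace ℝ (Fin d)} (hθ : θ ∈ interior Θ) (ω : Ω) (i j : Fin d) :
    hess (fun θ => localLik ℓ K X n (b n) u θ ω) θ i j = ∑ t ∈ Finset.Icc (p + 1) n,
      kernelWeight K b u n t * hess (ℓ (lags (p + 1) (fun s => X n s ω) (t : ℤ))) θ i j := by
  have h1 : pd (fun θ => localLik ℓ K X n (b n) u θ ω) i =ᶠ[𝓝 θ] fun θ =>
      ∑ t ∈ Finset.Icc (p + 1) n,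
        kernelWeight K b u n t * pd (ℓ (lags (p + 1) (fun s => X n s ω) (t : ℤ))) i θ := by
    filter_upwards [isOpen_interior.mem_nhds hθ] with θ' hθ'
    exact pd_localLik hC2 n hθ' ω i
  simp only [hess, Matrix.of_apply]
  rw [pd, h1.fderiv_eq, fderiv_fun_sum fun t _ => (differentiableAt_pd isOpen_interior
    (hC2 _) i hθ).const_mul _]
  simp only [sum_apply]
  refine Finset.sum_congr rfl fun t _ => ?_
  rw [fderiv_const_mul (differentiableAt_pd isOpen_interior (hC2 _) i hθ)]
  rfl

lemma contDiffOn_localLik (hC2 : ∀ z, ContDiffOn ℝ 2 (ℓ z) (interior Θ)) (n : ℕ) (ω : Ω) :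
    ContDiffOn ℝ 2 (fun θ => localLik ℓ K X n (b n) u θ ω) (interior Θ) := by
  simp only [localLik_eq]
  exact ContDiffOn.sum fun t _ => contDiffOn_const.mul (hC2 _)

lemma LocApprox.boundedInProb_lipschitz {q α : ℝ} (h : LocApprox P Xt X p q α) (hq : 1 ≤ q)
    (hα : 0 ≤ α) (hK : IsLocalizingKernel K) (hu : u ∈ Ioo (0 : ℝ) 1) (hb : IsBandwidth b) :
    BoundedInProb P (fun n ω => ∑ t ∈ Finset.Icc (p + 1) n, |kernelWeight K b u n t| *
      (1 + l1 (lags (p + 1) (fun s => X n s ω) (t : ℤ)) ^ q)) := by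
  obtain ⟨A, hA0, hA⟩ := h.exists_eLpNorm_l1_rpow_le hq hα
  obtain ⟨CK, hCK0, hCK⟩ := exists_sum_abs_kernelWeight_le hK hu hb p
  have hm : Measurable fun z : Fin (p + 1) → ℝ => l1 z ^ q :=
    (continuous_l1.measurable).pow_const q
  have hm' : Measurable fun z : Fin (p + 1) → ℝ => 1 + l1 z ^ q := hm.const_add 1
  refine boundedInProb_of_eLpNorm (C := CK * (1 + A))
    (fun n => h.aemeasurable_weighted hm' n _) ?_
  filter_upwards [hCK, eventually_ge_atTop 1] with n h1 hn
  refine eLpNorm_sum_mul_le_of_le _ _ (fun t ht => hm'.comp_aemeasurable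
    (h.aemeasurable_lags (Finset.mem_Icc.1 ht).2 _)) (by positivity) (by simpa using h1)
    fun t ht _ => ?_
  refine (eLpNorm_add_le (f := fun _ => (1 : ℝ)) aestronglyMeasurable_const
    (hm.comp_aemeasurable (h.aemeasurable_lags (Finset.mem_Icc.1 ht).2 _)).aestronglyMeasurable
    le_rfl).trans ?_
  rw [ENNReal.ofReal_add zero_le_one hA0]
  refine add_le_add ?_ (hA n t hn (Finset.mem_Icc.1 ht).2)
  rw [eLpNorm_const' _ one_ne_zero ENNReal.one_ne_top]
  simp

namespace EstimationSetup

variable (S : EstimationSetup P ε Θ θ₀ K ℓ M M' M'' α α' Xt X u b θhat)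
include S

lemma time' : u ∈ Icc (0 : ℝ) 1 := Ioo_subset_Icc_self S.time

lemma approx_grad : LocApprox P Xt X p (M' + 1) α' :=
  S.approx'.mono (le_max_of_le_left (by linarith [S.M'_nonneg]))

lemma approx_grad_two : LocApprox P Xt X p (2 * (M' + 1)) α' :=
  S.approx'.mono (le_max_left _ _)

lemma approx_hess : LocApprox P Xt X p (M'' + 1) α' := S.approx'.mono (le_max_right _ _)

/-- The Hessian of the limiting criterion is the expected Hessian. -/
lemma hessMat_apply {θ : EuclideanSpace ℝ (Fin d)} (hθ : θ ∈ interior Θ) (i j : Fin d) :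
    hessMat P ℓ Xt u θ i j =
      ∫ ω, hess (ℓ (lags (p + 1) (fun s => Xt s u ω) 0)) θ i j ∂P := by
  have hZ := S.approx.aemeasurable_lags_stationary S.time' 0 (p + 1)
  have hmg : ∀ θ ∈ interior Θ, ∀ i, AEStronglyMeasurable
      (fun ω => pd (ℓ (lags (p + 1) (fun s => Xt s u ω) 0)) i θ) P := by
    intro θ hθ i
    obtain ⟨-, Cz, -, -, -, hc, -⟩ := S.classLt_grad i
    exact ((hc θ hθ).continuous.measurable.comp_aemeasurable hZ).aestronglyMeasurable
  have hmh : ∀ i j, AEStronglyMeasurable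
      (fun ω => hess (ℓ (lags (p + 1) (fun s => Xt s u ω) 0)) θ i j) P := by
    intro i j
    obtain ⟨-, Cz, -, -, -, hc, -⟩ := S.classLt_hess i j
    exact ((hc θ hθ).continuous.measurable.comp_aemeasurable hZ).aestronglyMeasurable
  have h1 : pd (limLik P ℓ Xt u) i =ᶠ[𝓝 θ] fun θ =>
      ∫ ω, pd (ℓ (lags (p + 1) (fun s => Xt s u ω) 0)) i θ ∂P := by
    filter_upwards [isOpen_interior.mem_nhds hθ] with θ' hθ'
    exact (hasFDerivAt_integral_of_classLt S.classLt hθ' hZ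
      (S.approx.integrable_l1_rpow (by linarith [S.M_nonneg]) S.time' 0)
      (fun z => differentiableAt_of_contDiffOn_two isOpen_interior (S.contDiffOn z) hθ')
      (hmg θ' hθ')).2 i
  simp only [hessMat, hess, Matrix.of_apply]
  rw [pd, h1.fderiv_eq]
  exact (hasFDerivAt_integral_of_classLt (S.classLt_grad i) (by rwa [interior_interior]) hZ
      (S.approx_grad.integrable_l1_rpow (by linarith [S.M'_nonneg]) S.time' 0)
      (fun z => differentiableAt_pd isOpen_interior (S.contDiffOn z) i hθ) (hmh i)).2 j

lemma consistent : VanishesInProb P (fun n ω => ‖θhat n ω - θ₀‖) := by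
  obtain ⟨D, hD0, hD⟩ := S.classLt.abs_sub_le_norm
  have hM1 : 1 ≤ M + 1 := by linarith [S.M_nonneg]
  have hint := S.approx.integrable_l1_rpow hM1 S.time' 0
  have hZ := S.approx.aemeasurable_lags_stationary S.time' 0 (p + 1)
  obtain ⟨-, Cz, Cθ, hCz, hCθ, hc, -⟩ := S.classLt
  have hcont : ContinuousOn (limLik P ℓ Xt u) Θ := by
    set c := ∫ ω, D * (1 + l1 (lags (p + 1) (fun s => Xt s u ω) 0) ^ (M + 1)) ∂P with hcdef
    have hlip : LipschitzOnWith (Real.toNNReal c) (limLik P ℓ Xt u) Θ := by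
      refine LipschitzOnWith.of_dist_le_mul fun θ hθ θ' hθ' => ?_
      have hc0 : 0 ≤ c := integral_nonneg fun ω => by
        have : 0 ≤ l1 (lags (p + 1) (fun s => Xt s u ω) 0) ^ (M + 1) :=
          Real.rpow_nonneg (l1_nonneg _) _
        positivity
      rw [Real.coe_toNNReal _ hc0, Real.dist_eq, dist_eq_norm, limLik, limLik,
        ← integral_sub ((hc θ hθ).integrable hCz hZ hint) ((hc θ' hθ').integrable hCz hZ hint),
        hcdef, ← integral_mul_const, ← Real.norm_eq_abs]
      exact norm_integral_le_of_norm_le ((((integrable_const _).add hint).const_mul D).mul_const _)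
        (Eventually.of_forall fun ω => hD _ θ hθ θ' hθ')
    exact hlip.continuousOn
  refine vanishesInProb_norm_sub_argmin S.compact hcont (interior_subset S.mem_interior) S.argmin
    (Ln := fun n θ ω => localLik ℓ K X n (b n) u θ ω)
    (R := fun n ω => D * ∑ t ∈ Finset.Icc (p + 1) n, |kernelWeight K b u n t| *
      (1 + l1 (lags (p + 1) (fun s => X n s ω) (t : ℤ)) ^ (M + 1))) (fun θ hθ => ?_)
    ((S.approx.boundedInProb_lipschitz hM1 S.α_pos.le S.kernel S.time S.bandwidth).const_mul D)
    (fun n θ hθ θ' hθ' ω => ?_) fun n => (S.estimator n).argmin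
  · have h1 := S.approx.tendsto_weighted S.iid S.shift S.M_nonneg S.α_pos S.kernel S.time
      S.bandwidth hCz (hc θ hθ)
    refine vanishesInProb_of_eLpNorm (fun n => ?_) ?_
    · simp only [localLik_eq]
      exact (S.approx.aemeasurable_weighted (hc θ hθ).continuous.measurable n _).sub_const _
    · simpa only [localLik_eq, limLik] using h1
  · rw [localLik_eq, localLik_eq, ← Finset.sum_sub_distrib, Finset.mul_sum, Finset.sum_mul]
    refine (Finset.abs_sum_le_sum_abs _ _).trans (Finset.sum_le_sum fun t _ => ?_)
    rw [← mul_sub, abs_mul]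
    refine (mul_le_mul_of_nonneg_left (hD _ θ hθ θ' hθ') (abs_nonneg _)).trans (le_of_eq ?_)
    ring

lemma isUnit_det : IsUnit (hessMat P ℓ Xt u θ₀).det :=
  (Matrix.isUnit_iff_isUnit_det _).1 S.posDef.isUnit

lemma linearization {a : ℕ → ℝ} (ha : ∀ i, BoundedInProb P (fun n ω => a n *
      ∑ t ∈ Finset.Icc (p + 1) n, kernelWeight K b u n t *
        pd (ℓ (lags (p + 1) (fun s => X n s ω) (t : ℤ))) i θ₀)) :
    VanishesInProb P (fun n ω => ‖a n • (θhat n ω - θ₀ + invVec (hessMat P ℓ Xt u θ₀)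
      (fun i => ∑ t ∈ Finset.Icc (p + 1) n, kernelWeight K b u n t *
        pd (ℓ (lags (p + 1) (fun s => X n s ω) (t : ℤ))) i θ₀))‖) := by
  choose D hD0 hD using fun i j => (S.classLt_hess i j).abs_sub_le_norm
  set D' := ∑ i, ∑ j, D i j with hD'
  have hDle : ∀ i j, D i j ≤ D' := fun i j =>
    (Finset.single_le_sum (f := fun j => D i j) (fun j _ => hD0 i j) (Finset.mem_univ j)).trans
      (Finset.single_le_sum (f := fun i => ∑ j, D i j)
        (fun i _ => Finset.sum_nonneg fun j _ => hD0 i j) (Finset.mem_univ i))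
  have hpd : ∀ n ω i, pd (fun θ => localLik ℓ K X n (b n) u θ ω) i θ₀ = _ := fun n ω i =>
    pd_localLik S.contDiffOn n S.mem_interior ω i
  simp only [← hpd] at ha ⊢
  refine vanishesInProb_linearization S.mem_interior
    (Ln := fun n ω θ => localLik ℓ K X n (b n) u θ ω)
    (fun n ω => contDiffOn_localLik S.contDiffOn n ω) (fun n => (S.estimator n).argmin)
    S.consistent S.isUnit_det (fun i j => ?_)
    (R := fun n ω => D' * ∑ t ∈ Finset.Icc (p + 1) n, |kernelWeight K b u n t| *
      (1 + l1 (lags (p + 1) (fun s => X n s ω) (t : ℤ)) ^ (M'' + 1)))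
    ((S.approx_hess.boundedInProb_lipschitz (by linarith [S.M''_nonneg]) S.α'_pos.le S.kernel S.time
      S.bandwidth).const_mul D') (fun n ω θ hθ i j => ?_) ha
  · obtain ⟨-, Cz, Cθ, hCz, hCθ, hc, -⟩ := S.classLt_hess i j
    have h1 := S.approx_hess.tendsto_weighted S.iid S.shift S.M''_nonneg S.α'_pos S.kernel S.time
      S.bandwidth hCz (hc θ₀ S.mem_interior)
    simp only [hess_localLik S.contDiffOn _ S.mem_interior, S.hessMat_apply S.mem_interior]
    exact vanishesInProb_of_eLpNorm (fun n => (S.approx_hess.aemeasurable_weighted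
      (hc θ₀ S.mem_interior).continuous.measurable n _).sub_const _) h1
  · rw [hess_localLik S.contDiffOn n hθ, hess_localLik S.contDiffOn n S.mem_interior,
      ← Finset.sum_sub_distrib, Finset.mul_sum, Finset.sum_mul]
    refine (Finset.abs_sum_le_sum_abs _ _).trans (Finset.sum_le_sum fun t _ => ?_)
    rw [← mul_sub, abs_mul]
    have h2 := hD i j (lags (p + 1) (fun s => X n s ω) (t : ℤ)) θ hθ θ₀ S.mem_interior
    have h3 : 0 ≤ l1 (lags (p + 1) (fun s => X n s ω) (t : ℤ)) ^ (M'' + 1) :=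
      Real.rpow_nonneg (l1_nonneg _) _
    have h4 : D i j * (1 + l1 (lags (p + 1) (fun s => X n s ω) (t : ℤ)) ^ (M'' + 1)) * ‖θ - θ₀‖ ≤
        D' * (1 + l1 (lags (p + 1) (fun s => X n s ω) (t : ℤ)) ^ (M'' + 1)) * ‖θ - θ₀‖ := by
      have := hDle i j
      gcongr
    refine (mul_le_mul_of_nonneg_left (h2.trans h4) (abs_nonneg _)).trans (le_of_eq ?_)
    ring

lemma memLp_score (i : Fin d) (t : ℤ) : MemLp (score ℓ Xt t u θ₀ i) 2 P := by
  obtain ⟨-, Cz, Cθ, hCz, hCθ, hc, -⟩ := S.classLt_grad i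
  exact (hc θ₀ S.mem_interior).memLp_two hCz
    (S.approx.aemeasurable_lags_stationary S.time' t (p + 1))
    (S.approx_grad_two.integrable_l1_rpow (by linarith [S.M'_nonneg]) S.time' t)

lemma isShift_score (i : Fin d) : IsShift P ε (fun t => score ℓ Xt t u θ₀ i) := by
  obtain ⟨-, Cz, Cθ, hCz, hCθ, hc, -⟩ := S.classLt_grad i
  exact (S.shift.lags (p + 1)).comp (hc θ₀ S.mem_interior).continuous.measurable

/-- Asymptotic normality, given the expansion of the score up to a bounded deterministic bias. -/
lemma tendstoInDistribution {c : ℕ → Fin d → ℝ} {A : ℝ} (hcA : ∀ i, ∀ᶠ n in atTop, |c n i| ≤ A)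
    (hexp : ∀ i, Tendsto (fun n : ℕ => eLpNorm (fun ω =>
      √((n : ℝ) * b n) * (∑ t ∈ Finset.Icc (p + 1) n, kernelWeight K b u n t *
        (pd (ℓ (lags (p + 1) (fun s => X n s ω) (t : ℤ))) i θ₀ - score ℓ Xt t u θ₀ i ω)) - c n i)
      1 P) atTop (𝓝 0)) :
    TendstoInDistribution (fun (n : ℕ) ω => √((n : ℝ) * b n) • (θhat n ω - θ₀) +
        invVec (hessMat P ℓ Xt u θ₀) (c n)) atTop
      (id : EuclideanSpace ℝ (Fin d) → EuclideanSpace ℝ (Fin d)) (fun _ => P)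
      (multivariateGaussian 0 (asympCov P ℓ K Xt u θ₀)) := by
  set V := hessMat P ℓ Xt u θ₀ with hV
  set w : ℕ → ℕ → ℝ := fun n t => √((n : ℝ) * b n) * kernelWeight K b u n t with hw
  set T : ℕ → Ω → Fin d → ℝ := fun n ω i =>
    ∑ t ∈ Finset.Icc (p + 1) n, w n t * score ℓ Xt t u θ₀ i ω with hT
  set G : ℕ → Ω → Fin d → ℝ := fun n ω i => ∑ t ∈ Finset.Icc (p + 1) n,
    kernelWeight K b u n t * pd (ℓ (lags (p + 1) (fun s => X n s ω) (t : ℤ))) i θ₀ with hG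
  set R : ℕ → Ω → Fin d → ℝ := fun n ω i => √((n : ℝ) * b n) * G n ω i - T n ω i - c n i with hR
  obtain ⟨δ, hδ, hwδ⟩ := exists_abs_scaled_kernelWeight_le (u := u) S.kernel S.bandwidth
  have hσ := tendsto_sum_sq_kernelWeight S.kernel S.time S.bandwidth p
  have hVt : V⁻¹.transpose = V⁻¹ := by
    have h1 : V.transpose = V := by
      have := S.posDef.isHermitian.eq
      rwa [Matrix.conjTranspose_eq_transpose_of_trivial] at this
    rw [Matrix.transpose_nonsing_inv, h1]
  have hclt := tendstoInDistribution_weighted_sum S.iid S.isShift_score S.memLp_score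
    (fun i t => S.martingale t i) hσ hδ (Eventually.of_forall fun n t _ => hwδ n t) (-V⁻¹)
  have hcov : (∫ x, K x ^ 2) • ((-V⁻¹) * (Matrix.of fun i j =>
      ∫ ω, score ℓ Xt 0 u θ₀ i ω * score ℓ Xt 0 u θ₀ j ω ∂P) * (-V⁻¹).transpose) =
      asympCov P ℓ K Xt u θ₀ := by
    rw [Matrix.transpose_neg, hVt]
    simp only [asympCov, fisherMat, Matrix.neg_mul, Matrix.mul_neg, neg_neg]
    rw [← hV]
  rw [hcov] at hclt
  have hscm : ∀ i t, AEMeasurable (score ℓ Xt t u θ₀ i) P := fun i t =>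
    (S.memLp_score i t).1.aemeasurable
  have hGm : ∀ n i, AEMeasurable (fun ω => G n ω i) P := by
    intro n i
    obtain ⟨-, Cz, Cθ, hCz, hCθ, hc, -⟩ := S.classLt_grad i
    exact S.approx.aemeasurable_weighted (hc θ₀ S.mem_interior).continuous.measurable n _
  have hTm : ∀ n i, AEMeasurable (fun ω => T n ω i) P := fun n i =>
    Finset.aemeasurable_fun_sum _ fun t _ => (hscm i t).const_mul _
  have hReq : ∀ (n : ℕ) ω i, R n ω i = √((n : ℝ) * b n) * (∑ t ∈ Finset.Icc (p + 1) n,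
      kernelWeight K b u n t * (pd (ℓ (lags (p + 1) (fun s => X n s ω) (t : ℤ))) i θ₀ -
        score ℓ Xt t u θ₀ i ω)) - c n i := by
    intro n ω i
    simp only [hR, hG, hT, hw, mul_sub, Finset.sum_sub_distrib, mul_assoc, ← Finset.mul_sum]
  have hRm : ∀ n i, AEMeasurable (fun ω => R n ω i) P := fun n i =>
    (((hGm n i).const_mul _).sub (hTm n i)).sub_const _
  have hRv : ∀ i, VanishesInProb P (fun n ω => R n ω i) := fun i =>
    vanishesInProb_of_eLpNorm (fun n => hRm n i) (by simpa only [hReq] using hexp i)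
  have hTb : ∀ i, BoundedInProb P (fun n ω => T n ω i) := by
    intro i
    have h1 : ∀ n, ∫ ω, T n ω i ^ 2 ∂P =
        (∑ t ∈ Finset.Icc (p + 1) n, w n t ^ 2) * ∫ ω, score ℓ Xt 0 u θ₀ i ω ^ 2 ∂P := by
      intro n
      rw [integral_sq_sum_martingale_diff S.iid (fun t => (S.isShift_score i).causal t)
        (S.memLp_score i) (fun t => S.martingale t i), Finset.sum_mul]
      refine Finset.sum_congr rfl fun t _ => ?_
      congr 1
      exact (((S.isShift_score i).identDistrib S.iid t 0).comp
        (measurable_id.pow_const 2)).integral_eq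
    refine boundedInProb_of_eLpNorm (fun n => hTm n i)
      (C := 1 + ((∫ x, K x ^ 2) + 1) * ∫ ω, score ℓ Xt 0 u θ₀ i ω ^ 2 ∂P) ?_
    filter_upwards [hσ.eventually_le_const (lt_add_one _)] with n hn
    have h2 : MemLp (fun ω => T n ω i) 2 P :=
      memLp_finsetSum _ fun t _ => (S.memLp_score i t).const_mul _
    refine (eLpNorm_one_le_of_sq h2.integrable_sq one_pos).trans (ENNReal.ofReal_le_ofReal ?_)
    rw [div_one, h1]
    have h3 : 0 ≤ ∫ ω, score ℓ Xt 0 u θ₀ i ω ^ 2 ∂P := integral_nonneg fun ω => sq_nonneg _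
    linarith [mul_le_mul_of_nonneg_right hn h3]
  have hlin := S.linearization (a := fun n : ℕ => √((n : ℝ) * b n)) (fun i =>
    (((hRv i).bounded.add (hTb i)).add (boundedInProb_of_bounded (c := fun n => c n i)
      (hcA i))).of_ae_le (Eventually.of_forall fun n => Eventually.of_forall fun ω => by
        rw [show R n ω i + T n ω i + c n i = √((n : ℝ) * b n) * G n ω i by
          simp only [hR]; ring]))
  have hRb : VanishesInProb P (fun n ω => ∑ i, ∑ j, |V⁻¹ i j| * |R n ω j|) :=
    VanishesInProb.sum _ fun i _ => VanishesInProb.sum _ fun j _ => (hRv j).abs.const_mul _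
  refine tendstoInDistribution_of_tendstoInMeasure_sub _ _ hclt ?_ fun n => ?_
  · refine VanishesInProb.tendstoInMeasure ((hlin.add hRb).of_ae_le
      (Eventually.of_forall fun n => Eventually.of_forall fun ω => ?_))
    have e1 : (√((n : ℝ) * b n) • (θhat n ω - θ₀) + invVec V (c n)) -
        WithLp.toLp 2 ((-V⁻¹).mulVec (T n ω)) =
        √((n : ℝ) * b n) • (θhat n ω - θ₀ + invVec V (G n ω)) - invVec V (R n ω) := by
      have e2 : R n ω = √((n : ℝ) * b n) • G n ω - T n ω - c n := by
        ext i; simp [hR]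
      rw [e2]
      simp only [invVec, Matrix.mulVec_sub, Matrix.mulVec_smul, Matrix.neg_mulVec, smul_add,
        WithLp.toLp_sub, WithLp.toLp_smul, WithLp.toLp_neg]
      abel
    have e3 : 0 ≤ ∑ i, ∑ j, |V⁻¹ i j| * |R n ω j| :=
      Finset.sum_nonneg fun i _ => Finset.sum_nonneg fun j _ => by positivity
    rw [abs_norm, abs_of_nonneg (by positivity)]
    simp only [Pi.sub_apply]
    rw [e1]
    exact (norm_sub_le _ _).trans (add_le_add_right (norm_invVec_le _ _) _)
  · exact (((S.estimator n).aemeasurable.sub_const θ₀).const_smul √((n : ℝ) * b n)).add_const _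

/-- Asymptotic normality under undersmoothing. -/
lemma tendstoInDistribution_of_undersmoothing
    (hrate : Tendsto (fun n : ℕ => (n : ℝ) * b n ^ (1 + 2 * α')) atTop (𝓝 0)) :
    TendstoInDistribution (fun (n : ℕ) ω => √((n : ℝ) * b n) • (θhat n ω - θ₀)) atTop
      (id : EuclideanSpace ℝ (Fin d) → EuclideanSpace ℝ (Fin d)) (fun _ => P)
      (multivariateGaussian 0 (asympCov P ℓ K Xt u θ₀)) := by
  have h := S.tendstoInDistribution (c := fun _ _ => 0) (A := 0)
    (fun i => Eventually.of_forall fun n => by simp) (fun i => ?_)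
  · have h0 : invVec (hessMat P ℓ Xt u θ₀) (fun _ => 0) = 0 := by
      rw [invVec, show (fun _ : Fin d => (0 : ℝ)) = 0 from rfl, Matrix.mulVec_zero]
      rfl
    simpa only [h0, add_zero] using h
  · obtain ⟨-, Cz, Cθ, hCz, hCθ, hc, -⟩ := S.classLt_grad i
    obtain ⟨A, hA0, hA⟩ := S.approx_grad.exists_eLpNorm_weighted_sub_le S.M'_nonneg S.α'_pos.le
      S.kernel S.time S.bandwidth hCz (hc θ₀ S.mem_interior)
    have hs : Tendsto (fun n : ℕ => √((n : ℝ) * b n ^ (1 + 2 * α'))) atTop (𝓝 0) := by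
      have := (Real.continuous_sqrt.tendsto 0).comp hrate
      simpa [Function.comp_def] using this
    refine tendsto_eLpNorm_zero_of_le (c := fun n : ℕ => A * (2 * √((n : ℝ) * b n ^ (1 + 2 * α'))))
      (by simpa using (hs.const_mul 2).const_mul A) ?_
    filter_upwards [hA, S.bandwidth.tendsto_mul.eventually_ge_atTop 1, eventually_ge_atTop 1]
      with n hn hnb h1
    have hbn := S.bandwidth.pos n
    have hn0 : (0 : ℝ) < n := by exact_mod_cast h1
    simp only [sub_zero]
    refine (eLpNorm_const_smul_le (c := √((n : ℝ) * b n)) (p := 1) (μ := P)).trans ?_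
    rw [Real.enorm_eq_ofReal (Real.sqrt_nonneg _)]
    refine (mul_le_mul_right hn _).trans ?_
    rw [← ENNReal.ofReal_mul (Real.sqrt_nonneg _)]
    refine ENNReal.ofReal_le_ofReal ?_
    have h2 : (1 / (n : ℝ)) ^ α' ≤ b n ^ α' := by
      refine Real.rpow_le_rpow (by positivity) ?_ S.α'_pos.le
      rw [div_le_iff₀ hn0]
      linarith
    have h3 : √((n : ℝ) * b n) * b n ^ α' = √((n : ℝ) * b n ^ (1 + 2 * α')) := by
      rw [Real.rpow_add hbn, Real.rpow_one, ← mul_assoc,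
        Real.sqrt_mul (by positivity : 0 ≤ (n : ℝ) * b n), two_mul, Real.rpow_add hbn, Real.sqrt_mul_self (by positivity)]
    calc √((n : ℝ) * b n) * (A * ((1 / (n : ℝ)) ^ α' + b n ^ α'))
        ≤ √((n : ℝ) * b n) * (A * (b n ^ α' + b n ^ α')) := by gcongr
      _ = A * (2 * (√((n : ℝ) * b n) * b n ^ α')) := by ring
      _ = _ := by rw [h3]

end EstimationSetup

end Estimation

section SmoothRecursion

variable {p : ℕ} {G : ℝ → (Fin p → ℝ) → ℝ → ℝ} {a : ℝ}

lemma uniqueDiffOn_strip : UniqueDiffOn ℝ ((univ : Set (Fin p → ℝ)) ×ˢ Icc (0 : ℝ) 1) :=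
  uniqueDiffOn_univ.prod (uniqueDiffOn_Icc zero_lt_one)

lemma dG1_eq (hG : ContDiffOn ℝ 1 (fun yu : (Fin p → ℝ) × ℝ => G a yu.1 yu.2)
      (univ ×ˢ Icc (0 : ℝ) 1)) (y : Fin p → ℝ) {u : ℝ} (hu : u ∈ Icc (0 : ℝ) 1) (i : Fin p) :
    dG1 G a y u i = fderivWithin ℝ (fun yu : (Fin p → ℝ) × ℝ => G a yu.1 yu.2)
      (univ ×ˢ Icc (0 : ℝ) 1) (y, u) (Pi.single i 1, 0) := by
  have h1 := (hG.differentiableOn one_ne_zero (y, u) ⟨mem_univ _, hu⟩).hasFDerivWithinAt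
  have h2 : HasFDerivWithinAt (fun y : Fin p → ℝ => (y, u))
      (ContinuousLinearMap.inl ℝ (Fin p → ℝ) ℝ) univ y :=
    (hasFDerivAt_prodMk_left y u).hasFDerivWithinAt
  have hmaps : MapsTo (fun y : Fin p → ℝ => (y, u)) univ (univ ×ˢ Icc (0 : ℝ) 1) :=
    fun y' _ => ⟨mem_univ _, hu⟩
  have h3 := HasFDerivWithinAt.comp y h1 h2 hmaps
  rw [hasFDerivWithinAt_univ] at h3
  rw [dG1, show (fun y => G a y u) = (fun yu : (Fin p → ℝ) × ℝ => G a yu.1 yu.2) ∘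
    fun y => (y, u) from rfl, h3.fderiv]
  simp

lemma dG2_eq (hG : ContDiffOn ℝ 1 (fun yu : (Fin p → ℝ) × ℝ => G a yu.1 yu.2)
      (univ ×ˢ Icc (0 : ℝ) 1)) (y : Fin p → ℝ) {u : ℝ} (hu : u ∈ Icc (0 : ℝ) 1) :
    dG2 G a y u = fderivWithin ℝ (fun yu : (Fin p → ℝ) × ℝ => G a yu.1 yu.2)
      (univ ×ˢ Icc (0 : ℝ) 1) (y, u) (0, 1) := by
  have h1 := (hG.differentiableOn one_ne_zero (y, u) ⟨mem_univ _, hu⟩).hasFDerivWithinAt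
  have h2 : HasDerivWithinAt (fun v : ℝ => (y, v)) ((0 : Fin p → ℝ), (1 : ℝ)) (Icc 0 1) u :=
    (hasDerivWithinAt_const _ _ _).prodMk (hasDerivWithinAt_id _ _)
  have h3 := h1.comp_hasDerivWithinAt u h2 (fun v hv => ⟨mem_univ _, hv⟩)
  rw [dG2, show (fun v => G a y v) = (fun yu : (Fin p → ℝ) × ℝ => G a yu.1 yu.2) ∘
    fun v => (y, v) from rfl, h3.derivWithin (uniqueDiffOn_Icc zero_lt_one u hu)]

lemma continuousOn_dG1 (hG : ContDiffOn ℝ 1 (fun yu : (Fin p → ℝ) × ℝ => G a yu.1 yu.2)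
      (univ ×ˢ Icc (0 : ℝ) 1)) (i : Fin p) :
    ContinuousOn (fun yu : (Fin p → ℝ) × ℝ => dG1 G a yu.1 yu.2 i) (univ ×ˢ Icc (0 : ℝ) 1) := by
  have h := hG.continuousOn_fderivWithin uniqueDiffOn_strip le_rfl
  exact (h.clm_apply continuousOn_const).congr fun yu hyu => dG1_eq hG yu.1 hyu.2 i

lemma continuousOn_dG2 (hG : ContDiffOn ℝ 1 (fun yu : (Fin p → ℝ) × ℝ => G a yu.1 yu.2)
      (univ ×ˢ Icc (0 : ℝ) 1)) :
    ContinuousOn (fun yu : (Fin p → ℝ) × ℝ => dG2 G a yu.1 yu.2) (univ ×ˢ Icc (0 : ℝ) 1) := by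
  have h := hG.continuousOn_fderivWithin uniqueDiffOn_strip le_rfl
  exact (h.clm_apply continuousOn_const).congr fun yu hyu => dG2_eq hG yu.1 hyu.2

lemma hasDerivWithinAt_recursion (hG : ContDiffOn ℝ 1 (fun yu : (Fin p → ℝ) × ℝ => G a yu.1 yu.2)
      (univ ×ˢ Icc (0 : ℝ) 1)) {y : ℝ → Fin p → ℝ} {y' : Fin p → ℝ} {u : ℝ}
    (hu : u ∈ Icc (0 : ℝ) 1) (hy : ∀ i, HasDerivWithinAt (fun v => y v i) (y' i) (Icc 0 1) u) :
    HasDerivWithinAt (fun v => G a (y v) v) (∑ i, dG1 G a (y u) u i * y' i + dG2 G a (y u) u)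
      (Icc 0 1) u := by
  have h1 := (hG.differentiableOn one_ne_zero (y u, u) ⟨mem_univ _, hu⟩).hasFDerivWithinAt
  have h2 : HasDerivWithinAt (fun v : ℝ => (y v, v)) (y', (1 : ℝ)) (Icc 0 1) u :=
    (hasDerivWithinAt_pi.2 hy).prodMk (hasDerivWithinAt_id _ _)
  have h3 := HasFDerivWithinAt.comp_hasDerivWithinAt (f := fun v : ℝ => (y v, v)) u h1 h2
    (fun v hv => ⟨mem_univ _, hv⟩)
  refine h3.congr_deriv ?_
  have e1 : ((y', (1 : ℝ)) : (Fin p → ℝ) × ℝ) =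
      ∑ i, y' i • ((Pi.single i 1 : Fin p → ℝ), (0 : ℝ)) + (0, 1) := by
    refine Prod.ext ?_ ?_
    · ext j
      simp [Prod.fst_sum, Finset.sum_apply, Pi.single_apply]
    · simp [Prod.snd_sum]
  rw [e1, map_add, map_sum, ← dG2_eq hG (y u) hu]
  congr 1
  refine Finset.sum_congr rfl fun i _ => ?_
  rw [map_smul, ← dG1_eq hG (y u) hu i, smul_eq_mul, mul_comm]

lemma measurable_dG1 (hGm : ∀ u ∈ Icc (0 : ℝ) 1, Measurable fun ay : ℝ × (Fin p → ℝ) =>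
      G ay.1 ay.2 u)
    (hG : ∀ a, ContDiffOn ℝ 1 (fun yu : (Fin p → ℝ) × ℝ => G a yu.1 yu.2)
      (univ ×ˢ Icc (0 : ℝ) 1)) (y : Fin p → ℝ) {u : ℝ} (hu : u ∈ Icc (0 : ℝ) 1) (i : Fin p) :
    Measurable fun a => dG1 G a y u i := by
  have hlim : Tendsto (fun n : ℕ => 1 / ((n : ℝ) + 1)) atTop (𝓝[≠] 0) := by
    refine tendsto_nhdsWithin_iff.2 ⟨tendsto_one_div_add_atTop_nhds_zero_nat, ?_⟩
    exact Eventually.of_forall fun n => by simp; positivity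
  have hm : ∀ y, Measurable fun a => G a y u := fun y =>
    (hGm u hu).comp (measurable_id.prodMk measurable_const)
  refine measurable_of_tendsto_metrizable (f := fun (n : ℕ) a => (1 / ((n : ℝ) + 1))⁻¹ •
    (G a (y + (1 / ((n : ℝ) + 1)) • Pi.single i 1) u - G a y u)) (fun n => ?_)
    (tendsto_pi_nhds.2 fun a => ?_)
  · exact ((hm _).sub (hm _)).const_smul (1 / ((n : ℝ) + 1))⁻¹
  · have hd : DifferentiableAt ℝ (fun y => G a y u) y := by
      have h1 := (hG a).differentiableOn one_ne_zero (y, u) ⟨mem_univ _, hu⟩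
      have h3 := DifferentiableWithinAt.comp (s := univ) y h1
        (f := fun y : Fin p → ℝ => (y, u)) (by fun_prop) (fun y' _ => ⟨mem_univ _, hu⟩)
      rwa [differentiableWithinAt_univ] at h3
    have h2 := (hd.hasFDerivAt.hasLineDerivAt (Pi.single i 1)).tendsto_slope_zero
    exact h2.comp hlim

lemma measurable_dG2 (hGm : ∀ u ∈ Icc (0 : ℝ) 1, Measurable fun ay : ℝ × (Fin p → ℝ) =>
      G ay.1 ay.2 u)
    (hG : ∀ a, ContDiffOn ℝ 1 (fun yu : (Fin p → ℝ) × ℝ => G a yu.1 yu.2)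
      (univ ×ˢ Icc (0 : ℝ) 1)) (y : Fin p → ℝ) {u : ℝ} (hu : u ∈ Icc (0 : ℝ) 1) :
    Measurable fun a => dG2 G a y u := by
  obtain ⟨v, hv, hvlim⟩ : ∃ v : ℕ → ℝ, (∀ n, v n ∈ Icc (0 : ℝ) 1 \ {u}) ∧
      Tendsto v atTop (𝓝 u) := by
    have h1 : u ∈ closure (Icc (0 : ℝ) 1 \ {u}) := by
      have := (uniqueDiffOn_Icc (zero_lt_one (α := ℝ)) u hu).accPt
      rwa [accPt_principal_iff_clusterPt, ← mem_closure_iff_clusterPt] at this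
    exact mem_closure_iff_seq_limit.1 h1
  have hm : ∀ v ∈ Icc (0 : ℝ) 1, Measurable fun a => G a y v := fun v hv =>
    (hGm v hv).comp (measurable_id.prodMk measurable_const)
  refine measurable_of_tendsto_metrizable (f := fun (n : ℕ) a => slope (fun v => G a y v) u (v n))
    (fun n => ?_) (tendsto_pi_nhds.2 fun a => ?_)
  · simp only [slope, vsub_eq_sub]
    exact ((hm _ (hv n).1).sub (hm _ hu)).const_smul (v n - u)⁻¹
  · have h2 : HasDerivWithinAt (fun v => G a y v) (dG2 G a y u) (Icc 0 1) u := by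
      have := hasDerivWithinAt_recursion (hG a) (y := fun _ => y) (y' := 0) hu
        (fun i => hasDerivWithinAt_const _ _ _)
      simpa using this
    rw [hasDerivWithinAt_iff_tendsto_slope] at h2
    exact h2.comp (tendsto_nhdsWithin_iff.2 ⟨hvlim, Eventually.of_forall hv⟩)

end SmoothRecursion

section Domination

variable {Ω : Type*} [MeasurableSpace Ω] {P : Measure Ω} [IsProbabilityMeasure P]

/-- A random supremum of ratios is dominated by a measurable function of the innovation. -/
lemma exists_measurable_dominating {T : Type*} [TopologicalSpace T]
    [TopologicalSpace.SeparableSpace T] [Nonempty T] {e : Ω → ℝ} (he : Measurable e)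
    {N : ℝ → T → ℝ} {W : T → ℝ} (hN : ∀ a, Continuous (N a)) (hW : Continuous W)
    (hNm : ∀ τ, Measurable fun a => N a τ) (hW0 : ∀ τ, 0 ≤ W τ) {Φ : Ω → ℝ≥0∞}
    (hΦ : ∀ ω τ, ENNReal.ofReal (N (e ω) τ) / ENNReal.ofReal (W τ) ≤ Φ ω) {q : ℝ} (hq : 0 < q)
    {c : ℝ≥0∞} (hc : eLpNorm Φ (ENNReal.ofReal q) P ≤ c) (hc' : c < ∞) :
    ∃ (L : ℝ → ℝ) (s : Set ℝ), Measurable L ∧ (∀ a, 0 ≤ L a) ∧ MeasurableSet s ∧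
      (∀ᵐ ω ∂P, e ω ∈ s) ∧ eLpNorm (fun ω => L (e ω)) (ENNReal.ofReal q) P ≤ c ∧
      ∀ a ∈ s, ∀ τ, N a τ ≤ L a * W τ := by
  set Q : ℝ → ℝ≥0∞ := fun a => ⨆ k, ENNReal.ofReal (N a (TopologicalSpace.denseSeq T k)) /
    ENNReal.ofReal (W (TopologicalSpace.denseSeq T k)) with hQ
  have hQm : Measurable Q := Measurable.iSup fun k => (hNm _).ennreal_ofReal.div_const _
  have hQΦ : ∀ ω, Q (e ω) ≤ Φ ω := fun ω => iSup_le fun k => hΦ ω _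
  have hq0 : ENNReal.ofReal q ≠ 0 := (ENNReal.ofReal_pos.2 hq).ne'
  have hQn : eLpNorm (fun ω => Q (e ω)) (ENNReal.ofReal q) P ≤ c :=
    (eLpNorm_mono_enorm fun ω => by simpa using hQΦ ω).trans hc
  have hfin : ∀ᵐ ω ∂P, Q (e ω) < ∞ := by
    have h1 := (eLpNorm_lt_top_iff_lintegral_rpow_enorm_lt_top hq0 ENNReal.ofReal_ne_top).1
      (hQn.trans_lt hc')
    have h2 := ae_lt_top ((hQm.comp he).enorm.pow_const _) h1.ne
    filter_upwards [h2] with ω hω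
    rw [ENNReal.toReal_ofReal hq.le] at hω
    by_contra hcon
    rw [not_lt, top_le_iff] at hcon
    simp [hcon, ENNReal.top_rpow_of_pos hq] at hω
  refine ⟨fun a => (Q a).toReal, {a | Q a < ∞}, hQm.ennreal_toReal, fun a => ENNReal.toReal_nonneg,
    measurableSet_lt hQm measurable_const, hfin, le_trans (eLpNorm_mono_enorm fun ω => ?_) hQn,
    fun a ha => ?_⟩
  · rw [Real.enorm_eq_ofReal ENNReal.toReal_nonneg]
    exact ENNReal.ofReal_toReal_le
  · have hclosed : IsClosed {τ | N a τ ≤ (Q a).toReal * W τ} :=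
      isClosed_le (hN a) (continuous_const.mul hW)
    have hd : ∀ k, TopologicalSpace.denseSeq T k ∈ {τ | N a τ ≤ (Q a).toReal * W τ} := by
      intro k
      set τ := TopologicalSpace.denseSeq T k
      have h1 : ENNReal.ofReal (N a τ) / ENNReal.ofReal (W τ) ≤ Q a :=
        le_iSup (fun k => ENNReal.ofReal (N a (TopologicalSpace.denseSeq T k)) /
          ENNReal.ofReal (W (TopologicalSpace.denseSeq T k))) k
      have h2 : ENNReal.ofReal (N a τ) ≤ Q a * ENNReal.ofReal (W τ) :=
        (ENNReal.div_le_iff_le_mul (Or.inr ha.ne) (Or.inl ENNReal.ofReal_ne_top)).1 h1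
      have h3 : Q a * ENNReal.ofReal (W τ) = ENNReal.ofReal ((Q a).toReal * W τ) := by
        rw [ENNReal.ofReal_mul ENNReal.toReal_nonneg, ENNReal.ofReal_toReal ha.ne]
      rw [h3] at h2
      exact (ENNReal.ofReal_le_ofReal_iff (mul_nonneg ENNReal.toReal_nonneg (hW0 τ))).1 h2
    intro τ
    have h4 := (TopologicalSpace.denseRange_denseSeq T).closure_range
    have h5 : closure (range (TopologicalSpace.denseSeq T)) ⊆
        {τ | N a τ ≤ (Q a).toReal * W τ} :=
      hclosed.closure_subset_iff.2 (range_subset_iff.2 hd)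
    rw [h4] at h5
    exact h5 (mem_univ τ)

end Domination

section Picard

variable {p : ℕ}

/-- Picard iterates of the recursion along an innovation path. -/
def picard (G : ℝ → (Fin p → ℝ) → ℝ → ℝ) (e : ℤ → ℝ) : ℕ → ℤ → ℝ → ℝ
  | 0, _, _ => 0
  | k + 1, t, u => G (e t) (lags p (fun s => picard G e k s u) (t - 1)) u

/-- The derivatives in `u` of the Picard iterates. -/
def dpicard (G : ℝ → (Fin p → ℝ) → ℝ → ℝ) (e : ℤ → ℝ) : ℕ → ℤ → ℝ → ℝ
  | 0, _, _ => 0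
  | k + 1, t, u => ∑ i, dG1 G (e t) (lags p (fun s => picard G e k s u) (t - 1)) u i *
      lags p (fun s => dpicard G e k s u) (t - 1) i +
      dG2 G (e t) (lags p (fun s => picard G e k s u) (t - 1)) u

/-- Iterates of the linear recursion `x_t = L(e_t) ∑ χ_i x_{t-1-i}`. -/
def linIter (L : ℝ → ℝ) (χ : Fin p → ℝ) (e : ℤ → ℝ) (x : ℤ → ℝ) : ℕ → ℤ → ℝ
  | 0, t => x t
  | k + 1, t => L (e t) * ∑ i, |lags p (fun s => linIter L χ e x k s) (t - 1) i| * χ i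

/-- Bounds on the recursion function along an innovation path. -/
structure GoodPath (G : ℝ → (Fin p → ℝ) → ℝ → ℝ) (χ y₀ y₁ : Fin p → ℝ)
    (L A A' B₁ B₂ : ℝ → ℝ) (e : ℤ → ℝ) : Prop where
  weight_nonneg : ∀ i, 0 ≤ χ i
  L_nonneg : ∀ a, 0 ≤ L a
  A_nonneg : ∀ a, 0 ≤ A a
  A'_nonneg : ∀ a, 0 ≤ A' a
  B₁_nonneg : ∀ a, 0 ≤ B₁ a
  B₂_nonneg : ∀ a, 0 ≤ B₂ a
  smooth : ∀ a, ContDiffOn ℝ 1 (fun yu : (Fin p → ℝ) × ℝ => G a yu.1 yu.2)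
    (univ ×ˢ Icc (0 : ℝ) 1)
  lip : ∀ t, ∀ u ∈ Icc (0 : ℝ) 1, ∀ y y', |G (e t) y u - G (e t) y' u| ≤
    L (e t) * ∑ i, |y i - y' i| * χ i
  base : ∀ t, ∀ u ∈ Icc (0 : ℝ) 1, |G (e t) y₀ u| ≤ A (e t)
  base' : ∀ t, ∀ u ∈ Icc (0 : ℝ) 1, |dG2 G (e t) y₁ u| ≤ A' (e t)
  lip₁ : ∀ t, ∀ u ∈ Icc (0 : ℝ) 1, ∀ y y', l1 (fun i => dG1 G (e t) y u i - dG1 G (e t) y' u i) ≤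
    B₁ (e t) * l1 (fun i => y i - y' i)
  lip₂ : ∀ t, ∀ u ∈ Icc (0 : ℝ) 1, ∀ y y', |dG2 G (e t) y u - dG2 G (e t) y' u| ≤
    B₂ (e t) * l1 (fun i => y i - y' i)

variable {G : ℝ → (Fin p → ℝ) → ℝ → ℝ} {χ y₀ y₁ : Fin p → ℝ} {L A A' B₁ B₂ : ℝ → ℝ} {e : ℤ → ℝ}

/-- The first increment of the Picard iterates is bounded by this sequence. -/
def incrBound (L A : ℝ → ℝ) (χ y₀ : Fin p → ℝ) (e : ℤ → ℝ) (t : ℤ) : ℝ :=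
  A (e t) + L (e t) * ∑ i, |y₀ i| * χ i

/-- Bound for the remainder of the Picard iterates. -/
def incrTail (L A : ℝ → ℝ) (χ y₀ : Fin p → ℝ) (e : ℤ → ℝ) (k : ℕ) (t : ℤ) : ℝ :=
  ∑' j, linIter L χ e (incrBound L A χ y₀ e) (k + j) t

/-- Bound for the inhomogeneity in the recursion of the derivatives. -/
def derivBound (L A A' B₂ : ℝ → ℝ) (χ y₀ y₁ : Fin p → ℝ) (e : ℤ → ℝ) (t : ℤ) : ℝ :=
  A' (e t) + B₂ (e t) * (l1 (lags p (incrTail L A χ y₀ e 0) (t - 1)) + l1 y₁)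

/-- Perturbation of the recursion of the derivatives by the remainder of the iterates. -/
def derivPert (L A B₁ B₂ : ℝ → ℝ) (χ y₀ : Fin p → ℝ) (e : ℤ → ℝ) (D : ℤ → ℝ) (k : ℕ) (t : ℤ) : ℝ :=
  min (B₁ (e t) * l1 (lags p (incrTail L A χ y₀ e k) (t - 1)) * l1 (lags p D (t - 1)))
    (2 * (L (e t) * ∑ i, |lags p D (t - 1) i| * χ i)) +
    B₂ (e t) * l1 (lags p (incrTail L A χ y₀ e k) (t - 1))

lemma l1_mono {r : ℕ} {y y' : Fin r → ℝ} (h : ∀ i, |y i| ≤ |y' i|) : l1 y ≤ l1 y' :=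
  Finset.sum_le_sum fun i _ => h i

lemma abs_le_l1 {r : ℕ} (y : Fin r → ℝ) (i : Fin r) : |y i| ≤ l1 y :=
  Finset.single_le_sum (f := fun i => |y i|) (fun _ _ => abs_nonneg _) (Finset.mem_univ i)

lemma linIter_nonneg (hL : ∀ a, 0 ≤ L a) (hχ : ∀ i, 0 ≤ χ i) {x : ℤ → ℝ} (hx : ∀ t, 0 ≤ x t)
    (k : ℕ) (t : ℤ) : 0 ≤ linIter L χ e x k t := by
  cases k with
  | zero => exact hx t
  | succ k => exact mul_nonneg (hL _) (Finset.sum_nonneg fun i _ => mul_nonneg (abs_nonneg _) (hχ i))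

namespace GoodPath

variable (h : GoodPath G χ y₀ y₁ L A A' B₁ B₂ e)
include h

lemma incrBound_nonneg (t : ℤ) : 0 ≤ incrBound L A χ y₀ e t :=
  add_nonneg (h.A_nonneg _) (mul_nonneg (h.L_nonneg _)
    (Finset.sum_nonneg fun i _ => mul_nonneg (abs_nonneg _) (h.weight_nonneg i)))

lemma incr_nonneg (k : ℕ) (t : ℤ) : 0 ≤ linIter L χ e (incrBound L A χ y₀ e) k t :=
  linIter_nonneg h.L_nonneg h.weight_nonneg h.incrBound_nonneg k t

lemma abs_picard_succ_sub_le (k : ℕ) : ∀ (t : ℤ), ∀ u ∈ Icc (0 : ℝ) 1,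
    |picard G e (k + 1) t u - picard G e k t u| ≤ linIter L χ e (incrBound L A χ y₀ e) k t := by
  induction k with
  | zero =>
    intro t u hu
    simp only [picard, linIter, sub_zero]
    have h1 := h.lip t u hu (lags p (fun _ => 0) (t - 1)) y₀
    have h2 := h.base t u hu
    have h3 : ∑ i, |lags p (fun _ => (0 : ℝ)) (t - 1) i - y₀ i| * χ i = ∑ i, |y₀ i| * χ i := by
      refine Finset.sum_congr rfl fun i _ => ?_
      simp [lags]
    rw [h3] at h1
    unfold incrBound
    have := abs_add_le (G (e t) (lags p (fun _ => 0) (t - 1)) u - G (e t) y₀ u) (G (e t) y₀ u)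
    rw [sub_add_cancel] at this
    linarith
  | succ k ih =>
    intro t u hu
    rw [picard, picard, linIter]
    refine (h.lip t u hu _ _).trans (mul_le_mul_of_nonneg_left ?_ (h.L_nonneg _))
    refine Finset.sum_le_sum fun i _ => mul_le_mul_of_nonneg_right ?_ (h.weight_nonneg i)
    exact (ih _ u hu).trans (le_abs_self _)

variable (hs : ∀ t, Summable fun k => linIter L χ e (incrBound L A χ y₀ e) k t)
include hs

lemma abs_picard_add_sub_le (k j : ℕ) (t : ℤ) {u : ℝ} (hu : u ∈ Icc (0 : ℝ) 1) :
    |picard G e (k + j) t u - picard G e k t u| ≤ incrTail L A χ y₀ e k t := by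
  have h1 : |picard G e (k + j) t u - picard G e k t u| ≤
      ∑ i ∈ Finset.range j, linIter L χ e (incrBound L A χ y₀ e) (k + i) t := by
    induction j with
    | zero => simp
    | succ j ih =>
      rw [Finset.sum_range_succ]
      have h2 := h.abs_picard_succ_sub_le (k + j) t u hu
      have h3 := abs_add_le (picard G e (k + j) t u - picard G e k t u)
        (picard G e (k + j + 1) t u - picard G e (k + j) t u)
      rw [show picard G e (k + j) t u - picard G e k t u +
        (picard G e (k + j + 1) t u - picard G e (k + j) t u) =
        picard G e (k + (j + 1)) t u - picard G e k t u by rw [← add_assoc]; ring] at h3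
      linarith
  refine h1.trans (Summable.sum_le_tsum _ (fun i _ => h.incr_nonneg _ t) ?_)
  simpa only [add_comm] using (summable_nat_add_iff k).2 (hs t)

lemma abs_picard_le (k : ℕ) (t : ℤ) {u : ℝ} (hu : u ∈ Icc (0 : ℝ) 1) :
    |picard G e k t u| ≤ incrTail L A χ y₀ e 0 t := by
  have := h.abs_picard_add_sub_le hs 0 k t hu
  simpa [picard] using this

omit hs in
lemma hasDerivWithinAt_picard (k : ℕ) : ∀ (t : ℤ), ∀ u ∈ Icc (0 : ℝ) 1,
    HasDerivWithinAt (picard G e k t) (dpicard G e k t u) (Icc 0 1) u := by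
  induction k with
  | zero =>
    intro t u hu
    exact hasDerivWithinAt_const _ _ _
  | succ k ih =>
    intro t u hu
    exact hasDerivWithinAt_recursion (h.smooth (e t))
      (y := fun u => lags p (fun s => picard G e k s u) (t - 1)) hu fun i => ih _ u hu

omit hs in
lemma continuousOn_dpicard (k : ℕ) : ∀ t : ℤ, ContinuousOn (dpicard G e k t) (Icc 0 1) := by
  induction k with
  | zero =>
    intro t
    exact continuousOn_const
  | succ k ih =>
    intro t
    have hY : ContinuousOn (fun u => ((lags p (fun s => picard G e k s u) (t - 1) : Fin p → ℝ), u))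
        (Icc (0 : ℝ) 1) := by
      refine ContinuousOn.prodMk (continuousOn_pi.2 fun i => ?_) continuousOn_id
      exact fun u hu => (h.hasDerivWithinAt_picard k _ u hu).continuousWithinAt
    have hmaps : MapsTo (fun u => ((lags p (fun s => picard G e k s u) (t - 1) : Fin p → ℝ), u))
        (Icc (0 : ℝ) 1) (univ ×ˢ Icc (0 : ℝ) 1) := fun u hu => ⟨mem_univ _, hu⟩
    refine ContinuousOn.add (continuousOn_finsetSum _ fun i _ => ContinuousOn.mul ?_ (ih _)) ?_
    · exact (continuousOn_dG1 (h.smooth (e t)) i).comp hY hmaps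
    · exact (continuousOn_dG2 (h.smooth (e t))).comp hY hmaps

omit hs in
lemma abs_dG1_le (t : ℤ) (y : Fin p → ℝ) {u : ℝ} (hu : u ∈ Icc (0 : ℝ) 1) (i : Fin p) :
    |dG1 G (e t) y u i| ≤ L (e t) * χ i := by
  have hd : DifferentiableAt ℝ (fun y => G (e t) y u) y := by
    have h1 := (h.smooth (e t)).differentiableOn one_ne_zero (y, u) ⟨mem_univ _, hu⟩
    have h3 := DifferentiableWithinAt.comp (s := univ) y h1
      (f := fun y : Fin p → ℝ => (y, u)) (by fun_prop) (fun y' _ => ⟨mem_univ _, hu⟩)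
    rwa [differentiableWithinAt_univ] at h3
  have h2 : HasDerivAt (fun s : ℝ => G (e t) (y + s • Pi.single i 1) u)
      (dG1 G (e t) y u i) 0 := hd.hasFDerivAt.hasLineDerivAt (Pi.single i 1)
  have h4 := h2.le_of_lip' (C := L (e t) * χ i)
    (mul_nonneg (h.L_nonneg _) (h.weight_nonneg i)) (Eventually.of_forall fun s => ?_)
  · rwa [Real.norm_eq_abs] at h4
  · rw [Real.norm_eq_abs, Real.norm_eq_abs]
    refine (h.lip t u hu _ _).trans (le_of_eq ?_)
    rw [mul_assoc]
    congr 1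
    rw [Finset.sum_eq_single i]
    · simp [mul_comm]
    · intro j _ hj
      simp [hj]
    · simp

variable {D : ℤ → ℝ} (hD0 : ∀ t, 0 ≤ D t)
  (hD : ∀ t, L (e t) * ∑ i, |lags p D (t - 1) i| * χ i + derivBound L A A' B₂ χ y₀ y₁ e t ≤ D t)
include hD0 hD

lemma abs_dpicard_le (k : ℕ) : ∀ (t : ℤ), ∀ u ∈ Icc (0 : ℝ) 1, |dpicard G e k t u| ≤ D t := by
  induction k with
  | zero =>
    intro t u hu
    simpa [dpicard] using hD0 t
  | succ k ih =>
    intro t u hu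
    refine le_trans ?_ (hD t)
    rw [dpicard]
    refine (abs_add_le _ _).trans (add_le_add ?_ ?_)
    · refine (Finset.abs_sum_le_sum_abs _ _).trans ?_
      rw [Finset.mul_sum]
      refine Finset.sum_le_sum fun i _ => ?_
      rw [abs_mul]
      have h1 := h.abs_dG1_le t (lags p (fun s => picard G e k s u) (t - 1)) hu i
      have h2 : |lags p (fun s => dpicard G e k s u) (t - 1) i| ≤ |lags p D (t - 1) i| :=
        (ih _ u hu).trans (le_abs_self _)
      calc _ ≤ (L (e t) * χ i) * |lags p D (t - 1) i| := by
            gcongr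
            exact mul_nonneg (h.L_nonneg _) (h.weight_nonneg i)
        _ = _ := by ring
    · set Y := lags p (fun s => picard G e k s u) (t - 1) with hY
      have h1 := h.lip₂ t u hu Y y₁
      have h2 := h.base' t u hu
      have h3 : l1 (fun i => Y i - y₁ i) ≤ l1 (lags p (incrTail L A χ y₀ e 0) (t - 1)) + l1 y₁ := by
        unfold l1
        rw [← Finset.sum_add_distrib]
        refine Finset.sum_le_sum fun i _ => (abs_sub _ _).trans (add_le_add_left ?_ _)
        exact (h.abs_picard_le hs k _ hu).trans (le_abs_self _)
      have h4 := abs_add_le (dG2 G (e t) Y u - dG2 G (e t) y₁ u) (dG2 G (e t) y₁ u)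
      rw [sub_add_cancel] at h4
      have h5 := mul_le_mul_of_nonneg_left h3 (h.B₂_nonneg (e t))
      unfold derivBound
      linarith

lemma abs_dpicard_add_sub_le {δ : ℕ → ℤ → ℝ} (hδ0 : ∀ t, D t ≤ δ 0 t)
    (hδ : ∀ k t, L (e t) * ∑ i, |lags p (δ k) (t - 1) i| * χ i +
      derivPert L A B₁ B₂ χ y₀ e D k t ≤ δ (k + 1) t) (k : ℕ) :
    ∀ (j : ℕ) (t : ℤ), ∀ u ∈ Icc (0 : ℝ) 1,
      |dpicard G e (k + j) t u - dpicard G e k t u| ≤ δ k t := by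
  induction k with
  | zero =>
    intro j t u hu
    simp only [dpicard, sub_zero]
    exact (h.abs_dpicard_le hs hD0 hD _ t u hu).trans (hδ0 t)
  | succ k ih =>
    intro j t u hu
    refine le_trans ?_ (hδ k t)
    rw [show k + 1 + j = k + j + 1 by ring, dpicard, dpicard]
    set Y := lags p (fun s => picard G e (k + j) s u) (t - 1) with hY
    set Y' := lags p (fun s => picard G e k s u) (t - 1) with hY'
    set E := lags p (fun s => dpicard G e (k + j) s u) (t - 1) with hE
    set E' := lags p (fun s => dpicard G e k s u) (t - 1) with hE'
    have hYY : l1 (fun i => Y i - Y' i) ≤ l1 (lags p (incrTail L A χ y₀ e k) (t - 1)) :=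
      l1_mono fun i => (h.abs_picard_add_sub_le hs k j _ hu).trans (le_abs_self _)
    have hE'D : ∀ i, |E' i| ≤ |lags p D (t - 1) i| := fun i =>
      (h.abs_dpicard_le hs hD0 hD k _ u hu).trans (le_abs_self _)
    have h1 : |∑ i, dG1 G (e t) Y u i * (E i - E' i)| ≤
        L (e t) * ∑ i, |lags p (δ k) (t - 1) i| * χ i := by
      refine (Finset.abs_sum_le_sum_abs _ _).trans ?_
      rw [Finset.mul_sum]
      refine Finset.sum_le_sum fun i _ => ?_
      rw [abs_mul]
      have h2 : |E i - E' i| ≤ |lags p (δ k) (t - 1) i| := (ih j _ u hu).trans (le_abs_self _)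
      calc _ ≤ (L (e t) * χ i) * |lags p (δ k) (t - 1) i| := by
            gcongr
            · exact mul_nonneg (h.L_nonneg _) (h.weight_nonneg i)
            · exact h.abs_dG1_le t Y hu i
        _ = _ := by ring
    have h3 : |∑ i, (dG1 G (e t) Y u i - dG1 G (e t) Y' u i) * E' i| ≤
        min (B₁ (e t) * l1 (lags p (incrTail L A χ y₀ e k) (t - 1)) * l1 (lags p D (t - 1)))
          (2 * (L (e t) * ∑ i, |lags p D (t - 1) i| * χ i)) := by
      refine (Finset.abs_sum_le_sum_abs _ _).trans (le_min ?_ ?_)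
      · calc ∑ i, |(dG1 G (e t) Y u i - dG1 G (e t) Y' u i) * E' i|
            ≤ ∑ i, |dG1 G (e t) Y u i - dG1 G (e t) Y' u i| * l1 (lags p D (t - 1)) := by
              refine Finset.sum_le_sum fun i _ => ?_
              rw [abs_mul]
              exact mul_le_mul_of_nonneg_left ((hE'D i).trans (abs_le_l1 _ i)) (abs_nonneg _)
          _ = l1 (fun i => dG1 G (e t) Y u i - dG1 G (e t) Y' u i) * l1 (lags p D (t - 1)) := by
              rw [← Finset.sum_mul]; rfl
          _ ≤ _ := by
              refine mul_le_mul_of_nonneg_right ((h.lip₁ t u hu Y Y').trans ?_) (l1_nonneg _)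
              exact mul_le_mul_of_nonneg_left hYY (h.B₁_nonneg _)
      · rw [← mul_assoc, Finset.mul_sum]
        refine Finset.sum_le_sum fun i _ => ?_
        rw [abs_mul]
        have h4 := h.abs_dG1_le t Y hu i
        have h5 := h.abs_dG1_le t Y' hu i
        have h6 : |dG1 G (e t) Y u i - dG1 G (e t) Y' u i| ≤ 2 * (L (e t) * χ i) :=
          (abs_sub _ _).trans (by linarith)
        calc _ ≤ 2 * (L (e t) * χ i) * |lags p D (t - 1) i| := by
              refine mul_le_mul h6 (hE'D i) (abs_nonneg _) ?_
              exact (abs_nonneg _).trans h6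
          _ = _ := by ring
    have h7 : |dG2 G (e t) Y u - dG2 G (e t) Y' u| ≤
        B₂ (e t) * l1 (lags p (incrTail L A χ y₀ e k) (t - 1)) :=
      (h.lip₂ t u hu Y Y').trans (mul_le_mul_of_nonneg_left hYY (h.B₂_nonneg _))
    have h8 : ∑ i, dG1 G (e t) Y u i * E i + dG2 G (e t) Y u -
        (∑ i, dG1 G (e t) Y' u i * E' i + dG2 G (e t) Y' u) =
        ∑ i, dG1 G (e t) Y u i * (E i - E' i) +
          (∑ i, (dG1 G (e t) Y u i - dG1 G (e t) Y' u i) * E' i +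
          (dG2 G (e t) Y u - dG2 G (e t) Y' u)) := by
      simp only [mul_sub, sub_mul, Finset.sum_sub_distrib]
      ring
    rw [h8]
    unfold derivPert
    exact (abs_add_le _ _).trans (add_le_add h1 ((abs_add_le _ _).trans (add_le_add h3 h7)))

omit hD0 hD in
lemma tendsto_picard (t : ℤ) {u : ℝ} (hu : u ∈ Icc (0 : ℝ) 1) :
    Tendsto (fun k => picard G e k t u) atTop
      (𝓝 (∑' k, (picard G e (k + 1) t u - picard G e k t u))) := by
  have h1 : Summable fun k => picard G e (k + 1) t u - picard G e k t u :=
    Summable.of_norm_bounded (hs t) fun k => h.abs_picard_succ_sub_le k t u hu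
  refine h1.hasSum.tendsto_sum_nat.congr fun k => ?_
  rw [Finset.sum_range_sub (fun k => picard G e k t u)]
  simp [picard]

lemma abs_limit_sub_le (t : ℤ) {u v : ℝ} (hu : u ∈ Icc (0 : ℝ) 1) (hv : v ∈ Icc (0 : ℝ) 1) :
    |∑' k, (picard G e (k + 1) t v - picard G e k t v) -
      ∑' k, (picard G e (k + 1) t u - picard G e k t u)| ≤ D t * |v - u| := by
  refine le_of_tendsto ((h.tendsto_picard hs t hv).sub (h.tendsto_picard hs t hu)).abs
    (Eventually.of_forall fun k => ?_)
  have := (convex_Icc (0 : ℝ) 1).norm_image_sub_le_of_norm_hasDerivWithin_le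
    (f := picard G e k t) (f' := dpicard G e k t) (C := D t)
    (fun x hx => h.hasDerivWithinAt_picard k t x hx)
    (fun x hx => h.abs_dpicard_le hs hD0 hD k t x hx) hu hv
  simpa only [Real.norm_eq_abs] using this

/-- The limit of the Picard iterates is continuously differentiable. -/
lemma contDiffOn_limit {δ : ℕ → ℤ → ℝ} (hδ0 : ∀ t, D t ≤ δ 0 t)
    (hδ : ∀ k t, L (e t) * ∑ i, |lags p (δ k) (t - 1) i| * χ i +
      derivPert L A B₁ B₂ χ y₀ e D k t ≤ δ (k + 1) t) (t : ℤ)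
    (hδlim : ∀ η : ℝ, 0 < η → ∃ k, δ k t < η) :
    ContDiffOn ℝ 1 (fun u => ∑' k, (picard G e (k + 1) t u - picard G e k t u)) (Icc 0 1) := by
  have hcau : UniformCauchySeqOn (fun k => dpicard G e k t) atTop (Icc 0 1) := by
    rw [Metric.uniformCauchySeqOn_iff]
    intro η hη
    obtain ⟨k, hk⟩ := hδlim (η / 2) (half_pos hη)
    refine ⟨k, fun m hm n hn u hu => ?_⟩
    obtain ⟨i, rfl⟩ := Nat.exists_eq_add_of_le hm
    obtain ⟨j, rfl⟩ := Nat.exists_eq_add_of_le hn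
    have h1 := h.abs_dpicard_add_sub_le hs hD0 hD hδ0 hδ k i t u hu
    have h2 := h.abs_dpicard_add_sub_le hs hD0 hD hδ0 hδ k j t u hu
    rw [Real.dist_eq]
    have h3 := abs_sub (dpicard G e (k + i) t u - dpicard G e k t u)
      (dpicard G e (k + j) t u - dpicard G e k t u)
    rw [sub_sub_sub_cancel_right] at h3
    linarith
  choose! E hE using fun u (hu : u ∈ Icc (0 : ℝ) 1) =>
    cauchySeq_tendsto_of_complete (hcau.cauchySeq hu)
  have hunif : TendstoUniformlyOn (fun k => dpicard G e k t) E atTop (Icc 0 1) :=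
    hcau.tendstoUniformlyOn_of_tendsto hE
  have hEc : ContinuousOn E (Icc 0 1) :=
    hunif.continuousOn (Frequently.of_forall fun k => h.continuousOn_dpicard k t)
  set F : ℝ → ℝ := IccExtend (zero_le_one (α := ℝ)) (domRestrict (Icc 0 1) E) with hF
  have hFc : Continuous F := continuous_IccExtend_iff.2 (continuousOn_iff_continuous_domRestrict.1 hEc)
  have hFE : ∀ u ∈ Icc (0 : ℝ) 1, F u = E u := fun u hu => by
    rw [hF, IccExtend_of_mem _ _ hu]; rfl
  have hlim : ∀ u ∈ Icc (0 : ℝ) 1, ∑' k, (picard G e (k + 1) t u - picard G e k t u) =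
      ∑' k, (picard G e (k + 1) t 0 - picard G e k t 0) + ∫ v in (0 : ℝ)..u, F v := by
    intro u hu
    have h0 : (0 : ℝ) ∈ Icc (0 : ℝ) 1 := by simp
    have hsub : Icc 0 u ⊆ Icc (0 : ℝ) 1 := Icc_subset_Icc le_rfl hu.2
    have hint : ∀ k, ∫ v in (0 : ℝ)..u, dpicard G e k t v = picard G e k t u - picard G e k t 0 := by
      intro k
      refine intervalIntegral.integral_eq_sub_of_hasDerivAt_of_le hu.1
        (fun v hv => ((h.hasDerivWithinAt_picard k t v (hsub hv)).continuousWithinAt).mono hsub)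
        (fun v hv => ?_) ?_
      · exact (h.hasDerivWithinAt_picard k t v (hsub (Ioo_subset_Icc_self hv))).hasDerivAt
          (Icc_mem_nhds hv.1 (hv.2.trans_le hu.2))
      · refine ContinuousOn.intervalIntegrable ?_
        rw [uIcc_of_le hu.1]
        exact (h.continuousOn_dpicard k t).mono hsub
    have h1 : Tendsto (fun k => ∫ v in (0 : ℝ)..u, dpicard G e k t v) atTop
        (𝓝 (∫ v in (0 : ℝ)..u, F v)) := by
      rw [Metric.tendsto_atTop]
      intro η hη
      rw [Metric.tendstoUniformlyOn_iff] at hunif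
      obtain ⟨N, hN⟩ := eventually_atTop.1 (hunif (η / 2) (half_pos hη))
      refine ⟨N, fun k hk => ?_⟩
      have h2 : IntervalIntegrable (dpicard G e k t) volume 0 u := by
        refine ContinuousOn.intervalIntegrable ?_
        rw [uIcc_of_le hu.1]
        exact (h.continuousOn_dpicard k t).mono hsub
      rw [Real.dist_eq, ← intervalIntegral.integral_sub h2 (hFc.intervalIntegrable _ _),
        ← Real.norm_eq_abs]
      refine (intervalIntegral.norm_integral_le_of_norm_le_const (C := η / 2) fun v hv => ?_).trans_lt
        ?_
      · rw [uIoc_of_le hu.1] at hv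
        have hv' : v ∈ Icc (0 : ℝ) 1 := hsub (Ioc_subset_Icc_self hv)
        rw [hFE v hv', ← dist_eq_norm, dist_comm]
        exact (hN k hk v hv').le
      · rw [sub_zero, abs_of_nonneg hu.1]
        nlinarith [hu.2]
    have h3 := (h.tendsto_picard hs t hu).sub (h.tendsto_picard hs t h0)
    have h4 := tendsto_nhds_unique (h1.congr hint) h3
    linarith
  have hsm : ContDiff ℝ 1 (fun u => ∑' k, (picard G e (k + 1) t 0 - picard G e k t 0) +
      ∫ v in (0 : ℝ)..u, F v) := by
    have hd : ∀ u, HasDerivAt (fun u => ∑' k, (picard G e (k + 1) t 0 - picard G e k t 0) +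
        ∫ v in (0 : ℝ)..u, F v) (F u) u := fun u =>
      (intervalIntegral.integral_hasDerivAt_right (hFc.intervalIntegrable _ _)
        (hFc.stronglyMeasurableAtFilter _ _) hFc.continuousAt).const_add _
    rw [contDiff_one_iff_deriv]
    refine ⟨fun u => (hd u).differentiableAt, ?_⟩
    rwa [show deriv _ = F from funext fun u => (hd u).deriv]
  exact hsm.contDiffOn.congr hlim

end GoodPath

end Picard

section LinearRecursion

variable {Ω : Type*} [MeasurableSpace Ω] {P : Measure Ω} [IsProbabilityMeasure P] {ε : ℤ → Ω → ℝ}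
  {p : ℕ} {L : ℝ → ℝ} {χ : Fin p → ℝ} {q : ℝ}

lemma isShift_innovation : IsShift P ε ε :=
  ⟨fun e => e 0, measurable_pi_apply 0, fun t => Eventually.of_forall fun ω => by simp [hist]⟩

lemma IsShift.lags_pred {x : ℤ → Ω → ℝ} (hx : IsShift P ε x) (r : ℕ) :
    IsShift P ε (fun t ω => LocStat.lags r (fun s => x s ω) (t - 1)) :=
  (hx.lags r).lag 1

lemma isShift_linear_step (hL : Measurable L) {x : ℤ → Ω → ℝ} (hx : IsShift P ε x) :
    IsShift P ε (fun t ω => L (ε t ω) * ∑ i, |lags p (fun s => x s ω) (t - 1) i| * χ i) :=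
  (isShift_innovation.prodMk (hx.lags_pred p)).comp
    (g := fun ay : ℝ × (Fin p → ℝ) => L ay.1 * ∑ i, |ay.2 i| * χ i) (by fun_prop)

lemma eLpNorm_linear_step_le (hε : IsIID P ε) (hL : Measurable L) (hL1 :
    eLpNorm (fun ω => L (ε 0 ω)) (ENNReal.ofReal q) P ≤ 1) (hq : 1 ≤ q) (hχ : ∀ i, 0 ≤ χ i)
    {x : ℤ → Ω → ℝ} (hx : IsShift P ε x) {c : ℝ}
    (hc : ∀ t, eLpNorm (x t) (ENNReal.ofReal q) P ≤ ENNReal.ofReal c) (t : ℤ) :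
    eLpNorm (fun ω => L (ε t ω) * ∑ i, |lags p (fun s => x s ω) (t - 1) i| * χ i)
      (ENNReal.ofReal q) P ≤ ENNReal.ofReal ((∑ i, χ i) * c) := by
  have hcon : Contracts P (ε 0) (fun a y => L a * ∑ i, |y i| * χ i) χ q := by
    intro y y'
    have h1 : (fun ω => L (ε 0 ω) * ∑ i, |y i| * χ i - L (ε 0 ω) * ∑ i, |y' i| * χ i) =
        (∑ i, |y i| * χ i - ∑ i, |y' i| * χ i) • fun ω => L (ε 0 ω) := by
      ext ω
      simp only [Pi.smul_apply, smul_eq_mul]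
      ring
    rw [h1]
    refine (eLpNorm_const_smul_le).trans ((mul_le_mul_right hL1 _).trans ?_)
    rw [mul_one, Real.enorm_eq_ofReal_abs, ← Finset.sum_sub_distrib]
    refine ENNReal.ofReal_le_ofReal ((Finset.abs_sum_le_sum_abs _ _).trans
      (Finset.sum_le_sum fun i _ => ?_))
    rw [← sub_mul, abs_mul, abs_of_nonneg (hχ i)]
    exact mul_le_mul_of_nonneg_right (abs_abs_sub_abs_le_abs_sub _ _) (hχ i)
  have h2 := hcon.eLpNorm_sub_le hε (by fun_prop) hq hχ (t := t) ((hx.lags p).causal (t - 1))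
    (causal_const (t - 1) (0 : Fin p → ℝ))
  simp only [Pi.zero_apply, abs_zero, zero_mul, Finset.sum_const_zero, mul_zero, sub_zero] at h2
  exact h2.trans (sum_ofReal_mul_le hχ fun i => hc _)

lemma isShift_linIter (hL : Measurable L) {x : ℤ → Ω → ℝ} (hx : IsShift P ε x) (k : ℕ) :
    IsShift P ε (fun t ω => linIter L χ (fun s => ε s ω) (fun s => x s ω) k t) := by
  induction k with
  | zero => exact hx
  | succ k ih => exact isShift_linear_step hL ih

lemma eLpNorm_linIter_le (hε : IsIID P ε) (hL : Measurable L) (hL1 :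
    eLpNorm (fun ω => L (ε 0 ω)) (ENNReal.ofReal q) P ≤ 1) (hq : 1 ≤ q) (hχ : ∀ i, 0 ≤ χ i)
    {x : ℤ → Ω → ℝ} (hx : IsShift P ε x) {c : ℝ}
    (hc : ∀ t, eLpNorm (x t) (ENNReal.ofReal q) P ≤ ENNReal.ofReal c) (k : ℕ) (t : ℤ) :
    eLpNorm (fun ω => linIter L χ (fun s => ε s ω) (fun s => x s ω) k t) (ENNReal.ofReal q) P ≤
      ENNReal.ofReal ((∑ i, χ i) ^ k * c) := by
  induction k generalizing t with
  | zero => simpa [linIter] using hc t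
  | succ k ih =>
    refine (eLpNorm_linear_step_le hε hL hL1 hq hχ (isShift_linIter hL hx k) ih t).trans_eq ?_
    rw [pow_succ']
    ring_nf

lemma IsShift.tsum {x : ℕ → ℤ → Ω → ℝ} (hx : ∀ k, IsShift P ε (x k)) (h0 : ∀ k t ω, 0 ≤ x k t ω) :
    IsShift P ε (fun t ω => ∑' k, x k t ω) := by
  have h1 := (IsShift.pi hx).comp (g := fun v : ℕ → ℝ => (∑' k, ENNReal.ofReal (v k)).toReal)
    (Measurable.ennreal_toReal (Measurable.tsum fun k =>
      (measurable_pi_apply k).ennreal_ofReal))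
  refine h1.congr fun t => Eventually.of_forall fun ω => ?_
  simp only
  rw [ENNReal.tsum_toReal_eq fun k => ENNReal.ofReal_ne_top]
  exact tsum_congr fun k => (ENNReal.toReal_ofReal (h0 k t ω)).symm

lemma summable_of_eLpNorm_geometric (hq : 1 ≤ q) {f : ℕ → Ω → ℝ} (hf : ∀ k, AEMeasurable (f k) P)
    (h0 : ∀ k ω, 0 ≤ f k ω) {ρ c : ℝ} (hρ0 : 0 ≤ ρ) (hρ : ρ < 1) (hc : 0 ≤ c)
    (h : ∀ k, eLpNorm (f k) (ENNReal.ofReal q) P ≤ ENNReal.ofReal (ρ ^ k * c)) :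
    (∀ᵐ ω ∂P, Summable fun k => f k ω) ∧
      eLpNorm (fun ω => ∑' k, f k ω) (ENNReal.ofReal q) P ≤ ENNReal.ofReal (c / (1 - ρ)) := by
  have hsum : Summable fun k => ρ ^ k * c := (summable_geometric_of_lt_one hρ0 hρ).mul_right c
  have hval : ∑' k, ρ ^ k * c = c / (1 - ρ) := by
    rw [tsum_mul_right, tsum_geometric_of_lt_one hρ0 hρ]
    field_simp
  have hs : ∀ᵐ ω ∂P, Summable fun k => f k ω := by
    have h1 : ∫⁻ ω, ∑' k, ENNReal.ofReal (f k ω) ∂P ≠ ∞ := by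
      rw [lintegral_tsum fun k => (hf k).ennreal_ofReal]
      refine ne_top_of_le_ne_top (b := ∑' k, ENNReal.ofReal (ρ ^ k * c)) ?_
        (ENNReal.tsum_le_tsum fun k => ?_)
      · rw [← ENNReal.ofReal_tsum_of_nonneg (fun k => by positivity) hsum]
        exact ENNReal.ofReal_ne_top
      · refine le_trans (le_trans (le_of_eq ?_) (eLpNorm_le_eLpNorm_of_exponent_le
          (one_le_ofReal hq) (hf k).aestronglyMeasurable)) (h k)
        rw [eLpNorm_one_eq_lintegral_enorm]
        exact lintegral_congr fun ω => (Real.enorm_eq_ofReal (h0 k ω)).symm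
    filter_upwards [ae_lt_top' (AEMeasurable.tsum fun k => (hf k).ennreal_ofReal) h1]
      with ω hω
    have h2 := ENNReal.summable_toReal hω.ne
    exact h2.congr fun k => ENNReal.toReal_ofReal (h0 k ω)
  refine ⟨hs, ?_⟩
  have hlim : ∀ᵐ ω ∂P, Tendsto (fun N : ℕ => ∑ k ∈ Finset.range N, f k ω) atTop
      (𝓝 (∑' k, f k ω)) := by
    filter_upwards [hs] with ω hω
    exact hω.hasSum.tendsto_sum_nat
  refine (Lp.eLpNorm_lim_le_liminf_eLpNorm (fun N => (Finset.aemeasurable_fun_sum _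
    fun k _ => hf k).aestronglyMeasurable) _ hlim).trans ?_
  refine (liminf_le_liminf (Eventually.of_forall fun N => ?_)).trans_eq
    (liminf_const (f := atTop (α := ℕ)) (ENNReal.ofReal (c / (1 - ρ))))
  have h3 : (fun ω => ∑ k ∈ Finset.range N, f k ω) = ∑ k ∈ Finset.range N, f k := by
    ext ω; simp
  rw [h3]
  refine (eLpNorm_sum_le (fun k _ => (hf k).aestronglyMeasurable) (one_le_ofReal hq)).trans ?_
  refine (Finset.sum_le_sum fun k _ => h k).trans ?_
  rw [← ENNReal.ofReal_sum_of_nonneg fun k _ => by positivity]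
  refine ENNReal.ofReal_le_ofReal ?_
  rw [← hval]
  exact hsum.sum_le_tsum _ fun k _ => by positivity

lemma Causal.eLpNorm_innovation_mul_le (hε : IsIID P ε) {B : ℝ → ℝ} (hB : Measurable B)
    (hq : 0 < q) {t : ℤ} {W : Ω → ℝ} (hW : Causal P ε (t - 1) W) :
    eLpNorm (fun ω => B (ε t ω) * W ω) (ENNReal.ofReal q) P ≤
      eLpNorm (fun ω => B (ε 0 ω)) (ENNReal.ofReal q) P * eLpNorm W (ENNReal.ofReal q) P := by
  set b := eLpNorm (fun ω => B (ε 0 ω)) (ENNReal.ofReal q) P with hb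
  have h1 := hW.eLpNorm_innovation_le hε hq (f := fun aw => B aw.1 * aw.2)
    ((hB.comp measurable_fst).mul measurable_snd) (g := fun w => ‖w‖ₑ * b) (fun w => by
      have : (fun ω => B (ε 0 ω) * w) = w • fun ω => B (ε 0 ω) := by
        ext ω; simp [mul_comm]
      simp only [this]
      exact eLpNorm_const_smul_le)
  refine h1.trans (le_of_eq ?_)
  rw [eLpNorm_eq_lintegral_rpow_enorm_toReal (ENNReal.ofReal_pos.2 hq).ne' ENNReal.ofReal_ne_top,
    eLpNorm_eq_lintegral_rpow_enorm_toReal (ENNReal.ofReal_pos.2 hq).ne' ENNReal.ofReal_ne_top,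
    ENNReal.toReal_ofReal hq.le]
  simp only [enorm_eq_self, ENNReal.mul_rpow_of_nonneg _ _ hq.le]
  rw [lintegral_mul_const'' _ ((hW.aemeasurable hε.measurable).enorm.pow_const _),
    ENNReal.mul_rpow_of_nonneg _ _ (by positivity : 0 ≤ 1 / q), ← ENNReal.rpow_mul,
    mul_one_div_cancel hq.ne', ENNReal.rpow_one, mul_comm]

/-- The sum of the linear iterates solves the inhomogeneous recursion. -/
lemma tsum_linIter_eq {e : ℤ → ℝ} (hL : ∀ a, 0 ≤ L a) (hχ : ∀ i, 0 ≤ χ i) {x : ℤ → ℝ}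
    (hx : ∀ t, 0 ≤ x t) (hs : ∀ t, Summable fun k => linIter L χ e x k t) (t : ℤ) :
    L (e t) * ∑ i, |lags p (fun s => ∑' k, linIter L χ e x k s) (t - 1) i| * χ i + x t =
      ∑' k, linIter L χ e x k t := by
  have h0 := fun k t => linIter_nonneg (e := e) hL hχ hx k t
  rw [(hs t).tsum_eq_zero_add]
  simp only [linIter]
  rw [add_comm, tsum_mul_left, Summable.tsum_finsetSum]
  · congr 2
    refine Finset.sum_congr rfl fun i _ => ?_
    rw [tsum_mul_right]
    congr 1
    simp only [lags]
    rw [abs_of_nonneg (tsum_nonneg fun k => h0 k _)]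
    exact tsum_congr fun k => (abs_of_nonneg (h0 k _)).symm
  · intro i _
    refine Summable.mul_right _ ?_
    simp only [lags]
    exact (hs _).congr fun k => (abs_of_nonneg (h0 k _)).symm

lemma tendsto_zero_of_contraction {m φ : ℕ → ℝ} {ρ : ℝ} (hm : ∀ k, 0 ≤ m k) (hρ0 : 0 ≤ ρ)
    (hρ : ρ < 1) (hφ : Tendsto φ atTop (𝓝 0)) (h : ∀ k, m (k + 1) ≤ ρ * m k + φ k) :
    Tendsto m atTop (𝓝 0) := by
  rw [Metric.tendsto_atTop]
  intro η hη
  obtain ⟨N, hN⟩ := eventually_atTop.1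
    (hφ.eventually_le_const (show (0 : ℝ) < η / 2 * (1 - ρ) by nlinarith))
  have h1 : ∀ j, m (N + j) ≤ ρ ^ j * m N + η / 2 := by
    intro j
    induction j with
    | zero => simp; positivity
    | succ j ih =>
      have h2 := h (N + j)
      have h3 := hN (N + j) (Nat.le_add_right _ _)
      have h4 := mul_le_mul_of_nonneg_left ih hρ0
      rw [pow_succ', ← add_assoc]
      nlinarith
  have h5 : Tendsto (fun j => ρ ^ j * m N) atTop (𝓝 0) := by
    simpa using (tendsto_pow_atTop_nhds_zero_of_lt_one hρ0 hρ).mul_const (m N)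
  obtain ⟨J, hJ⟩ := eventually_atTop.1 (h5.eventually_lt_const (half_pos hη))
  refine ⟨N + J, fun n hn => ?_⟩
  obtain ⟨j, rfl⟩ := Nat.exists_eq_add_of_le (show N ≤ n by lia)
  rw [Real.dist_eq, sub_zero, abs_of_nonneg (hm _)]
  have := hJ j (by lia)
  linarith [h1 j]

end LinearRecursion

section DominatingFunctions

variable {Ω : Type*} [MeasurableSpace Ω] {P : Measure Ω} [IsProbabilityMeasure P] {ε : ℤ → Ω → ℝ}
  {p : ℕ} {G : ℝ → (Fin p → ℝ) → ℝ → ℝ} {q : ℝ}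

/-- A measurable function of the innovations that dominates `N` almost surely. -/
lemma exists_dominating_lipschitz (hε : IsIID P ε) (hq : 1 ≤ q)
    {N : ℝ → (Fin p → ℝ) → (Fin p → ℝ) → ℝ → ℝ} {χ : Fin p → ℝ} (hχ : ∀ i, 0 ≤ χ i)
    (hNc : ∀ a, Continuous fun τ : Icc (0 : ℝ) 1 × (Fin p → ℝ) × (Fin p → ℝ) =>
      N a τ.2.1 τ.2.2 τ.1)
    (hNm : ∀ y y', ∀ u ∈ Icc (0 : ℝ) 1, Measurable fun a => N a y y' u)
    (hN0 : ∀ a y u, N a y y u = 0) {c : ℝ≥0∞} (hc : c < ∞)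
    (h : eLpNorm (fun ω => ⨆ u ∈ Icc (0 : ℝ) 1, ⨆ (y : Fin p → ℝ) (y' : Fin p → ℝ) (_ : y ≠ y'),
      ENNReal.ofReal (N (ε 0 ω) y y' u) / ENNReal.ofReal (wnorm χ (min q 1) (y - y')))
      (ENNReal.ofReal q) P ≤ c) :
    ∃ (L : ℝ → ℝ) (s : Set ℝ), Measurable L ∧ (∀ a, 0 ≤ L a) ∧ MeasurableSet s ∧
      (∀ᵐ ω ∂P, ε 0 ω ∈ s) ∧ eLpNorm (fun ω => L (ε 0 ω)) (ENNReal.ofReal q) P ≤ c ∧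
      ∀ a ∈ s, ∀ u ∈ Icc (0 : ℝ) 1, ∀ y y', N a y y' u ≤ L a * ∑ i, |y i - y' i| * χ i := by
  have hΦ : ∀ ω (τ : Icc (0 : ℝ) 1 × (Fin p → ℝ) × (Fin p → ℝ)),
      ENNReal.ofReal (N (ε 0 ω) τ.2.1 τ.2.2 τ.1) /
        ENNReal.ofReal (∑ i, |τ.2.1 i - τ.2.2 i| * χ i) ≤
      ⨆ u ∈ Icc (0 : ℝ) 1, ⨆ (y : Fin p → ℝ) (y' : Fin p → ℝ) (_ : y ≠ y'),
        ENNReal.ofReal (N (ε 0 ω) y y' u) / ENNReal.ofReal (wnorm χ (min q 1) (y - y')) := by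
    rintro ω ⟨⟨u, hu⟩, y, y'⟩
    rcases eq_or_ne y y' with rfl | hyy
    · simp [hN0]
    · refine le_iSup₂_of_le u hu (le_iSup₂_of_le y y' (le_iSup_of_le hyy (le_of_eq ?_)))
      rw [min_eq_right hq, wnorm_one]
      rfl
  obtain ⟨L, s, hL, hL0, hs, hes, hLc, hb⟩ := exists_measurable_dominating
    (T := Icc (0 : ℝ) 1 × (Fin p → ℝ) × (Fin p → ℝ)) (hε.measurable 0)
    (N := fun a τ => N a τ.2.1 τ.2.2 τ.1) (W := fun τ => ∑ i, |τ.2.1 i - τ.2.2 i| * χ i) hNc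
    (by fun_prop) (fun τ => hNm _ _ _ τ.1.2)
    (fun τ => Finset.sum_nonneg fun i _ => mul_nonneg (abs_nonneg _) (hχ i)) hΦ
    (zero_lt_one.trans_le hq) h hc
  exact ⟨L, s, hL, hL0, hs, hes, hLc, fun a ha u hu y y' => hb a ha (⟨u, hu⟩, y, y')⟩

lemma exists_dominating_base (hε : IsIID P ε) (hq : 1 ≤ q) {N : ℝ → ℝ → ℝ}
    (hNc : ∀ a, Continuous fun τ : Icc (0 : ℝ) 1 => N a τ)
    (hNm : ∀ u ∈ Icc (0 : ℝ) 1, Measurable fun a => N a u)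
    (h : eLpNorm (fun ω => ⨆ u ∈ Icc (0 : ℝ) 1, ENNReal.ofReal (N (ε 0 ω) u))
      (ENNReal.ofReal q) P < ∞) :
    ∃ (L : ℝ → ℝ) (s : Set ℝ), Measurable L ∧ (∀ a, 0 ≤ L a) ∧ MeasurableSet s ∧
      (∀ᵐ ω ∂P, ε 0 ω ∈ s) ∧ eLpNorm (fun ω => L (ε 0 ω)) (ENNReal.ofReal q) P < ∞ ∧
      ∀ a ∈ s, ∀ u ∈ Icc (0 : ℝ) 1, N a u ≤ L a := by
  have hΦ : ∀ ω (τ : Icc (0 : ℝ) 1), ENNReal.ofReal (N (ε 0 ω) τ) / ENNReal.ofReal 1 ≤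
      ⨆ u ∈ Icc (0 : ℝ) 1, ENNReal.ofReal (N (ε 0 ω) u) := by
    intro ω τ
    simp only [ENNReal.ofReal_one, div_one]
    exact le_iSup₂_of_le (τ : ℝ) τ.2 le_rfl
  obtain ⟨L, s, hL, hL0, hs, hes, hLc, hb⟩ := exists_measurable_dominating
    (T := Icc (0 : ℝ) 1) (hε.measurable 0) (N := fun a τ => N a τ) (W := fun _ => 1) hNc
    continuous_const (fun τ => hNm _ τ.2) (fun _ => zero_le_one) hΦ
    (zero_lt_one.trans_le hq) le_rfl h
  exact ⟨L, s, hL, hL0, hs, hes, hLc.trans_lt h, fun a ha u hu => by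
    simpa using hb a ha ⟨u, hu⟩⟩

lemma ae_forall_innovation_mem (hε : IsIID P ε) {s : Set ℝ} (hs : MeasurableSet s)
    (h : ∀ᵐ ω ∂P, ε 0 ω ∈ s) : ∀ᵐ ω ∂P, ∀ t, ε t ω ∈ s := by
  rw [ae_all_iff]
  intro t
  exact (hε.identDistrib 0 t).ae_mem_snd hs h

lemma continuous_strip {f : (Fin p → ℝ) × ℝ → ℝ} (hf : ContinuousOn f (univ ×ˢ Icc (0 : ℝ) 1))
    {T : Type*} [TopologicalSpace T] {y : T → Fin p → ℝ} {u : T → Icc (0 : ℝ) 1}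
    (hy : Continuous y) (hu : Continuous u) : Continuous fun τ => f (y τ, u τ) :=
  hf.comp_continuous (hy.prodMk (continuous_subtype_val.comp hu)) fun τ => ⟨mem_univ _, (u τ).2⟩

/-- The innovation paths satisfy the smoothness bounds with dominating functions in `L^q`. -/
lemma exists_goodPath (hε : IsIID P ε)
    (hGm : ∀ u ∈ Icc (0 : ℝ) 1, Measurable fun ay : ℝ × (Fin p → ℝ) => G ay.1 ay.2 u) (hq : 1 ≤ q)
    {q₂ : ℝ} (hq₂ : q ≤ q₂) (hL2 : CondL2 P (ε 0) G q₂) (hL3 : CondL3 P (ε 0) G q) :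
    ∃ (χ y₀ y₁ : Fin p → ℝ) (L A A' B₁ B₂ : ℝ → ℝ), IsWeight χ ∧
      Measurable L ∧ Measurable A ∧ Measurable A' ∧ Measurable B₁ ∧ Measurable B₂ ∧
      eLpNorm (fun ω => L (ε 0 ω)) (ENNReal.ofReal q) P ≤ 1 ∧
      eLpNorm (fun ω => A (ε 0 ω)) (ENNReal.ofReal q) P < ∞ ∧
      eLpNorm (fun ω => A' (ε 0 ω)) (ENNReal.ofReal q) P < ∞ ∧
      eLpNorm (fun ω => B₂ (ε 0 ω)) (ENNReal.ofReal q) P < ∞ ∧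
      ∀ᵐ ω ∂P, GoodPath G χ y₀ y₁ L A A' B₁ B₂ (fun t => ε t ω) := by
  obtain ⟨hcont, χ, y₀, hχ, hA, hU⟩ := hL2
  obtain ⟨hC1, ⟨y₁, hA'⟩, hB₁, hB₂, -⟩ := hL3
  have hGm' : ∀ y, ∀ u ∈ Icc (0 : ℝ) 1, Measurable fun a => G a y u := fun y u hu =>
    (hGm u hu).comp (measurable_id.prodMk measurable_const)
  have hq₂1 : 1 ≤ q₂ := hq.trans hq₂
  obtain ⟨L, s1, hLm, hL0, hs1, he1, hLn, hL⟩ := exists_dominating_lipschitz hε hq₂1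
    (N := fun a y y' u => |G a y u - G a y' u|) hχ.1
    (fun a => ((continuous_strip (hcont a) (continuous_fst.comp continuous_snd)
      continuous_fst).sub (continuous_strip (hcont a) (continuous_snd.comp continuous_snd)
      continuous_fst)).abs)
    (fun y y' u hu => (((hGm' y u hu).sub (hGm' y' u hu))).abs) (by simp) ENNReal.one_lt_top hU
  obtain ⟨A, s2, hAm, hA0, hs2, he2, hAn, hA⟩ := exists_dominating_base hε hq₂1
    (N := fun a u => |G a y₀ u|)
    (fun a => (continuous_strip (hcont a) continuous_const continuous_id).abs)
    (fun u hu => (hGm' y₀ u hu).abs) hA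
  obtain ⟨A', s3, hA'm, hA'0, hs3, he3, hA'n, hA'⟩ := exists_dominating_base hε hq
    (N := fun a u => |dG2 G a y₁ u|)
    (fun a => (continuous_strip (continuousOn_dG2 (hC1 a)) continuous_const continuous_id).abs)
    (fun u hu => (measurable_dG2 hGm hC1 y₁ hu).abs) hA'
  obtain ⟨B₁, s4, hB₁m, hB₁0, hs4, he4, -, hB₁⟩ := exists_dominating_lipschitz hε hq
    (N := fun a y y' u => l1 (fun i => dG1 G a y u i - dG1 G a y' u i)) (χ := fun _ => 1)
    (fun _ => zero_le_one)
    (fun a => continuous_finsetSum _ fun i _ => ((continuous_strip (continuousOn_dG1 (hC1 a) i)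
      (continuous_fst.comp continuous_snd) continuous_fst).sub (continuous_strip
      (continuousOn_dG1 (hC1 a) i) (continuous_snd.comp continuous_snd) continuous_fst)).abs)
    (fun y y' u hu => Finset.measurable_fun_sum _ fun i _ =>
      ((measurable_dG1 hGm hC1 y hu i).sub (measurable_dG1 hGm hC1 y' hu i)).abs)
    (by simp [l1]) hB₁ le_rfl
  obtain ⟨B₂, s5, hB₂m, hB₂0, hs5, he5, hB₂n, hB₂'⟩ := exists_dominating_lipschitz hε hq
    (N := fun a y y' u => |dG2 G a y u - dG2 G a y' u|) (χ := fun _ => 1)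
    (fun _ => zero_le_one)
    (fun a => ((continuous_strip (continuousOn_dG2 (hC1 a)) (continuous_fst.comp continuous_snd)
      continuous_fst).sub (continuous_strip (continuousOn_dG2 (hC1 a))
      (continuous_snd.comp continuous_snd) continuous_fst)).abs)
    (fun y y' u hu => ((measurable_dG2 hGm hC1 y hu).sub (measurable_dG2 hGm hC1 y' hu)).abs)
    (by simp) hB₂ le_rfl
  have hmono : ∀ {f : ℝ → ℝ}, Measurable f → eLpNorm (fun ω => f (ε 0 ω)) (ENNReal.ofReal q) P ≤
      eLpNorm (fun ω => f (ε 0 ω)) (ENNReal.ofReal q₂) P := fun hf =>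
    eLpNorm_le_eLpNorm_of_exponent_le (ENNReal.ofReal_le_ofReal hq₂)
      (hf.comp (hε.measurable 0)).aestronglyMeasurable
  refine ⟨χ, y₀, y₁, L, A, A', B₁, B₂, hχ, hLm, hAm, hA'm, hB₁m, hB₂m, (hmono hLm).trans hLn,
    (hmono hAm).trans_lt hAn, hA'n, hB₂n.trans_lt hB₂, ?_⟩
  filter_upwards [ae_forall_innovation_mem hε hs1 he1, ae_forall_innovation_mem hε hs2 he2,
    ae_forall_innovation_mem hε hs3 he3, ae_forall_innovation_mem hε hs4 he4,
    ae_forall_innovation_mem hε hs5 he5] with ω h1 h2 h3 h4 h5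
  exact
    { weight_nonneg := hχ.1
      L_nonneg := hL0
      A_nonneg := hA0
      A'_nonneg := hA'0
      B₁_nonneg := hB₁0
      B₂_nonneg := hB₂0
      smooth := hC1
      lip := fun t u hu y y' => hL _ (h1 t) u hu y y'
      base := fun t u hu => hA _ (h2 t) u hu
      base' := fun t u hu => hA' _ (h3 t) u hu
      lip₁ := fun t u hu y y' => (hB₁ _ (h4 t) u hu y y').trans_eq (by simp [l1])
      lip₂ := fun t u hu y y' => (hB₂' _ (h5 t) u hu y y').trans_eq (by simp [l1]) }

end DominatingFunctions

section SmoothVersion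

variable {Ω : Type*} [MeasurableSpace Ω] {P : Measure Ω} [IsProbabilityMeasure P] {ε : ℤ → Ω → ℝ}
  {p : ℕ} {G : ℝ → (Fin p → ℝ) → ℝ → ℝ} {Xt : ℤ → ℝ → Ω → ℝ} {q : ℝ}

/-- Bounds for the increments of the derivatives of the Picard iterates. -/
def derivErr (L A B₁ B₂ : ℝ → ℝ) (χ y₀ : Fin p → ℝ) (e : ℤ → ℝ) (D : ℤ → ℝ) : ℕ → ℤ → ℝ
  | 0, t => D t
  | k + 1, t => L (e t) * ∑ i, |lags p (fun s => derivErr L A B₁ B₂ χ y₀ e D k s) (t - 1) i| * χ i +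
      derivPert L A B₁ B₂ χ y₀ e D k t

lemma IsShift.exists_eLpNorm_le (hε : IsIID P ε) {x : ℤ → Ω → ℝ} (hx : IsShift P ε x) {r : ℝ≥0∞}
    (h : eLpNorm (x 0) r P < ∞) : ∃ c : ℝ, 0 ≤ c ∧ ∀ t, eLpNorm (x t) r P ≤ ENNReal.ofReal c :=
  ⟨(eLpNorm (x 0) r P).toReal, ENNReal.toReal_nonneg, fun t => by
    rw [ENNReal.ofReal_toReal h.ne, hx.eLpNorm_eq hε r t 0]⟩

lemma measurable_l1 {r : ℕ} : Measurable (l1 : (Fin r → ℝ) → ℝ) := continuous_l1.measurable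

lemma tendsto_incrTail {L A : ℝ → ℝ} {χ y₀ : Fin p → ℝ} {e : ℤ → ℝ} (t : ℤ) :
    Tendsto (fun k => incrTail L A χ y₀ e k t) atTop (𝓝 0) := by
  have := tendsto_sum_nat_add fun k => linIter L χ e (incrBound L A χ y₀ e) k t
  simpa only [incrTail, add_comm] using this

lemma tendsto_l1_lags_incrTail {L A : ℝ → ℝ} {χ y₀ : Fin p → ℝ} {e : ℤ → ℝ} (t : ℤ) :
    Tendsto (fun k => l1 (lags p (incrTail L A χ y₀ e k) t)) atTop (𝓝 0) := by
  have h1 : Tendsto (fun k => ∑ i : Fin p, |incrTail L A χ y₀ e k (t - (i : ℕ))|) atTop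
      (𝓝 (∑ _i : Fin p, |(0 : ℝ)|)) :=
    tendsto_finsetSum _ fun i _ => (tendsto_incrTail _).abs
  simpa [l1, lags] using h1

lemma ae_exists_lt_of_eLpNorm {f : ℕ → Ω → ℝ} (hf : ∀ k, AEMeasurable (f k) P) {μ : ℕ → ℝ}
    (hμ : Tendsto μ atTop (𝓝 0)) (h : ∀ k, eLpNorm (f k) 1 P ≤ ENNReal.ofReal (μ k)) :
    ∀ᵐ ω ∂P, ∀ η : ℝ, 0 < η → ∃ k, f k ω < η := by
  have h1 : ∫⁻ ω, ⨅ k, ‖f k ω‖ₑ ∂P = 0 := by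
    have h2 := ENNReal.tendsto_ofReal hμ
    rw [ENNReal.ofReal_zero] at h2
    refine le_antisymm (ge_of_tendsto' h2 fun k => le_trans (lintegral_mono fun ω => ?_)
      (eLpNorm_one_eq_lintegral_enorm.ge.trans (h k)))
      zero_le
    exact iInf_le _ k
  rw [lintegral_eq_zero_iff' (AEMeasurable.iInf fun k => (hf k).enorm)] at h1
  filter_upwards [h1] with ω hω η hη
  have h3 : ⨅ k, ‖f k ω‖ₑ < ENNReal.ofReal η := by
    rw [show ⨅ k, ‖f k ω‖ₑ = 0 from hω]
    exact ENNReal.ofReal_pos.2 hη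
  obtain ⟨k, hk⟩ := iInf_lt_iff.1 h3
  refine ⟨k, ?_⟩
  rw [Real.enorm_eq_ofReal_abs, ENNReal.ofReal_lt_ofReal_iff hη] at hk
  exact (le_abs_self _).trans_lt hk

/-- The Picard iterates converge to the stationary solution. -/
lemma IsStationarySolution.ae_eq_limit (hε : IsIID P ε)
    (hGm : ∀ u ∈ Icc (0 : ℝ) 1, Measurable fun ay : ℝ × (Fin p → ℝ) => G ay.1 ay.2 u)
    (hXt : IsStationarySolution P ε G Xt) (hq : 1 ≤ q) {χ : Fin p → ℝ} (hχ : IsWeight χ) {u : ℝ}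
    (hu : u ∈ Icc (0 : ℝ) 1) (hcon : Contracts P (ε 0) (fun a y => G a y u) χ q) {B : ℝ}
    (hB : ∀ t, eLpNorm (Xt t u) (ENNReal.ofReal q) P ≤ ENNReal.ofReal B) {Xh : ℤ → Ω → ℝ}
    (hlim : ∀ t, ∀ᵐ ω ∂P, Tendsto (fun k => picard G (fun s => ε s ω) k t u) atTop (𝓝 (Xh t ω)))
    (t : ℤ) : Xh t =ᵐ[P] Xt t u := by
  have hsh : ∀ k, IsShift P ε (fun t ω => picard G (fun s => ε s ω) k t u) := by
    intro k
    induction k with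
    | zero => exact ⟨fun _ => 0, measurable_const, fun t => Eventually.of_forall fun ω => rfl⟩
    | succ k ih =>
      exact (isShift_innovation.prodMk (ih.lags_pred p)).comp (hGm u hu)
  have hXs := hXt.isShift hu
  have hbound : ∀ k t, eLpNorm (fun ω => picard G (fun s => ε s ω) k t u - Xt t u ω)
      (ENNReal.ofReal q) P ≤ ENNReal.ofReal ((∑ i, χ i) ^ k * B) := by
    intro k
    induction k with
    | zero =>
      intro t
      simp only [picard, zero_sub, pow_zero, one_mul]
      exact (eLpNorm_neg (Xt t u) _ _).trans_le (hB t)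
    | succ k ih =>
      intro t
      have h1 := hcon.eLpNorm_sub_le hε (hGm u hu) hq hχ.1 (t := t)
        (((hsh k).lags p).causal (t - 1)) ((hXs.lags p).causal (t - 1))
      have h2 : eLpNorm (fun ω => picard G (fun s => ε s ω) (k + 1) t u - Xt t u ω)
          (ENNReal.ofReal q) P = _ := eLpNorm_congr_ae (g := fun ω =>
            G (ε t ω) (lags p (fun s => picard G (fun s => ε s ω) k s u) (t - 1)) u -
            G (ε t ω) (lags p (fun s => Xt s u ω) (t - 1)) u) (by
          filter_upwards [hXt.recursion u hu t] with ω hω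
          rw [picard, hω])
      rw [h2]
      refine h1.trans ((sum_ofReal_mul_le hχ.1 fun i => ih _).trans_eq ?_)
      rw [pow_succ']
      ring_nf
  have hXm : ∀ t, AEMeasurable (Xt t u) P := fun t => (hXs.causal t).aemeasurable hε.measurable
  have hpm : ∀ k, AEMeasurable (fun ω => picard G (fun s => ε s ω) k t u) P := fun k =>
    ((hsh k).causal t).aemeasurable hε.measurable
  have hXhm : AEMeasurable (Xh t) P := aemeasurable_of_tendsto_metrizable_ae atTop hpm (hlim t)
  have h0 : eLpNorm (fun ω => Xh t ω - Xt t u ω) (ENNReal.ofReal q) P = 0 := by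
    refine le_antisymm ((Lp.eLpNorm_lim_le_liminf_eLpNorm
      (f := fun k ω => picard G (fun s => ε s ω) k t u - Xt t u ω)
      (fun k => ((hpm k).sub (hXm t)).aestronglyMeasurable) _ ?_).trans ?_) zero_le
    · filter_upwards [hlim t] with ω hω
      exact hω.sub_const _
    · have h1 : Tendsto (fun k => ENNReal.ofReal ((∑ i, χ i) ^ k * B)) atTop (𝓝 0) := by
        have h2 := (tendsto_pow_atTop_nhds_zero_of_lt_one
          (Finset.sum_nonneg fun i _ => hχ.1 i) hχ.2).mul_const B
        have h3 := ENNReal.tendsto_ofReal h2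
        simpa using h3
      exact (liminf_le_liminf (Eventually.of_forall fun k => hbound k t)).trans_eq h1.liminf_eq
  have h4 := (eLpNorm_eq_zero_iff (f := fun ω => Xh t ω - Xt t u ω)
    (hXhm.sub (hXm t)).aestronglyMeasurable
    (ENNReal.ofReal_pos.2 (zero_lt_one.trans_le hq)).ne').1 h0
  filter_upwards [h4] with ω hω
  exact sub_eq_zero.1 hω

lemma contracts_of_goodPath {χ y₀ y₁ : Fin p → ℝ} {L A A' B₁ B₂ : ℝ → ℝ} (hχ : ∀ i, 0 ≤ χ i)
    (hL : eLpNorm (fun ω => L (ε 0 ω)) (ENNReal.ofReal q) P ≤ 1)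
    (hgood : ∀ᵐ ω ∂P, GoodPath G χ y₀ y₁ L A A' B₁ B₂ fun t => ε t ω) {u : ℝ}
    (hu : u ∈ Icc (0 : ℝ) 1) : Contracts P (ε 0) (fun a y => G a y u) χ q := by
  intro y y'
  set c := ∑ i, |y i - y' i| * χ i with hc
  have hc0 : 0 ≤ c := Finset.sum_nonneg fun i _ => mul_nonneg (abs_nonneg _) (hχ i)
  have h1 : eLpNorm (fun ω => G (ε 0 ω) y u - G (ε 0 ω) y' u) (ENNReal.ofReal q) P ≤
      eLpNorm (c • fun ω => L (ε 0 ω)) (ENNReal.ofReal q) P := by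
    refine eLpNorm_mono_ae ?_
    filter_upwards [hgood] with ω hω
    rw [Real.norm_eq_abs, Real.norm_eq_abs]
    refine (hω.lip 0 u hu y y').trans (le_trans (le_of_eq ?_) (le_abs_self _))
    rw [Pi.smul_apply, smul_eq_mul, mul_comm]
  refine h1.trans ?_
  rw [eLpNorm_const_smul, Real.enorm_eq_ofReal hc0]
  exact (mul_le_mul_right hL _).trans_eq (mul_one _)

/-- The stationary solution has a continuously differentiable modification, with a Lipschitz
constant in `L^q`. -/
lemma exists_smooth_modification (hε : IsIID P ε)
    (hGm : ∀ u ∈ Icc (0 : ℝ) 1, Measurable fun ay : ℝ × (Fin p → ℝ) => G ay.1 ay.2 u)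
    (hXt : IsStationarySolution P ε G Xt) (hq : 1 ≤ q) {q₂ : ℝ} (hq₂ : q ≤ q₂) {B : ℝ}
    (hB : ∀ u ∈ Icc (0 : ℝ) 1, ∀ t, eLpNorm (Xt t u) (ENNReal.ofReal q) P ≤ ENNReal.ofReal B)
    (hL2 : CondL2 P (ε 0) G q₂) (hL3 : CondL3 P (ε 0) G q) :
    ∃ (Xh : ℤ → ℝ → Ω → ℝ) (D : ℤ → Ω → ℝ) (C : ℝ), IsC1Modification P Xt Xh ∧ 0 ≤ C ∧
      IsShift P ε D ∧ (∀ t ω, 0 ≤ D t ω) ∧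
      (∀ t, eLpNorm (D t) (ENNReal.ofReal q) P ≤ ENNReal.ofReal C) ∧
      ∀ t, ∀ᵐ ω ∂P, ∀ u ∈ Icc (0 : ℝ) 1, ∀ v ∈ Icc (0 : ℝ) 1,
        |Xh t v ω - Xh t u ω| ≤ D t ω * |v - u| := by
  obtain ⟨χ, y₀, y₁, L, A, A', B₁, B₂, hχ, hLm, hAm, hA'm, hB₁m, hB₂m, hLn, hAn, hA'n, hB₂n, hgood⟩ :=
    exists_goodPath hε hGm hq hq₂ hL2 hL3
  obtain ⟨ω₀, g₀⟩ := hgood.exists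
  have hq0 : 0 < q := zero_lt_one.trans_le hq
  have hq1 : (1 : ℝ≥0∞) ≤ ENNReal.ofReal q := one_le_ofReal hq
  have hρ0 : 0 ≤ ∑ i, χ i := Finset.sum_nonneg fun i _ => hχ.1 i
  have hmeas : ∀ {x : ℤ → Ω → ℝ}, IsShift P ε x → ∀ t, AEMeasurable (x t) P := fun hx t =>
    (hx.causal t).aemeasurable hε.measurable
  have hmono : ∀ {f : Ω → ℝ}, AEMeasurable f P → eLpNorm f 1 P ≤ eLpNorm f (ENNReal.ofReal q) P :=
    fun hf => eLpNorm_le_eLpNorm_of_exponent_le hq1 hf.aestronglyMeasurable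
  set a₀ : ℤ → Ω → ℝ := fun t ω => incrBound L A χ y₀ (fun s => ε s ω) t with ha₀
  have ha₀s : IsShift P ε a₀ := isShift_innovation.comp
    (g := fun a => A a + L a * ∑ i, |y₀ i| * χ i) (hAm.add (hLm.mul_const _))
  obtain ⟨c₀, hc₀, ha₀n⟩ := ha₀s.exists_eLpNorm_le hε (r := ENNReal.ofReal q) (by
    have h1 : MemLp (fun ω => A (ε 0 ω)) (ENNReal.ofReal q) P :=
      ⟨(hAm.comp (hε.measurable 0)).aestronglyMeasurable, hAn⟩
    have h2 : MemLp (fun ω => L (ε 0 ω)) (ENNReal.ofReal q) P :=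
      ⟨(hLm.comp (hε.measurable 0)).aestronglyMeasurable, hLn.trans_lt ENNReal.one_lt_top⟩
    exact (h1.add (h2.mul_const (∑ i, |y₀ i| * χ i))).2)
  have ha0 : ∀ k t ω, 0 ≤ linIter L χ (fun s => ε s ω) (fun s => a₀ s ω) k t := fun k t ω =>
    linIter_nonneg g₀.L_nonneg hχ.1 (fun t => add_nonneg (g₀.A_nonneg _) (mul_nonneg (g₀.L_nonneg _)
      (Finset.sum_nonneg fun i _ => mul_nonneg (abs_nonneg _) (hχ.1 i)))) k t
  have hgeo := fun t => summable_of_eLpNorm_geometric hq (fun k => hmeas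
    (isShift_linIter (χ := χ) hLm ha₀s k) t) (fun k ω => ha0 k t ω) hρ0 hχ.2 hc₀
    (fun k => eLpNorm_linIter_le hε hLm hLn hq hχ.1 ha₀s ha₀n k t)
  have hsum : ∀ᵐ ω ∂P, ∀ t, Summable fun k => linIter L χ (fun s => ε s ω)
      (incrBound L A χ y₀ fun s => ε s ω) k t := ae_all_iff.2 fun t => (hgeo t).1
  set R : ℕ → ℤ → Ω → ℝ := fun k t ω => incrTail L A χ y₀ (fun s => ε s ω) k t with hR
  have hRs : ∀ k, IsShift P ε (R k) := fun k =>
    IsShift.tsum (fun j => isShift_linIter hLm ha₀s (k + j)) fun j t ω => ha0 (k + j) t ω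
  have hRn : ∀ t, eLpNorm (R 0 t) (ENNReal.ofReal q) P ≤
      ENNReal.ofReal (c₀ / (1 - ∑ i, χ i)) := by
    intro t
    have := (hgeo t).2
    simpa only [hR, incrTail, zero_add] using this
  have hR0 : ∀ k t ω, 0 ≤ R k t ω := fun k t ω => tsum_nonneg fun j => ha0 (k + j) t ω
  set cb : ℤ → Ω → ℝ := fun t ω => derivBound L A A' B₂ χ y₀ y₁ (fun s => ε s ω) t with hcb
  have hcbs : IsShift P ε cb := (isShift_innovation.prodMk ((hRs 0).lags_pred p)).comp
    (g := fun ay : ℝ × (Fin p → ℝ) => A' ay.1 + B₂ ay.1 * (l1 ay.2 + l1 y₁))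
    ((hA'm.comp measurable_fst).add ((hB₂m.comp measurable_fst).mul
      ((measurable_l1.comp measurable_snd).add_const _)))
  have hB₂W : ∀ c : ℝ, eLpNorm (fun ω => B₂ (ε 0 ω) *
      (l1 (lags p (fun s => R 0 s ω) (0 - 1)) + c)) (ENNReal.ofReal q) P < ∞ := by
    intro c
    have hW : Causal P ε (0 - 1) (fun ω => l1 (lags p (fun s => R 0 s ω) (0 - 1)) + c) :=
      (((hRs 0).lags p).causal (0 - 1)).comp (measurable_l1.add_const _)
    refine (hW.eLpNorm_innovation_mul_le hε hB₂m hq0).trans_lt (ENNReal.mul_lt_top hB₂n ?_)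
    have h1 : MemLp (fun ω => l1 (lags p (fun s => R 0 s ω) (0 - 1))) (ENNReal.ofReal q) P :=
      ⟨(measurable_l1.comp_aemeasurable ((((hRs 0).lags p).causal (0 - 1)).aemeasurable
        hε.measurable)).aestronglyMeasurable, (eLpNorm_l1_le hq
        ((((hRs 0).lags p).causal (0 - 1)).aemeasurable hε.measurable)
        fun i => hRn _).trans_lt ENNReal.ofReal_lt_top⟩
    exact (h1.add (memLp_const c)).2
  obtain ⟨c₁, hc₁, hcbn⟩ := hcbs.exists_eLpNorm_le hε (r := ENNReal.ofReal q) (by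
    have h1 : MemLp (fun ω => A' (ε 0 ω)) (ENNReal.ofReal q) P :=
      ⟨(hA'm.comp (hε.measurable 0)).aestronglyMeasurable, hA'n⟩
    have h2 : AEStronglyMeasurable (fun ω => B₂ (ε 0 ω) *
        (l1 (lags p (fun s => R 0 s ω) (0 - 1)) + l1 y₁)) P :=
      ((hB₂m.comp (hε.measurable 0)).aemeasurable.mul ((measurable_l1.comp_aemeasurable
        ((((hRs 0).lags p).causal (0 - 1)).aemeasurable hε.measurable)).add_const
          _)).aestronglyMeasurable
    exact (h1.add ⟨h2, hB₂W (l1 y₁)⟩).2)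
  have hcb0 : ∀ t ω, 0 ≤ cb t ω := fun t ω => add_nonneg (g₀.A'_nonneg _)
    (mul_nonneg (g₀.B₂_nonneg _) (add_nonneg (l1_nonneg _) (l1_nonneg _)))
  have hD0' : ∀ k t ω, 0 ≤ linIter L χ (fun s => ε s ω) (fun s => cb s ω) k t := fun k t ω =>
    linIter_nonneg g₀.L_nonneg hχ.1 (fun t => hcb0 t ω) k t
  have hgeoD := fun t => summable_of_eLpNorm_geometric hq (fun k => hmeas
    (isShift_linIter (χ := χ) hLm hcbs k) t) (fun k ω => hD0' k t ω) hρ0 hχ.2 hc₁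
    (fun k => eLpNorm_linIter_le hε hLm hLn hq hχ.1 hcbs hcbn k t)
  set D : ℤ → Ω → ℝ := fun t ω => ∑' k, linIter L χ (fun s => ε s ω) (fun s => cb s ω) k t with hD
  have hDs : IsShift P ε D := IsShift.tsum (fun k => isShift_linIter hLm hcbs k) hD0'
  have hD0 : ∀ t ω, 0 ≤ D t ω := fun t ω => tsum_nonneg fun k => hD0' k t ω
  set C := c₁ / (1 - ∑ i, χ i) with hC
  have hC0 : 0 ≤ C := div_nonneg hc₁ (by linarith [hχ.2])
  have hDn : ∀ t, eLpNorm (D t) (ENNReal.ofReal q) P ≤ ENNReal.ofReal C := fun t => (hgeoD t).2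
  have hDrec : ∀ᵐ ω ∂P, ∀ t, L (ε t ω) * ∑ i, |lags p (fun s => D s ω) (t - 1) i| * χ i +
      derivBound L A A' B₂ χ y₀ y₁ (fun s => ε s ω) t ≤ D t ω := by
    have h1 : ∀ᵐ ω ∂P, ∀ t, Summable fun k => linIter L χ (fun s => ε s ω)
      (fun s => cb s ω) k t := ae_all_iff.2 fun t => (hgeoD t).1
    filter_upwards [h1] with ω hω t
    exact (tsum_linIter_eq (e := fun s => ε s ω) g₀.L_nonneg hχ.1 (fun t => hcb0 t ω) hω t).le
  set Pt : ℕ → ℤ → Ω → ℝ := fun k t ω =>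
    derivPert L A B₁ B₂ χ y₀ (fun s => ε s ω) (fun s => D s ω) k t with hPt
  have hPts : ∀ k, IsShift P ε (Pt k) := fun k =>
    (isShift_innovation.prodMk (((hRs k).lags_pred p).prodMk (hDs.lags_pred p))).comp
    (g := fun ay : ℝ × (Fin p → ℝ) × (Fin p → ℝ) =>
      min (B₁ ay.1 * l1 ay.2.1 * l1 ay.2.2) (2 * (L ay.1 * ∑ i, |ay.2.2 i| * χ i)) +
      B₂ ay.1 * l1 ay.2.1) (by
      have m1 : Measurable fun ay : ℝ × (Fin p → ℝ) × (Fin p → ℝ) => l1 ay.2.1 :=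
        measurable_l1.comp (measurable_fst.comp measurable_snd)
      have m2 : Measurable fun ay : ℝ × (Fin p → ℝ) × (Fin p → ℝ) => l1 ay.2.2 :=
        measurable_l1.comp (measurable_snd.comp measurable_snd)
      fun_prop)
  set bd : Ω → ℝ := fun ω => 2 * (L (ε 0 ω) * ∑ i, |lags p (fun s => D s ω) (0 - 1) i| * χ i) +
    B₂ (ε 0 ω) * (l1 (lags p (fun s => R 0 s ω) (0 - 1)) + 0) with hbd
  have hbdm : MemLp bd 1 P := by
    have h1 := (isShift_linear_step (χ := χ) hLm hDs)
    have h2 := eLpNorm_linear_step_le hε hLm hLn hq hχ.1 hDs hDn 0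
    have h3 : MemLp (fun ω => L (ε 0 ω) * ∑ i, |lags p (fun s => D s ω) (0 - 1) i| * χ i)
        (ENNReal.ofReal q) P := ⟨(hmeas h1 0).aestronglyMeasurable, h2.trans_lt
          ENNReal.ofReal_lt_top⟩
    have h4 : AEStronglyMeasurable (fun ω => B₂ (ε 0 ω) *
        (l1 (lags p (fun s => R 0 s ω) (0 - 1)) + 0)) P :=
      ((hB₂m.comp (hε.measurable 0)).aemeasurable.mul ((measurable_l1.comp_aemeasurable
        ((((hRs 0).lags p).causal (0 - 1)).aemeasurable hε.measurable)).add_const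
          _)).aestronglyMeasurable
    exact ((h3.const_mul 2).add ⟨h4, hB₂W 0⟩).mono_exponent hq1
  have hPt0 : ∀ k t ω, 0 ≤ Pt k t ω := by
    intro k t ω
    refine add_nonneg (le_min (mul_nonneg (mul_nonneg (g₀.B₁_nonneg _) (l1_nonneg _))
      (l1_nonneg _)) ?_) (mul_nonneg (g₀.B₂_nonneg _) (l1_nonneg _))
    exact mul_nonneg zero_le_two (mul_nonneg (g₀.L_nonneg _)
      (Finset.sum_nonneg fun i _ => mul_nonneg (abs_nonneg _) (hχ.1 i)))
  have hPtb : ∀ k, ∀ᵐ ω ∂P, ‖Pt k 0 ω‖ₑ ≤ ‖bd ω‖ₑ := by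
    intro k
    filter_upwards [hsum] with ω hω
    have h1 : ∀ s, R k s ω ≤ R 0 s ω := by
      intro s
      have h2 := (hω s).sum_add_tsum_nat_add k
      have h3 : 0 ≤ ∑ i ∈ Finset.range k, linIter L χ (fun s => ε s ω)
        (incrBound L A χ y₀ fun s => ε s ω) i s := Finset.sum_nonneg fun i _ => ha0 i s ω
      simp only [hR, incrTail, zero_add]
      simp only [add_comm] at h2 ⊢
      linarith
    have h4 : l1 (lags p (fun s => R k s ω) (0 - 1)) ≤ l1 (lags p (fun s => R 0 s ω) (0 - 1)) :=
      l1_mono fun i => abs_le_abs_of_nonneg (hR0 _ _ _) (h1 _)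
    rw [Real.enorm_eq_ofReal (hPt0 k 0 ω), Real.enorm_eq_ofReal_abs]
    refine ENNReal.ofReal_le_ofReal (le_trans ?_ (le_abs_self _))
    rw [hbd]
    simp only [add_zero]
    exact add_le_add (min_le_right _ _) (mul_le_mul_of_nonneg_left h4 (g₀.B₂_nonneg _))
  have hPtlim : Tendsto (fun k => eLpNorm (Pt k 0) 1 P) atTop (𝓝 0) := by
    simp only [eLpNorm_one_eq_lintegral_enorm]
    have h1 := tendsto_lintegral_of_dominated_convergence' (μ := P) (F := fun k ω => ‖Pt k 0 ω‖ₑ)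
      (f := fun _ => 0) (fun ω => ‖bd ω‖ₑ) (fun k => (hmeas (hPts k) 0).enorm) hPtb
      (by
        have := hbdm.2.ne
        rwa [eLpNorm_one_eq_lintegral_enorm] at this)
      (Eventually.of_forall fun ω => by
        have h2 := tendsto_l1_lags_incrTail (p := p) (L := L) (A := A) (χ := χ) (y₀ := y₀)
          (e := fun s => ε s ω) (0 - 1)
        have h3 : Tendsto (fun k => Pt k 0 ω) atTop (𝓝 0) := by
          refine squeeze_zero (fun k => hPt0 k 0 ω) (fun k => add_le_add_left (min_le_left _ _) _) ?_
          have h4 := ((h2.const_mul (B₁ (ε 0 ω))).mul_const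
            (l1 (lags p (fun s => D s ω) (0 - 1)))).add (h2.const_mul (B₂ (ε 0 ω)))
          simpa using h4
        simpa using h3.enorm)
    simpa using h1
  have hPtfin : ∀ k, eLpNorm (Pt k 0) 1 P ≠ ∞ := fun k =>
    ne_top_of_le_ne_top hbdm.2.ne (eLpNorm_mono_enorm_ae (hPtb k))
  set φ : ℕ → ℝ := fun k => (eLpNorm (Pt k 0) 1 P).toReal with hφ
  have hφlim : Tendsto φ atTop (𝓝 0) := by
    have := (ENNReal.tendsto_toReal ENNReal.zero_ne_top).comp hPtlim
    rw [ENNReal.toReal_zero] at this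
    exact this
  set μ : ℕ → ℝ := fun k => Nat.rec C (fun k m => (∑ i, χ i) * m + φ k) k with hμ
  have hμs : ∀ k, μ (k + 1) = (∑ i, χ i) * μ k + φ k := fun k => rfl
  have hμ0 : ∀ k, 0 ≤ μ k := by
    intro k
    induction k with
    | zero => exact hC0
    | succ k ih =>
      rw [hμs]
      exact add_nonneg (mul_nonneg hρ0 ih) ENNReal.toReal_nonneg
  have hμlim : Tendsto μ atTop (𝓝 0) :=
    tendsto_zero_of_contraction hμ0 hρ0 hχ.2 hφlim fun k => (hμs k).le
  set δ : ℕ → ℤ → Ω → ℝ := fun k t ω =>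
    derivErr L A B₁ B₂ χ y₀ (fun s => ε s ω) (fun s => D s ω) k t with hδ
  have hδs : ∀ k, IsShift P ε (δ k) := by
    intro k
    induction k with
    | zero => exact hDs
    | succ k ih =>
      exact ((isShift_linear_step (χ := χ) hLm ih).prodMk (hPts k)).comp
        (g := fun z : ℝ × ℝ => z.1 + z.2) (by fun_prop)
  have hL1' : eLpNorm (fun ω => L (ε 0 ω)) (ENNReal.ofReal 1) P ≤ 1 := by
    rw [ENNReal.ofReal_one]
    exact (hmono (hLm.comp (hε.measurable 0)).aemeasurable).trans hLn
  have hδn : ∀ k t, eLpNorm (δ k t) (ENNReal.ofReal 1) P ≤ ENNReal.ofReal (μ k) := by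
    intro k
    induction k with
    | zero =>
      intro t
      rw [ENNReal.ofReal_one]
      exact (hmono (hmeas hDs t)).trans (hDn t)
    | succ k ih =>
      intro t
      have h1 := eLpNorm_linear_step_le (p := p) hε hLm hL1' le_rfl hχ.1 (hδs k) ih t
      refine (eLpNorm_add_le (hmeas (isShift_linear_step (χ := χ) hLm (hδs k)) t).aestronglyMeasurable
        (hmeas (hPts k) t).aestronglyMeasurable (one_le_ofReal le_rfl)).trans ?_
      rw [hμs, ENNReal.ofReal_add (mul_nonneg hρ0 (hμ0 k)) ENNReal.toReal_nonneg]
      refine add_le_add h1 ?_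
      rw [ENNReal.ofReal_toReal (hPtfin k), ENNReal.ofReal_one]
      exact ((hPts k).eLpNorm_eq hε 1 t 0).le
  have hδlim : ∀ᵐ ω ∂P, ∀ t, ∀ η : ℝ, 0 < η → ∃ k, δ k t ω < η :=
    ae_all_iff.2 fun t => ae_exists_lt_of_eLpNorm (fun k => hmeas (hδs k) t) hμlim
      fun k => by simpa using hδn k t
  refine ⟨fun t u ω => ∑' k, (picard G (fun s => ε s ω) (k + 1) t u -
    picard G (fun s => ε s ω) k t u), D, C, ⟨fun t u hu => ?_, fun t => ?_⟩, hC0, hDs, hD0, hDn,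
    fun t => ?_⟩
  · refine hXt.ae_eq_limit (Xh := fun t ω => ∑' k, (picard G (fun s => ε s ω) (k + 1) t u -
      picard G (fun s => ε s ω) k t u)) hε hGm hq hχ hu (contracts_of_goodPath hχ.1 hLn hgood hu)
      (hB u hu) (fun t => ?_) t
    filter_upwards [hgood, hsum] with ω hω hs
    exact hω.tendsto_picard hs t hu
  · filter_upwards [hgood, hsum, hDrec, hδlim] with ω hω hs hd hl
    exact hω.contDiffOn_limit hs (fun t => hD0 t ω) hd (δ := fun k t => δ k t ω)
      (fun t => le_rfl) (fun k t => le_rfl) t (hl t)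
  · filter_upwards [hgood, hsum, hDrec] with ω hω hs hd u hu v hv
    exact hω.abs_limit_sub_le hs (fun t => hD0 t ω) hd t hu hv

end SmoothVersion

/-! ### Expansion of smooth functionals of the stationary approximation -/

section PathDerivative

variable {Ω : Type*} [MeasurableSpace Ω] {P : Measure Ω} [IsProbabilityMeasure P] {ε : ℤ → Ω → ℝ}
  {Xt Xh Xh' : ℤ → ℝ → Ω → ℝ}

lemma IsC1Modification.ae_eq (h : IsC1Modification P Xt Xh) (h' : IsC1Modification P Xt Xh')
    (t : ℤ) : ∀ᵐ ω ∂P, ∀ v ∈ Icc (0 : ℝ) 1, Xh t v ω = Xh' t v ω := by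
  have h1 : ∀ᵐ ω ∂P, ∀ n : ℕ, Xh t (TopologicalSpace.denseSeq (Icc (0 : ℝ) 1) n) ω =
      Xh' t (TopologicalSpace.denseSeq (Icc (0 : ℝ) 1) n) ω := ae_all_iff.2 fun n =>
    (h.modification t _ (Subtype.coe_prop _)).trans (h'.modification t _ (Subtype.coe_prop _)).symm
  filter_upwards [h1, h.contDiff t, h'.contDiff t] with ω hω hc hc' v hv
  have h2 := DenseRange.equalizer (TopologicalSpace.denseRange_denseSeq (Icc (0 : ℝ) 1))
    (continuousOn_iff_continuous_domRestrict.1 hc.continuousOn)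
    (continuousOn_iff_continuous_domRestrict.1 hc'.continuousOn) (funext hω)
  exact congrFun h2 ⟨v, hv⟩

lemma IsC1Modification.ae_lags_eq (h : IsC1Modification P Xt Xh) (r : ℕ) (t : ℤ) {v : ℝ}
    (hv : v ∈ Icc (0 : ℝ) 1) :
    ∀ᵐ ω ∂P, lags r (fun s => Xh s v ω) t = lags r (fun s => Xt s v ω) t := by
  filter_upwards [ae_all_iff.2 fun s => h.modification s v hv] with ω hω
  funext i
  exact hω _

lemma IsShift.of_tendsto {x : ℕ → ℤ → Ω → ℝ} (hx : ∀ n, IsShift P ε (x n)) {y : ℤ → Ω → ℝ}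
    (hy : ∀ t, ∀ᵐ ω ∂P, Tendsto (fun n => x n t ω) atTop (𝓝 (y t ω))) : IsShift P ε y := by
  have h1 := (IsShift.pi hx).comp (g := fun v : ℕ → ℝ => limsup v atTop)
    (Measurable.limsup fun n => measurable_pi_apply n)
  refine h1.congr fun t => ?_
  filter_upwards [hy t] with ω hω
  exact hω.limsup_eq.symm

variable {r : ℕ}

/-- The dominating function for the difference quotients of a function of polynomial growth along
paths with Lipschitz constants `D`. -/
def quotientBound (M C : ℝ) (z D : Fin r → ℝ) : ℝ := C * (l1 D * (1 + 2 * (l1 z + l1 D) ^ M))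

lemma ClassL.abs_sub_le_quotientBound {M C : ℝ} (hC : 0 ≤ C) {g : (Fin r → ℝ) → ℝ}
    (hg : ClassL M C g) {z z' D : Fin r → ℝ} {δ : ℝ} (hδ : 0 ≤ δ) (hδ1 : δ ≤ 1)
    (h : ∀ i, |z' i - z i| ≤ |D i| * δ) : |g z' - g z| ≤ quotientBound M C z D * δ := by
  have hM := hg.1
  have h1 : l1 (fun i => z' i - z i) ≤ l1 D * δ := by
    rw [l1, l1, Finset.sum_mul]
    exact Finset.sum_le_sum fun i _ => h i
  have h2 : l1 z' ≤ l1 z + l1 D := by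
    rw [l1, l1, l1, ← Finset.sum_add_distrib]
    refine Finset.sum_le_sum fun i _ => ?_
    have h3 := abs_sub_abs_le_abs_sub (z' i) (z i)
    have h4 := mul_le_of_le_one_right (abs_nonneg (D i)) hδ1
    linarith [h i]
  have h5 : l1 z' ^ M ≤ (l1 z + l1 D) ^ M := Real.rpow_le_rpow (l1_nonneg _) h2 hM
  have h6 : l1 z ^ M ≤ (l1 z + l1 D) ^ M :=
    Real.rpow_le_rpow (l1_nonneg _) (le_add_of_nonneg_right (l1_nonneg _)) hM
  have h7 : 0 ≤ 1 + l1 z' ^ M + l1 z ^ M := by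
    have := Real.rpow_nonneg (l1_nonneg z') M
    have := Real.rpow_nonneg (l1_nonneg z) M
    positivity
  calc |g z' - g z| ≤ C * (l1 (fun i => z' i - z i) * (1 + l1 z' ^ M + l1 z ^ M)) := hg.2 z' z
    _ ≤ C * (l1 D * δ * (1 + 2 * (l1 z + l1 D) ^ M)) := by
        refine mul_le_mul_of_nonneg_left (mul_le_mul h1 (by linarith) h7 ?_) hC
        exact mul_nonneg (l1_nonneg _) hδ
    _ = _ := by rw [quotientBound]; ring

lemma integrable_quotientBound {M C : ℝ} (hM : 0 ≤ M) {Z D : Ω → Fin r → ℝ}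
    (hZ : MemLp (fun ω => l1 (Z ω)) (ENNReal.ofReal (M + 1)) P)
    (hD : MemLp (fun ω => l1 (D ω)) (ENNReal.ofReal (M + 1)) P) :
    Integrable (fun ω => quotientBound M C (Z ω) (D ω)) P := by
  have hq : (1 : ℝ≥0∞) ≤ ENNReal.ofReal (M + 1) := one_le_ofReal (by linarith)
  have i1 : Integrable (fun ω => l1 (D ω)) P := hD.integrable hq
  have i2 := hD.integrable_norm_rpow (by positivity) ENNReal.ofReal_ne_top
  have i3 := (hZ.add hD).integrable_norm_rpow (by positivity) ENNReal.ofReal_ne_top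
  rw [ENNReal.toReal_ofReal (by linarith)] at i2 i3
  refine Integrable.const_mul ?_ C
  refine (i1.add ((i2.add i3).const_mul 2)).mono' ?_ (Eventually.of_forall fun ω => ?_)
  · exact (hD.1.aemeasurable.mul ((((hZ.1.aemeasurable.add hD.1.aemeasurable).pow_const
      M).const_mul 2).const_add 1)).aestronglyMeasurable
  · have h1 := l1_nonneg (D ω)
    have h2 := add_nonneg (l1_nonneg (Z ω)) h1
    have h3 := mul_rpow_le_add h1 h2 hM
    have h4 := Real.rpow_nonneg h2 M
    simp only [Pi.add_apply, Real.norm_eq_abs]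
    rw [abs_of_nonneg (by positivity), abs_of_nonneg h1, abs_of_nonneg h2]
    linarith

/-- Derivatives of `g(Xh_t(u), Xh_{t-1}(u), …)` in `u`: they form a stationary causal process of
integrable variables, and the first order expansion holds in `L¹`. -/
lemma exists_expansion (hε : IsIID P ε) (hXt : ∀ v ∈ Icc (0 : ℝ) 1, IsShift P ε fun t => Xt t v)
    (hXh : IsC1Modification P Xt Xh) {M C : ℝ} (hC : 0 ≤ C) {g : (Fin r → ℝ) → ℝ}
    (hg : ClassL M C g) (hgd : Differentiable ℝ g) {u : ℝ} (hu : u ∈ Ioo (0 : ℝ) 1) {B : ℝ}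
    (hB : ∀ t, eLpNorm (Xt t u) (ENNReal.ofReal (M + 1)) P ≤ ENNReal.ofReal B)
    {D : ℤ → Ω → ℝ} (hDs : IsShift P ε D) {B' : ℝ}
    (hDB : ∀ t, eLpNorm (D t) (ENNReal.ofReal (M + 1)) P ≤ ENNReal.ofReal B')
    (hlip : ∀ t, ∀ᵐ ω ∂P, ∀ w ∈ Icc (0 : ℝ) 1, ∀ v ∈ Icc (0 : ℝ) 1,
      |Xh t v ω - Xh t w ω| ≤ D t ω * |v - w|) :
    IsShift P ε (fun t ω => deriv (fun v => g (lags r (fun s => Xh s v ω) t)) u) ∧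
    Integrable (fun ω => deriv (fun v => g (lags r (fun s => Xh s v ω) 0)) u) P ∧
    ∀ η : ℝ, 0 < η → ∃ ρ : ℝ, 0 < ρ ∧ ∀ v ∈ Icc (0 : ℝ) 1, |v - u| ≤ ρ → ∀ t,
      eLpNorm (fun ω => g (lags r (fun s => Xt s v ω) t) - g (lags r (fun s => Xt s u ω) t) -
        (v - u) * deriv (fun v => g (lags r (fun s => Xh s v ω) t)) u) 1 P ≤
        ENNReal.ofReal (η * |v - u|) := by
  have hM := hg.1
  have hu' := Ioo_subset_Icc_self hu
  have hgm : Measurable g := hg.continuous.measurable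
  have hq : (1 : ℝ) ≤ M + 1 := by linarith
  set W : ℤ → ℝ → Ω → ℝ := fun t v ω => g (lags r (fun s => Xh s v ω) t) with hW
  set W' : ℤ → Ω → ℝ := fun t ω => deriv (fun v => W t v ω) u with hW'
  have hWeq : ∀ v ∈ Icc (0 : ℝ) 1, ∀ t, W t v =ᵐ[P] fun ω => g (lags r (fun s => Xt s v ω) t) := by
    intro v hv t
    filter_upwards [hXh.ae_lags_eq r t hv] with ω hω
    simp only [hW, hω]
  have hWs : ∀ v ∈ Icc (0 : ℝ) 1, IsShift P ε fun t => W t v := fun v hv =>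
    (((hXt v hv).lags r).comp hgm).congr (hWeq v hv)
  have hder : ∀ t, ∀ᵐ ω ∂P, HasDerivAt (fun v => W t v ω) (W' t ω) u := by
    intro t
    filter_upwards [ae_all_iff.2 hXh.contDiff] with ω hω
    have h1 : DifferentiableAt ℝ (fun v => lags r (fun s => Xh s v ω) t) u :=
      differentiableAt_pi.2 fun i => ((hω (t - (i : ℕ))).differentiableOn
        one_ne_zero).differentiableAt (Icc_mem_nhds hu.1 hu.2)
    exact ((hgd _).comp u h1).hasDerivAt
  have hslope : ∀ t, ∀ᵐ ω ∂P, Tendsto (fun v => (v - u)⁻¹ * (W t v ω - W t u ω)) (𝓝[≠] u)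
      (𝓝 (W' t ω)) := by
    intro t
    filter_upwards [hder t] with ω hω
    have := hasDerivAt_iff_tendsto_slope.1 hω
    exact this.congr fun v => by rw [slope_def_field, div_eq_inv_mul]
  have hvn : Tendsto (fun n : ℕ => u + (1 - u) * (1 / ((n : ℝ) + 1))) atTop (𝓝[≠] u) := by
    refine tendsto_nhdsWithin_iff.2 ⟨?_, Eventually.of_forall fun n => ?_⟩
    · have := (tendsto_one_div_add_atTop_nhds_zero_nat (𝕜 := ℝ)).const_mul (1 - u)
      simpa using this.const_add u
    · have : 0 < (1 - u) * (1 / ((n : ℝ) + 1)) := mul_pos (by linarith [hu.2]) (by positivity)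
      rw [mem_compl_iff, mem_singleton_iff]
      linarith
  have hvmem : ∀ n : ℕ, u + (1 - u) * (1 / ((n : ℝ) + 1)) ∈ Icc (0 : ℝ) 1 := by
    intro n
    have h1 : 0 < 1 / ((n : ℝ) + 1) := by positivity
    have h2 : 1 / ((n : ℝ) + 1) ≤ 1 := by
      rw [div_le_one (by positivity)]
      linarith [(Nat.cast_nonneg n : (0 : ℝ) ≤ n)]
    have h3 : 0 < 1 - u := by linarith [hu.2]
    constructor
    · have := mul_pos h3 h1
      linarith [hu.1]
    · nlinarith
  have hW's : IsShift P ε W' := by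
    refine IsShift.of_tendsto (x := fun n t ω => (u + (1 - u) * (1 / ((n : ℝ) + 1)) - u)⁻¹ *
      (W t (u + (1 - u) * (1 / ((n : ℝ) + 1))) ω - W t u ω)) (fun n => ?_) fun t => ?_
    · exact ((hWs _ (hvmem n)).prodMk (hWs u hu')).comp
        (g := fun z : ℝ × ℝ => (u + (1 - u) * (1 / ((n : ℝ) + 1)) - u)⁻¹ * (z.1 - z.2))
        (by fun_prop)
    · filter_upwards [hslope t] with ω hω
      exact hω.comp hvn
  set Φ : Ω → ℝ := fun ω => quotientBound M C (lags r (fun s => Xh s u ω) 0)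
    (lags r (fun s => D s ω) 0) with hΦ
  have hΦi : Integrable Φ P := by
    have hXm : AEMeasurable (fun ω => lags r (fun s => Xt s u ω) 0) P :=
      (((hXt u hu').lags r).causal 0).aemeasurable hε.measurable
    have hDm : AEMeasurable (fun ω => lags r (fun s => D s ω) 0) P :=
      ((hDs.lags r).causal 0).aemeasurable hε.measurable
    have m1 : MemLp (fun ω => l1 (lags r (fun s => Xt s u ω) 0)) (ENNReal.ofReal (M + 1)) P :=
      ⟨(measurable_l1.comp_aemeasurable hXm).aestronglyMeasurable,
        (eLpNorm_l1_le hq hXm fun i => hB _).trans_lt ENNReal.ofReal_lt_top⟩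
    have m2 : MemLp (fun ω => l1 (lags r (fun s => D s ω) 0)) (ENNReal.ofReal (M + 1)) P :=
      ⟨(measurable_l1.comp_aemeasurable hDm).aestronglyMeasurable,
        (eLpNorm_l1_le hq hDm fun i => hDB _).trans_lt ENNReal.ofReal_lt_top⟩
    refine (integrable_quotientBound (C := C) hM m1 m2).congr ?_
    filter_upwards [hXh.ae_lags_eq r 0 hu'] with ω hω
    simp only [hΦ, hω]
  have hdom : ∀ᵐ ω ∂P, ∀ v ∈ Icc (0 : ℝ) 1, |W 0 v ω - W 0 u ω| ≤ Φ ω * |v - u| := by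
    filter_upwards [ae_all_iff.2 hlip] with ω hω v hv
    refine hg.abs_sub_le_quotientBound hC (abs_nonneg _) ?_ fun i => ?_
    · rw [abs_le]
      exact ⟨by linarith [hv.1, hu.2], by linarith [hv.2, hu.1]⟩
    · exact (hω _ u hu' v hv).trans
        (mul_le_mul_of_nonneg_right (le_abs_self _) (abs_nonneg _))
  have hdom2 : ∀ᵐ ω ∂P, ∀ v ∈ Icc (0 : ℝ) 1, |(v - u)⁻¹ * (W 0 v ω - W 0 u ω)| ≤ Φ ω := by
    filter_upwards [hdom] with ω hω v hv
    rcases eq_or_ne v u with rfl | hne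
    · rw [sub_self, inv_zero, zero_mul, abs_zero]
      have h3 := hω 1 (right_mem_Icc.2 zero_le_one)
      have h4 : 0 < |1 - v| := abs_pos.2 (by linarith [hu.2])
      exact nonneg_of_mul_nonneg_left ((abs_nonneg _).trans h3) h4
    · have h4 : 0 < |v - u| := abs_pos.2 (sub_ne_zero.2 hne)
      rw [abs_mul, abs_inv, inv_mul_le_iff₀ h4, mul_comm]
      exact hω v hv
  have hW'b : ∀ᵐ ω ∂P, |W' 0 ω| ≤ Φ ω := by
    filter_upwards [hdom2, hslope 0] with ω hω hs
    exact le_of_tendsto' (hs.comp hvn).abs fun n => hω _ (hvmem n)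
  have hW'm : ∀ t, AEMeasurable (W' t) P := fun t => (hW's.causal t).aemeasurable hε.measurable
  have hW'i : Integrable (W' 0) P := hΦi.mono' (hW'm 0).aestronglyMeasurable hW'b
  refine ⟨hW's, hW'i, fun η hη => ?_⟩
  have hWm : ∀ v ∈ Icc (0 : ℝ) 1, ∀ t, AEMeasurable (W t v) P := fun v hv t =>
    ((hWs v hv).causal t).aemeasurable hε.measurable
  have hnear : ∀ᶠ v in 𝓝[≠] u, v ∈ Icc (0 : ℝ) 1 :=
    mem_nhdsWithin_of_mem_nhds (Icc_mem_nhds hu.1 hu.2)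
  have hlim : Tendsto (fun v => ∫ ω, |(v - u)⁻¹ * (W 0 v ω - W 0 u ω) - W' 0 ω| ∂P) (𝓝[≠] u)
      (𝓝 0) := by
    have h1 := tendsto_integral_filter_of_dominated_convergence (μ := P) (l := 𝓝[≠] u)
      (F := fun v ω => |(v - u)⁻¹ * (W 0 v ω - W 0 u ω) - W' 0 ω|) (f := fun _ => 0)
      (fun ω => Φ ω + Φ ω) ?_ ?_ (hΦi.add hΦi) ?_
    · simpa using h1
    · filter_upwards [hnear] with v hv
      exact ((((hWm v hv 0).sub (hWm u hu' 0)).const_mul _).sub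
        (hW'm 0)).norm.aestronglyMeasurable
    · filter_upwards [hnear] with v hv
      filter_upwards [hdom2, hW'b] with ω h2 h3
      rw [Real.norm_eq_abs, abs_abs]
      exact (abs_sub _ _).trans (add_le_add (h2 v hv) h3)
    · filter_upwards [hslope 0] with ω hω
      simpa using (hω.sub_const (W' 0 ω)).abs
  obtain ⟨ρ, hρ, hρ'⟩ := Metric.mem_nhdsWithin_iff.1 (hlim.eventually_lt_const hη)
  refine ⟨ρ / 2, by linarith, fun v hv hvρ t => ?_⟩
  have hs : IsShift P ε fun t ω => W t v ω - W t u ω - (v - u) * W' t ω :=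
    (((hWs v hv).prodMk (hWs u hu')).prodMk hW's).comp
      (g := fun z : (ℝ × ℝ) × ℝ => z.1.1 - z.1.2 - (v - u) * z.2) (by fun_prop)
  have e1 : eLpNorm (fun ω => g (lags r (fun s => Xt s v ω) t) - g (lags r (fun s => Xt s u ω) t) -
      (v - u) * W' t ω) 1 P = eLpNorm (fun ω => W 0 v ω - W 0 u ω - (v - u) * W' 0 ω) 1 P := by
    rw [← hs.eLpNorm_eq hε 1 t 0]
    refine eLpNorm_congr_ae ?_
    filter_upwards [hWeq v hv t, hWeq u hu' t] with ω h1 h2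
    rw [h1, h2]
  refine e1.trans_le ?_
  rcases eq_or_ne v u with rfl | hne
  · simp
  have h4 : v - u ≠ 0 := sub_ne_zero.2 hne
  have h5 : ∫ ω, |(v - u)⁻¹ * (W 0 v ω - W 0 u ω) - W' 0 ω| ∂P < η :=
    hρ' ⟨by rw [Metric.mem_ball, Real.dist_eq]; linarith, hne⟩
  have e2 : (fun ω => W 0 v ω - W 0 u ω - (v - u) * W' 0 ω) = (v - u) • fun ω =>
      (v - u)⁻¹ * (W 0 v ω - W 0 u ω) - W' 0 ω := by
    funext ω
    rw [Pi.smul_apply, smul_eq_mul]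
    field_simp
  have hi : Integrable (fun ω => (v - u)⁻¹ * (W 0 v ω - W 0 u ω) - W' 0 ω) P := by
    refine (hΦi.add hΦi).mono' ((((hWm v hv 0).sub (hWm u hu' 0)).const_mul _).sub
        (hW'm 0)).aestronglyMeasurable ?_
    filter_upwards [hdom2, hW'b] with ω h2 h3
    exact (abs_sub _ _).trans (add_le_add (h2 v hv) h3)
  rw [e2, eLpNorm_const_smul, eLpNorm_one_eq_lintegral_enorm,
    ← ofReal_integral_norm_eq_lintegral_enorm hi, Real.enorm_eq_ofReal_abs,
    ← ENNReal.ofReal_mul (abs_nonneg _), mul_comm η]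
  exact ENNReal.ofReal_le_ofReal (mul_le_mul_of_nonneg_left h5.le (abs_nonneg _))

end PathDerivative

/-! ### The bias of the local estimator -/

namespace EstimationSetup

variable {Ω : Type*} [MeasurableSpace Ω] {P : Measure Ω} [IsProbabilityMeasure P] {ε : ℤ → Ω → ℝ}
  {p d : ℕ} {Θ : Set (EuclideanSpace ℝ (Fin d))} {θ₀ : EuclideanSpace ℝ (Fin d)} {K : ℝ → ℝ}
  {ℓ : (Fin (p + 1) → ℝ) → EuclideanSpace ℝ (Fin d) → ℝ} {M M' M'' α α' : ℝ}
  {Xt Xh : ℤ → ℝ → Ω → ℝ} {X : ℕ → ℤ → Ω → ℝ} {u : ℝ} {b : ℕ → ℝ}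
  {θhat : ℕ → Ω → EuclideanSpace ℝ (Fin d)}
  (S : EstimationSetup P ε Θ θ₀ K ℓ M M' M'' α α' Xt X u b θhat)
include S

lemma exists_abs_sqrt_mul_le
    (hrate : (fun n : ℕ => (n : ℝ) * b n ^ 3) =O[atTop] (fun _ => (1 : ℝ))) :
    ∃ R : ℝ, 0 ≤ R ∧ ∀ᶠ n : ℕ in atTop, √((n : ℝ) * b n) * b n ≤ R := by
  obtain ⟨c, hc⟩ := hrate.bound
  refine ⟨√|c|, Real.sqrt_nonneg _, ?_⟩
  filter_upwards [hc] with n hn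
  have hbn := (S.bandwidth.pos n).le
  have h1 : √((n : ℝ) * b n) * b n = √((n : ℝ) * b n ^ 3) := by
    rw [show (n : ℝ) * b n ^ 3 = (n * b n) * b n ^ 2 by ring,
      Real.sqrt_mul (mul_nonneg (Nat.cast_nonneg n) hbn) (b n ^ 2), Real.sqrt_sq hbn]
  rw [h1]
  refine Real.sqrt_le_sqrt (le_trans ?_ (le_abs_self c))
  rw [norm_one, mul_one] at hn
  exact (le_abs_self _).trans hn

/-- The score at the observations, centred at the stationary score, has the asymptotic expansion
with leading term `b ∫ K(x) x dx · E ∂_u ∇ℓ`. -/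
lemma tendsto_expansion (hrate : (fun n : ℕ => (n : ℝ) * b n ^ 3) =O[atTop] (fun _ => (1 : ℝ)))
    (hX : LocApprox P Xt X p (M' + 1) 1) (i : Fin d) {W' : ℤ → Ω → ℝ} (hW' : IsShift P ε W')
    (hi : Integrable (W' 0) P)
    (hT : ∀ η : ℝ, 0 < η → ∃ ρ : ℝ, 0 < ρ ∧ ∀ v ∈ Icc (0 : ℝ) 1, |v - u| ≤ ρ → ∀ t,
      eLpNorm (fun ω => score ℓ Xt t v θ₀ i ω - score ℓ Xt t u θ₀ i ω - (v - u) * W' t ω) 1 P ≤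
        ENNReal.ofReal (η * |v - u|)) :
    Tendsto (fun n : ℕ => eLpNorm (fun ω =>
      √((n : ℝ) * b n) * (∑ t ∈ Finset.Icc (p + 1) n, kernelWeight K b u n t *
        (pd (ℓ (lags (p + 1) (fun s => X n s ω) (t : ℤ))) i θ₀ - score ℓ Xt t u θ₀ i ω)) -
        √((n : ℝ) * b n) * b n * ((∫ x, K x * x) * ∫ ω, W' 0 ω ∂P)) 1 P) atTop (𝓝 0) := by
  obtain ⟨-, Cz, Cθ, hCz, hCθ, hc, -⟩ := S.classLt_grad i
  have hg := hc θ₀ S.mem_interior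
  set g : (Fin (p + 1) → ℝ) → ℝ := fun z => pd (ℓ z) i θ₀ with hgdef
  have hgm : Measurable g := hg.continuous.measurable
  have hb := S.bandwidth
  have hK := S.kernel
  set w := kernelWeight K b u with hw
  set m := ∫ ω, W' 0 ω ∂P with hm
  set κ := ∫ x, K x * x with hκ
  obtain ⟨R, hR0, hR⟩ := S.exists_abs_sqrt_mul_le hrate
  obtain ⟨C, hC0, hC⟩ := exists_sum_abs_kernelWeight_le hK S.time hb p
  obtain ⟨B, hB0, hB⟩ := exists_abs_kernelWeight_le (u := u) hK hb
  have hsm : ∀ v ∈ Icc (0 : ℝ) 1, ∀ t, AEMeasurable (score ℓ Xt t v θ₀ i) P := fun v hv t =>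
    hgm.comp_aemeasurable (hX.aemeasurable_lags_stationary hv t (p + 1))
  have hW'm : ∀ t, AEMeasurable (W' t) P := fun t => (hW'.causal t).aemeasurable S.iid.measurable
  have hmem : ∀ {n t : ℕ}, t ∈ Finset.Icc (p + 1) n → (t : ℝ) / n ∈ Icc (0 : ℝ) 1 := by
    intro n t ht
    rw [Finset.mem_Icc] at ht
    exact ⟨by positivity, div_le_one_of_le₀ (by exact_mod_cast ht.2) (Nat.cast_nonneg n)⟩
  have hratio : ∀ n t : ℕ, |w n t * (((t : ℝ) / n - u) / b n)| ≤ |w n t| := by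
    intro n t
    rcases eq_or_ne (w n t) 0 with h0 | h0
    · simp [h0]
    · rw [abs_mul]
      refine mul_le_of_le_one_right (abs_nonneg _) ?_
      rw [abs_div, abs_of_pos (hb.pos n), div_le_one (hb.pos n)]
      exact abs_sub_le_of_kernelWeight_ne_zero hK hb h0
  set T₁ : ℕ → Ω → ℝ := fun n ω => √((n : ℝ) * b n) * ∑ t ∈ Finset.Icc (p + 1) n, w n t *
    (g (lags (p + 1) (fun s => X n s ω) (t : ℤ)) - score ℓ Xt t ((t : ℝ) / n) θ₀ i ω) with hT₁
  set T₂ : ℕ → Ω → ℝ := fun n ω => √((n : ℝ) * b n) * ∑ t ∈ Finset.Icc (p + 1) n, w n t *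
    (score ℓ Xt t ((t : ℝ) / n) θ₀ i ω - score ℓ Xt t u θ₀ i ω - ((t : ℝ) / n - u) * W' t ω) with hT₂
  set T₃ : ℕ → Ω → ℝ := fun n ω => ∑ t ∈ Finset.Icc (p + 1) n,
    (√((n : ℝ) * b n) * b n * (w n t * (((t : ℝ) / n - u) / b n))) * (W' t ω - m) with hT₃
  set T₄ : ℕ → ℝ := fun n => √((n : ℝ) * b n) * b n *
    ((∑ t ∈ Finset.Icc (p + 1) n, w n t * (((t : ℝ) / n - u) / b n) - κ) * m) with hT₄
  have f1 : ∀ n : ℕ, ∀ t ∈ Finset.Icc (p + 1) n, AEMeasurable (fun ω =>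
      g (lags (p + 1) (fun s => X n s ω) (t : ℤ)) - score ℓ Xt t ((t : ℝ) / n) θ₀ i ω) P :=
    fun n t ht => (hgm.comp_aemeasurable (hX.aemeasurable_lags (Finset.mem_Icc.1 ht).2 _)).sub
      (hsm _ (hmem ht) t)
  have f2 : ∀ n : ℕ, ∀ t ∈ Finset.Icc (p + 1) n, AEMeasurable (fun ω =>
      score ℓ Xt t ((t : ℝ) / n) θ₀ i ω - score ℓ Xt t u θ₀ i ω - ((t : ℝ) / n - u) * W' t ω) P :=
    fun n t ht => ((hsm _ (hmem ht) t).sub (hsm _ S.time' t)).sub ((hW'm t).const_mul _)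
  have m1 : ∀ n, AEMeasurable (T₁ n) P := fun n =>
    (Finset.aemeasurable_fun_sum _ fun t ht => (f1 n t ht).const_mul _).const_mul _
  have m2 : ∀ n, AEMeasurable (T₂ n) P := fun n =>
    (Finset.aemeasurable_fun_sum _ fun t ht => (f2 n t ht).const_mul _).const_mul _
  have m3 : ∀ n, AEMeasurable (T₃ n) P := fun n =>
    Finset.aemeasurable_fun_sum _ fun t ht => ((hW'm t).sub_const _).const_mul _
  have hscale : ∀ {n : ℕ} {f : Ω → ℝ} {c : ℝ}, eLpNorm f 1 P ≤ ENNReal.ofReal c →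
      eLpNorm (fun ω => √((n : ℝ) * b n) * f ω) 1 P ≤ ENNReal.ofReal (√((n : ℝ) * b n) * c) := by
    intro n f c h
    refine (eLpNorm_const_smul_le (c := √((n : ℝ) * b n)) (f := f)).trans ?_
    rw [Real.enorm_eq_ofReal (Real.sqrt_nonneg _), ENNReal.ofReal_mul (Real.sqrt_nonneg _)]
    exact mul_le_mul_right h _
  have l1 : Tendsto (fun n => eLpNorm (T₁ n) 1 P) atTop (𝓝 0) := by
    obtain ⟨A, hA0, hA⟩ := hX.exists_eLpNorm_comp_sub_le S.M'_nonneg zero_le_one hCz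
    refine tendsto_eLpNorm_zero_of_le (c := fun n => C * A * b n)
      (by simpa using hb.tendsto.const_mul (C * A)) ?_
    filter_upwards [hC, hb.tendsto_mul.eventually_ge_atTop 1, eventually_ge_atTop 1]
      with n hCn hnb hn
    have hn0 : (0 : ℝ) < n := by exact_mod_cast hn
    refine (hscale (eLpNorm_sum_mul_le_of_le _ (w n) (f1 n) (c := A * (1 / (n : ℝ)))
      (by positivity) hCn fun t ht _ => ?_)).trans (ENNReal.ofReal_le_ofReal ?_)
    · refine (hA g hg n t hn (Finset.mem_Icc.1 ht).2 _ (hmem ht)).trans_eq ?_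
      simp
    · have h1 : √((n : ℝ) * b n) ≤ n * b n := by
        rw [Real.sqrt_le_left (by positivity)]
        nlinarith
      calc √((n : ℝ) * b n) * (C * (A * (1 / (n : ℝ))))
          ≤ n * b n * (C * (A * (1 / (n : ℝ)))) := mul_le_mul_of_nonneg_right h1 (by positivity)
        _ = C * A * b n := by field_simp
  have l2 : Tendsto (fun n => eLpNorm (T₂ n) 1 P) atTop (𝓝 0) := by
    have key : ∀ η : ℝ, 0 < η → ∀ᶠ n in atTop, eLpNorm (T₂ n) 1 P ≤ ENNReal.ofReal (R * C * η) := by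
      intro η hη
      obtain ⟨ρ, hρ, hTρ⟩ := hT η hη
      filter_upwards [hC, hR, hb.tendsto.eventually_le_const hρ] with n hCn hRn hbρ
      have hbn := (hb.pos n).le
      refine (hscale (eLpNorm_sum_mul_le_of_le _ (w n) (f2 n) (c := η * b n) (by positivity) hCn
        fun t ht h0 => ?_)).trans (ENNReal.ofReal_le_ofReal ?_)
      · have h1 := abs_sub_le_of_kernelWeight_ne_zero hK hb h0
        refine (hTρ _ (hmem ht) (h1.trans hbρ) t).trans (ENNReal.ofReal_le_ofReal ?_)
        exact mul_le_mul_of_nonneg_left h1 hη.le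
      · calc √((n : ℝ) * b n) * (C * (η * b n)) = √((n : ℝ) * b n) * b n * (C * η) := by ring
          _ ≤ R * (C * η) := mul_le_mul_of_nonneg_right hRn (by positivity)
          _ = R * C * η := by ring
    rw [ENNReal.tendsto_nhds_zero]
    intro δ hδ
    have h1 : Tendsto (fun η : ℝ => ENNReal.ofReal (R * C * η)) (𝓝[>] 0) (𝓝 0) := by
      have h2 : Tendsto (fun η : ℝ => R * C * η) (𝓝[>] 0) (𝓝 0) := by
        have h3 : Continuous fun η : ℝ => R * C * η := by fun_prop
        have h4 := (h3.tendsto 0).mono_left (nhdsWithin_le_nhds (s := Ioi 0))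
        simpa using h4
      simpa using ENNReal.tendsto_ofReal h2
    obtain ⟨η, hη1, hη2⟩ := ((h1.eventually_le_const hδ).and self_mem_nhdsWithin).exists
    filter_upwards [key η hη2] with n hn
    exact hn.trans hη1
  have hR' : ∀ᶠ n : ℕ in atTop, |√((n : ℝ) * b n) * b n| ≤ R := by
    filter_upwards [hR] with n hn
    rwa [abs_of_nonneg (mul_nonneg (Real.sqrt_nonneg _) (hb.pos n).le)]
  have l3 : Tendsto (fun n => eLpNorm (T₃ n) 1 P) atTop (𝓝 0) := by
    refine hW'.tendsto_weighted_sum S.iid hi (C := R * C)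
      (δ := fun n => R * (B * (1 / ((n : ℝ) * b n)))) ?_ ?_ ?_
    · filter_upwards [hC, hR'] with n hCn hRn
      simp only [abs_mul (√((n : ℝ) * b n) * b n), ← Finset.mul_sum]
      refine mul_le_mul hRn ((Finset.sum_le_sum fun t _ => hratio n t).trans hCn)
        (Finset.sum_nonneg fun _ _ => abs_nonneg _) hR0
    · simpa using (hb.tendsto_inv B).const_mul R
    · filter_upwards [hR'] with n hRn t _
      rw [abs_mul]
      exact mul_le_mul hRn ((hratio n t).trans (hB n t)) (abs_nonneg _) hR0
  have l4 : Tendsto T₄ atTop (𝓝 0) := by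
    have h1 : Tendsto (fun n : ℕ => (∑ t ∈ Finset.Icc (p + 1) n,
        w n t * (((t : ℝ) / n - u) / b n) - κ) * m) atTop (𝓝 0) := by
      have h2 := ((tendsto_sum_kernelWeight_moment hK S.time hb p).sub_const κ).mul_const m
      rwa [← hκ, sub_self, zero_mul] at h2
    have h3 := h1.norm.const_mul R
    rw [norm_zero, mul_zero] at h3
    refine squeeze_zero_norm' ?_ h3
    filter_upwards [hR'] with n hn
    rw [hT₄, norm_mul]
    exact mul_le_mul_of_nonneg_right hn (norm_nonneg _)
  refine (tendsto_eLpNorm_zero_add (fun n => ((m1 n).add (m2 n)).add (m3 n))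
    (fun n => aemeasurable_const) (tendsto_eLpNorm_zero_add (fun n => (m1 n).add (m2 n)) m3
    (tendsto_eLpNorm_zero_add m1 m2 l1 l2) l3) (tendsto_eLpNorm_zero_const l4)).congr fun n => ?_
  congr 1
  funext ω
  have hbn := (hb.pos n).ne'
  have e : ∑ t ∈ Finset.Icc (p + 1) n, w n t * (g (lags (p + 1) (fun s => X n s ω) (t : ℤ)) -
      score ℓ Xt t u θ₀ i ω) =
      ∑ t ∈ Finset.Icc (p + 1) n, w n t * (g (lags (p + 1) (fun s => X n s ω) (t : ℤ)) -
        score ℓ Xt t ((t : ℝ) / n) θ₀ i ω) +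
      ∑ t ∈ Finset.Icc (p + 1) n, w n t * (score ℓ Xt t ((t : ℝ) / n) θ₀ i ω -
        score ℓ Xt t u θ₀ i ω - ((t : ℝ) / n - u) * W' t ω) +
      b n * (∑ t ∈ Finset.Icc (p + 1) n, w n t * (((t : ℝ) / n - u) / b n) * (W' t ω - m)) +
      b n * ((∑ t ∈ Finset.Icc (p + 1) n, w n t * (((t : ℝ) / n - u) / b n)) * m) := by
    rw [Finset.sum_mul, Finset.mul_sum, Finset.mul_sum, ← Finset.sum_add_distrib,
      ← Finset.sum_add_distrib, ← Finset.sum_add_distrib]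
    refine Finset.sum_congr rfl fun t _ => ?_
    field_simp
    ring
  have e3 : T₃ n ω = √((n : ℝ) * b n) * b n *
      ∑ t ∈ Finset.Icc (p + 1) n, w n t * (((t : ℝ) / n - u) / b n) * (W' t ω - m) := by
    rw [hT₃, Finset.mul_sum]
    exact Finset.sum_congr rfl fun t _ => by ring
  simp only [Pi.add_apply, e3, hT₁, hT₂, hT₄]
  rw [e]
  ring

/-- The limit distribution of the estimator with the bias along a smooth modification removed. -/
lemma tendstoInDistribution_add_biasVec
    (hrate : (fun n : ℕ => (n : ℝ) * b n ^ 3) =O[atTop] (fun _ => (1 : ℝ)))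
    (hX : LocApprox P Xt X p (M' + 1) 1) (hXt : ∀ v ∈ Icc (0 : ℝ) 1, IsShift P ε fun t => Xt t v)
    (hXh : IsC1Modification P Xt Xh) (hd : ∀ i, ContDiff ℝ 1 fun z => pd (ℓ z) i θ₀)
    {D : ℤ → Ω → ℝ} (hDs : IsShift P ε D) {B : ℝ}
    (hDB : ∀ t, eLpNorm (D t) (ENNReal.ofReal (M' + 1)) P ≤ ENNReal.ofReal B)
    (hlip : ∀ t, ∀ᵐ ω ∂P, ∀ w ∈ Icc (0 : ℝ) 1, ∀ v ∈ Icc (0 : ℝ) 1,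
      |Xh t v ω - Xh t w ω| ≤ D t ω * |v - w|) (t : ℤ) :
    (∀ i, Integrable (scoreDeriv ℓ Xh t u θ₀ i) P) ∧
    TendstoInDistribution (fun (n : ℕ) ω => √((n : ℝ) * b n) •
        (θhat n ω - θ₀ + b n • biasVec P ℓ K Xt Xh t u θ₀)) atTop
      (id : EuclideanSpace ℝ (Fin d) → EuclideanSpace ℝ (Fin d)) (fun _ => P)
      (multivariateGaussian 0 (asympCov P ℓ K Xt u θ₀)) := by
  obtain ⟨B₀, hB₀, hB⟩ := hX.moment
  have key : ∀ i, IsShift P ε (fun t => scoreDeriv ℓ Xh t u θ₀ i) ∧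
      Integrable (scoreDeriv ℓ Xh 0 u θ₀ i) P ∧
      ∀ η : ℝ, 0 < η → ∃ ρ : ℝ, 0 < ρ ∧ ∀ v ∈ Icc (0 : ℝ) 1, |v - u| ≤ ρ → ∀ t,
        eLpNorm (fun ω => score ℓ Xt t v θ₀ i ω - score ℓ Xt t u θ₀ i ω -
          (v - u) * scoreDeriv ℓ Xh t u θ₀ i ω) 1 P ≤ ENNReal.ofReal (η * |v - u|) := by
    intro i
    obtain ⟨-, Cz, Cθ, hCz, hCθ, hc, -⟩ := S.classLt_grad i
    exact exists_expansion S.iid hXt hXh hCz (hc θ₀ S.mem_interior)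
      ((hd i).differentiable one_ne_zero) S.time (hB u S.time') hDs hDB hlip
  refine ⟨fun i => ((key i).1.identDistrib S.iid 0 t).integrable_iff.1 (key i).2.1, ?_⟩
  have hmean : ∀ i, ∫ ω, scoreDeriv ℓ Xh t u θ₀ i ω ∂P = ∫ ω, scoreDeriv ℓ Xh 0 u θ₀ i ω ∂P :=
    fun i => ((key i).1.identDistrib S.iid t 0).integral_eq
  set m : Fin d → ℝ := fun i => ∫ ω, scoreDeriv ℓ Xh t u θ₀ i ω ∂P with hm
  set κ := ∫ x, K x * x with hκ
  obtain ⟨R, hR0, hR⟩ := S.exists_abs_sqrt_mul_le hrate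
  have h := S.tendstoInDistribution (c := fun n i => √((n : ℝ) * b n) * b n * (κ * m i))
    (A := R * ∑ i, |κ * m i|) (fun i => ?_) (fun i => ?_)
  · convert h using 3 with n ω
    rw [smul_add]
    congr 1
    have e : (fun i => √((n : ℝ) * b n) * b n * (κ * m i)) =
        (√((n : ℝ) * b n) * b n * κ) • m := by
      funext i
      rw [Pi.smul_apply, smul_eq_mul]
      ring
    rw [e, invVec, Matrix.mulVec_smul, WithLp.toLp_smul, biasVec, ← hκ, ← hm, smul_smul, smul_smul,
      mul_assoc]
  · filter_upwards [hR] with n hn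
    rw [abs_mul, abs_of_nonneg (mul_nonneg (Real.sqrt_nonneg _) (S.bandwidth.pos n).le)]
    exact mul_le_mul hn (Finset.single_le_sum (f := fun i => |κ * m i|)
      (fun _ _ => abs_nonneg _) (Finset.mem_univ i)) (abs_nonneg _) hR0
  · have h1 := S.tendsto_expansion hrate hX i (key i).1 (key i).2.1 (key i).2.2
    simpa only [hm, hmean] using h1

end EstimationSetup

section Approximation

variable {Ω : Type*} [MeasurableSpace Ω] {P : Measure Ω} [IsProbabilityMeasure P] {ε : ℤ → Ω → ℝ}
  {p : ℕ} {G : ℝ → (Fin p → ℝ) → ℝ → ℝ} {Xt Xh : ℤ → ℝ → Ω → ℝ} {X : ℕ → ℤ → Ω → ℝ} {q α : ℝ}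

lemma IsLocallyStationarySolution.locApprox_of_holder (hε : IsIID P ε)
    (hG : ∀ u ∈ Icc (0 : ℝ) 1, Measurable fun ay : ℝ × (Fin p → ℝ) => G ay.1 ay.2 u)
    (hXt : IsStationarySolution P ε G Xt) (hX : IsLocallyStationarySolution P ε G Xt X)
    {q₂ : ℝ} (hq : 1 ≤ q) (hq₂ : q ≤ q₂) (hα : α ∈ Ioc (0 : ℝ) 1) (hL1 : CondL1 P (ε 0) G q₂)
    {D : ℝ} (hD : 0 ≤ D) (hH : ∀ u ∈ Icc (0 : ℝ) 1, ∀ v ∈ Icc (0 : ℝ) 1, ∀ t,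
      eLpNorm (fun ω => Xt t u ω - Xt t v ω) (ENNReal.ofReal q) P ≤
        ENNReal.ofReal (D * |u - v| ^ α)) : LocApprox P Xt X p q α := by
  have hm : ∀ v ∈ Icc (0 : ℝ) 1, ∀ t, AEMeasurable (Xt t v) P := fun v hv t =>
    ((hXt.isShift hv).causal t).aemeasurable hε.measurable
  obtain ⟨χ, y₀, C₀, hχ, -, -, hc⟩ := hL1.exists_contracts (hq.trans hq₂)
  obtain ⟨B, hB0, hB⟩ := hXt.exists_eLpNorm_le hε hG (hq.trans hq₂) hL1
  refine ⟨hm, fun n t ht => (hX.causal hG hXt n t ht).aemeasurable hε.measurable,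
    ⟨B, hB0, fun v hv t => ?_⟩, hX.exists_eLpNorm_sub_le hε hG hXt hq hα hχ
      (fun u hu => (hc u hu).mono hε (hG u hu) hq₂) hD hH⟩
  exact (eLpNorm_le_eLpNorm_of_exponent_le (ENNReal.ofReal_le_ofReal hq₂)
    (hm v hv t).aestronglyMeasurable).trans (hB v hv t)

lemma IsLocallyStationarySolution.locApprox (hε : IsIID P ε)
    (hG : ∀ u ∈ Icc (0 : ℝ) 1, Measurable fun ay : ℝ × (Fin p → ℝ) => G ay.1 ay.2 u)
    (hXt : IsStationarySolution P ε G Xt) (hX : IsLocallyStationarySolution P ε G Xt X)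
    (hq : 1 ≤ q) (hα : α ∈ Ioc (0 : ℝ) 1) (hL1 : CondL1 P (ε 0) G q)
    (hL4 : CondL4 P (ε 0) G Xt q α) : LocApprox P Xt X p q α := by
  obtain ⟨D, hD, hH⟩ := hXt.exists_holder hε hG hq hL1 hL4
  exact hX.locApprox_of_holder hε hG hXt hq le_rfl hα hL1 hD hH

lemma IsC1Modification.eLpNorm_sub_le (hXh : IsC1Modification P Xt Xh) {D : ℤ → Ω → ℝ} {C : ℝ}
    (hD : ∀ t, eLpNorm (D t) (ENNReal.ofReal q) P ≤ ENNReal.ofReal C)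
    (hlip : ∀ t, ∀ᵐ ω ∂P, ∀ w ∈ Icc (0 : ℝ) 1, ∀ v ∈ Icc (0 : ℝ) 1,
      |Xh t v ω - Xh t w ω| ≤ D t ω * |v - w|) {u v : ℝ} (hu : u ∈ Icc (0 : ℝ) 1)
    (hv : v ∈ Icc (0 : ℝ) 1) (t : ℤ) :
    eLpNorm (fun ω => Xt t u ω - Xt t v ω) (ENNReal.ofReal q) P ≤
      ENNReal.ofReal (C * |u - v|) := by
  have h1 : eLpNorm (fun ω => Xt t u ω - Xt t v ω) (ENNReal.ofReal q) P ≤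
      eLpNorm (|u - v| • D t) (ENNReal.ofReal q) P := by
    refine eLpNorm_mono_ae ?_
    filter_upwards [hlip t, hXh.modification t u hu, hXh.modification t v hv] with ω hω h2 h3
    rw [Real.norm_eq_abs, Real.norm_eq_abs, ← h2, ← h3, Pi.smul_apply, smul_eq_mul, mul_comm]
    exact (hω v hv u hu).trans (le_abs_self _)
  refine h1.trans ?_
  rw [eLpNorm_const_smul, Real.enorm_eq_ofReal (abs_nonneg _), mul_comm C,
    ENNReal.ofReal_mul (abs_nonneg _)]
  exact mul_le_mul_right (hD t) _

end Approximation

lemma integral_mul_id_eq_zero_of_even {K : ℝ → ℝ} (hK : ∀ x, K (-x) = K x) :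
    ∫ x, K x * x = 0 := by
  have h := integral_neg_eq_self (fun x => K x * x) volume
  simp only [hK, mul_neg, integral_neg] at h
  linarith

end LocStat

end

theorem theorem5p4 {Ω : Type*} [MeasurableSpace Ω] (P : Measure Ω) [IsProbabilityMeasure P]
    {p d : ℕ}
    -- innovations and model `G̃_e(y, θ₀(u))`
    (ε : ℤ → Ω → ℝ) (hε : LocStat.IsIID P ε)
    (Gt : ℝ → (Fin p → ℝ) → EuclideanSpace ℝ (Fin d) → ℝ)
    (Θ : Set (EuclideanSpace ℝ (Fin d))) (hΘ : IsCompact Θ)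
    (θ₀ : ℝ → EuclideanSpace ℝ (Fin d)) (hθ₀ : ∀ u ∈ Icc (0 : ℝ) 1, θ₀ u ∈ interior Θ)
    (hGmeas : ∀ u ∈ Icc (0 : ℝ) 1, Measurable (fun ay : ℝ × (Fin p → ℝ) =>
      LocStat.curveRec Gt θ₀ ay.1 ay.2 u))
    (Xt : ℤ → ℝ → Ω → ℝ) (hXt : LocStat.IsStationarySolution P ε (LocStat.curveRec Gt θ₀) Xt)
    (X : ℕ → ℤ → Ω → ℝ) (hX : LocStat.IsLocallyStationarySolution P ε (LocStat.curveRec Gt θ₀) Xt X)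
    -- kernel and objective function
    (K : ℝ → ℝ) (hK : LocStat.IsLocalizingKernel K)
    (ℓ : (Fin (p + 1) → ℝ) → EuclideanSpace ℝ (Fin d) → ℝ)
    -- assumptions for consistency
    (M : ℝ) (hℓ : LocStat.ClassLt Θ M ℓ)
    (α : ℝ) (hα : α ∈ Ioc (0 : ℝ) 1)
    (hL1 : LocStat.CondL1 P (ε 0) (LocStat.curveRec Gt θ₀) (M + 1))
    (hL4 : LocStat.CondL4 P (ε 0) (LocStat.curveRec Gt θ₀) Xt (M + 1) α)
    (hmin : ∀ u ∈ Icc (0 : ℝ) 1, ∀ θ ∈ Θ, θ ≠ θ₀ u →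
      LocStat.limLik P ℓ Xt u (θ₀ u) < LocStat.limLik P ℓ Xt u θ)
    -- smoothness and moments of `∇ℓ`, `∇²ℓ`
    (hC2 : ∀ z, ContDiffOn ℝ 2 (ℓ z) (interior Θ))
    (M' M'' : ℝ)
    (hdℓ : ∀ i, LocStat.ClassLt (interior Θ) M' (fun z => LocStat.pd (ℓ z) i))
    (hM' : 0 ≤ M') (hM'' : 0 ≤ M'')
    (hddℓ : ∀ i j, LocStat.ClassLt (interior Θ) M'' (fun z θ => LocStat.hess (ℓ z) θ i j))
    (α' : ℝ) (hα' : α' ∈ Ioc (0 : ℝ) 1)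
    (hL1' : LocStat.CondL1 P (ε 0) (LocStat.curveRec Gt θ₀) (max (2 * (M' + 1)) (M'' + 1)))
    (hL4' : LocStat.CondL4 P (ε 0) (LocStat.curveRec Gt θ₀) Xt (max (2 * (M' + 1)) (M'' + 1)) α')
    (hL2 : LocStat.CondL2 P (ε 0) (LocStat.curveRec Gt θ₀) (2 * (M' + 1)))
    -- the time point, the martingale difference property and positive definiteness of `V(u)`
    (u : ℝ) (hu : u ∈ Ioo (0 : ℝ) 1)
    (hmart : ∀ t : ℤ, ∀ i,
      P[LocStat.score ℓ Xt t u (θ₀ u) i | LocStat.past ε (t - 1)] =ᵐ[P] 0)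
    (hV : (LocStat.hessMat P ℓ Xt u (θ₀ u)).PosDef)
    -- bandwidth and estimator
    (b : ℕ → ℝ) (hb : ∀ n, b n ∈ Ioo (0 : ℝ) 1) (hb0 : Tendsto b atTop (𝓝 0))
    (hnb : Tendsto (fun n : ℕ => (n : ℝ) * b n) atTop atTop)
    (hbα : Tendsto (fun n : ℕ => b n * (n : ℝ) ^ (1 - 2 * α)) atTop (𝓝 0))
    (θhat : ℕ → Ω → EuclideanSpace ℝ (Fin d))
    (hθhat : ∀ n, LocStat.IsLocalMLE P ℓ K Θ X n (b n) u (θhat n)) :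
    -- (i)
    (Tendsto (fun n : ℕ => (n : ℝ) * b n ^ (1 + 2 * α')) atTop (𝓝 0) →
      TendstoInDistribution (fun (n : ℕ) ω => √((n : ℝ) * b n) • (θhat n ω - θ₀ u)) atTop
        (id : EuclideanSpace ℝ (Fin d) → EuclideanSpace ℝ (Fin d)) (fun _ => P)
        (multivariateGaussian 0 (LocStat.asympCov P ℓ K Xt u (θ₀ u)))) ∧
    -- (ii)
    ((∀ θ ∈ interior Θ, ∀ i, ContDiff ℝ 1 (fun z => LocStat.pd (ℓ z) i θ)) →
      LocStat.CondL3 P (ε 0) (LocStat.curveRec Gt θ₀) (M' + 1) →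
      (fun n : ℕ => (n : ℝ) * b n ^ 3) =O[atTop] (fun _ => (1 : ℝ)) →
      (∃ Xh, LocStat.IsC1Modification P Xt Xh) ∧
      (∀ Xh, LocStat.IsC1Modification P Xt Xh → ∀ t : ℤ,
        (∀ i, Integrable (LocStat.scoreDeriv ℓ Xh t u (θ₀ u) i) P) ∧
        TendstoInDistribution (fun (n : ℕ) ω => √((n : ℝ) * b n) •
            (θhat n ω - θ₀ u + b n • LocStat.biasVec P ℓ K Xt Xh t u (θ₀ u))) atTop
          (id : EuclideanSpace ℝ (Fin d) → EuclideanSpace ℝ (Fin d)) (fun _ => P)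
          (multivariateGaussian 0 (LocStat.asympCov P ℓ K Xt u (θ₀ u)))) ∧
      ((∀ x, K (-x) = K x) →
        TendstoInDistribution (fun (n : ℕ) ω => √((n : ℝ) * b n) • (θhat n ω - θ₀ u)) atTop
          (id : EuclideanSpace ℝ (Fin d) → EuclideanSpace ℝ (Fin d)) (fun _ => P)
          (multivariateGaussian 0 (LocStat.asympCov P ℓ K Xt u (θ₀ u))))) := by
  have hM := hℓ.1
  have hq1 : 1 ≤ M' + 1 := by linarith
  have hq2 : M' + 1 ≤ 2 * (M' + 1) := by linarith
  have hq3 : M' + 1 ≤ max (2 * (M' + 1)) (M'' + 1) := hq2.trans (le_max_left _ _)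
  have S : LocStat.EstimationSetup P ε Θ (θ₀ u) K ℓ M M' M'' α α' Xt X u b θhat :=
    { iid := hε
      shift := hXt.isShift (Ioo_subset_Icc_self hu)
      compact := hΘ
      mem_interior := hθ₀ u (Ioo_subset_Icc_self hu)
      kernel := hK
      time := hu
      bandwidth := ⟨hb, hb0, hnb⟩
      classLt := hℓ
      contDiffOn := hC2
      classLt_grad := hdℓ
      classLt_hess := hddℓ
      M_nonneg := hM
      M'_nonneg := hM'
      M''_nonneg := hM''
      α_pos := hα.1
      α'_pos := hα'.1
      approx := hX.locApprox hε hGmeas hXt (by linarith) hα hL1 hL4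
      approx' := hX.locApprox hε hGmeas hXt (hq1.trans hq3) hα' hL1' hL4'
      argmin := hmin u (Ioo_subset_Icc_self hu)
      martingale := hmart
      posDef := hV
      estimator := hθhat }
  refine ⟨S.tendstoInDistribution_of_undersmoothing, fun hd hL3 hrate => ?_⟩
  obtain ⟨B, -, hB⟩ := S.approx_grad.moment
  obtain ⟨Xh₀, D, C, hXh₀, hC, hDs, -, hDC, hlip⟩ := LocStat.exists_smooth_modification hε hGmeas
    hXt hq1 hq2 hB hL2 hL3
  have hX1 : LocStat.LocApprox P Xt X p (M' + 1) 1 :=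
    hX.locApprox_of_holder hε hGmeas hXt hq1 hq3 ⟨zero_lt_one, le_rfl⟩ hL1' hC
      fun v hv w hw t => by
        rw [Real.rpow_one]
        exact hXh₀.eLpNorm_sub_le hDC hlip hv hw t
  have key : ∀ Xh, LocStat.IsC1Modification P Xt Xh → ∀ t : ℤ,
      (∀ i, Integrable (LocStat.scoreDeriv ℓ Xh t u (θ₀ u) i) P) ∧
      TendstoInDistribution (fun (n : ℕ) ω => √((n : ℝ) * b n) •
          (θhat n ω - θ₀ u + b n • LocStat.biasVec P ℓ K Xt Xh t u (θ₀ u))) atTop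
        (id : EuclideanSpace ℝ (Fin d) → EuclideanSpace ℝ (Fin d)) (fun _ => P)
        (multivariateGaussian 0 (LocStat.asympCov P ℓ K Xt u (θ₀ u))) := by
    intro Xh hXh t
    refine S.tendstoInDistribution_add_biasVec hrate hX1 (fun v hv => hXt.isShift hv) hXh
      (hd _ S.mem_interior) hDs hDC (fun s => ?_) t
    filter_upwards [hlip s, hXh.ae_eq hXh₀ s] with ω hω he w hw v hv
    rw [he v hv, he w hw]
    exact hω w hw v hv
  refine ⟨⟨Xh₀, hXh₀⟩, key, fun hsym => ?_⟩
  have h := (key Xh₀ hXh₀ 0).2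
  simpa only [LocStat.biasVec, LocStat.integral_mul_id_eq_zero_of_even hsym, zero_smul, smul_zero,
    add_zero] using h
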